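/- **Setting.** Let $L$ be a diagram in $S^2$ of an oriented link, with a marked point $p$ on the link which is not a crossing. Let $\Gamma_L\subset S^2$ be the projection, $F(L)$ the set of components (faces) of $S^2\setminus\Gamma_L$, and $R_L=\mathbb F_2[x_f\mid f\in F(L)]$. For a set $S$ of crossings let $L_S$ be the resolution in which the crossings in $S$ receive the $1$-resolution and the others the $0$-resolution; at a right-handed crossing the $0$-resolution is the one compatible with the orientation, at a left-handed crossing the $1$-resolution is. The circle of $L_S$ through $p$ is called marked. For an unmarked circle $C$ let $[C]\in R_L$ be the sum of the variables $x_f$ of the faces lying in the component of $S^2\setminus C$ that does not contain $p$. Let $$\mathcal V(L_S)=R_Lv_0\otimes\bigotimes_{C\ \text{unmarked}}\bigl(R_Lv_+\xrightarrow{\ [C]\ }R_Lv_-\bigr),$$ with total differential $\partial_{\mathcal V}$; $v_\pm$ has degree $\pm1$ and $v_0$, the generator of the marked circle, has degree $0$. Let $KT_*(L)=\bigoplus_S\mathcal V(L_S)$ with $\partial=\partial_{KH}+\partial_{\mathcal V}$. Here $\partial_{KH}$ is the sum over all $S$ and all crossings $c\notin S$ of the maps $\mathcal V(L_S)\to\mathcal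 V(L_{S\cup\{c\}})$ given by $\mu$ when two circles merge and by $\Delta$ when a circle splits, and by the identity on all other circles, where $$\mu:\ v_+\otimes v_+\mapsto v_+,\quad v_\pm\otimes v_\mp\mapsto v_-,\quad v_-\otimes v_-\mapsto0,\qquad \Delta:\ v_+\mapsto v_+\otimes v_-+v_-\otimes v_+,\quad v_-\mapsto v_-\otimes v_-,$$ and $v_0$ is treated as a $v_-$. An element of degree $q$ in $\mathcal V(L_S)$ is placed in degree $\delta=|S|-q-n_+(L)$, where $n_+(L)$ is the number of right-handed crossings. A complex $\mathcal C$ of free $\mathbb F_2[A]$-modules and a complex $\mathcal C'$ of free $\mathbb F_2[B]$-modules ($A$, $B$ sets of variables) are *stably chain homotopy equivalent* if there are an $\mathbb F_2$-vector space $W$ and injective linear maps $i:\mathbb F_2^{(A)}\to W$, $j:\mathbb F_2^{(B)}\to W$ such that, for the induced ring maps $\mathbb F_2[A]\to\mathrm{Sym}(W)$ and $\mathbb F_2[B]\to\mathrm{Sym}(W)$, the complexes $\mathcal C\otimes_{\mathbb F_2[A]}\mathrm{Sym}(W)$ and $\mathcal C'\otimes_{\mathbb F_2[B]}\mathrm{Sym}(W)$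 are graded chain homotopy equivalent over $\mathrm{Sym}(W)$. **Theorem.** Let $L$ and $L'$ be marked oriented link diagrams in $S^2$ that differ by a finite sequence of planar isotopies and Reidemeister I, II and III moves (in either direction, all variants) in which no strand is moved across the marked point. Then $(KT_*(L),\partial)$ and $(KT_*(L'),\partial)$ are chain complexes, with differentials of degree $+2$ in the $\delta$-grading, and they are stably chain homotopy equivalent. -/

import Mathlib

open CategoryTheory

/-! ### Marked oriented link diagrams on the sphere

A diagram on `S²`, up to orientation preserving homeomorphism of the sphere, is recorded by its
four-valent graph, its crossing data and its faces.  Besides the crossings the diagram carries a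
finite set of points lying on the link away from the crossings; one of them is the marked point,
the others are auxiliary (they can be created and deleted freely, see `IsSubdivision`, and every
component of the link without crossings contains at least one).

Travelling along the oriented link one passes through each crossing twice, once on the under-strand
and once on the over-strand, and through each point once.  These are the passages.  The successor
of a passage along the link is given by a permutation `next`; its cycles are the link components.
The edge leaving the passage `e` and running to `next e` is named `e`. -/

/-- The passages of an oriented link through its crossings and points. -/
inductive Passage (X P : Type) : Type
  | underpass (x : X) : Passage X P
  | overpass (x : X) : Passage X P
  | point (a : P) : Passage X P

namespace Passage

/-- The effect on passages of maps of crossings and of points. -/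
def map {X P X' P' : Type} (f : X → X') (g : P → P') : Passage X P → Passage X' P'
  | underpass x => underpass (f x)
  | overpass x => overpass (f x)
  | point a => point (g a)

/-- The passage through the crossing `x` on the over-strand if `o = true`, and on the under-strand
if `o = false`. -/
def strand {X P : Type} (o : Bool) (x : X) : Passage X P :=
  if o = true then overpass x else underpass x

/-- Two edges are linked if they are the ones before and after a passage, or if they leave the
same crossing.  The classes of the generated equivalence relation are the connected components of
the projection of the link. -/
inductive Linked {X P : Type} (next : Equiv.Perm (Passage X P)) :
    Passage X P → Passage X P → Prop
  | step (e : Passage X P) : Linked next e (next e)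
  | crossing (x : X) : Linked next (underpass x) (overpass x)

instance {X P : Type} [Finite X] [Finite P] : Finite (Passage X P) :=
  Finite.of_injective
    (fun e : Passage X P => (match e with
      | underpass x => Sum.inl x
      | overpass x => Sum.inr (Sum.inl x)
      | point a => Sum.inr (Sum.inr a) : X ⊕ X ⊕ P))
    (by
      intro a b h
      cases a <;> cases b <;> simp_all)

end Passage

open Passage in
/-- A diagram in `S²` of an oriented link with a marked point.

`left e` and `right e` are the faces on the left and on the right of the oriented edge `e`.  The
edge arriving at a passage `n` is `next.symm n`.  The fields `left_point`, `right_point` say that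
the sides of an edge do not change at a point.  At a crossing draw the under-strand going north; the
over-strand then goes east if the crossing is right-handed, west if it is left-handed.  The fields
`right_handed`, `left_handed` say, for the corners north-west, north-east, south-west and
south-east in this order, that the two edges bounding the corner see the same face there.
The last two fields say that the surface assembled from the diagram and its faces (each of which is
a sphere with holes) is connected and is a sphere: Euler's formula `V + F = E + 1 + c` holds, `c`
being the number of connected components of the projection. (The projection may be disconnected,
and faces need not be discs.) -/
structure MarkedDiagram where
  Crossing : Type
  Point : Type
  Face : Type
  [fintypeCrossing : Fintype Crossing]
  [decidableEqCrossing : DecidableEq Crossing]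
  [fintypePoint : Fintype Point]
  [fintypeFace : Fintype Face]
  /-- The handedness of a crossing: `true` for right-handed (positive) crossings. -/
  rightHanded : Crossing → Bool
  /-- The marked point. -/
  mark : Point
  next : Equiv.Perm (Passage Crossing Point)
  left : Passage Crossing Point → Face
  right : Passage Crossing Point → Face
  left_point : ∀ a, left (next.symm (point a)) = left (point a)
  right_point : ∀ a, right (next.symm (point a)) = right (point a)
  right_handed : ∀ x, rightHanded x = true →
    left (underpass x) = left (next.symm (overpass x)) ∧
    right (underpass x) = left (overpass x) ∧
    left (next.symm (underpass x)) = right (next.symm (overpass x)) ∧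
    right (next.symm (underpass x)) = right (overpass x)
  left_handed : ∀ x, rightHanded x = false →
    left (underpass x) = right (overpass x) ∧
    right (underpass x) = right (next.symm (overpass x)) ∧
    left (next.symm (underpass x)) = left (overpass x) ∧
    right (next.symm (underpass x)) = left (next.symm (overpass x))
  connected : ∀ f g : Face,
    Relation.EqvGen (fun f g => ∃ e, left e = f ∧ right e = g) f g
  euler : (Fintype.card Crossing + Fintype.card Point) + Fintype.card Face =
    (2 * Fintype.card Crossing + Fintype.card Point) + 1 + Nat.card (Quot (Linked next))

namespace MarkedDiagram

attribute [instance] fintypeCrossing decidableEqCrossing fintypePoint fintypeFace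

variable (L : MarkedDiagram)

/-- The edges of the diagram; `e : L.Edge` is the edge leaving the passage `e`. -/
abbrev Edge : Type := Passage L.Crossing L.Point

/-- The coefficient ring `𝔽₂[x_f | f a face]`. -/
abbrev CoeffRing : Type := MvPolynomial L.Face (ZMod 2)

/-! ### Resolutions -/

/-- At a right-handed crossing the `0`-resolution is the one compatible with the orientation, at a
left-handed crossing it is the `1`-resolution. `S` is the set of crossings given the
`1`-resolution. -/
def OrientedAt (S : Finset L.Crossing) (x : L.Crossing) : Prop :=
  L.rightHanded x = true ↔ x ∉ S

/-- The gluing of edges in the resolution of `L` along `S`. -/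
inductive Joined (S : Finset L.Crossing) : L.Edge → L.Edge → Prop
  | point (a : L.Point) : Joined S (L.next.symm (.point a)) (.point a)
  | oriented_under (x : L.Crossing) : L.OrientedAt S x →
      Joined S (L.next.symm (.underpass x)) (.overpass x)
  | oriented_over (x : L.Crossing) : L.OrientedAt S x →
      Joined S (L.next.symm (.overpass x)) (.underpass x)
  | unoriented_in (x : L.Crossing) : ¬ L.OrientedAt S x →
      Joined S (L.next.symm (.underpass x)) (L.next.symm (.overpass x))
  | unoriented_out (x : L.Crossing) : ¬ L.OrientedAt S x →
      Joined S (.underpass x) (.overpass x)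

/-- The circles of the resolution `L_S`. -/
def Circle (S : Finset L.Crossing) : Type := Quot (L.Joined S)

instance (S : Finset L.Crossing) : Finite (L.Circle S) :=
  inferInstanceAs (Finite (Quot (L.Joined S)))

noncomputable instance (S : Finset L.Crossing) : Fintype (L.Circle S) := Fintype.ofFinite _

/-- The circle of `L_S` containing the edge `e`. -/
def circleOf (S : Finset L.Crossing) (e : L.Edge) : L.Circle S := Quot.mk _ e

/-- The marked circle of `L_S`. -/
def markedCircle (S : Finset L.Crossing) : L.Circle S := L.circleOf S (.point L.mark)

/-- Adjacency of faces of `L_S` in the complement of the circle `C`: across an edge that is not in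
`C`, or through the gap between the two strands at a resolved crossing. The `0`-resolution opens a
gap between the two corners swept out by the over-strand when it is turned counterclockwise to the
under-strand, the `1`-resolution one between the two other corners. -/
inductive FaceJoined (S : Finset L.Crossing) (C : L.Circle S) : L.Face → L.Face → Prop
  | across (e : L.Edge) : L.circleOf S e ≠ C → FaceJoined S C (L.left e) (L.right e)
  | gap_zero (x : L.Crossing) : x ∉ S →
      FaceJoined S C (L.right (.underpass x)) (L.left (L.next.symm (.underpass x)))
  | gap_one (x : L.Crossing) : x ∈ S →
      FaceJoined S C (L.left (.underpass x)) (L.right (L.next.symm (.underpass x)))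

/-- The faces in the interior of an unmarked circle `C` of `L_S`: those that are not in the
component of `S² \ C` containing the marked point. -/
def interior (S : Finset L.Crossing) (C : L.Circle S) : Set L.Face :=
  {f | ¬ Relation.EqvGen (L.FaceJoined S C) f (L.left (.point L.mark))}

open Classical in
/-- The formal area `[C]`: the sum of the variables of the faces in the interior of `C`. -/
noncomputable def area (S : Finset L.Crossing) (C : L.Circle S) : L.CoeffRing :=
  ∑ f : L.Face, if f ∈ L.interior S C then MvPolynomial.X f else 0

/-! ### The totally twisted Khovanov complex -/

/-- Decorations of the circles of `L_S` by `v₊` (`true`) or `v₋` (`false`). The generator `v₀` of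
the marked circle is treated as a `v₋`. These are the pure states, a basis of the tensor product
over the unmarked circles `C` of the complexes `R v₊ → R v₋`, `v₊ ↦ [C] v₋`. -/
abbrev Decoration (S : Finset L.Crossing) : Type :=
  {ε : L.Circle S → Bool // ε (L.markedCircle S) = false}

noncomputable instance (S : Finset L.Crossing) : Fintype (L.Decoration S) := Fintype.ofFinite _

/-- The pure states of all resolutions of `L`. -/
abbrev State : Type := Σ S : Finset L.Crossing, L.Decoration S

open Classical in
/-- Change the sign on the circle `C` to `v₋`. -/
noncomputable def lower {S : Finset L.Crossing} (ε : L.Decoration S) (C : L.Circle S) :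
    L.Decoration S :=
  ⟨Function.update ε.1 C false, by
    by_cases h : L.markedCircle S = C
    · subst h; simp
    · rw [Function.update_of_ne h]; exact ε.2⟩

/-- The coefficient of `c` in `μ (a ⊗ b)`. -/
def mulCoeff : Bool → Bool → Bool → ZMod 2
  | true, true, true => 1
  | true, false, false => 1
  | false, true, false => 1
  | _, _, _ => 0

/-- The coefficient of `b ⊗ c` in `Δ a`. -/
def comulCoeff : Bool → Bool → Bool → ZMod 2
  | true, true, false => 1
  | true, false, true => 1
  | false, false, false => 1
  | _, _, _ => 0

open Classical in
/-- The coefficient of the pure state `η` of `L_{S ∪ {x}}` in the image of the pure state `ε` of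
`L_S` under the Khovanov map at the crossing `x`. The edges `L.next.symm (.underpass x)` and
`.underpass x` lie on the two different strands at `x` of either resolution. -/
noncomputable def khovanovCoeff {S : Finset L.Crossing} (x : L.Crossing) (ε : L.Decoration S)
    (η : L.Decoration (insert x S)) : ZMod 2 :=
  let A := L.circleOf S (L.next.symm (.underpass x))
  let B := L.circleOf S (.underpass x)
  let A' := L.circleOf (insert x S) (L.next.symm (.underpass x))
  let B' := L.circleOf (insert x S) (.underpass x)
  if ∀ e : L.Edge, L.circleOf S e ≠ A → L.circleOf S e ≠ B →
      η.1 (L.circleOf (insert x S) e) = ε.1 (L.circleOf S e) then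
    if A ≠ B ∧ A' = B' then mulCoeff (ε.1 A) (ε.1 B) (η.1 A')
    else if A = B ∧ A' ≠ B' then comulCoeff (ε.1 A) (η.1 A') (η.1 B')
    else 0
  else 0

open Classical in
/-- The Koszul differential on pure states. -/
noncomputable def koszul (s : L.State) : L.State →₀ L.CoeffRing :=
  ∑ C : L.Circle s.1,
    if s.2.1 C = true then Finsupp.single ⟨s.1, L.lower s.2 C⟩ (L.area s.1 C) else 0

/-- The Khovanov differential on pure states. -/
noncomputable def khovanov (s : L.State) : L.State →₀ L.CoeffRing :=
  ∑ x ∈ s.1ᶜ, ∑ η : L.Decoration (insert x s.1),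
    Finsupp.single ⟨insert x s.1, η⟩ (MvPolynomial.C (L.khovanovCoeff x s.2 η))

/-- The map `∂_KH + ∂_V` on the free module generated by the pure states. -/
noncomputable def differential : (L.State →₀ L.CoeffRing) →ₗ[L.CoeffRing] (L.State →₀ L.CoeffRing) :=
  Finsupp.linearCombination L.CoeffRing fun s => L.khovanov s + L.koszul s

open Classical in
/-- The `q`-grading of a pure state inside the Koszul complex of its resolution. -/
noncomputable def qDegree (s : L.State) : ℤ :=
  ∑ C : L.Circle s.1, if C = L.markedCircle s.1 then 0 else if s.2.1 C = true then 1 else -1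

/-- The number of right-handed crossings. -/
def nPlus : ℕ := (Finset.univ.filter fun x => L.rightHanded x = true).card

/-- The `δ`-grading `2 h - q`, where `h = |S|` and `q` is the Koszul grading shifted by `|S|`, with
the final shift by `- n₊`. -/
noncomputable def degree (s : L.State) : ℤ :=
  2 * (s.1.card : ℤ) - (L.qDegree s + s.1.card) - L.nPlus

/-- `∂_KH + ∂_V` is a differential: it squares to zero and raises the `δ`-grading by `2`. -/
def IsDifferential : Prop :=
  L.differential ∘ₗ L.differential = 0 ∧
  ∀ s t : L.State, L.differential (Finsupp.single s 1) t ≠ 0 → L.degree t = L.degree s + 2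

/-- The component of the differential from `δ`-degree `i` to `δ`-degree `j`. -/
noncomputable def component (i j : ℤ) :
    ({s : L.State | L.degree s = i} →₀ L.CoeffRing) →ₗ[L.CoeffRing]
      ({s : L.State | L.degree s = j} →₀ L.CoeffRing) :=
  Finsupp.lsubtypeDomain {s : L.State | L.degree s = j} ∘ₗ L.differential ∘ₗ
    Finsupp.lmapDomain L.CoeffRing L.CoeffRing Subtype.val

theorem component_comp (h : L.IsDifferential) (i j k : ℤ) (hij : i + 2 = j) :
    L.component j k ∘ₗ L.component i j = 0 := by
  refine Finsupp.lhom_ext' fun s => LinearMap.ext_ring (Finsupp.ext fun t => ?_)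
  have hv : Finsupp.mapDomain Subtype.val
      (Finsupp.subtypeDomain (fun s : L.State => s ∈ {s : L.State | L.degree s = j})
        (L.differential (Finsupp.single s.1 1))) = L.differential (Finsupp.single s.1 1) := by
    ext1 r
    by_cases hr : L.degree r = j
    · exact Finsupp.mapDomain_apply Subtype.val_injective _ (⟨r, hr⟩ : {s | L.degree s = j})
    · rw [Finsupp.mapDomain_of_notMem_range _ _ (by rintro ⟨r', rfl⟩; exact hr r'.2)]
      by_contra hne
      exact hr ((h.2 s.1 r (Ne.symm hne)).trans (by rw [s.2, hij]))
  have h2 := LinearMap.congr_fun h.1 (Finsupp.single s.1 1)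
  simp only [LinearMap.comp_apply, LinearMap.zero_apply] at h2
  simp only [component, LinearMap.comp_apply, Finsupp.lsubtypeDomain_apply,
    Finsupp.lmapDomain_apply, Finsupp.lsingle_apply, Finsupp.mapDomain_single]
  rw [hv, h2]
  rfl

/-- The totally twisted Khovanov complex of `L`, graded by `δ`, with a differential of degree `2`;
the chain group in degree `i` is free on the pure states of degree `i`. -/
noncomputable def KT (h : L.IsDifferential) :
    HomologicalComplex (ModuleCat L.CoeffRing) (ComplexShape.up' (2 : ℤ)) where
  X i := ModuleCat.of L.CoeffRing ({s : L.State | L.degree s = i} →₀ L.CoeffRing)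
  d i j := if i + 2 = j then ModuleCat.ofHom (L.component i j) else 0
  shape i j hij := if_neg hij
  d_comp_d' i j k hij hjk := by
    have hij' : i + 2 = j := hij
    have hjk' : j + 2 = k := hjk
    rw [if_pos hij', if_pos hjk', ← ModuleCat.ofHom_comp, L.component_comp h i j k hij']
    rfl

/-! ### Planar isotopies and Reidemeister moves -/

variable (L' : MarkedDiagram)

/-- `L` and `L'` are the same up to an isotopy of the sphere carrying the marked point to the marked
point: there are compatible bijections of crossings, points and faces. -/
def IsIsotopic : Prop :=
  ∃ (eX : L.Crossing ≃ L'.Crossing) (eP : L.Point ≃ L'.Point) (eF : L.Face ≃ L'.Face),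
    let ρ : L.Edge → L'.Edge := Passage.map eX eP
    (∀ x, L'.rightHanded (eX x) = L.rightHanded x) ∧
    L'.mark = eP L.mark ∧
    (∀ n, L'.next (ρ n) = ρ (L.next n)) ∧
    (∀ n, L'.left (ρ n) = eF (L.left n)) ∧
    (∀ n, L'.right (ρ n) = eF (L.right n))

/-- `L'` is obtained from `L` by placing an auxiliary point on an edge `e`. -/
def IsSubdivision : Prop :=
  ∃ (eX : L.Crossing ≃ L'.Crossing) (eP : Option L.Point ≃ L'.Point) (eF : L.Face ≃ L'.Face)
    (e : L.Edge),
    let ρ : L.Edge → L'.Edge := Passage.map eX (fun a => eP (some a))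
    let a : L'.Edge := .point (eP none)
    (∀ x, L'.rightHanded (eX x) = L.rightHanded x) ∧
    L'.mark = eP (some L.mark) ∧
    L'.next (ρ e) = a ∧ L'.next a = ρ (L.next e) ∧
    (∀ n, n ≠ e → L'.next (ρ n) = ρ (L.next n)) ∧
    (∀ n, L'.left (ρ n) = eF (L.left n)) ∧
    (∀ n, L'.right (ρ n) = eF (L.right n))

/-- `L'` is obtained from `L` by a Reidemeister I move creating a curl on the edge `e`. The new
crossing `c` is of either handedness, and is first passed either under or over, which gives the four
kinds of curls. The new face is the disc bounded by the curl. -/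
def IsReidemeisterI : Prop :=
  ∃ (eX : Option L.Crossing ≃ L'.Crossing) (eP : L.Point ≃ L'.Point)
    (eF : Option L.Face ≃ L'.Face) (e : L.Edge) (o : Bool),
    let ρ : L.Edge → L'.Edge := Passage.map (fun x => eX (some x)) eP
    let c : L'.Crossing := eX none
    let u : L'.Edge := Passage.strand o c
    let v : L'.Edge := Passage.strand (!o) c
    (∀ x, L'.rightHanded (eX (some x)) = L.rightHanded x) ∧
    L'.mark = eP L.mark ∧
    L'.next (ρ e) = u ∧ L'.next u = v ∧ L'.next v = ρ (L.next e) ∧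
    (∀ n, n ≠ e → L'.next (ρ n) = ρ (L.next n)) ∧
    (∀ n, L'.left (ρ n) = eF (some (L.left n))) ∧
    (∀ n, L'.right (ρ n) = eF (some (L.right n))) ∧
    L'.left v = eF (some (L.left e)) ∧
    L'.right v = eF (some (L.right e))

/-- The face on the left (`b = true`) or on the right (`b = false`) of an edge. -/
def side (b : Bool) (e : L.Edge) : L.Face := if b = true then L.left e else L.right e

/-- `L'` is obtained from `L` by a Reidemeister II move: an edge `e` is pushed across another edge
`f` through a face lying on the side `bE` of `e` and on the side `bF` of `f`. Here `o` says
whether `e` goes over or under `f`. The edge `e` first meets the new crossing `x` and then the new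
crossing `y`; so does `f` if `e` and `f` run in parallel directions along the common face, and
otherwise `f` meets them in the opposite order. The map `π` sends the faces of `L'` other than the
new bigon to the faces of `L` they come from; the common face may have been cut into two. -/
def IsReidemeisterII : Prop :=
  ∃ (eX : L.Crossing ⊕ Bool ≃ L'.Crossing) (eP : L.Point ≃ L'.Point)
    (π : L'.Face → Option L.Face) (e f : L.Edge) (bE bF o : Bool),
    let ρ : L.Edge → L'.Edge := Passage.map (fun x => eX (Sum.inl x)) eP
    let x : L'.Crossing := eX (Sum.inr false)
    let y : L'.Crossing := eX (Sum.inr true)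
    let e₁ : L'.Edge := Passage.strand o x
    let e₂ : L'.Edge := Passage.strand o y
    let f₁ : L'.Edge := Passage.strand (!o) (if bE = bF then y else x)
    let f₂ : L'.Edge := Passage.strand (!o) (if bE = bF then x else y)
    e ≠ f ∧ L.side bE e = L.side bF f ∧
    (∀ z, L'.rightHanded (eX (Sum.inl z)) = L.rightHanded z) ∧
    L'.rightHanded x = (o == bF) ∧ L'.rightHanded y = !(o == bF) ∧
    L'.mark = eP L.mark ∧
    L'.next (ρ e) = e₁ ∧ L'.next e₁ = e₂ ∧ L'.next e₂ = ρ (L.next e) ∧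
    L'.next (ρ f) = f₁ ∧ L'.next f₁ = f₂ ∧ L'.next f₂ = ρ (L.next f) ∧
    (∀ n, n ≠ e → n ≠ f → L'.next (ρ n) = ρ (L.next n)) ∧
    (∃! bigon, π bigon = none) ∧
    (∀ u v, π u = π v → u = v ∨
      (u = L'.side bE (ρ e) ∧ v = L'.side bE e₂) ∨
      (u = L'.side bE e₂ ∧ v = L'.side bE (ρ e))) ∧
    (∀ n, π (L'.left (ρ n)) = some (L.left n)) ∧
    (∀ n, π (L'.right (ρ n)) = some (L.right n)) ∧
    π (L'.left e₂) = some (L.left e) ∧ π (L'.right e₂) = some (L.right e) ∧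
    π (L'.left f₂) = some (L.left f) ∧ π (L'.right f₂) = some (L.right f)

open Classical in
/-- `L'` is obtained from `L` by a Reidemeister III move. There are three strands, top, middle and
bottom; `x` is the crossing of top and middle, `y` that of top and bottom, and `z` that of middle and
bottom. Each strand passes through its two crossings consecutively, along edges `iT`, `iM`, `iB`,
and these three edges bound a triangular face `t` of `L` to which no other edge is adjacent. The
move reverses the order in which each strand passes through its two crossings, and leaves
everything else in place. -/
def IsReidemeisterIII : Prop :=
  ∃ (eX : L.Crossing ≃ L'.Crossing) (eP : L.Point ≃ L'.Point) (eF : L.Face ≃ L'.Face)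
    (x y z : L.Crossing) (iT iM iB : L.Edge) (t : L.Face),
    let ρ : L.Edge → L'.Edge := Passage.map eX eP
    let σ : Equiv.Perm L.Edge :=
      Equiv.swap (.overpass x) (.overpass y) * Equiv.swap (.underpass x) (.overpass z) *
        Equiv.swap (.underpass y) (.underpass z)
    x ≠ y ∧ y ≠ z ∧ x ≠ z ∧
    (iT = .overpass x ∨ iT = .overpass y) ∧ L.next iT = σ iT ∧
    (iM = .underpass x ∨ iM = .overpass z) ∧ L.next iM = σ iM ∧
    (iB = .underpass y ∨ iB = .underpass z) ∧ L.next iB = σ iB ∧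
    (∀ n, (L.left n = t ∨ L.right n = t) ↔ (n = iT ∨ n = iM ∨ n = iB)) ∧
    (∀ c, L'.rightHanded (eX c) = L.rightHanded c) ∧
    L'.mark = eP L.mark ∧
    (∀ n, L'.next (ρ (σ n)) = ρ (σ (L.next n))) ∧
    (∀ n, n ≠ iT → n ≠ iM → n ≠ iB →
      L'.left (ρ (σ n)) = eF (L.left n) ∧ L'.right (ρ (σ n)) = eF (L.right n))

/-- An elementary move between marked diagrams: a planar isotopy, or a Reidemeister I, II or III
move away from the marked point. (Inverse moves are supplied by the generated equivalence
relation.) -/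
inductive Move : MarkedDiagram → MarkedDiagram → Prop
  | isotopy {L L' : MarkedDiagram} : L.IsIsotopic L' → Move L L'
  | subdivision {L L' : MarkedDiagram} : L.IsSubdivision L' → Move L L'
  | reidemeisterI {L L' : MarkedDiagram} : L.IsReidemeisterI L' → Move L L'
  | reidemeisterII {L L' : MarkedDiagram} : L.IsReidemeisterII L' → Move L L'
  | reidemeisterIII {L L' : MarkedDiagram} : L.IsReidemeisterIII L' → Move L L'

end MarkedDiagram

/-! ### Stable chain homotopy equivalence over polynomial rings -/

/-- The ring map `𝔽₂[A] = Sym (𝔽₂^(A)) → Sym W` induced by a linear map `𝔽₂^(A) → W`. -/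
noncomputable def symMap {A W : Type} [AddCommGroup W] [Module (ZMod 2) W]
    (i : (A →₀ ZMod 2) →ₗ[ZMod 2] W) :
    MvPolynomial A (ZMod 2) →+* SymmetricAlgebra (ZMod 2) W :=
  (MvPolynomial.aeval fun a =>
    SymmetricAlgebra.ι (ZMod 2) W (i (Finsupp.single a 1))).toRingHom

/-- Extension of scalars of a complex along a ring map. -/
noncomputable def extendComplex {R R' : Type} [CommRing R] [CommRing R'] (φ : R →+* R')
    {c : ComplexShape ℤ} (C : HomologicalComplex (ModuleCat.{0} R) c) :
    HomologicalComplex (ModuleCat.{0} R') c :=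
  ((ModuleCat.extendScalars φ).mapHomologicalComplex c).obj C

/-- Complexes over the polynomial rings `𝔽₂[A]` and `𝔽₂[B]` are stably chain homotopy equivalent
if they become chain homotopy equivalent over `Sym W`, for some `𝔽₂`-vector space `W` and some
linear injections into `W` of the spaces spanned by `A` and by `B`. -/
def StablyHomotopyEquivalent {A B : Type} {c : ComplexShape ℤ}
    (C : HomologicalComplex (ModuleCat.{0} (MvPolynomial A (ZMod 2))) c)
    (D : HomologicalComplex (ModuleCat.{0} (MvPolynomial B (ZMod 2))) c) : Prop :=
  ∃ (W : Type) (_ : AddCommGroup W) (_ : Module (ZMod 2) W)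
    (i : (A →₀ ZMod 2) →ₗ[ZMod 2] W) (j : (B →₀ ZMod 2) →ₗ[ZMod 2] W),
    Function.Injective i ∧ Function.Injective j ∧
    Nonempty (HomotopyEquiv (extendComplex (symMap i) C) (extendComplex (symMap j) D))

/-!
The areas of the circles of all resolutions come from weights on the edges of the diagram that do
not depend on the resolution. Joining each face to the marked point by a path and letting the weight
of an edge `e` be the sum of the variables of the faces whose path crosses `e`, the area of a circle
is the sum of the weights of its edges (`MarkedDiagram.sum_weight_circle`). This uses that a circle
bounds on the sphere; as faces need not be discs, it is deduced from Euler's formula by comparing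
ranks (`MarkedDiagram.exists_coboundary`). The total complex of a resolution becomes an algebra of
circles (`CircleAlgebra`): the polynomial ring on the edges modulo `X ^ 2 = 0`, the identification
of edges on the same circle, and `X = 0` on the marked circle. Here `1` stands for `v₊` and `X` for
`v₋`, the Koszul differential is multiplication by the sum of `w e • X e`, and the Khovanov maps are
linear over the polynomial ring, being given by `1 ↦ 1` for a merge and `1 ↦ X + X'` for a split.
Two resolutions differing at one crossing differ by a merge or a split, never by a rearrangement of
one circle, since the checkerboard colouring makes circles into cycles of a permutation that changes
by a transposition (`MarkedDiagram.surgery_circles`). So a diagram with weights yields a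
`SurgeryCube` and its complex, for arbitrary weights in an `𝔽₂`-algebra.

The main point is that conjugation by `1 + t φ`, with `φ` the Khovanov map at a crossing taken
backwards, moves a weight `t` from one strand at the crossing to the other
(`SurgeryCube.complex_slide`). Since weights may also slide along circles, the complex depends up to
equivalence only on the sum of the weights over each component of the link
(`MarkedDiagram.weightComplex_hEquiv`). It therefore suffices to show, for each move, that the
complexes of the two diagrams are equivalent for some weights with equal component sums, and these
can be chosen to vanish on the edges created or rearranged by the move
(`MarkedDiagram.hasEquivalentComplexes_of_moves`). With such weights the usual cancellations apply:
a small circle without weight contributes a tensor factor `⟨v₊, v₋⟩`, one half of which is cancelled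
against a neighbouring resolution. For the first move see `SurgeryCube.complex_hEquiv_low` and
`SurgeryCube.complex_hEquiv_high`, for the second one `SurgeryCube.quadRetraction`. For the third
one, fixing one of the two resolutions of one crossing leaves the square of a second Reidemeister
move; after its cancellation the complexes of both diagrams are the same cone
(`SurgeryCube.Triangle.hEquiv_of_low`, `SurgeryCube.Triangle.hEquiv_of_high`).

It remains to compare faces of different diagrams, and this is where stabilization enters. The sums
of the weights over the components are linearly independent in the space spanned by the faces
(`MarkedDiagram.linearIndependent_componentSum`), so that the spaces of the two diagrams embed into
a common one in which the sums over corresponding components agree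
(`MarkedDiagram.exists_embeddings`). Over the symmetric algebra of this space the totally twisted
complexes are the complexes of weights, in the basis of pure states
(`MarkedDiagram.extendComplexIso`), hence equivalent. The same comparison over the coefficient ring
itself shows that the differential squares to zero and has degree `2`
(`MarkedDiagram.isDifferential`).
-/

set_option linter.unusedSectionVars false

/-! ### Graded differential modules in characteristic two -/

/-- In a module over an algebra over `𝔽₂` every element is its own negative. -/
theorem add_self_of_charTwo (R : Type) [CommRing R] [Algebra (ZMod 2) R] {M : Type}
    [AddCommGroup M] [Module R M] (m : M) : m + m = 0 := by
  have h : (2 : R) = 0 := by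
    have := map_ofNat (algebraMap (ZMod 2) R) 2
    rw [← this, show (OfNat.ofNat 2 : ZMod 2) = 0 from rfl, map_zero]
  rw [← two_smul R m, h, zero_smul]

theorem eq_of_add_eq_zero_of_charTwo (R : Type) [CommRing R] [Algebra (ZMod 2) R] {M : Type}
    [AddCommGroup M] [Module R M] {a b : M} (h : a + b = 0) : a = b := by
  have := add_self_of_charTwo R b
  rw [← this] at h
  exact add_right_cancel h

/-- A module with a `ℤ`-indexed family of submodules and a differential of degree `2`. -/
structure DiffModule (R : Type) [CommRing R] where
  carrier : Type
  [addCommGroup : AddCommGroup carrier]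
  [module : Module R carrier]
  gr : ℤ → Submodule R carrier
  d : carrier →ₗ[R] carrier
  d_mem : ∀ i m, m ∈ gr i → d m ∈ gr (i + 2)
  d_d : ∀ m, d (d m) = 0

namespace DiffModule

attribute [instance] addCommGroup module

variable {R : Type} [CommRing R]

instance : CoeSort (DiffModule R) Type := ⟨carrier⟩

/-- Linear maps of degree `k`. -/
def IsHomogeneous {A B : DiffModule R} (f : A →ₗ[R] B) (k : ℤ) : Prop :=
  ∀ i m, m ∈ A.gr i → f m ∈ B.gr (i + k)

/-- Linear maps commuting with the differentials. -/
def IsChainMap {A B : DiffModule R} (f : A →ₗ[R] B) : Prop :=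
  ∀ m, f (A.d m) = B.d (f m)

theorem IsHomogeneous.comp {A B C : DiffModule R} {f : A →ₗ[R] B} {g : B →ₗ[R] C} {k l n : ℤ}
    (hg : IsHomogeneous g l) (hf : IsHomogeneous f k) (h : k + l = n) :
    IsHomogeneous (g ∘ₗ f) n := by
  intro i m hm
  have := hg _ _ (hf i m hm)
  rwa [add_assoc, h] at this

theorem IsHomogeneous.add {A B : DiffModule R} {f g : A →ₗ[R] B} {k : ℤ}
    (hf : IsHomogeneous f k) (hg : IsHomogeneous g k) : IsHomogeneous (f + g) k :=
  fun i m hm => add_mem (hf i m hm) (hg i m hm)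

theorem isHomogeneous_zero {A B : DiffModule R} (k : ℤ) :
    IsHomogeneous (0 : A →ₗ[R] B) k := fun _ _ _ => zero_mem _

theorem isHomogeneous_id (A : DiffModule R) :
    IsHomogeneous (LinearMap.id : A →ₗ[R] A) 0 := fun i m hm => by simpa using hm

theorem isHomogeneous_d (A : DiffModule R) : IsHomogeneous A.d 2 := A.d_mem

theorem IsChainMap.comp {A B C : DiffModule R} {f : A →ₗ[R] B} {g : B →ₗ[R] C}
    (hg : IsChainMap g) (hf : IsChainMap f) : IsChainMap (g ∘ₗ f) := fun m => by
  simp only [LinearMap.comp_apply]; rw [hf, hg]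

/-- Graded chain homotopy equivalence (in characteristic two, so that signs do not matter). -/
def HEquiv (A B : DiffModule R) : Prop :=
  ∃ (f : A →ₗ[R] B) (g : B →ₗ[R] A) (h : A →ₗ[R] A) (k : B →ₗ[R] B),
    IsHomogeneous f 0 ∧ IsHomogeneous g 0 ∧ IsHomogeneous h (-2) ∧ IsHomogeneous k (-2) ∧
    IsChainMap f ∧ IsChainMap g ∧
    (∀ a, g (f a) = a + (h (A.d a) + A.d (h a))) ∧
    (∀ b, f (g b) = b + (k (B.d b) + B.d (k b)))

theorem HEquiv.refl (A : DiffModule R) : HEquiv A A :=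
  ⟨.id, .id, 0, 0, isHomogeneous_id A, isHomogeneous_id A, isHomogeneous_zero _,
    isHomogeneous_zero _, fun _ => rfl, fun _ => rfl, by simp, by simp⟩

theorem HEquiv.symm {A B : DiffModule R} : HEquiv A B → HEquiv B A := by
  rintro ⟨f, g, h, k, hf, hg, hh, hk, cf, cg, e₁, e₂⟩
  exact ⟨g, f, k, h, hg, hf, hk, hh, cg, cf, e₂, e₁⟩

theorem HEquiv.trans {A B C : DiffModule R} : HEquiv A B → HEquiv B C → HEquiv A C := by
  rintro ⟨f, g, h, k, hf, hg, hh, hk, cf, cg, e₁, e₂⟩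
  rintro ⟨f', g', h', k', hf', hg', hh', hk', cf', cg', e₁', e₂'⟩
  refine ⟨f' ∘ₗ f, g ∘ₗ g', h + g ∘ₗ h' ∘ₗ f, k' + f' ∘ₗ k ∘ₗ g', hf'.comp hf (by simp),
    hg.comp hg' (by simp), hh.add (hg.comp (hh'.comp hf rfl) (by simp)),
    hk'.add (hf'.comp (hk.comp hg' rfl) (by simp)), cf'.comp cf, cg.comp cg', ?_, ?_⟩
  · intro a
    simp only [LinearMap.comp_apply, LinearMap.add_apply, map_add]
    rw [e₁', map_add, e₁, map_add, cf a, cg]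
    abel
  · intro c
    simp only [LinearMap.comp_apply, LinearMap.add_apply, map_add]
    rw [e₂, map_add, e₂', map_add, cg' c, cf']
    abel

theorem HEquiv.of_iso {A B : DiffModule R} (f : A →ₗ[R] B) (g : B →ₗ[R] A)
    (hf : IsHomogeneous f 0) (hg : IsHomogeneous g 0) (cf : IsChainMap f)
    (h₁ : ∀ a, g (f a) = a) (h₂ : ∀ b, f (g b) = b) : HEquiv A B :=
  ⟨f, g, 0, 0, hf, hg, isHomogeneous_zero _, isHomogeneous_zero _, cf,
    fun m => by rw [← h₁ (A.d (g m)), cf, h₂], by simp [h₁], by simp [h₂]⟩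

/-- The data exhibiting `B` as a strong deformation retract of `A`. -/
structure Retraction (A B : DiffModule R) where
  incl : B →ₗ[R] A
  proj : A →ₗ[R] B
  htpy : A →ₗ[R] A
  incl_mem : IsHomogeneous incl 0
  proj_mem : IsHomogeneous proj 0
  htpy_mem : IsHomogeneous htpy (-2)
  incl_d : IsChainMap incl
  proj_d : IsChainMap proj
  proj_incl : ∀ b, proj (incl b) = b
  incl_proj : ∀ a, incl (proj a) = a + (htpy (A.d a) + A.d (htpy a))
  htpy_incl : ∀ b, htpy (incl b) = 0
  proj_htpy : ∀ a, proj (htpy a) = 0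

theorem Retraction.hEquiv {A B : DiffModule R} (r : Retraction A B) : HEquiv A B :=
  ⟨r.proj, r.incl, r.htpy, 0, r.proj_mem, r.incl_mem, r.htpy_mem, isHomogeneous_zero _, r.proj_d,
    r.incl_d, r.incl_proj, by simp [r.proj_incl]⟩

variable [Algebra (ZMod 2) R]

/-- The mapping cone of a chain map of degree `2`. -/
def cone {A B : DiffModule R} (φ : A →ₗ[R] B) (hφ : IsHomogeneous φ 2) (cφ : IsChainMap φ) :
    DiffModule R where
  carrier := A × B
  gr i := (A.gr i).prod (B.gr i)
  d := LinearMap.prod (A.d ∘ₗ LinearMap.fst R A B)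
    (φ ∘ₗ LinearMap.fst R A B + B.d ∘ₗ LinearMap.snd R A B)
  d_mem := by
    rintro i ⟨a, b⟩ ⟨ha, hb⟩
    exact ⟨A.d_mem i a ha, add_mem (hφ i a ha) (B.d_mem i b hb)⟩
  d_d := by
    rintro ⟨a, b⟩
    refine Prod.ext (A.d_d a) ?_
    change φ (A.d a) + B.d (φ a + B.d b) = 0
    rw [cφ, map_add, B.d_d, add_zero, add_self_of_charTwo R]

/-- A deformation retraction of the source of a chain map extends over the mapping cone. -/
theorem cone_retract_source {A A₀ B : DiffModule R} (r : Retraction A A₀) {φ : A →ₗ[R] B}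
    {hφ : IsHomogeneous φ 2} {cφ : IsChainMap φ} {ψ : A₀ →ₗ[R] B} {hψ : IsHomogeneous ψ 2}
    {cψ : IsChainMap ψ} (h : ∀ a, ψ a = φ (r.incl a)) :
    HEquiv (cone φ hφ cφ) (cone ψ hψ cψ) := by
  let f : (A × B) →ₗ[R] (A₀ × B) := LinearMap.prod (r.proj ∘ₗ LinearMap.fst R A B)
    (LinearMap.snd R A B + φ ∘ₗ r.htpy ∘ₗ LinearMap.fst R A B)
  let g : (A₀ × B) →ₗ[R] (A × B) := LinearMap.prodMap r.incl LinearMap.id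
  let k : (A × B) →ₗ[R] (A × B) := LinearMap.prod (r.htpy ∘ₗ LinearMap.fst R A B) 0
  refine ⟨f, g, k, 0, ?_, ?_, ?_, isHomogeneous_zero _, ?_, ?_, ?_, ?_⟩
  · rintro i ⟨a, b⟩ ⟨ha, hb⟩
    refine ⟨r.proj_mem i a ha, add_mem (by simpa using hb) ?_⟩
    have := hφ _ _ (r.htpy_mem i a ha)
    rwa [show i + -2 + 2 = i + 0 by ring] at this
  · rintro i ⟨a, b⟩ ⟨ha, hb⟩
    exact ⟨r.incl_mem i a ha, (by simpa using hb : b ∈ B.gr (i + 0))⟩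
  · rintro i ⟨a, b⟩ ⟨ha, hb⟩
    exact ⟨r.htpy_mem i a ha, zero_mem _⟩
  · rintro ⟨a, b⟩
    refine Prod.ext (r.proj_d a) ?_
    change (φ a + B.d b) + φ (r.htpy (A.d a)) = ψ (r.proj a) + B.d (b + φ (r.htpy a))
    rw [h, r.incl_proj, map_add, map_add, map_add, ← cφ]
    apply eq_of_add_eq_zero_of_charTwo R
    have h1 := add_self_of_charTwo R (φ a)
    have h2 := add_self_of_charTwo R (B.d b)
    have h3 := add_self_of_charTwo R (φ (r.htpy (A.d a)))
    have h4 := add_self_of_charTwo R (φ (A.d (r.htpy a)))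
    calc _ = (φ a + φ a) + (B.d b + B.d b) + (φ (r.htpy (A.d a)) + φ (r.htpy (A.d a))) +
          (φ (A.d (r.htpy a)) + φ (A.d (r.htpy a))) := by abel
      _ = 0 := by rw [h1, h2, h3, h4]; simp
  · rintro ⟨a, b⟩
    refine Prod.ext (r.incl_d a) ?_
    change ψ a + B.d b = φ (r.incl a) + B.d b
    rw [h]
  · rintro ⟨a, b⟩
    refine Prod.ext (r.incl_proj a) ?_
    change b + φ (r.htpy a) = b + (0 + (φ (r.htpy a) + B.d 0))
    simp
  · rintro ⟨a, b⟩
    refine Prod.ext ?_ ?_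
    · change r.proj (r.incl a) = a + (0 + A₀.d 0)
      simp [r.proj_incl]
    · change b + φ (r.htpy (r.incl a)) = b + (0 + (ψ 0 + B.d 0))
      simp [r.htpy_incl]

/-- A deformation retraction of the target of a chain map extends over the mapping cone. -/
theorem cone_retract_target {A A₀ B : DiffModule R} (r : Retraction A A₀) {φ : B →ₗ[R] A}
    {hφ : IsHomogeneous φ 2} {cφ : IsChainMap φ} {ψ : B →ₗ[R] A₀} {hψ : IsHomogeneous ψ 2}
    {cψ : IsChainMap ψ} (h : ∀ b, ψ b = r.proj (φ b)) :
    HEquiv (cone φ hφ cφ) (cone ψ hψ cψ) := by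
  let f : (B × A) →ₗ[R] (B × A₀) := LinearMap.prodMap LinearMap.id r.proj
  let g : (B × A₀) →ₗ[R] (B × A) := LinearMap.prod (LinearMap.fst R B A₀)
    (r.incl ∘ₗ LinearMap.snd R B A₀ + r.htpy ∘ₗ φ ∘ₗ LinearMap.fst R B A₀)
  let k : (B × A) →ₗ[R] (B × A) := LinearMap.prod 0 (r.htpy ∘ₗ LinearMap.snd R B A)
  refine ⟨f, g, k, 0, ?_, ?_, ?_, isHomogeneous_zero _, ?_, ?_, ?_, ?_⟩
  · rintro i ⟨b, a⟩ ⟨hb, ha⟩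
    exact ⟨(by simpa using hb : b ∈ B.gr (i + 0)), r.proj_mem i a ha⟩
  · rintro i ⟨b, a⟩ ⟨hb, ha⟩
    refine ⟨(by simpa using hb : b ∈ B.gr (i + 0)), add_mem (r.incl_mem i a ha) ?_⟩
    have := r.htpy_mem _ _ (hφ i b hb)
    rwa [show i + 2 + -2 = i + 0 by ring] at this
  · rintro i ⟨b, a⟩ ⟨hb, ha⟩
    exact ⟨zero_mem _, r.htpy_mem i a ha⟩
  · rintro ⟨b, a⟩
    refine Prod.ext rfl ?_
    change r.proj (φ b + A.d a) = ψ b + A₀.d (r.proj a)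
    rw [h, map_add, r.proj_d]
  · rintro ⟨b, a⟩
    refine Prod.ext rfl ?_
    change r.incl (ψ b + A₀.d a) + r.htpy (φ (B.d b)) = φ b + A.d (r.incl a + r.htpy (φ b))
    rw [h, map_add, map_add, r.incl_proj, cφ, r.incl_d]
    have h3 := add_self_of_charTwo R (r.htpy (A.d (φ b)))
    calc _ = φ b + (A.d (r.incl a) + A.d (r.htpy (φ b))) +
          (r.htpy (A.d (φ b)) + r.htpy (A.d (φ b))) := by abel
      _ = _ := by rw [h3, add_zero]
  · rintro ⟨b, a⟩
    refine Prod.ext ?_ ?_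
    · change b = b + (0 + B.d 0)
      simp
    · change r.incl (r.proj a) + r.htpy (φ b) = a + (r.htpy (φ b + A.d a) + (φ 0 + A.d (r.htpy a)))
      rw [r.incl_proj, map_add, map_zero]
      abel
  · rintro ⟨b, a⟩
    refine Prod.ext ?_ ?_
    · change b = b + (0 + B.d 0)
      simp
    · change r.proj (r.incl a + r.htpy (φ b)) = a + (0 + (ψ 0 + A₀.d 0))
      simp [r.proj_incl, r.proj_htpy]

end DiffModule

/-! ### The algebra of a collection of circles -/

section CircleAlgebra

open MvPolynomial

/-- The relations of the algebra attached to the classes (the circles) of an equivalence relation on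
the set `E` of edges, one of which lies on the marked circle: `X² = 0` on each edge, edges on
the same circle act equally, and the marked edge acts by zero. -/
noncomputable def circleIdeal (R : Type) [CommRing R] {E : Type} (r : Setoid E) (m : E) :
    Ideal (MvPolynomial E R) :=
  Ideal.span ({f | ∃ e, f = X e ^ 2} ∪ {f | ∃ a b, r a b ∧ f = X a + X b} ∪ {X m})

/-- The tensor product over the unmarked circles of the algebras `R[X]/(X²)`, where `1` stands for
`v₊` and `X` for `v₋`, presented as a quotient of the polynomial ring on the edges. In this form
the Khovanov maps are linear over the polynomial ring, hence determined by the image of `1`. -/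
abbrev CircleAlgebra (R : Type) [CommRing R] {E : Type} (r : Setoid E) (m : E) : Type :=
  MvPolynomial E R ⧸ circleIdeal R r m

namespace CircleAlgebra

variable {R : Type} [CommRing R] {E : Type}

/-- The quotient map onto the algebra of circles. -/
noncomputable def mk (r : Setoid E) (m : E) : MvPolynomial E R →ₐ[R] CircleAlgebra R r m :=
  Ideal.Quotient.mkₐ R _

theorem mk_surjective (r : Setoid E) (m : E) :
    Function.Surjective (mk (R := R) r m) := Ideal.Quotient.mk_surjective

theorem mk_eq_zero_iff {r : Setoid E} {m : E} {f : MvPolynomial E R} :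
    mk r m f = 0 ↔ f ∈ circleIdeal R r m := Ideal.Quotient.eq_zero_iff_mem

/-- The action of an edge. -/
noncomputable def x (r : Setoid E) (m : E) (e : E) : CircleAlgebra R r m := mk r m (X e)

theorem mk_X (r : Setoid E) (m e : E) : mk (R := R) r m (X e) = x r m e := rfl

theorem x_mul_self (r : Setoid E) (m e : E) : x (R := R) r m e * x r m e = 0 := by
  rw [x, ← map_mul, ← pow_two, mk_eq_zero_iff]
  exact Ideal.subset_span (Or.inl (Or.inl ⟨e, rfl⟩))

theorem x_mark (r : Setoid E) (m : E) : x (R := R) r m m = 0 := by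
  rw [x, mk_eq_zero_iff]
  exact Ideal.subset_span (Or.inr rfl)

theorem x_add_x {r : Setoid E} (m : E) {a b : E} (h : r a b) :
    x (R := R) r m a + x r m b = 0 := by
  rw [x, x, ← map_add, mk_eq_zero_iff]
  exact Ideal.subset_span (Or.inl (Or.inr ⟨a, b, h, rfl⟩))

/-- The universal property of the algebra of circles. -/
noncomputable def lift {r : Setoid E} {m : E} {A : Type} [CommRing A] [Algebra R A] (f : E → A)
    (h₁ : ∀ e, f e ^ 2 = 0) (h₂ : ∀ a b, r a b → f a + f b = 0) (h₃ : f m = 0) :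
    CircleAlgebra R r m →ₐ[R] A :=
  Ideal.Quotient.liftₐ _ (aeval f) (by
    intro p hp
    have : circleIdeal R r m ≤ RingHom.ker (aeval (R := R) f) := by
      refine Ideal.span_le.2 ?_
      rintro _ ((⟨e, rfl⟩ | ⟨a, b, h, rfl⟩) | rfl)
      · simp [RingHom.mem_ker, h₁]
      · simp [RingHom.mem_ker, h₂ a b h]
      · simp [RingHom.mem_ker, h₃]
    exact this hp)

theorem lift_mk {r : Setoid E} {m : E} {A : Type} [CommRing A] [Algebra R A] (f : E → A)
    (h₁ : ∀ e, f e ^ 2 = 0) (h₂ : ∀ a b, r a b → f a + f b = 0) (h₃ : f m = 0)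
    (p : MvPolynomial E R) : lift (r := r) (m := m) f h₁ h₂ h₃ (mk r m p) = aeval f p := rfl

theorem lift_x {r : Setoid E} {m : E} {A : Type} [CommRing A] [Algebra R A] (f : E → A)
    (h₁ : ∀ e, f e ^ 2 = 0) (h₂ : ∀ a b, r a b → f a + f b = 0) (h₃ : f m = 0) (e : E) :
    lift (R := R) (r := r) (m := m) f h₁ h₂ h₃ (x r m e) = f e := by
  rw [x, lift_mk, aeval_X]

variable [Algebra (ZMod 2) R]

theorem add_self (r : Setoid E) (m : E) (a : CircleAlgebra R r m) : a + a = 0 :=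
  add_self_of_charTwo R a

theorem x_eq {r : Setoid E} (m : E) {a b : E} (h : r a b) : x (R := R) r m a = x r m b :=
  eq_of_add_eq_zero_of_charTwo R (x_add_x m h)

/-! ### Functoriality -/

/-- A map of edges carrying circles into circles and the marked circle to the marked circle. -/
structure IsCircleMap {E' : Type} (r : Setoid E) (m : E) (r' : Setoid E') (m' : E')
    (j : E → E') : Prop where
  rel : ∀ a b, r a b → r' (j a) (j b)
  mark : r' (j m) m'

variable {E' : Type}

/-- The algebra map induced by a map of edges. -/
noncomputable def map {r : Setoid E} {m : E} {r' : Setoid E'} {m' : E'} (j : E → E')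
    (h : IsCircleMap r m r' m' j) : CircleAlgebra R r m →ₐ[R] CircleAlgebra R r' m' :=
  lift (fun e => x r' m' (j e)) (fun e => by rw [pow_two, x_mul_self])
    (fun a b hab => x_add_x m' (h.rel a b hab))
    (by rw [x_eq m' h.mark, x_mark])

theorem map_x {r : Setoid E} {m : E} {r' : Setoid E'} {m' : E'} {j : E → E'}
    (h : IsCircleMap r m r' m' j) (e : E) :
    map (R := R) j h (x r m e) = x r' m' (j e) := lift_x ..

theorem map_mk {r : Setoid E} {m : E} {r' : Setoid E'} {m' : E'} {j : E → E'}
    (h : IsCircleMap r m r' m' j) (f : MvPolynomial E R) :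
    map (R := R) j h (mk r m f) = mk r' m' (rename j f) := by
  have : (map (R := R) j h).comp (mk r m) = (mk r' m').comp (rename j) := by
    ext e
    rw [AlgHom.comp_apply, AlgHom.comp_apply, rename_X, mk_X, mk_X, map_x]
  exact DFunLike.congr_fun this f

theorem hom_ext {r : Setoid E} {m : E} {A : Type} [Semiring A] [Algebra R A]
    {f g : CircleAlgebra R r m →ₐ[R] A} (h : ∀ e, f (x r m e) = g (x r m e)) : f = g := by
  have : f.comp (mk r m) = g.comp (mk r m) := by
    ext e; exact h e
  refine AlgHom.ext fun v => ?_
  obtain ⟨p, rfl⟩ := mk_surjective r m v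
  exact DFunLike.congr_fun this p

theorem map_map_eq_self {r : Setoid E} {m : E} {r' : Setoid E'} {m' : E'}
    {j : E → E'} {j' : E' → E} (h : IsCircleMap r m r' m' j)
    (h' : IsCircleMap r' m' r m j')
    (hjk : ∀ a, r (j' (j a)) a) (v : CircleAlgebra R r m) :
    map j' h' (map j h v) = v := by
  have : (map j' h').comp (map j h) = AlgHom.id R (CircleAlgebra R r m) := by
    apply hom_ext
    intro e
    rw [AlgHom.comp_apply, map_x, map_x, x_eq m (hjk e)]; rfl
  exact DFunLike.congr_fun this v

end CircleAlgebra

end CircleAlgebra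

/-! ### Surgeries -/

/-- `r'` arises from `r` by merging the classes of `p` and `q`, which are different. -/
def Merge {E : Type} (r r' : Setoid E) (p q : E) : Prop :=
  ¬ r p q ∧ ∀ a b, r' a b ↔ r a b ∨ (r a p ∧ r b q) ∨ (r a q ∧ r b p)

/-- One of `r`, `r'` arises from the other by merging the classes of `p` and `q`. -/
def Surgery {E : Type} (r r' : Setoid E) (p q : E) : Prop :=
  Merge r r' p q ∨ Merge r' r p q

section Surgery

variable {E : Type} {r r' : Setoid E} {p q : E}

theorem Merge.le (h : Merge r r' p q) {a b : E} (hab : r a b) : r' a b := (h.2 a b).2 (Or.inl hab)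

theorem Merge.rel (h : Merge r r' p q) : r' p q :=
  (h.2 p q).2 (Or.inr (Or.inl ⟨r.refl p, r.refl q⟩))

theorem Surgery.symm (h : Surgery r r' p q) : Surgery r' r p q := Or.symm h

theorem Surgery.xor (h : Surgery r r' p q) : r p q ↔ ¬ r' p q := by
  rcases h with h | h
  · exact iff_of_false h.1 (not_not.2 h.rel)
  · exact iff_of_true h.rel h.1

theorem Surgery.merge (h : Surgery r r' p q) (hpq : ¬ r p q) : Merge r r' p q :=
  h.resolve_right fun h' => hpq h'.rel

theorem Surgery.split (h : Surgery r r' p q) (hpq : r p q) : Merge r' r p q :=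
  h.resolve_left fun h' => h'.1 hpq

/-- The classes merged by a merge may be represented by other elements. -/
theorem Merge.congr (h : Merge r r' p q) {p' q' : E} (hp : r p' p) (hq : r q' q) :
    Merge r r' p' q' := by
  refine ⟨fun h' => h.1 (r.trans (r.symm hp) (r.trans h' hq)), fun a b => ?_⟩
  have e₁ : ∀ c, r c p ↔ r c p' := fun c => ⟨fun h => r.trans h (r.symm hp), fun h => r.trans h hp⟩
  have e₂ : ∀ c, r c q ↔ r c q' := fun c => ⟨fun h => r.trans h (r.symm hq), fun h => r.trans h hq⟩
  rw [h.2, e₁, e₁, e₂, e₂]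

/-- Restriction of a merge along a map of edges. -/
theorem Merge.comap {E₀ : Type} (j : E₀ → E) {p q : E₀} (h : Merge r r' (j p) (j q)) :
    Merge (r.comap j) (r'.comap j) p q :=
  ⟨h.1, fun a b => h.2 (j a) (j b)⟩

theorem Surgery.comap {E₀ : Type} (j : E₀ → E) {p q : E₀} (h : Surgery r r' (j p) (j q)) :
    Surgery (r.comap j) (r'.comap j) p q :=
  h.imp (Merge.comap j) (Merge.comap j)

/-- The pairs merged by two descriptions of the same merge have the same classes. -/
theorem Merge.rel_pair (h : Merge r r' p q) {p' q' : E} (h' : Merge r r' p' q') :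
    (r p' p ∧ r q' q) ∨ (r p' q ∧ r q' p) :=
  ((h.2 p' q').1 h'.rel).resolve_left h'.1

theorem Merge.not_merge (h : Merge r r' p q) {p' q' : E} (h' : Merge r' r p' q') : False :=
  h'.1 (h.le h'.rel)

/-- Merging two classes lowers the number of classes by one. -/
theorem Merge.card_quotient [Finite E] (h : Merge r r' p q) :
    Nat.card (Quotient r) = Nat.card (Quotient r') + 1 := by
  classical
  let f : {c : Quotient r // c ≠ Quotient.mk r p} → Quotient r' := fun c =>
    Quotient.map' (s₁ := r) (s₂ := r') id (fun a b hab => h.le hab) c.1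
  have hf : Function.Bijective f := by
    constructor
    · rintro ⟨⟨a⟩, ha⟩ ⟨⟨b⟩, hb⟩ hab
      have ha' : ¬ r a p := fun h => ha (Quotient.sound h)
      have hb' : ¬ r b p := fun h => hb (Quotient.sound h)
      have hab' : r' a b := Quotient.exact hab
      rw [h.2] at hab'
      refine Subtype.ext (Quotient.sound ?_)
      rcases hab' with h' | ⟨h', -⟩ | ⟨-, h'⟩
      · exact h'
      · exact absurd h' ha'
      · exact absurd h' hb'
    · rintro ⟨a⟩
      by_cases ha : r a p
      · exact ⟨⟨Quotient.mk r q, fun h' => h.1 (r.symm (Quotient.exact h'))⟩,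
          Quotient.sound ((h.2 q a).2 (Or.inr (Or.inr ⟨r.refl q, ha⟩)))⟩
      · exact ⟨⟨Quotient.mk r a, fun h' => ha (Quotient.exact h')⟩, rfl⟩
  rw [← Nat.card_congr (Equiv.ofBijective f hf),
    ← Nat.card_congr (Equiv.optionSubtypeNe (Quotient.mk r p)), Finite.card_option]

end Surgery

namespace CircleAlgebra

open MvPolynomial

variable {R : Type} [CommRing R] {E : Type} [Algebra (ZMod 2) R]

open Classical in
/-- The image of `1` under the surgery map: `1` for a merge, and the sum of the actions of the two
new circles for a split. -/
noncomputable def surgeryCoeff (R : Type) [CommRing R] (r : Setoid E) (p q : E) :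
    MvPolynomial E R :=
  if r p q then X p + X q else 1

theorem surgeryCoeff_congr {r r' : Setoid E} {p q : E} (h : r p q ↔ r' p q) :
    surgeryCoeff R r p q = surgeryCoeff R r' p q := by
  by_cases A : r p q
  · rw [surgeryCoeff, surgeryCoeff, if_pos A, if_pos (h.1 A)]
  · rw [surgeryCoeff, surgeryCoeff, if_neg A, if_neg fun B => A (h.2 B)]

theorem surgeryCoeff_mul_mem {r r' : Setoid E} {p q : E} (m : E) (h : Surgery r r' p q)
    {f : MvPolynomial E R} (hf : f ∈ circleIdeal R r m) :
    mk r' m (f * surgeryCoeff R r p q) = 0 := by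
  rw [mul_comm]
  refine Submodule.span_induction (p := fun f _ => mk r' m (surgeryCoeff R r p q * f) = 0)
    ?_ ?_ ?_ ?_ hf
  · rintro _ ((⟨e, rfl⟩ | ⟨a, b, hab, rfl⟩) | rfl)
    · rw [map_mul, map_pow, mk_X, pow_two, x_mul_self, mul_zero]
    · rw [map_mul, map_add, mk_X, mk_X]
      rw [surgeryCoeff]
      split_ifs with hpq
      · have hm := h.split hpq
        rw [map_add, mk_X, mk_X]
        rcases (hm.2 a b).1 hab with h' | ⟨h₁, h₂⟩ | ⟨h₁, h₂⟩
        · rw [x_add_x m h', mul_zero]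
        · rw [x_eq m h₁, x_eq m h₂, add_mul, mul_add, mul_add, x_mul_self, x_mul_self, zero_add,
            add_zero, mul_comm, add_self]
        · rw [x_eq m h₁, x_eq m h₂, add_mul, mul_add, mul_add, x_mul_self, x_mul_self, zero_add,
            add_zero, mul_comm, add_self]
      · rw [x_add_x m ((h.merge hpq).le hab), mul_zero]
    · rw [map_mul, mk_X, x_mark, mul_zero]
  · simp
  · intro a b _ _ ha hb
    rw [mul_add, map_add, ha, hb, add_zero]
  · intro a b _ hb
    rw [smul_eq_mul, mul_left_comm, map_mul, hb, mul_zero]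

open Classical in
/-- The Khovanov map between the algebras of two collections of circles that differ by a surgery
(and zero if they do not): the multiplication or the comultiplication. -/
noncomputable def surgery (r r' : Setoid E) (m : E) :
    CircleAlgebra R r m →ₗ[R] CircleAlgebra R r' m :=
  if h : ∃ p q, Surgery r r' p q then
    LinearMap.restrictScalars R
      (Submodule.liftQ (circleIdeal R r m)
        (LinearMap.toSpanSingleton (MvPolynomial E R) (CircleAlgebra R r' m)
          (mk r' m (surgeryCoeff R r h.choose h.choose_spec.choose)))
        (fun f hf => by
          rw [LinearMap.mem_ker, LinearMap.toSpanSingleton_apply]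
          exact surgeryCoeff_mul_mem m h.choose_spec.choose_spec hf))
  else 0

theorem surgery_mk {r r' : Setoid E} {p q : E} (m : E) (h : Surgery r r' p q)
    (f : MvPolynomial E R) :
    surgery r r' m (mk r m f) = mk r' m (f * surgeryCoeff R r p q) := by
  have hex : ∃ p q, Surgery r r' p q := ⟨p, q, h⟩
  have h' := hex.choose_spec.choose_spec
  have e : surgery r r' m (mk r m f) = mk r' m
      (f * surgeryCoeff R r hex.choose hex.choose_spec.choose) := by
    rw [surgery, dif_pos hex]; rfl
  rw [e, map_mul, map_mul]
  congr 1
  clear e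
  generalize hex.choose_spec.choose = q' at *
  generalize hex.choose = p' at *
  rcases h with h | h <;> rcases h' with h' | h'
  · rw [surgeryCoeff, surgeryCoeff, if_neg h.1, if_neg h'.1]
  · exact (h.not_merge h').elim
  · exact (h.not_merge h').elim
  · rw [surgeryCoeff, surgeryCoeff, if_pos h.rel, if_pos h'.rel, map_add, map_add, mk_X, mk_X,
      mk_X, mk_X]
    rcases h.rel_pair h' with ⟨h₁, h₂⟩ | ⟨h₁, h₂⟩
    · rw [x_eq m h₁, x_eq m h₂]
    · rw [x_eq m h₁, x_eq m h₂, add_comm]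

theorem surgery_mul {r r' : Setoid E} {p q : E} (m : E) (h : Surgery r r' p q)
    (v : CircleAlgebra R r m) (f : MvPolynomial E R) :
    surgery r r' m (mk r m f * v) = mk r' m f * surgery r r' m v := by
  obtain ⟨g, rfl⟩ := mk_surjective r m v
  rw [← map_mul, surgery_mk m h, surgery_mk m h, mul_assoc, map_mul]

theorem surgery_of_merge {r r' : Setoid E} {p q : E} (m : E) (h : Merge r r' p q)
    (f : MvPolynomial E R) : surgery r r' m (mk r m f) = mk r' m f := by
  rw [surgery_mk m (Or.inl h), surgeryCoeff, if_neg h.1, mul_one]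

theorem surgery_of_split {r r' : Setoid E} {p q : E} (m : E) (h : Merge r' r p q)
    (f : MvPolynomial E R) : surgery r r' m (mk r m f) = mk r' m f * (x r' m p + x r' m q) := by
  rw [surgery_mk m (Or.inr h), surgeryCoeff, if_pos h.rel, map_mul, map_add]; rfl

/-- The commutativity of two surgeries, in the case where performing the second one changes the kind
(merge or split) of the first. -/
theorem surgery_square_aux {r rx ry rxy : Setoid E} {px qx py qy : E} (m : E)
    (hx : Surgery r rx px qx) (hx' : Surgery ry rxy px qx)
    (hy : Surgery r ry py qy) (hy' : Surgery rx rxy py qy) (hne : ¬ (r px qx ↔ ry px qx)) :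
    mk rxy m (surgeryCoeff R r px qx * surgeryCoeff R rx py qy) =
      mk rxy m (surgeryCoeff R r py qy * surgeryCoeff R ry px qx) := by
  by_cases A : r px qx
  · have A' : ¬ ry px qx := fun h => hne (iff_of_true A h)
    have B : r py qy := by
      by_contra B
      exact A' ((hy.merge B).le A)
    have hxy : rxy px qx := (hx'.merge A').rel
    have B' : ¬ rx py qy := fun B' => hx.xor.1 A ((hy'.split B').le hxy)
    rw [surgeryCoeff, surgeryCoeff, surgeryCoeff, surgeryCoeff, if_pos A, if_neg A', if_pos B,
      if_neg B', mul_one, mul_one, map_add, map_add, mk_X, mk_X, mk_X, mk_X, x_add_x m hxy,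
      x_add_x m (hy'.merge B').rel]
  · have A' : ry px qx := by
      by_contra A'
      exact hne (iff_of_false A A')
    have B : ¬ r py qy := fun B => A ((hy.split B).le A')
    have hxy : ¬ rxy px qx := hx'.xor.1 A'
    have hx1 : rx px qx := (hx.merge A).rel
    have B' : rx py qy := by
      by_contra B'
      exact hxy ((hy'.merge B').le hx1)
    rw [surgeryCoeff, surgeryCoeff, surgeryCoeff, surgeryCoeff, if_neg A, if_pos A', if_neg B,
      if_pos B', one_mul, one_mul, map_add, map_add, mk_X, mk_X, mk_X, mk_X]
    rcases (((hy'.split B').2 px qx).1 hx1).resolve_left hxy with ⟨h₁, h₂⟩ | ⟨h₁, h₂⟩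
    · rw [x_eq m h₁, x_eq m h₂]
    · rw [x_eq m h₁, x_eq m h₂, add_comm]

/-- Surgeries at two different places commute. -/
theorem surgery_square {r rx ry rxy : Setoid E} {px qx py qy : E} (m : E)
    (hx : Surgery r rx px qx) (hx' : Surgery ry rxy px qx)
    (hy : Surgery r ry py qy) (hy' : Surgery rx rxy py qy) (v : CircleAlgebra R r m) :
    surgery rx rxy m (surgery r rx m v) = surgery ry rxy m (surgery r ry m v) := by
  obtain ⟨f, rfl⟩ := mk_surjective r m v
  rw [surgery_mk m hx, surgery_mk m hy, surgery_mk m hx', surgery_mk m hy', mul_assoc, mul_assoc,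
    map_mul _ f, map_mul _ f]
  congr 1
  by_cases h₁ : r px qx ↔ ry px qx
  · by_cases h₂ : r py qy ↔ rx py qy
    · rw [surgeryCoeff_congr h₁, surgeryCoeff_congr h₂, mul_comm]
    · exact (surgery_square_aux m hy hy' hx hx' h₂).symm
  · exact surgery_square_aux m hx hx' hy hy' h₁

/-- Going back and forth along a surgery is the sum of the actions of its two strands. -/
theorem surgery_surgery {r r' : Setoid E} {p q : E} (m : E) (h : Surgery r r' p q)
    (v : CircleAlgebra R r m) :
    surgery r' r m (surgery r r' m v) = (x r m p + x r m q) * v := by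
  obtain ⟨f, rfl⟩ := mk_surjective r m v
  rw [surgery_mk m h, surgery_mk m h.symm, mul_assoc, map_mul, mul_comm]
  congr 1
  rw [surgeryCoeff, surgeryCoeff]
  by_cases A : r p q
  · rw [if_pos A, if_neg (h.xor.1 A), mul_one, map_add]; rfl
  · rw [if_neg A, if_pos (h.merge A).rel, one_mul, map_add]; rfl

/-- The two strands of a surgery act equally on the image of the surgery map. -/
theorem x_add_x_mul_surgery {r r' : Setoid E} {p q : E} (m : E) (h : Surgery r r' p q)
    (v : CircleAlgebra R r m) : (x r' m p + x r' m q) * surgery r r' m v = 0 := by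
  obtain ⟨f, rfl⟩ := mk_surjective r m v
  by_cases A : r p q
  · have e : (x (R := R) r' m p + x r' m q) * (x r' m p + x r' m q) = 0 := by
      rw [add_mul, mul_add, mul_add, x_mul_self, x_mul_self, zero_add, add_zero,
        mul_comm (x r' m q), add_self]
    rw [surgery_of_split m (h.split A), mul_left_comm, e, mul_zero]
  · rw [x_add_x m (h.merge A).rel, zero_mul]

/-- Surgery maps are natural for maps of edges that are bijective on circles. -/
theorem surgery_map {E₀ : Type} {r r' : Setoid E} {m p q : E} {r₀ r₀' : Setoid E₀} {m₀ : E₀}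
    {j : E₀ → E} (h : Surgery r r' p q) (h₀ : IsCircleMap r₀ m₀ r m j)
    (h₀' : IsCircleMap r₀' m₀ r' m j) (hr : ∀ a b, r₀ a b ↔ r (j a) (j b))
    (hr' : ∀ a b, r₀' a b ↔ r' (j a) (j b)) (hs : ∀ e, ∃ a, r (j a) e) (hs' : ∀ e, ∃ a, r' (j a) e)
    (v : CircleAlgebra R r₀ m₀) :
    surgery r r' m (map j h₀ v) = map j h₀' (surgery r₀ r₀' m₀ v) := by
  have er : r₀ = r.comap j := Setoid.ext fun a b => hr a b
  have er' : r₀' = r'.comap j := Setoid.ext fun a b => hr' a b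
  obtain ⟨f, rfl⟩ := mk_surjective r₀ m₀ v
  rcases h with h | h
  · obtain ⟨p₀, hp⟩ := hs p
    obtain ⟨q₀, hq⟩ := hs q
    have k := h.congr hp hq
    have k₀ : Merge r₀ r₀' p₀ q₀ := by rw [er, er']; exact k.comap j
    rw [map_mk, surgery_of_merge m k, surgery_of_merge m₀ k₀, map_mk]
  · obtain ⟨p₀, hp⟩ := hs' p
    obtain ⟨q₀, hq⟩ := hs' q
    have k := h.congr hp hq
    have k₀ : Merge r₀' r₀ p₀ q₀ := by rw [er, er']; exact k.comap j
    rw [map_mk, surgery_of_split m k, surgery_of_split m₀ k₀, map_mul, map_mk, map_add, map_x,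
      map_x]

/-! ### Gradings -/

/-- The part of degree `d` of the algebra of circles. A monomial of polynomial degree `k` has degree
`2 k` minus the number of unmarked circles. -/
noncomputable def gr (R : Type) [CommRing R] (r : Setoid E) (m : E) (d : ℤ) :
    Submodule R (CircleAlgebra R r m) :=
  Submodule.span R {v | ∃ s : E →₀ ℕ,
    2 * (s.degree : ℤ) - (Nat.card (Quotient r) - 1) = d ∧ v = mk r m (monomial s 1)}

theorem mk_monomial_mem {r : Setoid E} {m : E} {d : ℤ} {s : E →₀ ℕ}
    (h : 2 * (s.degree : ℤ) - (Nat.card (Quotient r) - 1) = d) :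
    mk r m (monomial s (1 : R)) ∈ gr R r m d := Submodule.subset_span ⟨s, h, rfl⟩

theorem map_mem_of_monomial {M : Type} [AddCommGroup M] [Module R M] {r : Setoid E} {m : E} {d : ℤ}
    (f : CircleAlgebra R r m →ₗ[R] M) (N : Submodule R M)
    (h : ∀ s : E →₀ ℕ, 2 * (s.degree : ℤ) - (Nat.card (Quotient r) - 1) = d →
      f (mk r m (monomial s 1)) ∈ N) {v : CircleAlgebra R r m} (hv : v ∈ gr R r m d) : f v ∈ N := by
  have : gr R r m d ≤ N.comap f := by
    refine Submodule.span_le.2 ?_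
    rintro _ ⟨s, hs, rfl⟩
    exact h s hs
  exact this hv

theorem monomial_mul_X (s : E →₀ ℕ) (e : E) :
    (monomial s (1 : R)) * X e = monomial (s + Finsupp.single e 1) 1 := by
  rw [X, monomial_mul, mul_one]

theorem x_mul_mem {r : Setoid E} {m : E} {d : ℤ} (e : E) {v : CircleAlgebra R r m}
    (hv : v ∈ gr R r m d) : x r m e * v ∈ gr R r m (d + 2) := by
  refine map_mem_of_monomial (LinearMap.mulLeft R (x r m e)) _ ?_ hv
  intro s hs
  rw [LinearMap.mulLeft_apply, ← mk_X, mul_comm, ← map_mul, monomial_mul_X]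
  refine mk_monomial_mem ?_
  rw [map_add, Finsupp.degree_single]
  push_cast
  linarith

theorem map_mem {E' : Type} {r : Setoid E} {m : E} {r' : Setoid E'} {m' : E'} {j : E → E'}
    (h : IsCircleMap r m r' m' j) {d d' : ℤ}
    (hd : d - Nat.card (Quotient r') = d' - Nat.card (Quotient r))
    {v : CircleAlgebra R r m} (hv : v ∈ gr R r m d) : map j h v ∈ gr R r' m' d' := by
  refine map_mem_of_monomial (map j h).toLinearMap _ ?_ hv
  intro s hs
  rw [AlgHom.toLinearMap_apply, map_mk, rename_monomial]
  refine mk_monomial_mem ?_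
  rw [Finsupp.degree_mapDomain]
  linarith

theorem surgery_mem [Finite E] {r r' : Setoid E} {p q m : E} (h : Surgery r r' p q) {d : ℤ}
    {v : CircleAlgebra R r m} (hv : v ∈ gr R r m d) : surgery r r' m v ∈ gr R r' m (d + 1) := by
  refine map_mem_of_monomial (surgery r r' m) _ ?_ hv
  intro s hs
  rcases h with h | h
  · rw [surgery_of_merge m h]
    refine mk_monomial_mem ?_
    have := h.card_quotient
    rw [this] at hs
    push_cast at hs
    linarith
  · rw [surgery_of_split m h, mul_add]
    have := h.card_quotient
    rw [← mk_X, ← mk_X, ← map_mul, ← map_mul, monomial_mul_X, monomial_mul_X]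
    refine add_mem (mk_monomial_mem ?_) (mk_monomial_mem ?_) <;>
    · rw [map_add, Finsupp.degree_single, this]
      push_cast
      linarith

end CircleAlgebra

/-! ### Cubes of surgeries and their complexes -/

/-- A family of equivalence relations on a set `E` of edges, indexed by the resolutions of a set `X` of
crossings. Changing the resolution of a crossing `x` is a surgery, along arcs that pass through the
edges `p x` and `q x`. -/
structure SurgeryCube (X E : Type) [DecidableEq X] where
  rel : Finset X → Setoid E
  p : X → E
  q : X → E
  surgery : ∀ S x, x ∉ S → Surgery (rel S) (rel (insert x S)) (p x) (q x)

namespace SurgeryCube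

open DiffModule

variable {X E : Type} [DecidableEq X] (C : SurgeryCube X E) (R : Type) [CommRing R] (m : E)

theorem surgery_erase {S : Finset X} {x : X} (h : x ∈ S) :
    Surgery (C.rel (S.erase x)) (C.rel S) (C.p x) (C.q x) := by
  have := C.surgery (S.erase x) x (Finset.notMem_erase x S)
  rwa [Finset.insert_erase h] at this

/-- The sum over all resolutions of the algebras of circles. -/
abbrev Total : Type := ∀ S : Finset X, CircleAlgebra R (C.rel S) m

variable [Algebra (ZMod 2) R] {R} {m}

/-- The Khovanov map at the crossing `x`. -/
noncomputable def up (x : X) : C.Total R m →ₗ[R] C.Total R m :=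
  LinearMap.pi fun T => if x ∈ T then
    CircleAlgebra.surgery (C.rel (T.erase x)) (C.rel T) m ∘ₗ LinearMap.proj (T.erase x) else 0

/-- The reversed Khovanov map at the crossing `x`. -/
noncomputable def down (x : X) : C.Total R m →ₗ[R] C.Total R m :=
  LinearMap.pi fun T => if x ∈ T then 0 else
    CircleAlgebra.surgery (C.rel (insert x T)) (C.rel T) m ∘ₗ LinearMap.proj (insert x T)

/-- The action of a polynomial in the edges. -/
noncomputable def act (f : MvPolynomial E R) : C.Total R m →ₗ[R] C.Total R m :=
  LinearMap.pi fun T => LinearMap.mulLeft R (CircleAlgebra.mk (C.rel T) m f) ∘ₗ LinearMap.proj T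

variable {C}

theorem up_apply_of_mem {x : X} {T : Finset X} (h : x ∈ T) (v : C.Total R m) :
    C.up x v T = CircleAlgebra.surgery (C.rel (T.erase x)) (C.rel T) m (v (T.erase x)) := by
  simp [up, h]

theorem up_apply_of_notMem {x : X} {T : Finset X} (h : x ∉ T) (v : C.Total R m) :
    C.up x v T = 0 := by
  simp [up, h]

theorem down_apply_of_mem {x : X} {T : Finset X} (h : x ∈ T) (v : C.Total R m) :
    C.down x v T = 0 := by
  simp [down, h]

theorem down_apply_of_notMem {x : X} {T : Finset X} (h : x ∉ T) (v : C.Total R m) :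
    C.down x v T = CircleAlgebra.surgery (C.rel (insert x T)) (C.rel T) m (v (insert x T)) := by
  simp [down, h]

theorem act_apply (f : MvPolynomial E R) (v : C.Total R m) (T : Finset X) :
    C.act f v T = CircleAlgebra.mk (C.rel T) m f * v T := rfl

theorem up_up_self (x : X) (v : C.Total R m) : C.up x (C.up x v) = 0 := by
  funext T
  by_cases h : x ∈ T
  · rw [up_apply_of_mem h, up_apply_of_notMem (Finset.notMem_erase x T), map_zero]; rfl
  · rw [up_apply_of_notMem h]; rfl

theorem down_down_self (x : X) (v : C.Total R m) : C.down x (C.down x v) = 0 := by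
  funext T
  by_cases h : x ∈ T
  · rw [down_apply_of_mem h]; rfl
  · rw [down_apply_of_notMem h, down_apply_of_mem (Finset.mem_insert_self x T), map_zero]; rfl

theorem up_up_comm (x y : X) (v : C.Total R m) : C.up x (C.up y v) = C.up y (C.up x v) := by
  by_cases hxy : x = y
  · rw [hxy]
  funext T
  by_cases hx : x ∈ T <;> by_cases hy : y ∈ T
  · have hy' : y ∈ T.erase x := Finset.mem_erase.2 ⟨Ne.symm hxy, hy⟩
    have hx' : x ∈ T.erase y := Finset.mem_erase.2 ⟨hxy, hx⟩
    rw [up_apply_of_mem hx, up_apply_of_mem hy, up_apply_of_mem hy', up_apply_of_mem hx']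
    have e : (T.erase x).erase y = (T.erase y).erase x := Finset.erase_right_comm
    have s₁ := C.surgery_erase hy'
    rw [e] at s₁ ⊢
    exact CircleAlgebra.surgery_square m s₁ (C.surgery_erase hy) (C.surgery_erase hx')
      (C.surgery_erase hx) _
  · rw [up_apply_of_mem hx, up_apply_of_notMem hy,
      up_apply_of_notMem fun h => hy (Finset.mem_of_mem_erase h), map_zero]
  · rw [up_apply_of_notMem hx, up_apply_of_mem hy,
      up_apply_of_notMem fun h => hx (Finset.mem_of_mem_erase h), map_zero]
  · rw [up_apply_of_notMem hx, up_apply_of_notMem hy]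

theorem up_down_comm {x y : X} (hxy : x ≠ y) (v : C.Total R m) :
    C.up y (C.down x v) = C.down x (C.up y v) := by
  funext T
  by_cases hx : x ∈ T <;> by_cases hy : y ∈ T
  · have hx' : x ∈ T.erase y := Finset.mem_erase.2 ⟨hxy, hx⟩
    rw [up_apply_of_mem hy, down_apply_of_mem hx, down_apply_of_mem hx', map_zero]
  · rw [up_apply_of_notMem hy, down_apply_of_mem hx]
  · have hx' : x ∉ T.erase y := fun h => hx (Finset.mem_of_mem_erase h)
    have hy' : y ∈ insert x T := Finset.mem_insert_of_mem hy
    rw [up_apply_of_mem hy, down_apply_of_notMem hx, down_apply_of_notMem hx',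
      up_apply_of_mem hy']
    have e : (insert x T).erase y = insert x (T.erase y) :=
      Finset.erase_insert_of_ne hxy
    have s₁ := C.surgery_erase hy'
    rw [e] at s₁ ⊢
    exact CircleAlgebra.surgery_square m (C.surgery _ x hx').symm (C.surgery _ x hx).symm s₁
      (C.surgery_erase hy) _
  · have hy' : y ∉ insert x T := fun h =>
      (Finset.mem_insert.1 h).elim (fun h => hxy h.symm) hy
    rw [up_apply_of_notMem hy, down_apply_of_notMem hx, up_apply_of_notMem hy', map_zero]

theorem up_down_self (x : X) (v : C.Total R m) :
    C.up x (C.down x v) + C.down x (C.up x v) =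
      C.act (MvPolynomial.X (C.p x) + MvPolynomial.X (C.q x)) v := by
  funext T
  rw [Pi.add_apply, act_apply, map_add]
  by_cases hx : x ∈ T
  · have e : insert x (T.erase x) = T := Finset.insert_erase hx
    rw [down_apply_of_mem hx, add_zero, up_apply_of_mem hx,
      down_apply_of_notMem (Finset.notMem_erase x T), e,
      CircleAlgebra.surgery_surgery m (C.surgery_erase hx).symm]
    rfl
  · have e : (insert x T).erase x = T := Finset.erase_insert hx
    rw [up_apply_of_notMem hx, zero_add, down_apply_of_notMem hx,
      up_apply_of_mem (Finset.mem_insert_self x T), e,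
      CircleAlgebra.surgery_surgery m (C.surgery _ x hx)]
    rfl

theorem act_down_self (x : X) (v : C.Total R m) :
    C.act (MvPolynomial.X (C.p x) + MvPolynomial.X (C.q x)) (C.down x v) = 0 := by
  funext T
  rw [act_apply, map_add]
  by_cases hx : x ∈ T
  · rw [down_apply_of_mem hx, mul_zero]; rfl
  · rw [down_apply_of_notMem hx]
    exact CircleAlgebra.x_add_x_mul_surgery m (C.surgery _ x hx).symm _

theorem act_up (f : MvPolynomial E R) (x : X) (v : C.Total R m) :
    C.act f (C.up x v) = C.up x (C.act f v) := by
  funext T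
  rw [act_apply]
  by_cases hx : x ∈ T
  · rw [up_apply_of_mem hx, up_apply_of_mem hx, act_apply,
      CircleAlgebra.surgery_mul m (C.surgery_erase hx)]
  · rw [up_apply_of_notMem hx, up_apply_of_notMem hx, mul_zero]

theorem act_down (f : MvPolynomial E R) (x : X) (v : C.Total R m) :
    C.act f (C.down x v) = C.down x (C.act f v) := by
  funext T
  rw [act_apply]
  by_cases hx : x ∈ T
  · rw [down_apply_of_mem hx, down_apply_of_mem hx, mul_zero]
  · rw [down_apply_of_notMem hx, down_apply_of_notMem hx, act_apply,
      CircleAlgebra.surgery_mul m (C.surgery _ x hx).symm]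

theorem act_act (f g : MvPolynomial E R) (v : C.Total R m) :
    C.act f (C.act g v) = C.act (f * g) v := by
  funext T
  rw [act_apply, act_apply, act_apply, map_mul, mul_assoc]

theorem act_add (f g : MvPolynomial E R) (v : C.Total R m) :
    C.act (f + g) v = C.act f v + C.act g v := by
  funext T
  rw [Pi.add_apply, act_apply, act_apply, act_apply, map_add, add_mul]

theorem act_smul (t : R) (f : MvPolynomial E R) (v : C.Total R m) :
    C.act (t • f) v = t • C.act f v := by
  funext T
  rw [Pi.smul_apply, act_apply, act_apply, map_smul, smul_mul_assoc]

end SurgeryCube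

/-- The linear form with the given coefficients on the edges. -/
noncomputable def weightPoly {E R : Type} [Fintype E] [CommRing R] (w : E → R) :
    MvPolynomial E R := ∑ e, w e • MvPolynomial.X e

theorem weightPoly_add {E R : Type} [Fintype E] [CommRing R] (w w' : E → R) :
    weightPoly (w + w') = weightPoly w + weightPoly w' := by
  simp [weightPoly, add_smul, Finset.sum_add_distrib]

theorem weightPoly_single {E R : Type} [Fintype E] [DecidableEq E] [CommRing R] (e : E) (t : R) :
    weightPoly (Pi.single e t) = t • MvPolynomial.X e := by
  rw [weightPoly, Finset.sum_eq_single e]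
  · rw [Pi.single_eq_same]
  · intro b _ hb; rw [Pi.single_eq_of_ne hb, zero_smul]
  · simp

namespace SurgeryCube

open DiffModule

section

variable {X E : Type} [DecidableEq X] (C : SurgeryCube X E) {R : Type} [CommRing R] {m : E}
  [Algebra (ZMod 2) R] [Fintype X] [Fintype E]

theorem act_weightPoly_self (w : E → R) (v : C.Total R m) :
    C.act (weightPoly w) (C.act (weightPoly w) v) = 0 := by
  rw [act_act]
  funext T
  rw [act_apply]
  have : CircleAlgebra.mk (C.rel T) m (weightPoly w * weightPoly w) = 0 := by
    rw [weightPoly, Finset.sum_mul_sum, map_sum]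
    simp_rw [map_sum]
    rw [← Finset.sum_product']
    -- The terms with two different edges cancel in pairs.
    refine Finset.sum_involution (fun a _ => (a.2, a.1)) ?_ ?_ (by simp) (by simp)
    · rintro ⟨a, b⟩ -
      rw [mul_comm (w b • _)]
      exact CircleAlgebra.add_self _ _ _
    · rintro ⟨a, b⟩ - hne h
      obtain rfl : b = a := congrArg Prod.fst h
      refine hne ?_
      rw [map_mul, map_smul, CircleAlgebra.mk_X, smul_mul_smul_comm, CircleAlgebra.x_mul_self,
        smul_zero]
  rw [this, zero_mul]; rfl

/-- The sum of the Khovanov maps and of the action of the weights. -/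
noncomputable def differential (w : E → R) : C.Total R m →ₗ[R] C.Total R m :=
  (∑ x, C.up x) + C.act (weightPoly w)

theorem differential_apply (w : E → R) (v : C.Total R m) :
    C.differential w v = (∑ x, C.up x v) + C.act (weightPoly w) v := by
  rw [differential, LinearMap.add_apply, LinearMap.sum_apply]

theorem sum_up_sum_up (v : C.Total R m) : ∑ x, C.up x (∑ y, C.up y v) = 0 := by
  simp_rw [map_sum]
  rw [← Finset.sum_product']
  refine Finset.sum_involution (fun a _ => (a.2, a.1)) ?_ ?_ (by simp) (by simp)
  · rintro ⟨a, b⟩ -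
    rw [up_up_comm]
    exact add_self_of_charTwo R _
  · rintro ⟨a, b⟩ - hne h
    obtain rfl : b = a := congrArg Prod.fst h
    exact hne (up_up_self _ _)

theorem differential_differential (w : E → R) (v : C.Total R m) :
    C.differential w (C.differential w v) = 0 := by
  rw [differential_apply, differential_apply, map_add, act_weightPoly_self, add_zero]
  simp_rw [map_add]
  rw [Finset.sum_add_distrib, sum_up_sum_up, zero_add, map_sum]
  simp_rw [act_up]
  exact add_self_of_charTwo R _

/-- The part of `δ`-degree `i`, for a link with `n` right-handed crossings. -/
noncomputable def gr (n : ℤ) (i : ℤ) : Submodule R (C.Total R m) :=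
  Submodule.pi Set.univ fun S => CircleAlgebra.gr R (C.rel S) m (i - S.card + n)

theorem mem_gr {n i : ℤ} {v : C.Total R m} :
    v ∈ C.gr n i ↔ ∀ S, v S ∈ CircleAlgebra.gr R (C.rel S) m (i - S.card + n) := by
  simp [gr, Submodule.mem_pi]

theorem act_X_mem {n i : ℤ} {v : C.Total R m} (e : E) (hv : v ∈ C.gr n i) :
    C.act (MvPolynomial.X e) v ∈ C.gr n (i + 2) := by
  rw [mem_gr] at hv ⊢
  intro S
  have := CircleAlgebra.x_mul_mem e (hv S)
  rwa [show i - S.card + n + 2 = i + 2 - S.card + n by ring] at this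

theorem act_weightPoly_mem {n i : ℤ} {v : C.Total R m} (w : E → R) (hv : v ∈ C.gr n i) :
    C.act (weightPoly w) v ∈ C.gr n (i + 2) := by
  have : C.act (weightPoly w) v = ∑ e, w e • C.act (MvPolynomial.X e) v := by
    funext T
    rw [act_apply, weightPoly, map_sum, Finset.sum_mul, Finset.sum_apply]
    refine Finset.sum_congr rfl fun e _ => ?_
    rw [map_smul, smul_mul_assoc]; rfl
  rw [this]
  exact sum_mem fun e _ => Submodule.smul_mem _ _ (C.act_X_mem e hv)

theorem up_mem {n i : ℤ} {v : C.Total R m} (x : X) (hv : v ∈ C.gr n i) :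
    C.up x v ∈ C.gr n (i + 2) := by
  rw [mem_gr] at hv ⊢
  intro S
  by_cases hx : x ∈ S
  · rw [up_apply_of_mem hx]
    have := CircleAlgebra.surgery_mem (C.surgery_erase hx) (hv (S.erase x))
    rw [← Finset.card_erase_add_one hx]
    push_cast
    rwa [show i - (S.erase x).card + n + 1 = i + 2 - ((S.erase x).card + 1) + n by ring] at this
  · rw [up_apply_of_notMem hx]; exact zero_mem _

theorem down_mem {n i : ℤ} {v : C.Total R m} (x : X) (hv : v ∈ C.gr n i) :
    C.down x v ∈ C.gr n i := by
  rw [mem_gr] at hv ⊢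
  intro S
  by_cases hx : x ∈ S
  · rw [down_apply_of_mem hx]; exact zero_mem _
  · rw [down_apply_of_notMem hx]
    have := CircleAlgebra.surgery_mem (C.surgery _ x hx).symm (hv (insert x S))
    rw [Finset.card_insert_of_notMem hx] at this
    push_cast at this
    rwa [show i - (S.card + 1) + n + 1 = i - S.card + n by ring] at this

/-- The complex of a cube of surgeries with weights on the edges. -/
noncomputable def complex (m : E) (w : E → R) (n : ℤ) : DiffModule R where
  carrier := C.Total R m
  gr := C.gr n
  d := C.differential w
  d_mem i v hv := by
    rw [differential_apply]
    exact add_mem (sum_mem fun x _ => C.up_mem x hv) (C.act_weightPoly_mem w hv)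
  d_d := C.differential_differential w

variable {C}

/-- Only the sums of the weights over the circles matter. -/
theorem complex_congr {w w' : E → R} (n : ℤ)
    (h : ∀ S, CircleAlgebra.mk (C.rel S) m (weightPoly w) =
      CircleAlgebra.mk (C.rel S) m (weightPoly w')) :
    HEquiv (C.complex m w n) (C.complex m w' n) := by
  refine HEquiv.of_iso LinearMap.id LinearMap.id ?_ ?_ ?_ (fun _ => rfl) (fun _ => rfl)
  · intro i v hv; rwa [add_zero]
  · intro i v hv; rwa [add_zero]
  · intro (v : C.Total R m)
    change C.differential w v = C.differential w' v
    rw [differential_apply, differential_apply]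
    congr 1
    funext T
    rw [act_apply, act_apply, h]

/-- Weights may be moved through a crossing, from one of its strands to the other. This is the
conjugation of the differential by `1 + t φ`, where `φ` is the reversed Khovanov map at the
crossing. -/
theorem complex_slide [DecidableEq E] (w : E → R) (n : ℤ) (x : X) (t : R) :
    HEquiv (C.complex m w n)
      (C.complex m (w + (Pi.single (C.p x) t + Pi.single (C.q x) t)) n) := by
  let f : C.Total R m →ₗ[R] C.Total R m := LinearMap.id + t • C.down x
  have hf : ∀ v, f v = v + t • C.down x v := fun v => rfl
  have ff : ∀ v, f (f v) = v := by
    intro v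
    rw [hf, hf, map_add, map_smul, down_down_self, smul_zero, add_zero, add_assoc,
      add_self_of_charTwo R, add_zero]
  have fm : ∀ i v, v ∈ C.gr n i → f v ∈ C.gr n (i + 0) := by
    intro i v hv
    rw [add_zero]
    exact add_mem hv (Submodule.smul_mem _ _ (C.down_mem x hv))
  refine HEquiv.of_iso (A := C.complex m w n) f f fm fm ?_ ff ff
  intro (v : C.Total R m)
  change f (C.differential w v) = C.differential _ (f v)
  rw [differential_apply, differential_apply, hf, hf, weightPoly_add, weightPoly_add, weightPoly_single,
    weightPoly_single, ← smul_add, act_add, act_smul, map_add (C.act (_ + _)), map_smul (C.act _),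
    act_down_self, smul_zero, add_zero]
  simp_rw [map_add, map_smul]
  rw [Finset.sum_add_distrib, ← Finset.smul_sum, act_down, map_sum]
  -- The commutator of the differential and `φ` is the difference of the actions of the two strands.
  have key : ∑ y, C.down x (C.up y v) = ∑ y, C.up y (C.down x v) +
      C.act (MvPolynomial.X (C.p x) + MvPolynomial.X (C.q x)) v := by
    rw [← Finset.add_sum_erase _ _ (Finset.mem_univ x),
      ← Finset.add_sum_erase Finset.univ (fun y => C.up y (C.down x v)) (Finset.mem_univ x),
      ← up_down_self, Finset.sum_congr rfl fun y hy =>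
        (up_down_comm (Ne.symm (Finset.ne_of_mem_erase hy)) v).symm]
    have := add_self_of_charTwo R (C.up x (C.down x v))
    calc _ = (C.up x (C.down x v) + C.up x (C.down x v)) + (C.down x (C.up x v) +
          ∑ y ∈ Finset.univ.erase x, C.up y (C.down x v)) := by rw [this, zero_add]
      _ = _ := by abel
  rw [key, smul_add, smul_add]
  abel

/-- A weight may be moved along a circle. -/
theorem complex_joined [DecidableEq E] (w : E → R) (n : ℤ) (t : R) {a b : E}
    (h : ∀ S, C.rel S a b) :
    HEquiv (C.complex m w n) (C.complex m (w + (Pi.single a t + Pi.single b t)) n) := by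
  refine complex_congr n fun S => ?_
  rw [weightPoly_add, weightPoly_add, weightPoly_single, weightPoly_single, map_add, map_add,
    map_smul, map_smul, CircleAlgebra.mk_X, CircleAlgebra.mk_X, CircleAlgebra.x_eq m (h S),
    CircleAlgebra.add_self, add_zero]

end

/-! ### Relabelling crossings, and splitting off a crossing -/

variable {X E : Type} [DecidableEq X] {R : Type} [CommRing R] {m : E}
  [Algebra (ZMod 2) R] [Fintype X] [Fintype E]

/-- The cube with crossings renamed. -/
def relabel {X' : Type} [DecidableEq X'] (C : SurgeryCube X' E) (e : X ≃ X') : SurgeryCube X E where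
  rel S := C.rel (S.map e.toEmbedding)
  p x := C.p (e x)
  q x := C.q (e x)
  surgery S x hx := by
    rw [Finset.map_insert]
    exact C.surgery _ _ (by simpa using hx)

/-- Graded isomorphisms. -/
structure _root_.DiffModule.IsIso {A B : DiffModule R} (f : A →ₗ[R] B) : Prop where
  bijective : Function.Bijective f
  mem_iff : ∀ i v, f v ∈ B.gr i ↔ v ∈ A.gr i
  chain : IsChainMap f

theorem _root_.DiffModule.IsIso.hEquiv {A B : DiffModule R} {f : A →ₗ[R] B} (h : IsIso f) :
    HEquiv A B := by
  let e := LinearEquiv.ofBijective f h.bijective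
  refine HEquiv.of_iso f e.symm.toLinearMap ?_ ?_ h.chain (fun a => e.symm_apply_apply a)
    (fun b => e.apply_symm_apply b)
  · intro i v hv; rw [add_zero]; exact (h.mem_iff i v).2 hv
  · intro i v hv; rw [add_zero]; refine (h.mem_iff i _).1 ?_
    rw [show f (e.symm.toLinearMap v) = v from e.apply_symm_apply v]; exact hv

/-- The renaming of the crossings on chains. -/
noncomputable def relabelMap {X' : Type} [DecidableEq X'] (C : SurgeryCube X' E) (e : X ≃ X') :
    C.Total R m →ₗ[R] (C.relabel e).Total R m :=
  LinearMap.pi fun S => LinearMap.proj (S.map e.toEmbedding)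

theorem relabelMap_isIso {X' : Type} [DecidableEq X'] [Fintype X'] (C : SurgeryCube X' E)
    (e : X ≃ X') (w : E → R) (n : ℤ) :
    IsIso (A := C.complex m w n) (B := (C.relabel e).complex m w n) (C.relabelMap e) := by
  let f : C.Total R m →ₗ[R] (C.relabel e).Total R m := C.relabelMap e
  have hS : ∀ S : Finset X', (S.map e.symm.toEmbedding).map e.toEmbedding = S :=
    fun S => e.finsetCongr.apply_symm_apply S
  refine ⟨⟨?_, ?_⟩, ?_, ?_⟩
  · intro v v' h
    funext S
    have := congrFun h (S.map e.symm.toEmbedding)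
    change v ((S.map e.symm.toEmbedding).map e.toEmbedding) = v' _ at this
    rwa [hS] at this
  · intro u
    refine ⟨Equiv.piCongrLeft (fun S => CircleAlgebra R (C.rel S) m) e.finsetCongr u, ?_⟩
    funext S
    exact Equiv.piCongrLeft_apply_apply (fun S => CircleAlgebra R (C.rel S) m) e.finsetCongr u S
  · intro i v
    refine ((C.relabel e).mem_gr).trans (Iff.trans ?_ C.mem_gr.symm)
    constructor
    · intro h S
      have := h (S.map e.symm.toEmbedding)
      change v ((S.map e.symm.toEmbedding).map e.toEmbedding) ∈
        CircleAlgebra.gr R (C.rel ((S.map e.symm.toEmbedding).map e.toEmbedding)) m _ at this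
      rwa [hS, Finset.card_map] at this
    · intro h S
      have := h (S.map e.toEmbedding)
      rwa [Finset.card_map] at this
  · intro (v : C.Total R m)
    change f (C.differential w v) = (C.relabel e).differential w (f v)
    rw [differential_apply, differential_apply]
    funext S
    change ((∑ x, C.up x v) + C.act (weightPoly w) v) (S.map e.toEmbedding) = _
    rw [Pi.add_apply, Pi.add_apply, Finset.sum_apply, Finset.sum_apply]
    congr 1
    refine (Fintype.sum_equiv e _ _ fun x => ?_).symm
    by_cases hx : x ∈ S
    · refine (up_apply_of_mem hx _).trans
        (Eq.trans ?_ (up_apply_of_mem (Finset.mem_map_of_mem e.toEmbedding hx) v).symm)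
      rw [← Finset.map_erase]
      rfl
    · exact (up_apply_of_notMem hx _).trans (up_apply_of_notMem (by simpa using hx) v).symm

/-- The face of a cube where a crossing receives the `0`-resolution. -/
def low (C : SurgeryCube (Option X) E) : SurgeryCube X E where
  rel S := C.rel (S.map Function.Embedding.some)
  p x := C.p (some x)
  q x := C.q (some x)
  surgery S x hx := by
    rw [Finset.map_insert]
    exact C.surgery _ _ (by simpa using hx)

theorem insert_some_insertNone (S : Finset X) (x : X) :
    Finset.insertNone (insert x S) = insert (some x) (Finset.insertNone S) := by
  ext (_ | y) <;> simp

/-- The face of a cube where a crossing receives the `1`-resolution. -/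
def high (C : SurgeryCube (Option X) E) : SurgeryCube X E where
  rel S := C.rel (Finset.insertNone S)
  p x := C.p (some x)
  q x := C.q (some x)
  surgery S x hx := by
    rw [insert_some_insertNone]
    exact C.surgery _ _ (by simpa using hx)

/-- The resolution by resolution surgery map between two cubes. -/
noncomputable def surgeryMap (C C' : SurgeryCube X E) : C.Total R m →ₗ[R] C'.Total R m :=
  LinearMap.pi fun S => CircleAlgebra.surgery (C.rel S) (C'.rel S) m ∘ₗ LinearMap.proj S

/-- The linear map between the complexes of two cubes given by maps between the algebras of circles of
their resolutions. -/
noncomputable def pointwise {E' : Type} {m' : E'} {C : SurgeryCube X E} {C' : SurgeryCube X E'}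
    (F : ∀ S, CircleAlgebra R (C.rel S) m →ₗ[R] CircleAlgebra R (C'.rel S) m') :
    C.Total R m →ₗ[R] C'.Total R m' :=
  LinearMap.pi fun S => F S ∘ₗ LinearMap.proj S

theorem pointwise_isChainMap {E' : Type} [Fintype E'] {m' : E'} {C : SurgeryCube X E}
    {C' : SurgeryCube X E'}
    (F : ∀ S, CircleAlgebra R (C.rel S) m →ₗ[R] CircleAlgebra R (C'.rel S) m')
    {w : E → R} {w' : E' → R} {n n' : ℤ}
    (h₁ : ∀ S x, x ∉ S → ∀ v,
      F (insert x S) (CircleAlgebra.surgery (C.rel S) (C.rel (insert x S)) m v) =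
        CircleAlgebra.surgery (C'.rel S) (C'.rel (insert x S)) m' (F S v))
    (h₂ : ∀ S v, F S (CircleAlgebra.mk (C.rel S) m (weightPoly w) * v) =
      CircleAlgebra.mk (C'.rel S) m' (weightPoly w') * F S v) :
    IsChainMap (A := C.complex m w n) (B := C'.complex m' w' n') (pointwise F) := by
  intro (v : C.Total R m)
  change pointwise F (C.differential w v) = C'.differential w' (pointwise F v)
  rw [differential_apply, differential_apply, map_add]
  congr 1
  · rw [map_sum]
    refine Finset.sum_congr rfl fun x _ => ?_
    funext S
    change F S (C.up x v S) = _
    by_cases hx : x ∈ S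
    · rw [up_apply_of_mem hx, up_apply_of_mem hx]
      have := h₁ _ x (Finset.notMem_erase x S) (v (S.erase x))
      rw [Finset.insert_erase hx] at this
      exact this
    · rw [up_apply_of_notMem hx, up_apply_of_notMem hx, map_zero]
  · funext S
    exact h₂ S (v S)

theorem pointwise_isHomogeneous {E' : Type} [Fintype E'] {m' : E'} {C : SurgeryCube X E}
    {C' : SurgeryCube X E'}
    (F : ∀ S, CircleAlgebra R (C.rel S) m →ₗ[R] CircleAlgebra R (C'.rel S) m')
    {w : E → R} {w' : E' → R} {n n' k l : ℤ} (hl : l = k + n' - n)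
    (h : ∀ S d v, v ∈ CircleAlgebra.gr R (C.rel S) m d →
      F S v ∈ CircleAlgebra.gr R (C'.rel S) m' (d + l)) :
    IsHomogeneous (A := C.complex m w n) (B := C'.complex m' w' n') (pointwise F) k := by
  intro i v hv
  refine C'.mem_gr.2 fun S => ?_
  have := h S _ _ (C.mem_gr.1 hv S)
  rwa [hl, show i - (S.card : ℤ) + n + (k + n' - n) = i + k - S.card + n' by ring] at this

/-- Two cubes that differ by a surgery in each resolution, along the same arcs. -/
def Adjacent (C C' : SurgeryCube X E) : Prop :=
  (C.p = C'.p ∧ C.q = C'.q) ∧ ∃ p q, ∀ S, Surgery (C.rel S) (C'.rel S) p q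

theorem surgeryMap_isChainMap {C C' : SurgeryCube X E} (h : Adjacent C C') (w : E → R) (n n' : ℤ) :
    IsChainMap (A := C.complex m w n) (B := C'.complex m w n') (surgeryMap C C') := by
  obtain ⟨⟨hp, hq⟩, p, q, h⟩ := h
  refine pointwise_isChainMap (fun S => CircleAlgebra.surgery (C.rel S) (C'.rel S) m) ?_ ?_
  · intro S x hx v
    have := C'.surgery S x hx
    rw [← hp, ← hq] at this
    exact CircleAlgebra.surgery_square m (C.surgery S x hx) this (h _) (h _) v
  · intro S v
    exact CircleAlgebra.surgery_mul m (h S) v _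

theorem surgeryMap_isHomogeneous {C C' : SurgeryCube X E} (h : Adjacent C C') (w : E → R)
    {n n' k : ℤ} (hk : k + n' - n = 1) :
    IsHomogeneous (A := C.complex m w n) (B := C'.complex m w n') (surgeryMap C C') k := by
  obtain ⟨-, p, q, h⟩ := h
  exact pointwise_isHomogeneous (fun S => CircleAlgebra.surgery (C.rel S) (C'.rel S) m) hk.symm
    fun S d v hv => CircleAlgebra.surgery_mem (h S) hv

theorem insert_none_map_some (S : Finset X) :
    insert none (S.map Function.Embedding.some) = Finset.insertNone S := by
  ext (_ | y) <;> simp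

theorem adjacent_low_high (C : SurgeryCube (Option X) E) : Adjacent C.low C.high := by
  refine ⟨⟨rfl, rfl⟩, C.p none, C.q none, fun S => ?_⟩
  have := C.surgery (S.map Function.Embedding.some) none (by simp)
  rwa [insert_none_map_some] at this

theorem low_up (C : SurgeryCube (Option X) E) (v : C.Total R m) (x : X) (S : Finset X) :
    C.low.up x (fun T => v (T.map Function.Embedding.some) : C.low.Total R m) S =
      C.up (some x) v (S.map Function.Embedding.some) := by
  by_cases hx : x ∈ S
  · have hx' : some x ∈ S.map Function.Embedding.some := by simpa using hx
    have e : (S.erase x).map Function.Embedding.some =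
        (S.map Function.Embedding.some).erase (some x) := Finset.map_erase _ _ _
    refine (up_apply_of_mem hx _).trans (Eq.trans ?_ (up_apply_of_mem hx' v).symm)
    rw [← e]
    rfl
  · have hx' : some x ∉ S.map Function.Embedding.some := by simpa using hx
    exact (up_apply_of_notMem hx _).trans (up_apply_of_notMem hx' v).symm

theorem high_up (C : SurgeryCube (Option X) E) (v : C.Total R m) (x : X) (S : Finset X) :
    C.high.up x (fun T => v (Finset.insertNone T) : C.high.Total R m) S =
      C.up (some x) v (Finset.insertNone S) := by
  by_cases hx : x ∈ S
  · have hx' : some x ∈ Finset.insertNone S := by simpa using hx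
    have e : Finset.insertNone (S.erase x) = (Finset.insertNone S).erase (some x) := by
      ext (_ | y) <;> simp
    refine (up_apply_of_mem hx _).trans (Eq.trans ?_ (up_apply_of_mem hx' v).symm)
    rw [← e]
    rfl
  · have hx' : some x ∉ Finset.insertNone S := by simpa using hx
    exact (up_apply_of_notMem hx _).trans (up_apply_of_notMem hx' v).symm

/-- The decomposition of the chains of a cube according to the resolution of one crossing. -/
noncomputable def split (C : SurgeryCube (Option X) E) :
    C.Total R m →ₗ[R] C.low.Total R m × C.high.Total R m :=
  LinearMap.prod (LinearMap.pi fun S => LinearMap.proj (S.map Function.Embedding.some))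
    (LinearMap.pi fun S => LinearMap.proj (Finset.insertNone S))

theorem map_some_or_insertNone (S : Finset (Option X)) :
    (∃ T : Finset X, S = T.map Function.Embedding.some) ∨
      ∃ T : Finset X, S = Finset.insertNone T := by
  by_cases h : none ∈ S
  · right
    refine ⟨Finset.eraseNone S, ?_⟩
    rw [Finset.insertNone_eraseNone, Finset.insert_eq_of_mem h]
  · left
    refine ⟨Finset.eraseNone S, ?_⟩
    rw [Finset.map_some_eraseNone, Finset.erase_eq_of_notMem h]

theorem split_bijective (C : SurgeryCube (Option X) E) :
    Function.Bijective (C.split (R := R) (m := m)) := by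
  let g : Finset X ⊕ Finset X → Finset (Option X) :=
    Sum.elim (fun S => S.map Function.Embedding.some) (fun S => Finset.insertNone S)
  have hg : Function.Bijective g := by
    constructor
    · rintro (S | S) (T | T) h
      · exact congrArg Sum.inl (Finset.map_injective _ h)
      · have h : S.map Function.Embedding.some = Finset.insertNone T := h
        have : none ∈ S.map Function.Embedding.some := h ▸ Finset.none_mem_insertNone
        simp at this
      · have h : Finset.insertNone S = T.map Function.Embedding.some := h
        have : none ∈ T.map Function.Embedding.some := h ▸ Finset.none_mem_insertNone
        simp at this
      · exact congrArg Sum.inr (Finset.insertNone.injective h)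
    · intro S
      rcases map_some_or_insertNone S with ⟨T, rfl⟩ | ⟨T, rfl⟩
      exacts [⟨Sum.inl T, rfl⟩, ⟨Sum.inr T, rfl⟩]
  constructor
  · intro v v' h
    funext S
    rcases map_some_or_insertNone S with ⟨T, rfl⟩ | ⟨T, rfl⟩
    · exact congrFun (congrArg Prod.fst h) T
    · exact congrFun (congrArg Prod.snd h) T
  · rintro ⟨a, b⟩
    let u : ∀ s, CircleAlgebra R (C.rel (Equiv.ofBijective g hg s)) m
      | Sum.inl S => a S
      | Sum.inr S => b S
    refine ⟨Equiv.piCongrLeft (fun S => CircleAlgebra R (C.rel S) m) (Equiv.ofBijective g hg) u, ?_⟩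
    refine Prod.ext ?_ ?_
    · funext S
      exact Equiv.piCongrLeft_apply_apply (fun S => CircleAlgebra R (C.rel S) m)
        (Equiv.ofBijective g hg) u (Sum.inl S)
    · funext S
      exact Equiv.piCongrLeft_apply_apply (fun S => CircleAlgebra R (C.rel S) m)
        (Equiv.ofBijective g hg) u (Sum.inr S)

theorem split_mem_iff (C : SurgeryCube (Option X) E) (n i : ℤ) (v : C.Total R m) :
    ((C.split v).1 ∈ C.low.gr n i ∧ (C.split v).2 ∈ C.high.gr (n - 1) i) ↔ v ∈ C.gr n i := by
  have hcard : ∀ S : Finset X, i - (Finset.insertNone S).card + n = i - S.card + (n - 1) := by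
    intro S
    rw [Finset.card_insertNone]
    push_cast; ring
  rw [mem_gr, mem_gr, mem_gr]
  constructor
  · rintro ⟨ha, hb⟩ S
    rcases map_some_or_insertNone S with ⟨T, rfl⟩ | ⟨T, rfl⟩
    · have := ha T
      rw [Finset.card_map]; exact this
    · have := hb T
      rw [hcard]; exact this
  · intro h
    refine ⟨fun S => ?_, fun S => ?_⟩
    · have := h (S.map Function.Embedding.some)
      rw [Finset.card_map] at this; exact this
    · have := h (Finset.insertNone S)
      rw [hcard] at this; exact this

/-- The complex of a cube is the mapping cone of the Khovanov map at any of its crossings. -/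
theorem split_differential (C : SurgeryCube (Option X) E) (w : E → R) (v : C.Total R m) :
    C.split (C.differential w v) = (C.low.differential w (C.split v).1,
      surgeryMap C.low C.high (C.split v).1 + C.high.differential w (C.split v).2) := by
  rw [differential_apply, differential_apply, differential_apply]
  refine Prod.ext ?_ ?_
  · funext S
    change ((∑ x, C.up x v) + C.act (weightPoly w) v) (S.map Function.Embedding.some) =
      ((∑ x, C.low.up x (C.split v).1) + C.low.act (weightPoly w) (C.split v).1) S
    rw [Pi.add_apply, Pi.add_apply, Finset.sum_apply, Finset.sum_apply, Fintype.sum_option,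
      up_apply_of_notMem (by simp), zero_add]
    congr 1
    exact Finset.sum_congr rfl fun x _ => (C.low_up v x S).symm
  · funext S
    change ((∑ x, C.up x v) + C.act (weightPoly w) v) (Finset.insertNone S) =
      surgeryMap C.low C.high (C.split v).1 S +
        ((∑ x, C.high.up x (C.split v).2) + C.high.act (weightPoly w) (C.split v).2) S
    rw [Pi.add_apply, Pi.add_apply, Finset.sum_apply, Finset.sum_apply, Fintype.sum_option,
      up_apply_of_mem (by simp), add_assoc]
    have e₀ : (Finset.insertNone S).erase none = S.map Function.Embedding.some := by
      ext (_ | y) <;> simp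
    rw [e₀]
    congr 2
    exact Finset.sum_congr rfl fun x _ => (C.high_up v x S).symm

theorem split_isIso (C : SurgeryCube (Option X) E) (w : E → R) (n : ℤ) :
    IsIso (A := C.complex m w n)
      (B := cone (A := C.low.complex m w n) (B := C.high.complex m w (n - 1))
        (surgeryMap C.low C.high)
        (surgeryMap_isHomogeneous C.adjacent_low_high w (by ring))
        (surgeryMap_isChainMap C.adjacent_low_high w n (n - 1))) C.split :=
  ⟨C.split_bijective, C.split_mem_iff n, C.split_differential w⟩

end SurgeryCube

/-! ### Identifying and removing circles -/

namespace CircleAlgebra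

open MvPolynomial

variable {R : Type} [CommRing R] {E E₀ : Type} [Algebra (ZMod 2) R]

/-- A map of edges that is bijective on circles and preserves the marked circle. -/
structure IsCircleEquiv (r₀ : Setoid E₀) (m₀ : E₀) (r : Setoid E) (m : E) (j : E₀ → E) :
    Prop where
  rel : ∀ a b, r₀ a b ↔ r (j a) (j b)
  cover : ∀ e, ∃ a, r (j a) e
  mark : r (j m₀) m

theorem IsCircleEquiv.isCircleMap {r₀ : Setoid E₀} {m₀ : E₀} {r : Setoid E} {m : E} {j : E₀ → E}
    (h : IsCircleEquiv r₀ m₀ r m j) : IsCircleMap r₀ m₀ r m j :=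
  ⟨fun a b => (h.rel a b).1, h.mark⟩

theorem IsCircleEquiv.exists_inverse {r₀ : Setoid E₀} {m₀ : E₀} {r : Setoid E} {m : E}
    {j : E₀ → E} (h : IsCircleEquiv r₀ m₀ r m j) :
    ∃ s : E → E₀, IsCircleMap r m r₀ m₀ s ∧ (∀ a, r₀ (s (j a)) a) ∧ ∀ e, r (j (s e)) e := by
  choose s hs using h.cover
  refine ⟨s, ⟨fun a b hab => ?_, ?_⟩, fun a => (h.rel _ _).2 (hs _), hs⟩
  · exact (h.rel _ _).2 (r.trans (hs a) (r.trans hab (r.symm (hs b))))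
  · exact (h.rel _ _).2 (r.trans (hs m) (r.symm h.mark))

theorem IsCircleEquiv.card_quotient {r₀ : Setoid E₀} {m₀ : E₀} {r : Setoid E} {m : E}
    {j : E₀ → E} (h : IsCircleEquiv r₀ m₀ r m j) :
    Nat.card (Quotient r₀) = Nat.card (Quotient r) := by
  refine Nat.card_congr (Equiv.ofBijective
    (Quotient.map' (s₁ := r₀) (s₂ := r) j fun a b hab => (h.rel a b).1 hab) ⟨?_, ?_⟩)
  · rintro ⟨a⟩ ⟨b⟩ hab
    exact Quotient.sound ((h.rel a b).2 (Quotient.exact hab))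
  · rintro ⟨e⟩
    obtain ⟨a, ha⟩ := h.cover e
    exact ⟨Quotient.mk _ a, Quotient.sound ha⟩

/-- The isomorphism induced by a bijection of circles. -/
noncomputable def mapEquiv {r₀ : Setoid E₀} {m₀ : E₀} {r : Setoid E} {m : E}
    {j : E₀ → E} (h : IsCircleEquiv r₀ m₀ r m j) :
    CircleAlgebra R r₀ m₀ ≃ₐ[R] CircleAlgebra R r m :=
  AlgEquiv.ofBijective (map j h.isCircleMap) (by
    obtain ⟨s, hs, h₁, h₂⟩ := h.exists_inverse
    exact Function.bijective_iff_has_inverse.2 ⟨map s hs,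
      map_map_eq_self h.isCircleMap hs h₁, map_map_eq_self hs h.isCircleMap h₂⟩)

theorem mapEquiv_mk {r₀ : Setoid E₀} {m₀ : E₀} {r : Setoid E} {m : E}
    {j : E₀ → E} (h : IsCircleEquiv r₀ m₀ r m j) (f : MvPolynomial E₀ R) :
    mapEquiv h (mk r₀ m₀ f) = mk r m (rename j f) := map_mk h.isCircleMap f

theorem mapEquiv_symm_mk {r₀ : Setoid E₀} {m₀ : E₀} {r : Setoid E} {m : E}
    {j : E₀ → E} (h : IsCircleEquiv r₀ m₀ r m j) (f : MvPolynomial E₀ R) :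
    (mapEquiv h).symm (mk r m (rename j f)) = mk r₀ m₀ f := by
  rw [← mapEquiv_mk h, AlgEquiv.symm_apply_apply]

theorem mapEquiv_mem {r₀ : Setoid E₀} {m₀ : E₀} {r : Setoid E} {m : E}
    {j : E₀ → E} (h : IsCircleEquiv r₀ m₀ r m j) {d : ℤ} {v : CircleAlgebra R r₀ m₀}
    (hv : v ∈ gr R r₀ m₀ d) : mapEquiv h v ∈ gr R r m d :=
  map_mem h.isCircleMap (by rw [h.card_quotient]) hv

theorem mapEquiv_symm_mem {r₀ : Setoid E₀} {m₀ : E₀} {r : Setoid E} {m : E}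
    {j : E₀ → E} (h : IsCircleEquiv r₀ m₀ r m j) {d : ℤ} {v : CircleAlgebra R r m}
    (hv : v ∈ gr R r m d) : (mapEquiv h).symm v ∈ gr R r₀ m₀ d := by
  obtain ⟨s, hs, h₁, h₂⟩ := h.exists_inverse
  have : (mapEquiv h).symm v = map s hs v := by
    rw [AlgEquiv.symm_apply_eq]
    exact (map_map_eq_self hs h.isCircleMap h₂ v).symm
  rw [this]
  exact map_mem hs (by rw [h.card_quotient]) hv

theorem exists_rename {r₀ : Setoid E₀} {m₀ : E₀} {r : Setoid E} {m : E}
    {j : E₀ → E} (h : IsCircleEquiv r₀ m₀ r m j) (v : CircleAlgebra R r m) :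
    ∃ f : MvPolynomial E₀ R, v = mk r m (rename j f) := by
  obtain ⟨f, hf⟩ := mk_surjective r₀ m₀ ((mapEquiv h).symm v)
  exact ⟨f, by rw [← mapEquiv_mk h, hf, AlgEquiv.apply_symm_apply]⟩

theorem surgery_mapEquiv {r r' : Setoid E} {m p q : E} {r₀ r₀' : Setoid E₀} {m₀ : E₀}
    {j : E₀ → E} (h : Surgery r r' p q) (h₀ : IsCircleEquiv r₀ m₀ r m j)
    (h₀' : IsCircleEquiv r₀' m₀ r' m j) (v : CircleAlgebra R r₀ m₀) :
    surgery r r' m (mapEquiv h₀ v) = mapEquiv h₀' (surgery r₀ r₀' m₀ v) :=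
  surgery_map h h₀.isCircleMap h₀'.isCircleMap h₀.rel h₀'.rel h₀.cover h₀'.cover v

theorem surgery_mapEquiv_symm {r r' : Setoid E} {m p q : E} {r₀ r₀' : Setoid E₀} {m₀ : E₀}
    {j : E₀ → E} (h : Surgery r r' p q) (h₀ : IsCircleEquiv r₀ m₀ r m j)
    (h₀' : IsCircleEquiv r₀' m₀ r' m j) (v : CircleAlgebra R r m) :
    surgery r₀ r₀' m₀ ((mapEquiv h₀).symm v) = (mapEquiv h₀').symm (surgery r r' m v) := by
  rw [← AlgEquiv.symm_apply_apply (mapEquiv h₀') (surgery r₀ r₀' m₀ _), ← surgery_mapEquiv h h₀ h₀',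
    AlgEquiv.apply_symm_apply]

/-- The edges that are not in the image of `j` form (up to circles meeting the image of `j`) a single
unmarked circle, the circle of `u`. -/
structure IsolatesCircle (r₀ : Setoid E₀) (m₀ : E₀) (r : Setoid E) (m : E) (j : E₀ → E) (u : E) :
    Prop where
  intro ::
  rel : ∀ a b, r₀ a b ↔ r (j a) (j b)
  not_rel : ∀ a, ¬ r (j a) u
  cover : ∀ e, r e u ∨ ∃ a, r (j a) e
  mark : r (j m₀) m

namespace IsolatesCircle

variable {r₀ : Setoid E₀} {m₀ : E₀} {r : Setoid E} {m : E} {j : E₀ → E} {u : E}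

theorem isCircleMap (h : IsolatesCircle r₀ m₀ r m j u) : IsCircleMap r₀ m₀ r m j := ⟨fun a b => (h.rel a b).1, h.mark⟩

theorem card_quotient (h : IsolatesCircle r₀ m₀ r m j u) [Finite E] : Nat.card (Quotient r) = Nat.card (Quotient r₀) + 1 := by
  classical
  let f : Quotient r₀ → {c : Quotient r // c ≠ Quotient.mk r u} := fun c =>
    ⟨Quotient.map' (s₁ := r₀) (s₂ := r) j (fun a b hab => (h.rel a b).1 hab) c, by
      obtain ⟨a⟩ := c
      exact fun h' => h.not_rel a (Quotient.exact h')⟩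
  have hf : Function.Bijective f := by
    constructor
    · rintro ⟨a⟩ ⟨b⟩ hab
      exact Quotient.sound ((h.rel a b).2 (Quotient.exact (congrArg Subtype.val hab)))
    · rintro ⟨⟨e⟩, he⟩
      obtain ⟨a, ha⟩ := (h.cover e).resolve_left fun h' => he (Quotient.sound h')
      exact ⟨Quotient.mk _ a, Subtype.ext (Quotient.sound ha)⟩
  rw [Nat.card_congr (Equiv.ofBijective f hf),
    ← Nat.card_congr (Equiv.optionSubtypeNe (Quotient.mk r u)), Finite.card_option]

/-- Merging the isolated circle into another one yields the remaining circles. -/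
theorem isCircleEquiv_of_merge (h : IsolatesCircle r₀ m₀ r m j u) {r' : Setoid E} {a : E₀} (hm : Merge r r' u (j a)) :
    IsCircleEquiv r₀ m₀ r' m j where
  rel b c := by
    rw [h.rel, hm.2]
    constructor
    · exact Or.inl
    · rintro (h' | ⟨h', -⟩ | ⟨-, h'⟩)
      · exact h'
      · exact (h.not_rel _ h').elim
      · exact (h.not_rel _ h').elim
  cover e := by
    rcases h.cover e with h' | ⟨b, h'⟩
    · exact ⟨a, r'.symm (r'.trans (hm.le h') hm.rel)⟩
    · exact ⟨b, hm.le h'⟩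
  mark := hm.le h.mark

open Classical in
/-- The action of an edge on the dual numbers over the algebra of the remaining circles. -/
noncomputable def dualX (R : Type) [CommRing R] (r₀ : Setoid E₀) (m₀ : E₀) (r : Setoid E)
    (j : E₀ → E) (e : E) : DualNumber (CircleAlgebra R r₀ m₀) :=
  if he : ∃ a, r (j a) e then TrivSqZeroExt.inl (x r₀ m₀ he.choose) else DualNumber.eps

theorem dualX_of_rel (h : IsolatesCircle r₀ m₀ r m j u) {a : E₀} {e : E} (he : r (j a) e) :
    dualX R r₀ m₀ r j e = TrivSqZeroExt.inl (x r₀ m₀ a) := by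
  have hex : ∃ a, r (j a) e := ⟨a, he⟩
  have e' : x (R := R) r₀ m₀ hex.choose = x r₀ m₀ a :=
    x_eq m₀ ((h.rel _ _).2 (r.trans hex.choose_spec (r.symm he)))
  rw [dualX, dif_pos hex, e']

theorem dualX_of_rel_self (h : IsolatesCircle r₀ m₀ r m j u) {e : E} (he : r e u) :
    dualX R r₀ m₀ r j e = DualNumber.eps := by
  rw [dualX, dif_neg]
  rintro ⟨a, ha⟩
  exact h.not_rel a (r.trans ha he)

/-- The algebra of circles is free of rank two over the algebra of the remaining circles. -/
noncomputable def toDual (h : IsolatesCircle r₀ m₀ r m j u) :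
    CircleAlgebra R r m →ₐ[R] DualNumber (CircleAlgebra R r₀ m₀) :=
  lift (A := DualNumber (CircleAlgebra R r₀ m₀)) (dualX R r₀ m₀ r j)
    (by
      intro e
      rcases h.cover e with he | ⟨a, he⟩
      · rw [h.dualX_of_rel_self he, pow_two, DualNumber.eps_mul_eps]
      · rw [h.dualX_of_rel he, pow_two, TrivSqZeroExt.inl_mul_inl, x_mul_self,
          TrivSqZeroExt.inl_zero])
    (by
      intro a b hab
      rcases h.cover a with ha | ⟨a', ha⟩
      · rw [h.dualX_of_rel_self ha, h.dualX_of_rel_self (r.trans (r.symm hab) ha)]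
        exact add_self_of_charTwo R _
      · rw [h.dualX_of_rel ha, h.dualX_of_rel (r.trans ha hab)]
        exact add_self_of_charTwo R _)
    (by rw [h.dualX_of_rel h.mark, x_mark, TrivSqZeroExt.inl_zero])

theorem toDual_map (h : IsolatesCircle r₀ m₀ r m j u) (v : CircleAlgebra R r₀ m₀) :
    h.toDual (map j h.isCircleMap v) = TrivSqZeroExt.inl v := by
  have : (h.toDual (R := R)).comp (map j h.isCircleMap) =
      TrivSqZeroExt.inlAlgHom R (CircleAlgebra R r₀ m₀) (CircleAlgebra R r₀ m₀) := by
    apply hom_ext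
    intro e
    rw [AlgHom.comp_apply, map_x, toDual, lift_x, h.dualX_of_rel (r.refl _)]
    rfl
  exact DFunLike.congr_fun this v

theorem toDual_x (h : IsolatesCircle r₀ m₀ r m j u) :
    h.toDual (x (R := R) r m u) = DualNumber.eps := by
  rw [toDual, lift_x, h.dualX_of_rel_self (r.refl u)]

/-- The removal of the isolated circle: the counit `v₊ ↦ 0`, `v₋ ↦ 1`. -/
noncomputable def counit (h : IsolatesCircle r₀ m₀ r m j u) : CircleAlgebra R r m →ₗ[R] CircleAlgebra R r₀ m₀ :=
  (TrivSqZeroExt.sndHom (CircleAlgebra R r₀ m₀) (CircleAlgebra R r₀ m₀)).restrictScalars R ∘ₗ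
    h.toDual.toLinearMap

theorem counit_map (h : IsolatesCircle r₀ m₀ r m j u) (v : CircleAlgebra R r₀ m₀) : h.counit (map j h.isCircleMap v) = 0 := by
  change TrivSqZeroExt.snd (h.toDual _) = 0
  rw [toDual_map]; rfl

theorem counit_x_mul_map (h : IsolatesCircle r₀ m₀ r m j u) (v : CircleAlgebra R r₀ m₀) :
    h.counit (x r m u * map j h.isCircleMap v) = v := by
  change TrivSqZeroExt.snd (h.toDual _) = v
  rw [map_mul, toDual_map, toDual_x, TrivSqZeroExt.snd_mul]
  simp

/-- Every monomial is, in the algebra of circles, zero or a monomial in the image of `j`, possibly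
multiplied by the action of the isolated circle. -/
theorem monomial_cases (h : IsolatesCircle r₀ m₀ r m j u) (s : E →₀ ℕ) : mk r m (monomial s (1 : R)) = 0 ∨
    (∃ s₀ : E₀ →₀ ℕ, s₀.degree = s.degree ∧
      mk r m (monomial s (1 : R)) = map j h.isCircleMap (mk r₀ m₀ (monomial s₀ 1))) ∨
    ∃ s₀ : E₀ →₀ ℕ, s₀.degree + 1 = s.degree ∧
      mk r m (monomial s (1 : R)) = x r m u * map j h.isCircleMap (mk r₀ m₀ (monomial s₀ 1)) := by
  let P : (E →₀ ℕ) → Prop := fun s => mk r m (monomial s (1 : R)) = 0 ∨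
    (∃ s₀ : E₀ →₀ ℕ, s₀.degree = s.degree ∧
      mk r m (monomial s (1 : R)) = map j h.isCircleMap (mk r₀ m₀ (monomial s₀ 1))) ∨
    ∃ s₀ : E₀ →₀ ℕ, s₀.degree + 1 = s.degree ∧
      mk r m (monomial s (1 : R)) = x r m u * map j h.isCircleMap (mk r₀ m₀ (monomial s₀ 1))
  have h0 : P 0 := Or.inr (Or.inl ⟨0, by simp, by
    rw [monomial_zero', monomial_zero', map_one, map_one, map_one, map_one, map_one]⟩)
  have hadd : ∀ s t, P s → P t → P (s + t) := by
    intro s t hs ht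
    have e : mk r m (monomial (s + t) (1 : R)) =
        mk r m (monomial s (1 : R)) * mk r m (monomial t (1 : R)) := by
      rw [← map_mul, monomial_mul, one_mul]
    have e₀ : ∀ s₀ t₀ : E₀ →₀ ℕ, map j h.isCircleMap (mk r₀ m₀ (monomial (s₀ + t₀) (1 : R))) =
        map j h.isCircleMap (mk r₀ m₀ (monomial s₀ 1)) *
          map j h.isCircleMap (mk r₀ m₀ (monomial t₀ 1)) := by
      intro s₀ t₀
      rw [← map_mul, ← map_mul, monomial_mul, one_mul]
    rcases hs with hs | ⟨s₀, ds, hs⟩ | ⟨s₀, ds, hs⟩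
    · left; rw [e, hs, zero_mul]
    · rcases ht with ht | ⟨t₀, dt, ht⟩ | ⟨t₀, dt, ht⟩
      · left; rw [e, ht, mul_zero]
      · exact Or.inr (Or.inl ⟨s₀ + t₀, by rw [map_add, map_add, ds, dt], by rw [e, e₀, hs, ht]⟩)
      · exact Or.inr (Or.inr ⟨s₀ + t₀, by rw [map_add, map_add, ds, ← dt, add_assoc],
          by rw [e, e₀, hs, ht, mul_left_comm]⟩)
    · rcases ht with ht | ⟨t₀, dt, ht⟩ | ⟨t₀, dt, ht⟩
      · left; rw [e, ht, mul_zero]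
      · exact Or.inr (Or.inr ⟨s₀ + t₀, by rw [map_add, map_add, ← ds, dt, add_right_comm],
          by rw [e, e₀, hs, ht, mul_assoc]⟩)
      · left; rw [e, hs, ht, mul_mul_mul_comm, x_mul_self, zero_mul]
  have hsingle : ∀ e, P (Finsupp.single e 1) := by
    intro e
    have e' : mk r m (monomial (Finsupp.single e 1) (1 : R)) = x r m e := rfl
    rcases h.cover e with he | ⟨a, ha⟩
    · refine Or.inr (Or.inr ⟨0, by rw [Finsupp.degree_single]; simp, ?_⟩)
      rw [e', monomial_zero', map_one, map_one, map_one, mul_one, x_eq m he]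
    · refine Or.inr (Or.inl ⟨Finsupp.single a 1, by simp [Finsupp.degree_single], ?_⟩)
      rw [e', ← x_eq m ha]
      exact (map_x _ a).symm
  have hall : P s := by
    induction s using Finsupp.induction_linear with
    | zero => exact h0
    | add s t hs ht => exact hadd s t hs ht
    | single e n =>
      induction n with
      | zero => rw [Finsupp.single_zero]; exact h0
      | succ n ih => rw [Finsupp.single_add]; exact hadd _ _ ih (hsingle e)
  exact hall

theorem exists_decomposition (h : IsolatesCircle r₀ m₀ r m j u) (v : CircleAlgebra R r m) : ∃ a b,
    v = map j h.isCircleMap a + x r m u * map j h.isCircleMap b := by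
  obtain ⟨f, rfl⟩ := mk_surjective r m v
  induction f using MvPolynomial.induction_on' with
  | monomial s t =>
    have e : mk r m (monomial s t) = t • mk r m (monomial s (1 : R)) := by
      rw [← map_smul, smul_monomial, smul_eq_mul, mul_one]
    rcases h.monomial_cases (R := R) s with hs | ⟨s₀, -, hs⟩ | ⟨s₀, -, hs⟩
    · exact ⟨0, 0, by rw [e, hs]; simp⟩
    · exact ⟨t • mk r₀ m₀ (monomial s₀ 1), 0, by rw [e, hs, map_smul]; simp⟩
    · exact ⟨0, t • mk r₀ m₀ (monomial s₀ 1), by rw [e, hs, map_smul, mul_smul_comm]; simp⟩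
  | add f g hf hg =>
    obtain ⟨a, b, hf⟩ := hf
    obtain ⟨a', b', hg⟩ := hg
    exact ⟨a + a', b + b', by rw [map_add, hf, hg, map_add, map_add, mul_add]; abel⟩

theorem counit_mul (h : IsolatesCircle r₀ m₀ r m j u) (f : MvPolynomial E₀ R) (v : CircleAlgebra R r m) :
    h.counit (mk r m (rename j f) * v) = mk r₀ m₀ f * h.counit v := by
  obtain ⟨a, b, rfl⟩ := h.exists_decomposition v
  rw [← map_mk h.isCircleMap, mul_add, mul_left_comm, ← map_mul, ← map_mul, map_add, map_add,
    counit_map, counit_map, counit_x_mul_map, counit_x_mul_map, zero_add, zero_add]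

theorem counit_mem (h : IsolatesCircle r₀ m₀ r m j u) [Finite E] {d : ℤ} {v : CircleAlgebra R r m} (hv : v ∈ gr R r m d) :
    h.counit v ∈ gr R r₀ m₀ (d - 1) := by
  refine map_mem_of_monomial h.counit _ ?_ hv
  intro s hs
  have hc := h.card_quotient
  rcases h.monomial_cases (R := R) s with e | ⟨s₀, -, e⟩ | ⟨s₀, ds, e⟩
  · rw [e, map_zero]; exact zero_mem _
  · rw [e, counit_map]; exact zero_mem _
  · rw [e, counit_x_mul_map]
    refine mk_monomial_mem ?_
    rw [← ds, hc] at hs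
    push_cast at hs
    linarith

theorem inclusion_mem (h : IsolatesCircle r₀ m₀ r m j u) [Finite E] {d : ℤ} {v : CircleAlgebra R r₀ m₀} (hv : v ∈ gr R r₀ m₀ d) :
    map j h.isCircleMap v ∈ gr R r m (d - 1) :=
  CircleAlgebra.map_mem _ (by rw [h.card_quotient]; push_cast; ring) hv

/-- Surgeries away from the isolated circle. -/
theorem surgery_inclusion (h : IsolatesCircle r₀ m₀ r m j u) {r₀' : Setoid E₀} {r' : Setoid E} {p q : E₀}
    (h' : IsolatesCircle r₀' m₀ r' m j u) (hs : Surgery r r' (j p) (j q))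
    (v : CircleAlgebra R r₀ m₀) :
    surgery r r' m (map j h.isCircleMap v) =
      map j h'.isCircleMap (surgery r₀ r₀' m₀ v) := by
  have er : r₀ = r.comap j := Setoid.ext fun a b => h.rel a b
  have er' : r₀' = r'.comap j := Setoid.ext fun a b => h'.rel a b
  have hs₀ : Surgery r₀ r₀' p q := by rw [er, er']; exact hs.comap j
  obtain ⟨f, rfl⟩ := mk_surjective r₀ m₀ v
  rw [map_mk, surgery_mk m hs, surgery_mk m₀ hs₀, map_mk, map_mul (rename j)]
  congr 2
  by_cases hpq : r₀ p q
  · rw [surgeryCoeff, surgeryCoeff, if_pos hpq, if_pos ((h.rel _ _).1 hpq), map_add, rename_X,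
      rename_X]
  · rw [surgeryCoeff, surgeryCoeff, if_neg hpq, if_neg fun h' => hpq ((h.rel _ _).2 h'), map_one]

theorem surgery_counit (h : IsolatesCircle r₀ m₀ r m j u) {r₀' : Setoid E₀} {r' : Setoid E} {p q : E₀}
    (h' : IsolatesCircle r₀' m₀ r' m j u) (hs : Surgery r r' (j p) (j q))
    (v : CircleAlgebra R r m) :
    h'.counit (surgery r r' m v) = surgery r₀ r₀' m₀ (h.counit v) := by
  obtain ⟨a, b, rfl⟩ := h.exists_decomposition v
  rw [map_add, ← mk_X, surgery_mul m hs, h.surgery_inclusion h' hs, h.surgery_inclusion h' hs, mk_X, mk_X,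
    map_add, map_add, counit_map, counit_map, counit_x_mul_map, counit_x_mul_map, zero_add,
    zero_add]

/-- Creation of the isolated circle, with sign `v₊`. -/
noncomputable def birth (h : IsolatesCircle r₀ m₀ r m j u) {r' : Setoid E} {a : E₀} (hm : Merge r r' u (j a)) :
    CircleAlgebra R r' m →ₗ[R] CircleAlgebra R r m :=
  (map j h.isCircleMap).toLinearMap ∘ₗ
    (mapEquiv (h.isCircleEquiv_of_merge hm)).symm.toLinearMap

/-- Removal of the isolated circle, with values in the algebra of another collection of circles, into
which the remaining ones are identified. -/
noncomputable def death (h : IsolatesCircle r₀ m₀ r m j u) {r' : Setoid E} {a : E₀} (hm : Merge r r' u (j a)) :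
    CircleAlgebra R r m →ₗ[R] CircleAlgebra R r' m :=
  (mapEquiv (h.isCircleEquiv_of_merge hm)).toLinearMap ∘ₗ h.counit

section

variable {r' r'' : Setoid E} {a' a'' : E₀} (hm : Merge r r' u (j a')) (hm' : Merge r r'' u (j a''))

theorem birth_mk (h : IsolatesCircle r₀ m₀ r m j u) (f : MvPolynomial E₀ R) :
    h.birth hm (mk r' m (rename j f)) = mk r m (rename j f) := by
  change map j h.isCircleMap ((mapEquiv _).symm _) = _
  rw [mapEquiv_symm_mk, map_mk]

theorem death_apply (h : IsolatesCircle r₀ m₀ r m j u) (v : CircleAlgebra R r m) :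
    h.death hm v = mapEquiv (h.isCircleEquiv_of_merge hm) (h.counit v) := rfl

theorem surgery_birth (h : IsolatesCircle r₀ m₀ r m j u) (v : CircleAlgebra R r' m) : surgery r r' m (h.birth hm v) = v := by
  obtain ⟨f, rfl⟩ := exists_rename (h.isCircleEquiv_of_merge hm) v
  rw [birth_mk, surgery_of_merge m hm]

theorem death_surgery (h : IsolatesCircle r₀ m₀ r m j u) (v : CircleAlgebra R r' m) : h.death hm (surgery r' r m v) = v := by
  obtain ⟨f, rfl⟩ := exists_rename (h.isCircleEquiv_of_merge hm) v
  rw [surgery_of_split m hm, death_apply, counit_mul, map_add, ← map_x h.isCircleMap a', counit_map,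
    add_zero, ← mul_one (x r m u), ← map_one (map j h.isCircleMap), counit_x_mul_map, mul_one,
    mapEquiv_mk]

theorem death_birth (h : IsolatesCircle r₀ m₀ r m j u) (v : CircleAlgebra R r'' m) : h.death hm (h.birth hm' v) = 0 := by
  change mapEquiv (h.isCircleEquiv_of_merge hm) (h.counit (map j h.isCircleMap _)) = 0
  rw [counit_map, map_zero]

/-- An element that does not involve the isolated circle can be recovered after merging. -/
theorem birth_surgery_of_death_eq_zero (h : IsolatesCircle r₀ m₀ r m j u) {v : CircleAlgebra R r m} (hv : h.death hm v = 0) :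
    h.birth hm' (surgery r r'' m v) = v := by
  rw [death_apply, EmbeddingLike.map_eq_zero_iff] at hv
  obtain ⟨a, b, rfl⟩ := h.exists_decomposition v
  rw [map_add, counit_map, counit_x_mul_map, zero_add] at hv
  rw [hv, map_zero, mul_zero, add_zero]
  obtain ⟨f, rfl⟩ := mk_surjective r₀ m₀ a
  rw [map_mk, surgery_of_merge m hm', birth_mk]

theorem birth_mem (h : IsolatesCircle r₀ m₀ r m j u) [Finite E] {d : ℤ} {v : CircleAlgebra R r' m} (hv : v ∈ gr R r' m d) :
    h.birth hm v ∈ gr R r m (d - 1) :=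
  h.inclusion_mem (mapEquiv_symm_mem _ hv)

theorem death_mem (h : IsolatesCircle r₀ m₀ r m j u) [Finite E] {d : ℤ} {v : CircleAlgebra R r m} (hv : v ∈ gr R r m d) :
    h.death hm v ∈ gr R r' m (d - 1) :=
  mapEquiv_mem (h.isCircleEquiv_of_merge hm) (h.counit_mem hv)

theorem birth_mul (h : IsolatesCircle r₀ m₀ r m j u) (f : MvPolynomial E₀ R) (v : CircleAlgebra R r' m) :
    h.birth hm (mk r' m (rename j f) * v) = mk r m (rename j f) * h.birth hm v := by
  obtain ⟨g, rfl⟩ := exists_rename (h.isCircleEquiv_of_merge hm) v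
  rw [← map_mul, ← map_mul, birth_mk, birth_mk, map_mul, map_mul]

theorem death_mul (h : IsolatesCircle r₀ m₀ r m j u) (f : MvPolynomial E₀ R) (v : CircleAlgebra R r m) :
    h.death hm (mk r m (rename j f) * v) = mk r' m (rename j f) * h.death hm v := by
  rw [death_apply, counit_mul, map_mul, mapEquiv_mk, death_apply]

end

section

variable {s₀ : Setoid E₀} {s : Setoid E} (k : IsolatesCircle s₀ m₀ s m j u) {p q : E₀} {p' q' : E}
  {r' s' : Setoid E} {a b : E₀}
  (hm : Merge r r' u (j a)) (km : Merge s s' u (j b))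

theorem surgery_birth_comm (h : IsolatesCircle r₀ m₀ r m j u)
    (hs : Surgery r s (j p) (j q)) (hs' : Surgery r' s' p' q') (v : CircleAlgebra R r' m) :
    k.birth km (surgery r' s' m v) = surgery r s m (h.birth hm v) := by
  change map j k.isCircleMap ((mapEquiv _).symm (surgery r' s' m v)) =
    surgery r s m (map j h.isCircleMap ((mapEquiv _).symm v))
  rw [h.surgery_inclusion k hs, surgery_mapEquiv_symm hs' (h.isCircleEquiv_of_merge hm)
    (k.isCircleEquiv_of_merge km)]

theorem surgery_death_comm (h : IsolatesCircle r₀ m₀ r m j u)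
    (hs : Surgery r s (j p) (j q)) (hs' : Surgery r' s' p' q') (v : CircleAlgebra R r m) :
    k.death km (surgery r s m v) = surgery r' s' m (h.death hm v) := by
  rw [death_apply, death_apply, h.surgery_counit k hs,
    surgery_mapEquiv hs' (h.isCircleEquiv_of_merge hm) (k.isCircleEquiv_of_merge km)]

end

end IsolatesCircle

end CircleAlgebra

/-! ### Transfer between diagrams with the same circles -/

section PushWeight

open Classical in
/-- The push-forward of weights along a map of edges. -/
noncomputable def pushWeight {E₀ E R : Type} [Fintype E₀] [CommRing R] (j : E₀ → E)
    (w : E₀ → R) : E → R := fun e => ∑ a, if j a = e then w a else 0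

theorem weightPoly_pushWeight {E₀ E R : Type} [Fintype E₀] [Fintype E] [CommRing R] (j : E₀ → E)
    (w : E₀ → R) : weightPoly (pushWeight j w) = MvPolynomial.rename j (weightPoly w) := by
  classical
  simp only [weightPoly, pushWeight, map_sum, map_smul, MvPolynomial.rename_X, Finset.sum_smul]
  rw [Finset.sum_comm]
  refine Finset.sum_congr rfl fun a _ => ?_
  rw [Finset.sum_eq_single (j a)]
  · rw [if_pos rfl]
  · intro b _ hb; rw [if_neg (Ne.symm hb), zero_smul]
  · simp

end PushWeight

namespace CircleAlgebra

open MvPolynomial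

variable {R : Type} [CommRing R] {E E' E₀ : Type} [Algebra (ZMod 2) R]
  {r₀ : Setoid E₀} {m₀ : E₀} {r : Setoid E} {m : E} {j : E₀ → E} {r' : Setoid E'} {m' : E'}
  {j' : E₀ → E'}

/-- The isomorphism of the algebras of two collections of circles, both identified with a third one. -/
noncomputable def transfer (h : IsCircleEquiv r₀ m₀ r m j) (h' : IsCircleEquiv r₀ m₀ r' m' j') :
    CircleAlgebra R r m ≃ₐ[R] CircleAlgebra R r' m' :=
  (mapEquiv h).symm.trans (mapEquiv h')

theorem transfer_mapEquiv (h : IsCircleEquiv r₀ m₀ r m j) (h' : IsCircleEquiv r₀ m₀ r' m' j')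
    (v : CircleAlgebra R r₀ m₀) : transfer h h' (mapEquiv h v) = mapEquiv h' v := by
  rw [transfer, AlgEquiv.trans_apply, AlgEquiv.symm_apply_apply]

theorem transfer_mk (h : IsCircleEquiv r₀ m₀ r m j) (h' : IsCircleEquiv r₀ m₀ r' m' j')
    (f : MvPolynomial E₀ R) : transfer h h' (mk r m (rename j f)) = mk r' m' (rename j' f) := by
  rw [← mapEquiv_mk h, transfer_mapEquiv, mapEquiv_mk]

theorem transfer_mem_iff (h : IsCircleEquiv r₀ m₀ r m j) (h' : IsCircleEquiv r₀ m₀ r' m' j')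
    {d : ℤ} {v : CircleAlgebra R r m} : transfer h h' v ∈ gr R r' m' d ↔ v ∈ gr R r m d := by
  constructor
  · intro hv
    have := mapEquiv_mem h (mapEquiv_symm_mem h' hv)
    rwa [transfer, AlgEquiv.trans_apply, AlgEquiv.symm_apply_apply,
      AlgEquiv.apply_symm_apply] at this
  · exact fun hv => mapEquiv_mem h' (mapEquiv_symm_mem h hv)

theorem transfer_surgery {s₀ : Setoid E₀} {s : Setoid E} {s' : Setoid E'} {p q : E} {p' q' : E'}
    (h : IsCircleEquiv r₀ m₀ r m j) (h' : IsCircleEquiv r₀ m₀ r' m' j')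
    (k : IsCircleEquiv s₀ m₀ s m j) (k' : IsCircleEquiv s₀ m₀ s' m' j')
    (hs : Surgery r s p q) (hs' : Surgery r' s' p' q') (v : CircleAlgebra R r m) :
    transfer k k' (surgery r s m v) = surgery r' s' m' (transfer h h' v) := by
  obtain ⟨v, rfl⟩ := (mapEquiv h).surjective v
  rw [surgery_mapEquiv hs h k, transfer_mapEquiv, transfer_mapEquiv, surgery_mapEquiv hs' h' k']

namespace IsolatesCircle

variable {u : E}

/-- Away from the isolated circle, splitting off and removing cancel up to merging and creating. -/
theorem add_surgery_death (h : IsolatesCircle r₀ m₀ r m j u) {r' r'' : Setoid E} {a a' : E₀}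
    (hm : Merge r r' u (j a)) (hm' : Merge r r'' u (j a')) (v : CircleAlgebra R r m) :
    h.birth hm' (surgery r r'' m (v + surgery r' r m (h.death hm v))) =
      v + surgery r' r m (h.death hm v) := by
  refine h.birth_surgery_of_death_eq_zero hm hm' ?_
  rw [map_add, death_surgery, add_self]

theorem surgery_birth_transfer (h : IsolatesCircle r₀ m₀ r m j u) {r' r'' : Setoid E} {a a' : E₀}
    (hm : Merge r r' u (j a)) (hm' : Merge r r'' u (j a')) (v : CircleAlgebra R r₀ m₀) :
    surgery r r'' m (h.birth hm (mapEquiv (h.isCircleEquiv_of_merge hm) v)) =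
      mapEquiv (h.isCircleEquiv_of_merge hm') v := by
  obtain ⟨f, rfl⟩ := mk_surjective r₀ m₀ v
  rw [mapEquiv_mk, birth_mk, surgery_of_merge m hm', mapEquiv_mk]

theorem death_surgery_transfer (h : IsolatesCircle r₀ m₀ r m j u) {r' r'' : Setoid E} {a a' : E₀}
    (hm : Merge r r' u (j a)) (hm' : Merge r r'' u (j a')) (v : CircleAlgebra R r₀ m₀) :
    h.death hm (surgery r'' r m (mapEquiv (h.isCircleEquiv_of_merge hm') v)) =
      mapEquiv (h.isCircleEquiv_of_merge hm) v := by
  obtain ⟨f, rfl⟩ := mk_surjective r₀ m₀ v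
  rw [mapEquiv_mk, surgery_of_split m hm', death_apply, counit_mul, map_add,
    ← map_x h.isCircleMap a', counit_map, add_zero, ← mul_one (x r m u),
    ← map_one (map j h.isCircleMap), counit_x_mul_map, mul_one]

end IsolatesCircle

end CircleAlgebra

namespace SurgeryCube

open DiffModule CircleAlgebra

variable {X E E' E₀ : Type} [DecidableEq X] {R : Type} [CommRing R] {m : E} {m' : E'} {m₀ : E₀}
  [Algebra (ZMod 2) R] [Fintype X] [Fintype E] [Fintype E'] [Fintype E₀] {j : E₀ → E}
  {j' : E₀ → E'}

theorem complex_cast {C : SurgeryCube X E} {w : E → R} {n n' : ℤ} (h : n = n') :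
    HEquiv (C.complex m w n) (C.complex m w n') := h ▸ HEquiv.refl _

/-- The transfer isomorphism between the chains of two cubes. -/
noncomputable def transferMap {C : SurgeryCube X E} {C' : SurgeryCube X E'}
    {r₀ : Finset X → Setoid E₀} (h : ∀ S, IsCircleEquiv (r₀ S) m₀ (C.rel S) m j)
    (h' : ∀ S, IsCircleEquiv (r₀ S) m₀ (C'.rel S) m' j') : C.Total R m →ₗ[R] C'.Total R m' :=
  pointwise fun S => (transfer (h S) (h' S)).toLinearMap

theorem transferMap_apply {C : SurgeryCube X E} {C' : SurgeryCube X E'}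
    {r₀ : Finset X → Setoid E₀} (h : ∀ S, IsCircleEquiv (r₀ S) m₀ (C.rel S) m j)
    (h' : ∀ S, IsCircleEquiv (r₀ S) m₀ (C'.rel S) m' j') (v : C.Total R m) (S : Finset X) :
    transferMap h h' v S = transfer (h S) (h' S) (v S) := rfl

theorem transferMap_isIso {C : SurgeryCube X E} {C' : SurgeryCube X E'}
    {r₀ : Finset X → Setoid E₀} (h : ∀ S, IsCircleEquiv (r₀ S) m₀ (C.rel S) m j)
    (h' : ∀ S, IsCircleEquiv (r₀ S) m₀ (C'.rel S) m' j') (w₀ : E₀ → R) (n : ℤ) :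
    IsIso (A := C.complex m (pushWeight j w₀) n) (B := C'.complex m' (pushWeight j' w₀) n)
      (transferMap h h') := by
  refine ⟨⟨?_, ?_⟩, ?_, ?_⟩
  · intro v v' hv
    funext S
    exact (transfer (h S) (h' S)).injective (congrFun hv S)
  · intro (u : C'.Total R m')
    exact ⟨fun S => (transfer (h S) (h' S)).symm (u S),
      funext fun S => (transfer (h S) (h' S)).apply_symm_apply (u S)⟩
  · intro i (v : C.Total R m)
    refine C'.mem_gr.trans (Iff.trans ?_ C.mem_gr.symm)
    exact forall_congr' fun S => transfer_mem_iff (h S) (h' S)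
  · refine pointwise_isChainMap _ (fun S x hx v => ?_) (fun S v => ?_)
    · exact transfer_surgery (h S) (h' S) (h _) (h' _) (C.surgery S x hx) (C'.surgery S x hx) v
    · change transfer (h S) (h' S) _ = _ * transfer (h S) (h' S) v
      rw [map_mul, weightPoly_pushWeight, weightPoly_pushWeight, transfer_mk]

/-! ### The first Reidemeister move for cubes of surgeries -/

/-- The edges of the arcs at the crossings of a cube come from `E₀`. -/
def ArcsFrom (C : SurgeryCube X E) (j : E₀ → E) : Prop :=
  ∀ x, ∃ a b, C.p x = j a ∧ C.q x = j b

section Isolated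

variable {N Q : SurgeryCube X E} {r₀ : Finset X → Setoid E₀} {u : E} {a : Finset X → E₀}
  (h : ∀ S, IsolatesCircle (r₀ S) m₀ (N.rel S) m j u)
  (hm : ∀ S, Merge (N.rel S) (Q.rel S) u (j (a S)))

/-- Creation of the isolated circle in each resolution. -/
noncomputable def birthMap : Q.Total R m →ₗ[R] N.Total R m :=
  pointwise fun S => (h S).birth (hm S)

/-- Removal of the isolated circle in each resolution. -/
noncomputable def deathMap : N.Total R m →ₗ[R] Q.Total R m :=
  pointwise fun S => (h S).death (hm S)

theorem birthMap_isChainMap (hN : N.ArcsFrom j) (w₀ : E₀ → R) (n n' : ℤ) :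
    IsChainMap (A := Q.complex m (pushWeight j w₀) n) (B := N.complex m (pushWeight j w₀) n')
      (birthMap h hm) := by
  refine pointwise_isChainMap _ (fun S x hx v => ?_) (fun S v => ?_)
  · obtain ⟨p, q, hp, hq⟩ := hN x
    have hs := N.surgery S x hx
    rw [hp, hq] at hs
    exact (h _).surgery_birth_comm (hm S) (hm _) (h S) hs (Q.surgery S x hx) v
  · rw [weightPoly_pushWeight]
    exact (h S).birth_mul (hm S) _ v

theorem deathMap_isChainMap (hN : N.ArcsFrom j) (w₀ : E₀ → R) (n n' : ℤ) :
    IsChainMap (A := N.complex m (pushWeight j w₀) n) (B := Q.complex m (pushWeight j w₀) n')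
      (deathMap h hm) := by
  refine pointwise_isChainMap _ (fun S x hx v => ?_) (fun S v => ?_)
  · obtain ⟨p, q, hp, hq⟩ := hN x
    have hs := N.surgery S x hx
    rw [hp, hq] at hs
    exact (h _).surgery_death_comm (hm S) (hm _) (h S) hs (Q.surgery S x hx) v
  · rw [weightPoly_pushWeight]
    exact (h S).death_mul (hm S) _ v

theorem birthMap_isHomogeneous (w : E → R) {n n' k : ℤ} (hk : k + n' - n = -1) :
    IsHomogeneous (A := Q.complex m w n) (B := N.complex m w n') (birthMap h hm) k :=
  pointwise_isHomogeneous _ hk.symm fun S _ _ hv => (h S).birth_mem (hm S) hv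

theorem deathMap_isHomogeneous (w : E → R) {n n' k : ℤ} (hk : k + n' - n = -1) :
    IsHomogeneous (A := N.complex m w n) (B := Q.complex m w n') (deathMap h hm) k :=
  pointwise_isHomogeneous _ hk.symm fun S _ _ hv => (h S).death_mem (hm S) hv

theorem surgeryMap_birthMap (v : Q.Total R m) : surgeryMap N Q (birthMap h hm v) = v :=
  funext fun S => (h S).surgery_birth (hm S) (v S)

theorem deathMap_surgeryMap (v : Q.Total R m) : deathMap h hm (surgeryMap Q N v) = v :=
  funext fun S => (h S).death_surgery (hm S) (v S)

theorem deathMap_birthMap {P : SurgeryCube X E} {b : Finset X → E₀}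
    (hm' : ∀ S, Merge (N.rel S) (P.rel S) u (j (b S))) (v : P.Total R m) :
    deathMap h hm (birthMap h hm' v) = 0 :=
  funext fun S => (h S).death_birth (hm S) (hm' S) (v S)

theorem birthMap_add_surgeryMap_deathMap {P : SurgeryCube X E} {b : Finset X → E₀}
    (hm' : ∀ S, Merge (N.rel S) (P.rel S) u (j (b S))) (v : N.Total R m) :
    birthMap h hm' (surgeryMap N P v) + birthMap h hm' (surgeryMap N P (surgeryMap Q N
      (deathMap h hm v))) = v + surgeryMap Q N (deathMap h hm v) := by
  rw [← map_add, ← map_add]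
  exact funext fun S => (h S).add_surgery_death (hm S) (hm' S) (v S)

theorem surgeryMap_surgeryMap_eq_zero (hm : ∀ S, Merge (N.rel S) (Q.rel S) u (j (a S)))
    (v : Q.Total R m) :
    surgeryMap N Q (surgeryMap Q N v) = 0 := by
  funext S
  refine (surgery_surgery m (Or.inr (hm S)) (v S)).trans ?_
  rw [x_add_x m (hm S).rel, zero_mul]; rfl

theorem birthMap_surgeryMap (v : N.Total R m) :
    birthMap h hm (surgeryMap N Q v) = v + surgeryMap Q N (deathMap h hm v) := by
  rw [← birthMap_add_surgeryMap_deathMap h hm hm, surgeryMap_surgeryMap_eq_zero hm, map_zero,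
    add_zero]

end Isolated

/-- A curl whose loop is split off by the `0`-resolution can be removed. -/
theorem complex_hEquiv_high (C : SurgeryCube (Option X) E) {r₀ : Finset X → Setoid E₀} {u : E}
    {a : Finset X → E₀} (h : ∀ S, IsolatesCircle (r₀ S) m₀ (C.low.rel S) m j u)
    (hm : ∀ S, Merge (C.low.rel S) (C.high.rel S) u (j (a S))) (hC : C.low.ArcsFrom j)
    (w₀ : E₀ → R) (n : ℤ) :
    HEquiv (C.complex m (pushWeight j w₀) n) (C.high.complex m (pushWeight j w₀) (n - 1)) := by
  refine (C.split_isIso _ n).hEquiv.trans ?_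
  have hCh : Adjacent C.high C.low := by
    obtain ⟨⟨h₁, h₂⟩, p, q, h₃⟩ := C.adjacent_low_high
    exact ⟨⟨h₁.symm, h₂.symm⟩, p, q, fun S => (h₃ S).symm⟩
  have z : ∀ v : C.low.Total R m, v + v = 0 := add_self_of_charTwo R
  have z' : ∀ v : C.high.Total R m, v + v = 0 := add_self_of_charTwo R
  let f : C.high.Total R m →ₗ[R] C.low.Total R m × C.high.Total R m :=
    LinearMap.prod (surgeryMap C.high C.low) 0
  let g : C.low.Total R m × C.high.Total R m →ₗ[R] C.high.Total R m :=
    deathMap h hm ∘ₗ LinearMap.fst R _ _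
  let k : C.low.Total R m × C.high.Total R m →ₗ[R] C.low.Total R m × C.high.Total R m :=
    LinearMap.prod (birthMap h hm ∘ₗ LinearMap.snd R _ _) 0
  have cb := birthMap_isChainMap h hm hC w₀ (n - 1) n
  have cd := deathMap_isChainMap h hm hC w₀ n (n - 1)
  have cs := surgeryMap_isChainMap (R := R) (m := m) hCh (pushWeight j w₀) (n - 1) n
  refine ⟨g, f, k, 0, ?_, ?_, ?_, isHomogeneous_zero _, ?_, ?_, ?_, ?_⟩
  · rintro i ⟨v, v'⟩ ⟨hv, -⟩
    exact deathMap_isHomogeneous h hm (pushWeight j w₀) (n := n) (n' := n - 1) (by ring) i v hv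
  · intro i v hv
    exact ⟨surgeryMap_isHomogeneous hCh (pushWeight j w₀) (n := n - 1) (n' := n) (by ring) i v hv,
      zero_mem _⟩
  · rintro i ⟨v, v'⟩ ⟨-, hv⟩
    exact ⟨birthMap_isHomogeneous h hm (pushWeight j w₀) (n := n - 1) (n' := n) (by ring) i v' hv,
      zero_mem _⟩
  · rintro ⟨v, v'⟩
    exact cd v
  · intro (v : C.high.Total R m)
    refine Prod.ext (cs v) ?_
    change 0 = surgeryMap C.low C.high (surgeryMap C.high C.low v) + C.high.differential _ 0
    rw [surgeryMap_surgeryMap_eq_zero hm, map_zero, add_zero]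
  · rintro ⟨(v : C.low.Total R m), (v' : C.high.Total R m)⟩
    refine Prod.ext ?_ ?_
    · change surgeryMap C.high C.low (deathMap h hm v) = v +
        (birthMap h hm (surgeryMap C.low C.high v + C.high.differential _ v') +
          C.low.differential _ (birthMap h hm v'))
      have e : birthMap h hm (C.high.differential (pushWeight j w₀) v') =
        C.low.differential (pushWeight j w₀) (birthMap h hm v') := cb v'
      rw [map_add, e, add_assoc (birthMap h hm _), z, add_zero, birthMap_surgeryMap, ← add_assoc,
        z, zero_add]
    · change 0 = v' + (0 + (surgeryMap C.low C.high (birthMap h hm v') + C.high.differential _ 0))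
      rw [surgeryMap_birthMap, map_zero, add_zero, zero_add, z']
  · intro (v : C.high.Total R m)
    have e : v + (0 + C.high.differential (pushWeight j w₀) 0) = v := by
      rw [map_zero, add_zero, add_zero]
    exact (deathMap_surgeryMap h hm v).trans e.symm

/-- A curl whose loop is split off by the `1`-resolution can be removed. -/
theorem complex_hEquiv_low (C : SurgeryCube (Option X) E) {r₀ : Finset X → Setoid E₀} {u : E}
    {a : Finset X → E₀} (h : ∀ S, IsolatesCircle (r₀ S) m₀ (C.high.rel S) m j u)
    (hm : ∀ S, Merge (C.high.rel S) (C.low.rel S) u (j (a S))) (hC : C.high.ArcsFrom j)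
    (w₀ : E₀ → R) (n : ℤ) :
    HEquiv (C.complex m (pushWeight j w₀) n) (C.low.complex m (pushWeight j w₀) n) := by
  refine (C.split_isIso _ n).hEquiv.trans ?_
  have hCh : Adjacent C.high C.low := by
    obtain ⟨⟨h₁, h₂⟩, p, q, h₃⟩ := C.adjacent_low_high
    exact ⟨⟨h₁.symm, h₂.symm⟩, p, q, fun S => (h₃ S).symm⟩
  have z : ∀ v : C.low.Total R m, v + v = 0 := add_self_of_charTwo R
  have z' : ∀ v : C.high.Total R m, v + v = 0 := add_self_of_charTwo R
  let f : C.low.Total R m →ₗ[R] C.low.Total R m × C.high.Total R m :=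
    LinearMap.prod 0 (birthMap h hm)
  let g : C.low.Total R m × C.high.Total R m →ₗ[R] C.low.Total R m :=
    surgeryMap C.high C.low ∘ₗ LinearMap.snd R _ _
  let k : C.low.Total R m × C.high.Total R m →ₗ[R] C.low.Total R m × C.high.Total R m :=
    LinearMap.prod (deathMap h hm ∘ₗ LinearMap.snd R _ _) 0
  have cb := birthMap_isChainMap h hm hC w₀ n (n - 1)
  have cd := deathMap_isChainMap h hm hC w₀ (n - 1) n
  have cs := surgeryMap_isChainMap (R := R) (m := m) hCh (pushWeight j w₀) (n - 1) n
  refine ⟨g, f, k, 0, ?_, ?_, ?_, isHomogeneous_zero _, ?_, ?_, ?_, ?_⟩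
  · rintro i ⟨v, v'⟩ ⟨-, hv⟩
    exact surgeryMap_isHomogeneous hCh (pushWeight j w₀) (n := n - 1) (n' := n) (by ring) i v' hv
  · intro i v hv
    exact ⟨zero_mem _,
      birthMap_isHomogeneous h hm (pushWeight j w₀) (n := n) (n' := n - 1) (by ring) i v hv⟩
  · rintro i ⟨v, v'⟩ ⟨-, hv⟩
    exact ⟨deathMap_isHomogeneous h hm (pushWeight j w₀) (n := n - 1) (n' := n) (by ring) i v' hv,
      zero_mem _⟩
  · rintro ⟨(v : C.low.Total R m), (v' : C.high.Total R m)⟩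
    change surgeryMap C.high C.low (surgeryMap C.low C.high v + C.high.differential _ v') = _
    rw [map_add, surgeryMap_surgeryMap_eq_zero hm, zero_add]
    exact cs v'
  · intro (v : C.low.Total R m)
    refine Prod.ext ?_ ?_
    · change 0 = C.low.differential _ 0
      rw [map_zero]
    · change birthMap h hm (C.low.differential _ v) =
        surgeryMap C.low C.high 0 + C.high.differential _ (birthMap h hm v)
      rw [map_zero, zero_add]
      exact cb v
  · rintro ⟨(v : C.low.Total R m), (v' : C.high.Total R m)⟩
    refine Prod.ext ?_ ?_
    · change 0 = v +
        (deathMap h hm (surgeryMap C.low C.high v + C.high.differential _ v') +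
          C.low.differential _ (deathMap h hm v'))
      have e : deathMap h hm (C.high.differential (pushWeight j w₀) v') =
        C.low.differential (pushWeight j w₀) (deathMap h hm v') := cd v'
      rw [map_add, deathMap_surgeryMap, e, add_assoc v, z, add_zero, z]
    · change birthMap h hm (surgeryMap C.high C.low v') =
        v' + (0 + (surgeryMap C.low C.high (deathMap h hm v') + C.high.differential _ 0))
      rw [birthMap_surgeryMap, map_zero, add_zero, zero_add]
  · intro (v : C.low.Total R m)
    have e : v + (0 + C.low.differential (pushWeight j w₀) 0) = v := by
      rw [map_zero, add_zero, add_zero]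
    exact (surgeryMap_birthMap h hm v).trans e.symm

end SurgeryCube

/-! ### The square of resolutions of two crossings -/

namespace SurgeryCube

open DiffModule CircleAlgebra

variable {X E E' E₀ : Type} [DecidableEq X] {R : Type} [CommRing R] {m : E} {m' : E'} {m₀ : E₀}
  [Algebra (ZMod 2) R] [Fintype X] [Fintype E] [Fintype E'] [Fintype E₀] {j : E₀ → E}
  {j' : E₀ → E'}

theorem Adjacent.low {C C' : SurgeryCube (Option X) E} (h : Adjacent C C') :
    Adjacent C.low C'.low := by
  obtain ⟨⟨h₁, h₂⟩, p, q, h₃⟩ := h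
  exact ⟨⟨funext fun x => congrFun h₁ (some x), funext fun x => congrFun h₂ (some x)⟩, p, q,
    fun S => h₃ _⟩

theorem Adjacent.high {C C' : SurgeryCube (Option X) E} (h : Adjacent C C') :
    Adjacent C.high C'.high := by
  obtain ⟨⟨h₁, h₂⟩, p, q, h₃⟩ := h
  exact ⟨⟨funext fun x => congrFun h₁ (some x), funext fun x => congrFun h₂ (some x)⟩, p, q,
    fun S => h₃ _⟩

section Quad

variable (T : SurgeryCube (Option (Option X)) E)

/-- The decomposition of the chains of a cube according to the resolutions of two crossings. -/
noncomputable def quad : T.Total R m ≃ₗ[R] (T.low.low.Total R m × T.low.high.Total R m) ×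
    (T.high.low.Total R m × T.high.high.Total R m) :=
  (LinearEquiv.ofBijective T.split T.split_bijective).trans
    ((LinearEquiv.ofBijective T.low.split T.low.split_bijective).prodCongr
      (LinearEquiv.ofBijective T.high.split T.high.split_bijective))

theorem quad_apply (v : T.Total R m) :
    T.quad v = (T.low.split (T.split v).1, T.high.split (T.split v).2) := rfl

theorem quad_mem_iff {n i : ℤ} {v : T.Total R m} :
    v ∈ T.gr n i ↔
      ((T.quad v).1.1 ∈ T.low.low.gr n i ∧ (T.quad v).1.2 ∈ T.low.high.gr (n - 1) i) ∧
      ((T.quad v).2.1 ∈ T.high.low.gr (n - 1) i ∧ (T.quad v).2.2 ∈ T.high.high.gr (n - 1 - 1) i) := by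
  rw [← split_mem_iff, ← split_mem_iff, ← split_mem_iff]; rfl

theorem quad_differential (w : E → R) (v : T.Total R m) :
    T.quad (T.differential w v) =
      ((T.low.low.differential w (T.quad v).1.1,
        surgeryMap T.low.low T.low.high (T.quad v).1.1 +
          T.low.high.differential w (T.quad v).1.2),
      (surgeryMap T.low.low T.high.low (T.quad v).1.1 +
          T.high.low.differential w (T.quad v).2.1,
        surgeryMap T.low.high T.high.high (T.quad v).1.2 +
          (surgeryMap T.high.low T.high.high (T.quad v).2.1 +
            T.high.high.differential w (T.quad v).2.2))) := by
  rw [quad_apply, split_differential]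
  refine Prod.ext (T.low.split_differential w _) ?_
  change T.high.split (_ + _) = _
  rw [map_add, split_differential]
  rfl

theorem surgeryMap_square (v : T.low.low.Total R m) :
    surgeryMap T.low.high T.high.high (surgeryMap T.low.low T.low.high v) =
      surgeryMap T.high.low T.high.high (surgeryMap T.low.low T.high.low v) := by
  funext S
  obtain ⟨-, p, q, h₁⟩ := T.adjacent_low_high
  have h₂ := T.surgery ((S.map Function.Embedding.some).map Function.Embedding.some) (some none)
    (by simp)
  have h₃ := T.surgery (Finset.insertNone (S.map Function.Embedding.some)) (some none)
    (by simp)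
  have e₂ : insert (some none) ((S.map Function.Embedding.some).map Function.Embedding.some) =
      (Finset.insertNone S).map Function.Embedding.some := by ext (_ | _ | y) <;> simp
  have e₃ : insert (some none) (Finset.insertNone (S.map Function.Embedding.some)) =
      Finset.insertNone (Finset.insertNone S) := by ext (_ | _ | y) <;> simp
  rw [e₂] at h₂
  rw [e₃] at h₃
  exact surgery_square m h₂ h₃ (h₁ _) (h₁ _) (v S)

variable {T}
variable {r₀ : Finset X → Setoid E₀} {u : E} {a a' : Finset X → E₀}
  (h : ∀ S, IsolatesCircle (r₀ S) m₀ (T.low.high.rel S) m j u)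
  (hm : ∀ S, Merge (T.low.high.rel S) (T.high.high.rel S) u (j (a S)))
  (hm' : ∀ S, Merge (T.low.high.rel S) (T.low.low.rel S) u (j (a' S)))

/-- The inclusion of the deformation retract in `quadRetraction`. -/
noncomputable def quadIncl : T.high.low.Total R m →ₗ[R] T.Total R m :=
  T.quad.symm.toLinearMap ∘ₗ LinearMap.prod
    (LinearMap.prod 0 (birthMap h hm ∘ₗ surgeryMap T.high.low T.high.high))
    (LinearMap.prod LinearMap.id 0)

/-- The projection to the deformation retract in `quadRetraction`. -/
noncomputable def quadProj : T.Total R m →ₗ[R] T.high.low.Total R m :=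
  (LinearMap.fst R (T.high.low.Total R m) (T.high.high.Total R m) ∘ₗ LinearMap.snd R _ _ +
    surgeryMap T.low.low T.high.low ∘ₗ deathMap h hm' ∘ₗ
      LinearMap.snd R (T.low.low.Total R m) (T.low.high.Total R m) ∘ₗ LinearMap.fst R _ _) ∘ₗ
    T.quad.toLinearMap

/-- The homotopy in `quadRetraction`. -/
noncomputable def quadHtpy : T.Total R m →ₗ[R] T.Total R m :=
  T.quad.symm.toLinearMap ∘ₗ LinearMap.prod
    (LinearMap.prod
      (deathMap h hm' ∘ₗ LinearMap.snd R (T.low.low.Total R m) (T.low.high.Total R m) ∘ₗ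
        LinearMap.fst R _ _)
      (birthMap h hm ∘ₗ LinearMap.snd R (T.high.low.Total R m) (T.high.high.Total R m) ∘ₗ
        LinearMap.snd R _ _)) 0 ∘ₗ T.quad.toLinearMap

theorem quad_quadIncl (k : T.high.low.Total R m) : T.quad (quadIncl h hm k) =
    ((0, birthMap h hm (surgeryMap T.high.low T.high.high k)), (k, 0)) :=
  T.quad.apply_symm_apply _

theorem quadProj_apply (v : T.Total R m) : quadProj h hm' v =
    (T.quad v).2.1 + surgeryMap T.low.low T.high.low (deathMap h hm' (T.quad v).1.2) := rfl

theorem quad_quadHtpy (v : T.Total R m) : T.quad (quadHtpy h hm hm' v) =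
    ((deathMap h hm' (T.quad v).1.2, birthMap h hm (T.quad v).2.2), (0, 0)) :=
  T.quad.apply_symm_apply _

/-- If one of the four resolutions of two crossings splits off a circle, the two neighbouring
resolutions cancel against it, and the opposite one is a deformation retract. -/
noncomputable def quadRetraction (hT : T.low.high.ArcsFrom j) (w₀ : E₀ → R) (n : ℤ) :
    Retraction (T.complex m (pushWeight j w₀) n)
      (T.high.low.complex m (pushWeight j w₀) (n - 1)) where
  incl := quadIncl h hm
  proj := quadProj h hm'
  htpy := quadHtpy h hm hm'
  incl_mem := by
    intro i (k : T.high.low.Total R m) hk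
    change quadIncl h hm k ∈ T.gr n (i + 0)
    rw [quad_mem_iff, quad_quadIncl]
    have h₁ := surgeryMap_isHomogeneous T.high.adjacent_low_high (pushWeight j w₀) (n := n - 1)
      (n' := n - 1 - 1) (k := 2) (by ring) i k hk
    have h₂ := birthMap_isHomogeneous h hm (pushWeight j w₀) (n := n - 1 - 1)
      (n' := n - 1) (k := -2) (by ring) _ _ h₁
    rw [show i + 2 + -2 = i by ring] at h₂
    rw [add_zero]
    exact ⟨⟨zero_mem _, h₂⟩, hk, zero_mem _⟩
  proj_mem i v hv := by
    have hv' := T.quad_mem_iff.1 hv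
    have h₁ := deathMap_isHomogeneous h hm' (pushWeight j w₀) (n := n - 1)
      (n' := n) (k := -2) (by ring) _ _ hv'.1.2
    have h₂ := surgeryMap_isHomogeneous T.adjacent_low_high.low (pushWeight j w₀) (n := n)
      (n' := n - 1) (k := 2) (by ring) _ _ h₁
    rw [show i + -2 + 2 = i by ring] at h₂
    have := add_mem hv'.2.1 h₂
    rw [add_zero]
    exact this
  htpy_mem := by
    intro i (v : T.Total R m) hv
    change quadHtpy h hm hm' v ∈ T.gr n (i + -2)
    rw [quad_mem_iff, quad_quadHtpy]
    have hv' := T.quad_mem_iff.1 hv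
    exact ⟨⟨deathMap_isHomogeneous h hm' (pushWeight j w₀) (n := n - 1)
      (n' := n) (k := -2) (by ring) _ _ hv'.1.2, birthMap_isHomogeneous h hm (pushWeight j w₀)
      (n := n - 1 - 1) (n' := n - 1) (k := -2) (by ring) _ _ hv'.2.2⟩, zero_mem _, zero_mem _⟩
  incl_d := by
    intro (k : T.high.low.Total R m)
    change quadIncl h hm (T.high.low.differential _ k) = T.differential _ (quadIncl h hm k)
    apply T.quad.injective
    have cb : ∀ v, birthMap h hm (T.high.high.differential (pushWeight j w₀) v) =
        T.low.high.differential (pushWeight j w₀) (birthMap h hm v) :=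
      birthMap_isChainMap h hm hT w₀ 0 0
    have cs : ∀ v : T.high.low.Total R m, surgeryMap T.high.low T.high.high
        (T.high.low.differential (pushWeight j w₀) v) = T.high.high.differential (pushWeight j w₀)
          (surgeryMap T.high.low T.high.high v) :=
      surgeryMap_isChainMap T.high.adjacent_low_high _ 0 0
    have z : ∀ v : T.high.high.Total R m, v + v = 0 := add_self_of_charTwo R
    rw [quad_differential, quad_quadIncl, quad_quadIncl]
    refine Prod.ext (Prod.ext ?_ ?_) (Prod.ext ?_ ?_) <;> dsimp only
    · rw [map_zero]
    · rw [map_zero, zero_add, cs, cb]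
    · rw [map_zero, zero_add]
    · rw [surgeryMap_birthMap, map_zero, add_zero, z]
  proj_d := by
    intro (v : T.Total R m)
    change quadProj h hm' (T.differential _ v) = T.high.low.differential _ (quadProj h hm' v)
    have cd : ∀ v, deathMap h hm' (T.low.high.differential (pushWeight j w₀) v) =
        T.low.low.differential (pushWeight j w₀) (deathMap h hm' v) :=
      deathMap_isChainMap h hm' hT w₀ 0 0
    have cs : ∀ v : T.low.low.Total R m, surgeryMap T.low.low T.high.low
        (T.low.low.differential (pushWeight j w₀) v) = T.high.low.differential (pushWeight j w₀)
          (surgeryMap T.low.low T.high.low v) :=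
      surgeryMap_isChainMap T.adjacent_low_high.low _ 0 0
    have z : ∀ v : T.high.low.Total R m, v + v = 0 := add_self_of_charTwo R
    rw [quadProj_apply, quadProj_apply, quad_differential]
    dsimp only
    rw [map_add (deathMap h hm'), deathMap_surgeryMap, cd, map_add (surgeryMap _ _), cs, map_add]
    rw [add_comm (surgeryMap _ _ (T.quad v).1.1), add_assoc, ← add_assoc (surgeryMap _ _ _), z,
      zero_add]
  proj_incl := by
    intro (k : T.high.low.Total R m)
    change quadProj h hm' (quadIncl h hm k) = k
    rw [quadProj_apply, quad_quadIncl]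
    dsimp only
    rw [deathMap_birthMap, map_zero, add_zero]
  incl_proj := by
    intro (v : T.Total R m)
    change quadIncl h hm (quadProj h hm' v) = v + (quadHtpy h hm hm' (T.differential _ v) +
      T.differential _ (quadHtpy h hm hm' v))
    have cb : ∀ v, birthMap h hm (T.high.high.differential (pushWeight j w₀) v) =
        T.low.high.differential (pushWeight j w₀) (birthMap h hm v) :=
      birthMap_isChainMap h hm hT w₀ 0 0
    have cd : ∀ v, deathMap h hm' (T.low.high.differential (pushWeight j w₀) v) =
        T.low.low.differential (pushWeight j w₀) (deathMap h hm' v) :=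
      deathMap_isChainMap h hm' hT w₀ 0 0
    have z₀ : ∀ v : T.low.low.Total R m, v + v = 0 := add_self_of_charTwo R
    have z₁ : ∀ v : T.low.high.Total R m, v + v = 0 := add_self_of_charTwo R
    have z₃ : ∀ v : T.high.high.Total R m, v + v = 0 := add_self_of_charTwo R
    apply T.quad.injective
    rw [map_add, map_add, quad_differential, quad_quadIncl, quad_quadHtpy, quad_quadHtpy,
      quad_differential, quadProj_apply]
    generalize T.quad v = t
    obtain ⟨⟨p, n⟩, ⟨k, q⟩⟩ := t
    refine Prod.ext (Prod.ext ?_ ?_) (Prod.ext ?_ ?_)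
    · change 0 = p + (deathMap h hm' (surgeryMap T.low.low T.low.high p +
        T.low.high.differential _ n) + T.low.low.differential _ (deathMap h hm' n))
      rw [map_add, deathMap_surgeryMap, cd, add_assoc p, z₀, add_zero, z₀]
    · change birthMap h hm (surgeryMap T.high.low T.high.high
        (k + surgeryMap T.low.low T.high.low (deathMap h hm' n))) =
        n + (birthMap h hm (surgeryMap T.low.high T.high.high n +
          (surgeryMap T.high.low T.high.high k + T.high.high.differential _ q)) +
          (surgeryMap T.low.low T.low.high (deathMap h hm' n) +
            T.low.high.differential _ (birthMap h hm q)))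
      -- The creation and the removal of the circle give complementary idempotents.
      have key := birthMap_add_surgeryMap_deathMap h hm' hm n
      rw [surgeryMap_square] at key
      rw [map_add, map_add, map_add (birthMap h hm), map_add (birthMap h hm), cb]
      apply eq_of_add_eq_zero_of_charTwo R
      have k₁ := z₁ (birthMap h hm (surgeryMap T.high.low T.high.high k))
      have k₂ := z₁ (T.low.high.differential (pushWeight j w₀) (birthMap h hm q))
      have k₃ := z₁ (n + surgeryMap T.low.low T.low.high (deathMap h hm' n))
      calc _ = (birthMap h hm (surgeryMap T.high.low T.high.high k) +
              birthMap h hm (surgeryMap T.high.low T.high.high k)) +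
            (T.low.high.differential (pushWeight j w₀) (birthMap h hm q) +
              T.low.high.differential (pushWeight j w₀) (birthMap h hm q)) +
            ((birthMap h hm (surgeryMap T.low.high T.high.high n) +
              birthMap h hm (surgeryMap T.high.low T.high.high
                (surgeryMap T.low.low T.high.low (deathMap h hm' n)))) +
            (n + surgeryMap T.low.low T.low.high (deathMap h hm' n))) := by abel
        _ = 0 := by rw [key, k₁, k₂, k₃]; simp
    · change k + surgeryMap T.low.low T.high.low (deathMap h hm' n) = k + (0 +
        (surgeryMap T.low.low T.high.low (deathMap h hm' n) + T.high.low.differential _ 0))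
      rw [map_zero, add_zero, zero_add]
    · change 0 = q + (0 + (surgeryMap T.low.high T.high.high (birthMap h hm q) +
        (surgeryMap T.high.low T.high.high 0 + T.high.high.differential _ 0)))
      rw [map_zero, map_zero, surgeryMap_birthMap, add_zero, add_zero, zero_add, z₃]
  htpy_incl := by
    intro (k : T.high.low.Total R m)
    change quadHtpy h hm hm' (quadIncl h hm k) = 0
    apply T.quad.injective
    rw [quad_quadHtpy, quad_quadIncl, map_zero]
    dsimp only
    rw [deathMap_birthMap, map_zero]; rfl
  proj_htpy := by
    intro (v : T.Total R m)
    change quadProj h hm' (quadHtpy h hm hm' v) = 0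
    rw [quadProj_apply, quad_quadHtpy]
    dsimp only
    rw [deathMap_birthMap, map_zero, add_zero]

end Quad

end SurgeryCube

/-! ### The third Reidemeister move for cubes of surgeries -/

theorem DiffModule.HEquiv.cone_of_isIso {R : Type} [CommRing R] [Algebra (ZMod 2) R]
    {A B A' B' : DiffModule R} {f : A →ₗ[R] A'} {g : B →ₗ[R] B'} (hf : IsIso f) (hg : IsIso g)
    {φ : A →ₗ[R] B} {hφ : IsHomogeneous φ 2} {cφ : IsChainMap φ} {ψ : A' →ₗ[R] B'}
    {hψ : IsHomogeneous ψ 2} {cψ : IsChainMap ψ} (h : ∀ a, g (φ a) = ψ (f a)) :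
    HEquiv (cone φ hφ cφ) (cone ψ hψ cψ) := by
  refine IsIso.hEquiv (A := cone φ hφ cφ) (B := cone ψ hψ cψ) (f := LinearMap.prodMap f g)
    ⟨?_, ?_, ?_⟩
  · exact hf.bijective.prodMap hg.bijective
  · rintro i ⟨a, b⟩
    exact and_congr (hf.mem_iff i a) (hg.mem_iff i b)
  · rintro ⟨a, b⟩
    refine Prod.ext (hf.chain a) ?_
    change g (φ a + B.d b) = ψ (f a) + B'.d (g b)
    rw [map_add, h, hg.chain]

namespace SurgeryCube

open DiffModule CircleAlgebra

variable {X E E' E₀ : Type} [DecidableEq X] {R : Type} [CommRing R] {m : E} {m' : E'} {m₀ : E₀}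
  [Algebra (ZMod 2) R] [Fintype X] [Fintype E] [Fintype E'] [Fintype E₀] {j : E₀ → E}
  {j' : E₀ → E'}

theorem Adjacent.surgery {C C' : SurgeryCube X E} (h : Adjacent C C') :
    ∃ p q, ∀ S, Surgery (C.rel S) (C'.rel S) p q := h.2

theorem transferMap_transferMap {C : SurgeryCube X E} {C' : SurgeryCube X E'}
    {r₀ : Finset X → Setoid E₀} (h : ∀ S, IsCircleEquiv (r₀ S) m₀ (C.rel S) m j)
    (h' : ∀ S, IsCircleEquiv (r₀ S) m₀ (C'.rel S) m' j') (v : C.Total R m) :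
    transferMap h' h (transferMap h h' v) = v := by
  funext S
  rw [transferMap_apply, transferMap_apply]
  obtain ⟨f, hf⟩ := exists_rename (h S) (v S)
  rw [hf, transfer_mk, transfer_mk]

theorem transferMap_surgeryMap {C D : SurgeryCube X E} {C' D' : SurgeryCube X E'}
    {r₀ s₀ : Finset X → Setoid E₀} (h : ∀ S, IsCircleEquiv (r₀ S) m₀ (C.rel S) m j)
    (h' : ∀ S, IsCircleEquiv (r₀ S) m₀ (C'.rel S) m' j')
    (k : ∀ S, IsCircleEquiv (s₀ S) m₀ (D.rel S) m j)
    (k' : ∀ S, IsCircleEquiv (s₀ S) m₀ (D'.rel S) m' j') (hC : Adjacent C D)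
    (hC' : Adjacent C' D') (v : C.Total R m) :
    transferMap k k' (surgeryMap C D v) = surgeryMap C' D' (transferMap h h' v) := by
  obtain ⟨p, q, hs⟩ := hC.surgery
  obtain ⟨p', q', hs'⟩ := hC'.surgery
  exact funext fun S => transfer_surgery (h S) (h' S) (k S) (k' S) (hs S) (hs' S) (v S)

theorem quad_surgeryMap (T B : SurgeryCube (Option (Option X)) E) (v : T.Total R m) :
    B.quad (surgeryMap T B v) =
      ((surgeryMap T.low.low B.low.low (T.quad v).1.1,
        surgeryMap T.low.high B.low.high (T.quad v).1.2),
      (surgeryMap T.high.low B.high.low (T.quad v).2.1,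
        surgeryMap T.high.high B.high.high (T.quad v).2.2)) := rfl

/-- The two faces `T` and `B` of the cube of resolutions of the three crossings of a triangle, `T` being
the one that contains the resolution splitting off the triangle. Apart from the two resolutions in
`T` that cancel against the latter, the circles of all the resolutions are
described on the set `E₀` of edges outside the triangle, by `k₀`, `p₀`, `q₀`, `r₀` and
`s₀`. -/
structure Triangle (T B : SurgeryCube (Option (Option X)) E) (j : E₀ → E) (m₀ : E₀) (m : E)
    (k₀ p₀ q₀ r₀ s₀ : Finset X → Setoid E₀) where
  u : E
  a : Finset X → E₀
  a' : Finset X → E₀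
  b : Finset X → E₀
  isolates : ∀ S, IsolatesCircle (r₀ S) m₀ (T.low.high.rel S) m j u
  merge : ∀ S, Merge (T.low.high.rel S) (T.high.high.rel S) u (j (a S))
  merge' : ∀ S, Merge (T.low.high.rel S) (T.low.low.rel S) u (j (a' S))
  merge_base : ∀ S, Merge (T.low.high.rel S) (B.low.high.rel S) u (j (b S))
  core : ∀ S, IsCircleEquiv (k₀ S) m₀ (T.high.low.rel S) m j
  lowLow : ∀ S, IsCircleEquiv (p₀ S) m₀ (B.low.low.rel S) m j
  highHigh : ∀ S, IsCircleEquiv (q₀ S) m₀ (B.high.high.rel S) m j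
  highLow : ∀ S, IsCircleEquiv (s₀ S) m₀ (B.high.low.rel S) m j
  arcs : T.low.high.ArcsFrom j

namespace Triangle

variable {T B : SurgeryCube (Option (Option X)) E} {T' B' : SurgeryCube (Option (Option X)) E'}
  {k₀ p₀ q₀ r₀ s₀ : Finset X → Setoid E₀}

theorem lowHigh (t : Triangle T B j m₀ m k₀ p₀ q₀ r₀ s₀) (S : Finset X) :
    IsCircleEquiv (r₀ S) m₀ (B.low.high.rel S) m j :=
  (t.isolates S).isCircleEquiv_of_merge (t.merge_base S)

/-- The deformation retraction of the face containing the triangle. -/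
noncomputable def retraction (t : Triangle T B j m₀ m k₀ p₀ q₀ r₀ s₀) (w₀ : E₀ → R) (n : ℤ) :
    Retraction (T.complex m (pushWeight j w₀) n)
      (T.high.low.complex m (pushWeight j w₀) (n - 1)) :=
  quadRetraction t.isolates t.merge t.merge' t.arcs w₀ n

/-- The identification of the faces of the cubes of two diagrams that do not involve the triangle. It
exchanges the roles of two of the crossings. -/
noncomputable def baseMap (t : Triangle T B j m₀ m k₀ p₀ q₀ r₀ s₀)
    (t' : Triangle T' B' j' m₀ m' k₀ p₀ q₀ s₀ r₀) : B.Total R m →ₗ[R] B'.Total R m' :=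
  B'.quad.symm.toLinearMap ∘ₗ LinearMap.prod
    (LinearMap.prodMap (transferMap t.lowLow t'.lowLow) (transferMap t.highLow t'.lowHigh) ∘ₗ
      LinearMap.prodMap (LinearMap.fst R (B.low.low.Total R m) (B.low.high.Total R m))
        (LinearMap.fst R (B.high.low.Total R m) (B.high.high.Total R m)))
    (LinearMap.prodMap (transferMap t.lowHigh t'.highLow) (transferMap t.highHigh t'.highHigh) ∘ₗ
      LinearMap.prodMap (LinearMap.snd R (B.low.low.Total R m) (B.low.high.Total R m))
        (LinearMap.snd R (B.high.low.Total R m) (B.high.high.Total R m))) ∘ₗ B.quad.toLinearMap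

theorem quad_baseMap (t : Triangle T B j m₀ m k₀ p₀ q₀ r₀ s₀)
    (t' : Triangle T' B' j' m₀ m' k₀ p₀ q₀ s₀ r₀) (v : B.Total R m) :
    B'.quad (baseMap t t' v) =
      ((transferMap t.lowLow t'.lowLow (B.quad v).1.1,
        transferMap t.highLow t'.lowHigh (B.quad v).2.1),
      (transferMap t.lowHigh t'.highLow (B.quad v).1.2,
        transferMap t.highHigh t'.highHigh (B.quad v).2.2)) :=
  B'.quad.apply_symm_apply _

theorem baseMap_baseMap (t : Triangle T B j m₀ m k₀ p₀ q₀ r₀ s₀)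
    (t' : Triangle T' B' j' m₀ m' k₀ p₀ q₀ s₀ r₀) (v : B.Total R m) :
    baseMap t' t (baseMap t t' v) = v := by
  apply B.quad.injective
  rw [quad_baseMap, quad_baseMap]
  refine Prod.ext (Prod.ext ?_ ?_) (Prod.ext ?_ ?_) <;> exact transferMap_transferMap _ _ _

theorem baseMap_isIso (t : Triangle T B j m₀ m k₀ p₀ q₀ r₀ s₀)
    (t' : Triangle T' B' j' m₀ m' k₀ p₀ q₀ s₀ r₀) (w₀ : E₀ → R) (n : ℤ) :
    IsIso (A := B.complex m (pushWeight j w₀) n) (B := B'.complex m' (pushWeight j' w₀) n)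
      (baseMap t t') := by
  refine ⟨Function.bijective_iff_has_inverse.2
    ⟨baseMap t' t, baseMap_baseMap t t', baseMap_baseMap t' t⟩, ?_, ?_⟩
  · intro i (v : B.Total R m)
    change baseMap t t' v ∈ B'.gr n i ↔ v ∈ B.gr n i
    have h₁ := (transferMap_isIso t.lowLow t'.lowLow w₀ n).mem_iff i (B.quad v).1.1
    have h₂ := (transferMap_isIso t.highLow t'.lowHigh w₀ (n - 1)).mem_iff i (B.quad v).2.1
    have h₃ := (transferMap_isIso t.lowHigh t'.highLow w₀ (n - 1)).mem_iff i (B.quad v).1.2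
    have h₄ := (transferMap_isIso t.highHigh t'.highHigh w₀ (n - 1 - 1)).mem_iff i (B.quad v).2.2
    rw [quad_mem_iff, quad_mem_iff, quad_baseMap]
    refine Iff.trans (and_congr (and_congr h₁ h₂) (and_congr h₃ h₄)) ?_
    exact and_and_and_comm
  · intro (v : B.Total R m)
    change baseMap t t' (B.differential _ v) = B'.differential _ (baseMap t t' v)
    have h₁ : ∀ a, transferMap t.lowLow t'.lowLow (B.low.low.differential (pushWeight j w₀) a) =
        B'.low.low.differential (pushWeight j' w₀) (transferMap t.lowLow t'.lowLow a) :=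
      (transferMap_isIso t.lowLow t'.lowLow w₀ 0).chain
    have h₂ : ∀ a, transferMap t.highLow t'.lowHigh
        (B.high.low.differential (pushWeight j w₀) a) =
        B'.low.high.differential (pushWeight j' w₀) (transferMap t.highLow t'.lowHigh a) :=
      (transferMap_isIso t.highLow t'.lowHigh w₀ 0).chain
    have h₃ : ∀ a, transferMap t.lowHigh t'.highLow
        (B.low.high.differential (pushWeight j w₀) a) =
        B'.high.low.differential (pushWeight j' w₀) (transferMap t.lowHigh t'.highLow a) :=
      (transferMap_isIso t.lowHigh t'.highLow w₀ 0).chain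
    have h₄ : ∀ a, transferMap t.highHigh t'.highHigh
        (B.high.high.differential (pushWeight j w₀) a) =
        B'.high.high.differential (pushWeight j' w₀) (transferMap t.highHigh t'.highHigh a) :=
      (transferMap_isIso t.highHigh t'.highHigh w₀ 0).chain
    apply B'.quad.injective
    rw [quad_differential, quad_baseMap, quad_differential, quad_baseMap]
    refine Prod.ext (Prod.ext ?_ ?_) (Prod.ext ?_ ?_) <;> dsimp only
    · exact h₁ _
    · rw [map_add, h₂, transferMap_surgeryMap t.lowLow t'.lowLow _ _ B.adjacent_low_high.low
        B'.low.adjacent_low_high]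
    · rw [map_add, h₃, transferMap_surgeryMap t.lowLow t'.lowLow _ _ B.low.adjacent_low_high
        B'.adjacent_low_high.low]
    · rw [map_add, map_add, h₄, transferMap_surgeryMap t.lowHigh t'.highLow _ _
        B.adjacent_low_high.high B'.high.adjacent_low_high,
        transferMap_surgeryMap t.highLow t'.lowHigh _ _
        B.high.adjacent_low_high B'.adjacent_low_high.high, add_left_comm]

/-- In terms of the edges outside the triangle, the detour through the resolution splitting off the
triangle is a surgery map. -/
theorem surgeryMap_birthMap (t : Triangle T B j m₀ m k₀ p₀ q₀ r₀ s₀)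
    (t' : Triangle T' B' j' m₀ m' k₀ p₀ q₀ s₀ r₀) (hTB' : Adjacent T' B')
    (v : T.high.low.Total R m) :
    transferMap t.lowHigh t'.highLow (surgeryMap T.low.high B.low.high
      (birthMap t.isolates t.merge (surgeryMap T.high.low T.high.high v))) =
    surgeryMap T'.high.low B'.high.low (transferMap t.core t'.core v) := by
  funext S
  obtain ⟨p, q, hs⟩ := T.high.adjacent_low_high.surgery
  obtain ⟨p', q', hs'⟩ := hTB'.high.low.surgery
  obtain ⟨y, hy⟩ := (mapEquiv (t.core S)).surjective (v S)
  change transfer (t.lowHigh S) (t'.highLow S) (CircleAlgebra.surgery _ _ m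
    ((t.isolates S).birth (t.merge S) (CircleAlgebra.surgery _ _ m (v S)))) =
    CircleAlgebra.surgery _ _ m' (transfer (t.core S) (t'.core S) (v S))
  rw [← hy, surgery_mapEquiv (hs S) (t.core S)
    ((t.isolates S).isCircleEquiv_of_merge (t.merge S)),
    (t.isolates S).surgery_birth_transfer (t.merge S) (t.merge_base S), transfer_mapEquiv,
    transfer_mapEquiv, surgery_mapEquiv (hs' S) (t'.core S) (t'.highLow S)]

theorem surgeryMap_deathMap (t : Triangle T B j m₀ m k₀ p₀ q₀ r₀ s₀)
    (t' : Triangle T' B' j' m₀ m' k₀ p₀ q₀ s₀ r₀) (hTB' : Adjacent B' T')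
    (v : B.low.high.Total R m) :
    transferMap t.core t'.core (surgeryMap T.low.low T.high.low
      (deathMap t.isolates t.merge' (surgeryMap B.low.high T.low.high v))) =
    surgeryMap B'.high.low T'.high.low (transferMap t.lowHigh t'.highLow v) := by
  funext S
  obtain ⟨p, q, hs⟩ := T.adjacent_low_high.low.surgery
  obtain ⟨p', q', hs'⟩ := hTB'.high.low.surgery
  obtain ⟨y, hy⟩ := (mapEquiv (t.lowHigh S)).surjective (v S)
  change transfer (t.core S) (t'.core S) (CircleAlgebra.surgery _ _ m
    ((t.isolates S).death (t.merge' S) (CircleAlgebra.surgery _ _ m (v S)))) =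
    CircleAlgebra.surgery _ _ m' (transfer (t.lowHigh S) (t'.highLow S) (v S))
  rw [← hy, (t.isolates S).death_surgery_transfer (t.merge' S) (t.merge_base S),
    surgery_mapEquiv (hs S) ((t.isolates S).isCircleEquiv_of_merge (t.merge' S)) (t.core S),
    transfer_mapEquiv, transfer_mapEquiv, surgery_mapEquiv (hs' S) (t'.highLow S) (t'.core S)]

/-- The third Reidemeister move, in the case where the triangle is split off by a resolution in which the
last crossing receives the `0`-resolution. -/
theorem hEquiv_of_low {C : SurgeryCube (Option (Option (Option X))) E}
    {C' : SurgeryCube (Option (Option (Option X))) E'}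
    (t : Triangle C.low C.high j m₀ m k₀ p₀ q₀ r₀ s₀)
    (t' : Triangle C'.low C'.high j' m₀ m' k₀ p₀ q₀ s₀ r₀) (w₀ : E₀ → R) (n : ℤ) :
    HEquiv (C.complex m (pushWeight j w₀) n) (C'.complex m' (pushWeight j' w₀) n) := by
  let r := t.retraction w₀ n
  let r' := t'.retraction w₀ n
  have hφ := surgeryMap_isHomogeneous (R := R) (m := m) C.adjacent_low_high (pushWeight j w₀)
    (n := n) (n' := n - 1) (k := 2) (by ring)
  have cφ := surgeryMap_isChainMap (R := R) (m := m) C.adjacent_low_high (pushWeight j w₀) n (n - 1)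
  have hφ' := surgeryMap_isHomogeneous (R := R) (m := m') C'.adjacent_low_high (pushWeight j' w₀)
    (n := n) (n' := n - 1) (k := 2) (by ring)
  have cφ' := surgeryMap_isChainMap (R := R) (m := m') C'.adjacent_low_high (pushWeight j' w₀)
    n (n - 1)
  refine (C.split_isIso _ n).hEquiv.trans (HEquiv.trans ?_ (C'.split_isIso _ n).hEquiv.symm)
  refine (cone_retract_source r (hψ := hφ.comp r.incl_mem (by ring)) (cψ := cφ.comp r.incl_d)
    (fun _ => rfl)).trans (HEquiv.trans ?_ (cone_retract_source r'
    (hψ := hφ'.comp r'.incl_mem (by ring)) (cψ := cφ'.comp r'.incl_d) (fun _ => rfl)).symm)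
  refine HEquiv.cone_of_isIso (transferMap_isIso t.core t'.core w₀ (n - 1))
    (baseMap_isIso t t' w₀ (n - 1)) ?_
  intro (k : C.low.high.low.Total R m)
  change baseMap t t' (surgeryMap C.low C.high (quadIncl t.isolates t.merge k)) =
    surgeryMap C'.low C'.high (quadIncl t'.isolates t'.merge (transferMap t.core t'.core k))
  apply C'.high.quad.injective
  rw [quad_baseMap, quad_surgeryMap, quad_surgeryMap, quad_quadIncl, quad_quadIncl]
  refine Prod.ext (Prod.ext ?_ ?_) (Prod.ext ?_ ?_) <;> dsimp only
  · rw [map_zero, map_zero, map_zero]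
  · have key := t'.surgeryMap_birthMap t C.adjacent_low_high (transferMap t.core t'.core k)
    rw [transferMap_transferMap] at key
    rw [← key, transferMap_transferMap]
  · exact t.surgeryMap_birthMap t' C'.adjacent_low_high k
  · rw [map_zero, map_zero, map_zero]

/-- The third Reidemeister move, in the case where the triangle is split off by a resolution in which the
last crossing receives the `1`-resolution. -/
theorem hEquiv_of_high {C : SurgeryCube (Option (Option (Option X))) E}
    {C' : SurgeryCube (Option (Option (Option X))) E'}
    (t : Triangle C.high C.low j m₀ m k₀ p₀ q₀ r₀ s₀)
    (t' : Triangle C'.high C'.low j' m₀ m' k₀ p₀ q₀ s₀ r₀) (w₀ : E₀ → R) (n : ℤ) :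
    HEquiv (C.complex m (pushWeight j w₀) n) (C'.complex m' (pushWeight j' w₀) n) := by
  let r := t.retraction w₀ (n - 1)
  let r' := t'.retraction w₀ (n - 1)
  have hφ := surgeryMap_isHomogeneous (R := R) (m := m) C.adjacent_low_high (pushWeight j w₀)
    (n := n) (n' := n - 1) (k := 2) (by ring)
  have cφ := surgeryMap_isChainMap (R := R) (m := m) C.adjacent_low_high (pushWeight j w₀) n (n - 1)
  have hφ' := surgeryMap_isHomogeneous (R := R) (m := m') C'.adjacent_low_high (pushWeight j' w₀)
    (n := n) (n' := n - 1) (k := 2) (by ring)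
  have cφ' := surgeryMap_isChainMap (R := R) (m := m') C'.adjacent_low_high (pushWeight j' w₀)
    n (n - 1)
  refine (C.split_isIso _ n).hEquiv.trans (HEquiv.trans ?_ (C'.split_isIso _ n).hEquiv.symm)
  refine (cone_retract_target r (hψ := r.proj_mem.comp hφ (by ring)) (cψ := r.proj_d.comp cφ)
    (fun _ => rfl)).trans (HEquiv.trans ?_ (cone_retract_target r'
    (hψ := r'.proj_mem.comp hφ' (by ring)) (cψ := r'.proj_d.comp cφ') (fun _ => rfl)).symm)
  refine HEquiv.cone_of_isIso (baseMap_isIso t t' w₀ n)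
    (transferMap_isIso t.core t'.core w₀ (n - 1 - 1)) ?_
  intro (b : C.low.Total R m)
  change transferMap t.core t'.core (quadProj t.isolates t.merge' (surgeryMap C.low C.high b)) =
    quadProj t'.isolates t'.merge' (surgeryMap C'.low C'.high (baseMap t t' b))
  rw [quadProj_apply, quadProj_apply, quad_surgeryMap, quad_surgeryMap, quad_baseMap]
  dsimp only
  rw [map_add, add_comm]
  refine congrArg₂ (· + ·) (t.surgeryMap_deathMap t' C'.adjacent_low_high _) ?_
  have key := t'.surgeryMap_deathMap t C.adjacent_low_high
    (transferMap t.highLow t'.lowHigh (C.low.quad b).2.1)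
  rw [transferMap_transferMap] at key
  rw [← key, transferMap_transferMap]

end Triangle

end SurgeryCube

/-! ### Cycles on the sphere are boundaries -/

noncomputable instance {X P : Type} [Finite X] [Finite P] : Fintype (Passage X P) :=
  Fintype.ofFinite _

theorem Passage.card_eq (X P : Type) [Fintype X] [Fintype P] :
    Fintype.card (Passage X P) = 2 * Fintype.card X + Fintype.card P := by
  let e : Passage X P ≃ (X ⊕ X) ⊕ P :=
    { toFun := fun n => match n with
        | .underpass x => Sum.inl (Sum.inl x)
        | .overpass x => Sum.inl (Sum.inr x)
        | .point a => Sum.inr a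
      invFun := Sum.elim (Sum.elim .underpass .overpass) .point
      left_inv := by rintro (x | x | a) <;> rfl
      right_inv := by rintro ((x | x) | a) <;> rfl }
  rw [Fintype.card_congr e, Fintype.card_sum, Fintype.card_sum, two_mul]

namespace MarkedDiagram

variable (L : MarkedDiagram)

open Passage

/-- The edge arriving at a crossing on the under-strand. -/
abbrev underIn (x : L.Crossing) : L.Edge := L.next.symm (underpass x)

/-- The edge leaving a crossing on the under-strand. -/
abbrev underOut (x : L.Crossing) : L.Edge := underpass x

/-- The edge arriving at a crossing on the over-strand. -/
abbrev overIn (x : L.Crossing) : L.Edge := L.next.symm (overpass x)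

/-- The edge leaving a crossing on the over-strand. -/
abbrev overOut (x : L.Crossing) : L.Edge := overpass x

/-- The vertex at which an edge starts. -/
def source : L.Edge → L.Crossing ⊕ L.Point
  | underpass x => Sum.inl x
  | overpass x => Sum.inl x
  | point a => Sum.inr a

/-- The boundary of a chain of edges modulo `2`. -/
noncomputable def boundary : (L.Edge → ZMod 2) →ₗ[ZMod 2] (L.Crossing ⊕ L.Point → ZMod 2) where
  toFun z := Sum.elim
    (fun x => (z (L.underIn x) + z (L.underOut x)) + (z (L.overIn x) + z (L.overOut x)))
    (fun a => z (L.next.symm (point a)) + z (point a))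
  map_add' z z' := by
    funext v
    rcases v with x | a <;> simp only [Sum.elim_inl, Sum.elim_inr, Pi.add_apply] <;> abel
  map_smul' t z := by
    funext v
    rcases v with x | a <;>
      simp only [Sum.elim_inl, Sum.elim_inr, Pi.smul_apply, smul_eq_mul, RingHom.id_apply] <;> ring

theorem boundary_inl (z : L.Edge → ZMod 2) (x : L.Crossing) : L.boundary z (Sum.inl x) =
    (z (L.underIn x) + z (L.underOut x)) + (z (L.overIn x) + z (L.overOut x)) := rfl

theorem boundary_inr (z : L.Edge → ZMod 2) (a : L.Point) : L.boundary z (Sum.inr a) =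
    z (L.next.symm (point a)) + z (point a) := rfl

/-- The difference modulo `2` of a function on faces across the edges. -/
noncomputable def coboundary : (L.Face → ZMod 2) →ₗ[ZMod 2] (L.Edge → ZMod 2) where
  toFun χ e := χ (L.left e) + χ (L.right e)
  map_add' χ χ' := by funext e; simp only [Pi.add_apply]; abel
  map_smul' t χ := by funext e; simp [mul_add]

theorem zmod_two_add_self (a : ZMod 2) : a + a = 0 := CharTwo.add_self_eq_zero a

theorem boundary_coboundary (χ : L.Face → ZMod 2) : L.boundary (L.coboundary χ) = 0 := by
  funext v
  rcases v with x | a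
  · change (χ _ + χ _) + (χ _ + χ _) + ((χ _ + χ _) + (χ _ + χ _)) = (0 : ZMod 2)
    cases hx : L.rightHanded x with
    | true =>
      obtain ⟨h₁, h₂, h₃, h₄⟩ := L.right_handed x hx
      rw [h₁, h₂, h₃, h₄]
      grind [zmod_two_add_self]
    | false =>
      obtain ⟨h₁, h₂, h₃, h₄⟩ := L.left_handed x hx
      rw [h₁, h₂, h₃, h₄]
      grind [zmod_two_add_self]
  · change (χ _ + χ _) + (χ _ + χ _) = (0 : ZMod 2)
    rw [L.left_point, L.right_point]
    exact zmod_two_add_self _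

open Classical in
theorem boundary_single (e : L.Edge) : L.boundary (Pi.single e 1) =
    Pi.single (L.source e) 1 + Pi.single (L.source (L.next e)) 1 := by
  have h : ∀ n n' : L.Edge, (Pi.single e (1 : ZMod 2) : L.Edge → ZMod 2) (L.next.symm n) =
      (Pi.single (L.next e) 1 : L.Edge → ZMod 2) n := by
    intro n _
    by_cases hn : n = L.next e
    · subst hn; simp
    · rw [Pi.single_eq_of_ne hn, Pi.single_eq_of_ne]
      rintro rfl; simp at hn
  have key : ∀ (e : L.Edge) (v : L.Crossing ⊕ L.Point), (Pi.single (L.source e) 1 : _ → ZMod 2) v =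
      Sum.elim (fun x => (Pi.single e (1 : ZMod 2) : L.Edge → ZMod 2) (underpass x) +
        (Pi.single e (1 : ZMod 2) : L.Edge → ZMod 2) (overpass x))
        (fun a => (Pi.single e (1 : ZMod 2) : L.Edge → ZMod 2) (point a)) v := by
    intro e v
    rcases v with x | a <;> rcases e with y | y | b <;> simp [source, Pi.single_apply]
  funext v
  rw [Pi.add_apply, key, key]
  rcases v with x | a
  · rw [boundary_inl, h _ (underpass x), h _ (underpass x)]
    simp only [Sum.elim_inl]
    abel
  · rw [boundary_inr, h _ (point a), add_comm]
    rfl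

theorem single_source_add_mem {e e' : L.Edge} (h : Relation.EqvGen (Linked L.next) e e') :
    open Classical in
    (Pi.single (L.source e) 1 + Pi.single (L.source e') 1 : _ → ZMod 2) ∈
      LinearMap.range L.boundary := by
  classical
  induction h with
  | rel e e' h =>
    cases h with
    | step => exact ⟨_, L.boundary_single e⟩
    | crossing x =>
      have : (Pi.single (L.source (underpass x)) 1 + Pi.single (L.source (overpass x)) 1 :
          L.Crossing ⊕ L.Point → ZMod 2) = 0 := by
        funext v; exact zmod_two_add_self _
      rw [this]; exact zero_mem _
  | refl e =>
    have : (Pi.single (L.source e) 1 + Pi.single (L.source e) 1 :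
        L.Crossing ⊕ L.Point → ZMod 2) = 0 := by
      funext v; exact zmod_two_add_self _
    rw [this]; exact zero_mem _
  | symm e e' _ ih => rwa [add_comm]
  | trans e e' e'' _ _ ih₁ ih₂ =>
    have := add_mem ih₁ ih₂
    have h2 : (Pi.single (L.source e') 1 + Pi.single (L.source e') 1 :
        L.Crossing ⊕ L.Point → ZMod 2) = 0 := by
      funext v; exact zmod_two_add_self _
    rwa [add_assoc, ← add_assoc (Pi.single (L.source e') 1), h2, zero_add] at this

theorem card_vertices_le : Fintype.card L.Crossing + Fintype.card L.Point ≤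
    Module.finrank (ZMod 2) (LinearMap.range L.boundary) + Nat.card (Quot (Linked L.next)) := by
  classical
  have : Fintype (Quot (Linked L.next)) := Fintype.ofFinite _
  let s : (Quot (Linked L.next) → ZMod 2) →ₗ[ZMod 2] (L.Crossing ⊕ L.Point → ZMod 2) :=
    Fintype.linearCombination (ZMod 2) fun c => Pi.single (L.source c.out) 1
  have htop : LinearMap.range L.boundary ⊔ LinearMap.range s = ⊤ := by
    rw [eq_top_iff, ← (Pi.basisFun (ZMod 2) (L.Crossing ⊕ L.Point)).span_eq, Submodule.span_le]
    rintro _ ⟨v, rfl⟩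
    obtain ⟨e, rfl⟩ : ∃ e, L.source e = v := by
      rcases v with x | a
      exacts [⟨underpass x, rfl⟩, ⟨point a, rfl⟩]
    rw [Pi.basisFun_apply]
    have h₁ := L.single_source_add_mem (Quot.eqvGen_exact (Quot.out_eq (Quot.mk (Linked L.next) e)))
    have h₂ : s (Pi.single (Quot.mk _ e) 1) = Pi.single (L.source (Quot.mk (Linked L.next) e).out) 1 := by
      rw [Fintype.linearCombination_apply_single, one_smul]
    have h₃ := Submodule.add_mem_sup h₁ (LinearMap.mem_range_self s (Pi.single (Quot.mk _ e) 1))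
    rw [h₂, add_comm (Pi.single (L.source (Quot.mk (Linked L.next) e).out) 1), add_assoc] at h₃
    have h4 : (Pi.single (L.source (Quot.mk (Linked L.next) e).out) 1 +
      Pi.single (L.source (Quot.mk (Linked L.next) e).out) 1 :
        L.Crossing ⊕ L.Point → ZMod 2) = 0 := by
      funext v; exact zmod_two_add_self _
    rwa [h4, add_zero] at h₃
  have h₁ := Submodule.finrank_add_le_finrank_add_finrank (LinearMap.range L.boundary)
    (LinearMap.range s)
  rw [htop, finrank_top, Module.finrank_fintype_fun_eq_card, Fintype.card_sum] at h₁
  have h₂ := LinearMap.finrank_range_le s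
  rw [Module.finrank_fintype_fun_eq_card, ← Nat.card_eq_fintype_card] at h₂
  omega

theorem card_faces_le : Fintype.card L.Face ≤
    Module.finrank (ZMod 2) (LinearMap.range L.coboundary) + 1 := by
  have h := LinearMap.finrank_range_add_finrank_ker L.coboundary
  rw [Module.finrank_fintype_fun_eq_card] at h
  have hk : LinearMap.ker L.coboundary ≤ Submodule.span (ZMod 2) {fun _ => 1} := by
    intro χ hχ
    have hχ' : ∀ f g, Relation.EqvGen (fun f g => ∃ e, L.left e = f ∧ L.right e = g) f g →
        χ f = χ g := by
      intro f g hfg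
      induction hfg with
      | rel f g h =>
        obtain ⟨e, rfl, rfl⟩ := h
        exact CharTwo.add_eq_zero.1 (congrFun hχ e)
      | refl => rfl
      | symm _ _ _ ih => exact ih.symm
      | trans _ _ _ _ _ ih₁ ih₂ => exact ih₁.trans ih₂
    refine Submodule.mem_span_singleton.2 ⟨χ (L.left (point L.mark)), ?_⟩
    funext f
    simp [hχ' f (L.left (point L.mark)) (L.connected _ _)]
  have h₂ : Module.finrank (ZMod 2) (LinearMap.ker L.coboundary) ≤ 1 :=
    (Submodule.finrank_mono hk).trans ((finrank_span_le_card _).trans (by simp))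
  omega

/-- On the sphere, every cycle of edges modulo `2` separates the faces into two sets. -/
theorem exists_coboundary {z : L.Edge → ZMod 2} (hz : L.boundary z = 0) :
    ∃ χ : L.Face → ZMod 2, ∀ e, z e = χ (L.left e) + χ (L.right e) := by
  have hle : LinearMap.range L.coboundary ≤ LinearMap.ker L.boundary := by
    rintro _ ⟨χ, rfl⟩
    exact L.boundary_coboundary χ
  have h₁ := LinearMap.finrank_range_add_finrank_ker L.boundary
  rw [Module.finrank_fintype_fun_eq_card, Passage.card_eq] at h₁
  have h₂ := L.card_vertices_le
  have h₃ := L.card_faces_le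
  have h₄ := L.euler
  have heq : LinearMap.range L.coboundary = LinearMap.ker L.boundary :=
    Submodule.eq_of_le_of_finrank_le hle (by omega)
  obtain ⟨χ, hχ⟩ : z ∈ LinearMap.range L.coboundary := heq ▸ hz
  exact ⟨χ, fun e => (congrFun hχ e).symm⟩

/-! ### The checkerboard colouring and the cube of resolutions -/

/-- A colouring of the edges that changes along the link at each crossing and not at the points, such
that the edges leaving a crossing have different colours. Orienting the edges of one colour along the
link and those of the other one against it, one obtains an orientation of all the circles of
all resolutions. -/
structure IsColouring (s : L.Edge → Bool) : Prop where
  overOut : ∀ x, s (L.overOut x) = !s (L.underOut x)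
  underIn : ∀ x, s (L.underIn x) = !s (L.underOut x)
  overIn : ∀ x, s (L.overIn x) = s (L.underOut x)
  point : ∀ a, s (L.next.symm (point a)) = s (point a)

theorem IsColouring.not {s : L.Edge → Bool} (h : L.IsColouring s) :
    L.IsColouring fun e => !s e :=
  ⟨fun x => by rw [h.overOut], fun x => by rw [h.underIn], fun x => by rw [h.overIn],
    fun a => by rw [h.point]⟩

theorem exists_isColouring : ∃ s, L.IsColouring s := by
  obtain ⟨χ, hχ⟩ := L.exists_coboundary (z := fun _ => 1) (by
    funext v
    rcases v with x | a
    · change (1 + 1) + (1 + 1) = (0 : ZMod 2); rfl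
    · change 1 + 1 = (0 : ZMod 2); rfl)
  have hr : ∀ e, decide (χ (L.right e) = 1) = !decide (χ (L.left e) = 1) := by
    intro e
    have := hχ e
    generalize χ (L.right e) = a at *
    generalize χ (L.left e) = b at *
    revert a b; decide
  refine ⟨fun e => decide (χ (L.left e) = 1), fun x => ?_, fun x => ?_, fun x => ?_, fun a => ?_⟩
  · cases hx : L.rightHanded x with
    | true => rw [← hr, ← (L.right_handed x hx).2.1]
    | false => rw [(L.left_handed x hx).1, hr, Bool.not_not]
  · cases hx : L.rightHanded x with
    | true =>
      rw [(L.right_handed x hx).2.2.1, hr, (L.right_handed x hx).1]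
    | false =>
      rw [(L.left_handed x hx).2.2.1, (L.left_handed x hx).1, hr, Bool.not_not]
  · cases hx : L.rightHanded x with
    | true => rw [(L.right_handed x hx).1]
    | false =>
      have h₁ := hr (L.underOut x)
      rw [(L.left_handed x hx).2.1, hr] at h₁
      exact Bool.not_inj h₁
  · exact congrArg (fun f => decide (χ f = 1)) (L.left_point a)

end MarkedDiagram

section SwapCycles

open Equiv Equiv.Perm

variable {α : Type} [DecidableEq α]

/-- A map commuting with two permutations up to cycles preserves cycles. -/
theorem Equiv.Perm.SameCycle.map_of_step {α β : Type} {f : Perm α} {g : Perm β} {ρ : α → β}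
    (h : ∀ a, g.SameCycle (ρ a) (ρ (f a))) {a b : α} (hab : f.SameCycle a b) :
    g.SameCycle (ρ a) (ρ b) := by
  obtain ⟨n, rfl⟩ := hab
  induction n with
  | zero => exact SameCycle.refl _ _
  | succ n ih =>
    refine ih.trans ?_
    rw [add_comm, zpow_add, zpow_one, mul_apply]
    exact h _
  | pred n ih =>
    refine ih.trans ?_
    have := (h ((f ^ (-(n : ℤ) - 1)) a)).symm
    rwa [← mul_apply, ← zpow_one_add, add_sub_cancel] at this

theorem sameCycle_mul_swap_of_not {f : Perm α} [Finite α] {a b : α} (h : ¬ f.SameCycle a b) :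
    (f * swap a b).SameCycle a b := by
  have hab : a ≠ b := fun e => h (e ▸ SameCycle.refl _ _)
  -- The first return of `b` to itself under `f` is where `a` goes under the product.
  have hex : ∃ n, 0 < n ∧ (f ^ n) b = b :=
    ⟨orderOf f, orderOf_pos f, by rw [pow_orderOf_eq_one]; rfl⟩
  classical
  let n := Nat.find hex
  have hn : 0 < n ∧ (f ^ n) b = b := Nat.find_spec hex
  have key : ∀ i, i < n → ((f * swap a b) ^ (i + 1)) a = (f ^ (i + 1)) b := by
    intro i
    induction i with
    | zero => intro _; simp [swap_apply_left]
    | succ i ih =>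
      intro hi
      rw [pow_succ', mul_apply, ih (by omega), mul_apply, swap_apply_of_ne_of_ne, pow_succ' f (i + 1),
        mul_apply]
      · intro e
        exact h (SameCycle.symm ⟨((i + 1 : ℕ) : ℤ), by rw [zpow_natCast, e]⟩)
      · intro e
        exact Nat.find_min hex hi ⟨by omega, e⟩
  refine ⟨(n : ℤ), ?_⟩
  have := key (n - 1) (by omega)
  rw [Nat.sub_add_cancel hn.1] at this
  rw [zpow_natCast, this, hn.2]

theorem not_sameCycle_mul_swap {f : Perm α} [Finite α] {a b : α} (hab : a ≠ b)
    (h : f.SameCycle a b) : ¬ (f * swap a b).SameCycle a b := by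
  have hex : ∃ n, 0 < n ∧ (f ^ n) b = a := by
    obtain ⟨i, hi, -, h'⟩ := h.symm.exists_pow_eq''
    exact ⟨i, hi, h'⟩
  classical
  let n := Nat.find hex
  have hn : 0 < n ∧ (f ^ n) b = a := Nat.find_spec hex
  have hmin : ∀ i, 0 < i → i < n → (f ^ i) b ≠ a := fun i h₀ hi e => Nat.find_min hex hi ⟨h₀, e⟩
  have hnb : ∀ i, 0 < i → i ≤ n → (f ^ i) b ≠ b := by
    intro i h₀ hi e
    rcases hi.eq_or_lt with rfl | hi
    · exact hab (hn.2.symm.trans e)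
    · refine hmin (n - i) (by omega) (by omega) ?_
      have := hn.2
      rwa [show n = (n - i) + i by omega, pow_add, mul_apply, e] at this
  -- The iterates of `b` up to the first visit to `a` form a cycle of the product.
  let A : Set α := {c | ∃ i, 0 < i ∧ i ≤ n ∧ (f ^ i) b = c}
  have hA : ∀ c ∈ A, (f * swap a b) c ∈ A := by
    rintro _ ⟨i, h₀, hi, rfl⟩
    rcases hi.eq_or_lt with rfl | hi
    · refine ⟨1, one_pos, hn.1, ?_⟩
      rw [mul_apply, hn.2, swap_apply_left, pow_one]
    · refine ⟨i + 1, by omega, hi, ?_⟩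
      rw [mul_apply, swap_apply_of_ne_of_ne (hmin i h₀ hi) (hnb i h₀ hi.le), pow_succ', mul_apply]
  intro h'
  obtain ⟨i, -, -, h'⟩ := h'.exists_pow_eq''
  have : ∀ k, ((f * swap a b) ^ k) a ∈ A := by
    intro k
    induction k with
    | zero => exact ⟨n, hn.1, le_rfl, hn.2⟩
    | succ k ih => rw [pow_succ', mul_apply]; exact hA _ ih
  obtain ⟨k, h₀, hk, e⟩ := this i
  exact hnb k h₀ hk (e.trans h')

theorem sameCycle_or_of_mul_swap {f : Perm α} {a b c d : α}
    (h : (f * swap a b).SameCycle c d) : f.SameCycle c d ∨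
      (f.SameCycle c a ∧ f.SameCycle b d) ∨ (f.SameCycle c b ∧ f.SameCycle a d) ∨
      (f.SameCycle c a ∧ f.SameCycle a d) := by
  classical
  -- Identify the cycles of `a` and `b`.
  let r : Setoid α :=
    { r := fun c d => f.SameCycle c d ∨ ((f.SameCycle c a ∨ f.SameCycle c b) ∧
        (f.SameCycle d a ∨ f.SameCycle d b))
      iseqv := by
        refine ⟨fun c => Or.inl (SameCycle.refl _ _), ?_, ?_⟩
        · rintro c d (h | ⟨h₁, h₂⟩)
          exacts [Or.inl h.symm, Or.inr ⟨h₂, h₁⟩]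
        · rintro c d e (h | ⟨h₁, h₂⟩) (h' | ⟨h₃, h₄⟩)
          · exact Or.inl (h.trans h')
          · exact Or.inr ⟨h₃.imp h.trans h.trans, h₄⟩
          · exact Or.inr ⟨h₁, h₂.imp h'.symm.trans h'.symm.trans⟩
          · exact Or.inr ⟨h₁, h₄⟩ }
  have hstep : ∀ c, r c ((f * swap a b) c) := by
    intro c
    rw [mul_apply]
    have hf : ∀ e, f.SameCycle (f e) e := fun e => sameCycle_apply_left.2 (SameCycle.refl _ _)
    by_cases ha : c = a
    · subst ha
      rw [swap_apply_left]
      exact Or.inr ⟨Or.inl (SameCycle.refl _ _), Or.inr (hf _)⟩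
    · by_cases hb : c = b
      · subst hb
        rw [swap_apply_right]
        exact Or.inr ⟨Or.inr (SameCycle.refl _ _), Or.inl (hf _)⟩
      · rw [swap_apply_of_ne_of_ne ha hb]
        exact Or.inl (hf _).symm
  have : r c d := by
    obtain ⟨n, rfl⟩ := h
    induction n with
    | zero => exact r.refl c
    | succ n ih =>
      refine r.trans ih ?_
      rw [add_comm, zpow_add, zpow_one, mul_apply]
      exact hstep _
    | pred n ih =>
      refine r.trans ih (r.symm ?_)
      have := hstep (((f * swap a b) ^ (-(n : ℤ) - 1)) c)
      rwa [← mul_apply, ← zpow_one_add, add_sub_cancel] at this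
  rcases this with h | ⟨h₁ | h₁, h₂ | h₂⟩
  · exact Or.inl h
  · exact Or.inl (h₁.trans h₂.symm)
  · exact Or.inr (Or.inl ⟨h₁, h₂.symm⟩)
  · exact Or.inr (Or.inr (Or.inl ⟨h₁, h₂.symm⟩))
  · exact Or.inl (h₁.trans h₂.symm)

/-- Multiplying a permutation by a transposition merges or splits its cycles. -/
theorem merge_of_not_sameCycle {f : Perm α} [Finite α] {a b : α} (h : ¬ f.SameCycle a b) :
    Merge (SameCycle.setoid f) (SameCycle.setoid (f * swap a b)) a b := by
  refine ⟨h, fun c d => ⟨fun h' => ?_, ?_⟩⟩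
  · change (f * swap a b).SameCycle c d at h'
    rcases sameCycle_or_of_mul_swap h' with h' | ⟨h₁, h₂⟩ | ⟨h₁, h₂⟩ | ⟨h₁, h₂⟩
    · exact Or.inl h'
    · exact Or.inr (Or.inl ⟨h₁, h₂.symm⟩)
    · exact Or.inr (Or.inr ⟨h₁, h₂.symm⟩)
    · exact Or.inl (h₁.trans h₂)
  · have hab := sameCycle_mul_swap_of_not h
    have hle : ∀ c d, f.SameCycle c d → (f * swap a b).SameCycle c d := by
      intro c d hcd
      have e : f = (f * swap a b) * swap a b := by rw [mul_assoc, swap_mul_self, mul_one]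
      rw [e] at hcd
      rcases sameCycle_or_of_mul_swap hcd with h' | ⟨h₁, h₂⟩ | ⟨h₁, h₂⟩ | ⟨h₁, h₂⟩
      · exact h'
      · exact h₁.trans (hab.trans h₂)
      · exact h₁.trans (hab.symm.trans h₂)
      · exact h₁.trans h₂
    rintro (h' | ⟨h₁, h₂⟩ | ⟨h₁, h₂⟩)
    · exact hle _ _ h'
    · exact (hle _ _ h₁).trans (hab.trans (hle _ _ h₂).symm)
    · exact (hle _ _ h₁).trans (hab.symm.trans (hle _ _ h₂).symm)

theorem surgery_mul_swap [Finite α] (f : Perm α) {a b : α} (hab : a ≠ b) :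
    Surgery (SameCycle.setoid f) (SameCycle.setoid (f * swap a b)) a b := by
  by_cases h : f.SameCycle a b
  · right
    have := merge_of_not_sameCycle (not_sameCycle_mul_swap hab h)
    rwa [mul_assoc, swap_mul_self, mul_one] at this
  · exact Or.inl (merge_of_not_sameCycle h)

end SwapCycles

namespace MarkedDiagram

variable (L : MarkedDiagram)

open Passage

/-- The equivalence relation whose classes are the circles of a resolution. -/
def circles (S : Finset L.Crossing) : Setoid L.Edge := Relation.EqvGen.setoid (L.Joined S)

theorem circles_iff {S : Finset L.Crossing} {a b : L.Edge} :
    L.circles S a b ↔ L.circleOf S a = L.circleOf S b :=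
  ⟨fun h => Quot.eqvGen_sound h, fun h => Quot.eqvGen_exact h⟩

theorem circles_of_joined {S : Finset L.Crossing} {a b : L.Edge} (h : L.Joined S a b) :
    L.circles S a b := Relation.EqvGen.rel _ _ h

section Travel

open Classical in
/-- The edge by which one leaves a passage when travelling along a circle of the resolution, having
arrived by the edge before the passage (`b = true`) or by the edge after it. -/
noncomputable def turn (S : Finset L.Crossing) (b : Bool) : L.Edge → L.Edge
  | point a => if b = true then point a else L.next.symm (point a)
  | underpass x => if b = true then (if L.OrientedAt S x then L.overOut x else L.overIn x)
      else (if L.OrientedAt S x then L.overIn x else L.overOut x)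
  | overpass x => if b = true then (if L.OrientedAt S x then L.underOut x else L.underIn x)
      else (if L.OrientedAt S x then L.underIn x else L.underOut x)

/-- Travelling one edge further along a circle, in the direction given by a colouring. -/
noncomputable def travelFun (s : L.Edge → Bool) (S : Finset L.Crossing) (e : L.Edge) : L.Edge :=
  L.turn S (s e) (if s e = true then L.next e else e)

variable {L}

theorem travelFun_travelFun {s : L.Edge → Bool} (h : L.IsColouring s) (S : Finset L.Crossing)
    (e : L.Edge) : L.travelFun (fun e => !s e) S (L.travelFun s S e) = e := by
  have h₁ := h.overOut
  have h₂ := h.underIn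
  have h₃ := h.overIn
  have h₄ := h.point
  simp only [underIn, overIn, underOut, overOut] at h₁ h₂ h₃
  cases hs : s e with
  | true =>
    have key : ∀ n, e = L.next.symm n → L.travelFun (fun e => !s e) S (L.turn S true n) = e := by
      rintro n rfl
      rcases n with x | x | a
      · rw [h₂] at hs
        by_cases hx : L.OrientedAt S x
        · simp_all [travelFun, turn]
        · simp_all [travelFun, turn]
      · rw [h₃] at hs
        by_cases hx : L.OrientedAt S x
        · simp_all [travelFun, turn]
        · simp_all [travelFun, turn]
      · rw [h₄] at hs
        simp_all [travelFun, turn]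
    have := key (L.next e) (by simp)
    rwa [travelFun.eq_def L s, if_pos hs, hs]
  | false =>
    rw [travelFun.eq_def L s, if_neg (by simp [hs]), hs]
    rcases e with x | x | a
    · by_cases hx : L.OrientedAt S x
      · simp_all [travelFun, turn]
      · simp_all [travelFun, turn]
    · rw [h₁] at hs
      by_cases hx : L.OrientedAt S x
      · simp_all [travelFun, turn]
      · simp_all [travelFun, turn]
    · simp_all [travelFun, turn]

/-- The permutation of the edges travelling along the circles of a resolution, in the direction given by
a colouring. -/
noncomputable def travel {s : L.Edge → Bool} (h : L.IsColouring s) (S : Finset L.Crossing) :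
    Equiv.Perm L.Edge where
  toFun := L.travelFun s S
  invFun := L.travelFun (fun e => !s e) S
  left_inv := travelFun_travelFun h S
  right_inv e := by
    have := travelFun_travelFun (h.not L) S e
    simpa using this

theorem travel_apply {s : L.Edge → Bool} (h : L.IsColouring s) (S : Finset L.Crossing)
    (e : L.Edge) : travel h S e = L.travelFun s S e := rfl

theorem circles_turn (S : Finset L.Crossing) (n : L.Edge) :
    L.circles S (L.next.symm n) (L.turn S true n) ∧ L.circles S n (L.turn S false n) := by
  rcases n with x | x | a
  · by_cases hx : L.OrientedAt S x
    · simp only [turn, hx, if_true, Bool.false_eq_true, if_false]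
      exact ⟨L.circles_of_joined (.oriented_under x hx),
        (L.circles S).symm (L.circles_of_joined (.oriented_over x hx))⟩
    · simp only [turn, hx, if_true, Bool.false_eq_true, if_false]
      exact ⟨L.circles_of_joined (.unoriented_in x hx),
        L.circles_of_joined (.unoriented_out x hx)⟩
  · by_cases hx : L.OrientedAt S x
    · simp only [turn, hx, if_true, Bool.false_eq_true, if_false]
      exact ⟨L.circles_of_joined (.oriented_over x hx),
        (L.circles S).symm (L.circles_of_joined (.oriented_under x hx))⟩
    · simp only [turn, hx, if_true, Bool.false_eq_true, if_false]
      exact ⟨(L.circles S).symm (L.circles_of_joined (.unoriented_in x hx)),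
        (L.circles S).symm (L.circles_of_joined (.unoriented_out x hx))⟩
  · simp only [turn, if_true, Bool.false_eq_true, if_false]
    exact ⟨L.circles_of_joined (.point a), (L.circles S).symm (L.circles_of_joined (.point a))⟩

theorem sameCycle_travel_of_joined {s : L.Edge → Bool} (h : L.IsColouring s)
    {S : Finset L.Crossing} {a b : L.Edge} (hab : L.Joined S a b) :
    (travel h S).SameCycle a b := by
  have hin : ∀ n, s (L.next.symm n) = true → travel h S (L.next.symm n) = L.turn S true n := by
    intro n hn
    rw [travel_apply, travelFun, if_pos hn, hn, Equiv.apply_symm_apply]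
  have hout : ∀ n, s n = false → travel h S n = L.turn S false n := by
    intro n hn
    rw [travel_apply, travelFun, if_neg (by simp [hn]), hn]
  have fwd : ∀ a b, travel h S a = b → (travel h S).SameCycle a b := by
    rintro a _ rfl
    exact Equiv.Perm.sameCycle_apply_right.2 (Equiv.Perm.SameCycle.refl _ _)
  have h₁ := h.overOut
  have h₂ := h.underIn
  have h₃ := h.overIn
  have h₄ := h.point
  simp only [underIn, overIn, underOut, overOut] at h₁ h₂ h₃
  cases hab with
  | point a =>
    cases hs : s (point a) with
    | true => exact fwd _ _ (by rw [hin _ (by rw [h₄, hs])]; simp [turn])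
    | false => exact (fwd _ _ (by rw [hout _ hs]; simp [turn])).symm
  | oriented_under x hx =>
    cases hs : s (underpass x) with
    | true => exact (fwd _ _ (by rw [hout _ (by rw [h₁, hs]; rfl)]; simp [turn, hx])).symm
    | false => exact fwd _ _ (by rw [hin _ (by rw [h₂, hs]; rfl)]; simp [turn, hx])
  | oriented_over x hx =>
    cases hs : s (underpass x) with
    | true => exact fwd _ _ (by rw [hin _ (by rw [h₃, hs])]; simp [turn, hx])
    | false => exact (fwd _ _ (by rw [hout _ hs]; simp [turn, hx])).symm
  | unoriented_in x hx =>
    cases hs : s (underpass x) with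
    | true => exact (fwd _ _ (by rw [hin _ (by rw [h₃, hs])]; simp [turn, hx])).symm
    | false => exact fwd _ _ (by rw [hin _ (by rw [h₂, hs]; rfl)]; simp [turn, hx])
  | unoriented_out x hx =>
    cases hs : s (underpass x) with
    | true => exact (fwd _ _ (by rw [hout _ (by rw [h₁, hs]; rfl)]; simp [turn, hx])).symm
    | false => exact fwd _ _ (by rw [hout _ hs]; simp [turn, hx])

theorem circles_eq_sameCycle {s : L.Edge → Bool} (h : L.IsColouring s) (S : Finset L.Crossing) :
    L.circles S = Equiv.Perm.SameCycle.setoid (travel h S) := by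
  refine le_antisymm (Setoid.eqvGen_le fun a b hab => sameCycle_travel_of_joined h hab) ?_
  intro a b hab
  obtain ⟨n, rfl⟩ := hab
  have hstep : ∀ c, L.circles S c (travel h S c) := by
    intro c
    rw [travel_apply, travelFun]
    cases hs : s c with
    | true =>
      rw [if_pos rfl]
      have := (circles_turn S (L.next c)).1
      rwa [Equiv.symm_apply_apply] at this
    | false =>
      rw [if_neg (by simp)]
      exact (circles_turn S c).2
  induction n with
  | zero => exact (L.circles S).refl a
  | succ n ih =>
    refine (L.circles S).trans ih ?_
    rw [add_comm, zpow_add, zpow_one, Equiv.Perm.mul_apply]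
    exact hstep _
  | pred n ih =>
    refine (L.circles S).trans ih ((L.circles S).symm ?_)
    have := hstep ((travel h S ^ (-(n : ℤ) - 1)) a)
    rwa [← Equiv.Perm.mul_apply, ← zpow_one_add, add_sub_cancel] at this

theorem orientedAt_insert_iff {S : Finset L.Crossing} {x : L.Crossing} (hx : x ∉ S) :
    L.OrientedAt (insert x S) x ↔ ¬ L.OrientedAt S x := by
  simp only [OrientedAt, Finset.mem_insert_self, hx]
  cases L.rightHanded x <;> simp

theorem orientedAt_insert_of_ne {S : Finset L.Crossing} {x y : L.Crossing} (hxy : y ≠ x) :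
    L.OrientedAt (insert x S) y ↔ L.OrientedAt S y := by
  simp only [OrientedAt, Finset.mem_insert, hxy, false_or]

open Classical in
theorem travel_insert {s : L.Edge → Bool} (h : L.IsColouring s) {S : Finset L.Crossing}
    {x : L.Crossing} (hx : x ∉ S) (hs : s (L.underOut x) = false) :
    travel h (insert x S) = travel h S * Equiv.swap (L.underIn x) (L.underOut x) := by
  have h₁ := h.overOut x
  have h₂ := h.underIn x
  have h₃ := h.overIn x
  rw [hs] at h₁ h₂ h₃
  ext e
  rw [Equiv.Perm.mul_apply, travel_apply, travel_apply]
  have key : ∀ n : L.Edge, n ≠ underpass x → n ≠ overpass x → ∀ b,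
      L.turn (insert x S) b n = L.turn S b n := by
    intro n hu ho b
    rcases n with y | y | a
    · have : y ≠ x := fun e => hu (by rw [e])
      simp [turn, orientedAt_insert_of_ne this]
    · have : y ≠ x := fun e => ho (by rw [e])
      simp [turn, orientedAt_insert_of_ne this]
    · simp [turn]
  by_cases hin : e = L.underIn x
  · rw [hin, Equiv.swap_apply_left, travelFun, travelFun, hs, h₂]
    simp only [Bool.not_false, if_true, Bool.false_eq_true, if_false, Equiv.apply_symm_apply, turn,
      orientedAt_insert_iff hx, ite_not]
  · by_cases hout : e = L.underOut x
    · rw [hout, Equiv.swap_apply_right, travelFun, travelFun, hs, h₂]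
      simp only [Bool.not_false, if_true, Bool.false_eq_true, if_false, Equiv.apply_symm_apply, turn,
        orientedAt_insert_iff hx, ite_not]
    · rw [Equiv.swap_apply_of_ne_of_ne hin hout, travelFun, travelFun]
      refine key _ ?_ ?_ _
      · split_ifs with hse
        · intro h'; exact hin (L.next.eq_symm_apply.2 h')
        · exact hout
      · split_ifs with hse
        · intro h'
          have : e = L.overIn x := L.next.eq_symm_apply.2 h'
          rw [this, h₃] at hse
          exact absurd hse (by simp)
        · rintro rfl
          exact hse h₁

end Travel

theorem surgery_circles {S : Finset L.Crossing} {x : L.Crossing} (hx : x ∉ S) :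
    Surgery (L.circles S) (L.circles (insert x S)) (L.underIn x) (L.underOut x) := by
  classical
  obtain ⟨s, h, hs⟩ : ∃ s, L.IsColouring s ∧ s (L.underOut x) = false := by
    obtain ⟨s, h⟩ := L.exists_isColouring
    cases hs : s (L.underOut x) with
    | true => exact ⟨_, h.not L, by simp [hs]⟩
    | false => exact ⟨s, h, hs⟩
  rw [circles_eq_sameCycle h, circles_eq_sameCycle h, travel_insert h hx hs]
  refine surgery_mul_swap _ fun e => ?_
  have := h.underIn x
  rw [e, hs] at this
  exact absurd this (by simp)

/-- The cube of resolutions of a link diagram. -/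
def cube : SurgeryCube L.Crossing L.Edge where
  rel := L.circles
  p := L.underIn
  q := L.underOut
  surgery _ _ hx := L.surgery_circles hx

end MarkedDiagram

namespace MarkedDiagram

variable (L : MarkedDiagram)

open Passage

/-! ### The areas of circles as sums of weights of edges -/

open Classical in
/-- The edges of a circle, as a chain modulo `2`. -/
noncomputable def circleChain (S : Finset L.Crossing) (C : L.Circle S) (e : L.Edge) : ZMod 2 :=
  if L.circleOf S e = C then 1 else 0

variable {L}

theorem circleChain_of_joined {S : Finset L.Crossing} (C : L.Circle S) {a b : L.Edge}
    (h : L.Joined S a b) : L.circleChain S C a = L.circleChain S C b := by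
  have : L.circleOf S a = L.circleOf S b := Quot.sound h
  rw [circleChain, circleChain, this]

theorem circleChain_eq_one {S : Finset L.Crossing} {C : L.Circle S} {a : L.Edge}
    (h : L.circleOf S a = C) : L.circleChain S C a = 1 := if_pos h

theorem circleChain_eq_zero {S : Finset L.Crossing} {C : L.Circle S} {a : L.Edge}
    (h : L.circleOf S a ≠ C) : L.circleChain S C a = 0 := if_neg h

theorem boundary_circleChain (S : Finset L.Crossing) (C : L.Circle S) :
    L.boundary (L.circleChain S C) = 0 := by
  funext v
  rcases v with x | a
  · rw [boundary_inl]
    by_cases hx : L.OrientedAt S x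
    · rw [circleChain_of_joined C (.oriented_under x hx), circleChain_of_joined C
        (.oriented_over x hx), Pi.zero_apply]
      grind [zmod_two_add_self]
    · rw [circleChain_of_joined C (.unoriented_in x hx), circleChain_of_joined C
        (.unoriented_out x hx), Pi.zero_apply]
      grind [zmod_two_add_self]
  · rw [boundary_inr, circleChain_of_joined C (.point a)]
    exact zmod_two_add_self _

/-- The circle `C` separates the faces on which `χ` vanishes from the other ones. -/
def Separates (S : Finset L.Crossing) (C : L.Circle S) (χ : L.Face → ZMod 2) : Prop :=
  ∀ e, L.circleChain S C e = χ (L.left e) + χ (L.right e)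

theorem orientedAt_of_right {S : Finset L.Crossing} {x : L.Crossing} (hx : L.rightHanded x = true) :
    L.OrientedAt S x ↔ x ∉ S := by simp [OrientedAt, hx]

theorem orientedAt_of_left {S : Finset L.Crossing} {x : L.Crossing} (hx : L.rightHanded x = false) :
    L.OrientedAt S x ↔ x ∈ S := by simp [OrientedAt, hx]

theorem Separates.of_faceJoined {S : Finset L.Crossing} {C : L.Circle S} {χ : L.Face → ZMod 2}
    (h : Separates S C χ) {f g : L.Face} (hfg : L.FaceJoined S C f g) : χ f = χ g := by
  have z := zmod_two_add_self
  cases hfg with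
  | across e he =>
    have := h e
    rw [circleChain_eq_zero he] at this
    exact CharTwo.add_eq_zero.1 this.symm
  | gap_zero x hx =>
    have e₁ := h (L.underIn x)
    have e₂ := h (L.underOut x)
    have e₃ := h (L.overIn x)
    have e₄ := h (L.overOut x)
    cases hr : L.rightHanded x with
    | true =>
      have ho := (orientedAt_of_right (S := S) hr).2 hx
      have j := circleChain_of_joined C (.oriented_over x ho)
      obtain ⟨h₁, h₂, h₃, h₄⟩ := L.right_handed x hr
      simp only [underIn, overIn, underOut, overOut] at *
      rw [h₁] at e₂
      rw [h₃]
      grind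
    | false =>
      have ho := fun h' => hx ((orientedAt_of_left (S := S) hr).1 h')
      have j := circleChain_of_joined C (.unoriented_out x ho)
      obtain ⟨h₁, h₂, h₃, h₄⟩ := L.left_handed x hr
      simp only [underIn, overIn, underOut, overOut] at *
      rw [h₁] at e₂
      rw [h₃]
      grind
  | gap_one x hx =>
    have e₁ := h (L.underIn x)
    have e₂ := h (L.underOut x)
    have e₃ := h (L.overIn x)
    have e₄ := h (L.overOut x)
    cases hr : L.rightHanded x with
    | true =>
      have ho := fun h' => ((orientedAt_of_right (S := S) hr).1 h') hx
      have j := circleChain_of_joined C (.unoriented_out x ho)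
      obtain ⟨h₁, h₂, h₃, h₄⟩ := L.right_handed x hr
      simp only [underIn, overIn, underOut, overOut] at *
      rw [h₂] at e₂
      rw [h₄]
      grind
    | false =>
      have ho := (orientedAt_of_left (S := S) hr).2 hx
      have j := circleChain_of_joined C (.oriented_over x ho)
      obtain ⟨h₁, h₂, h₃, h₄⟩ := L.left_handed x hr
      simp only [underIn, overIn, underOut, overOut] at *
      rw [h₂] at e₂
      rw [h₄]
      grind

variable (L) in
/-- The faces of a resolution in the complement of a circle. -/
def regions (S : Finset L.Crossing) (C : L.Circle S) : Setoid L.Face :=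
  Relation.EqvGen.setoid (L.FaceJoined S C)

theorem Separates.of_regions {S : Finset L.Crossing} {C : L.Circle S} {χ : L.Face → ZMod 2}
    (h : Separates S C χ) {f g : L.Face} (hfg : L.regions S C f g) : χ f = χ g := by
  induction hfg with
  | rel f g hfg => exact h.of_faceJoined hfg
  | refl => rfl
  | symm _ _ _ ih => exact ih.symm
  | trans _ _ _ _ _ ih₁ ih₂ => exact ih₁.trans ih₂

/-- Consecutive edges of a circle have the same regions on their sides. -/
theorem regions_of_joined {S : Finset L.Crossing} (C : L.Circle S) {a b : L.Edge}
    (h : L.Joined S a b) :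
    (L.regions S C (L.left a) (L.left b) ∧ L.regions S C (L.right a) (L.right b)) ∨
      (L.regions S C (L.left a) (L.right b) ∧ L.regions S C (L.right a) (L.left b)) := by
  have hz : ∀ x, x ∉ S → L.regions S C (L.right (underpass x)) (L.left (L.next.symm (underpass x))) :=
    fun x hx => Relation.EqvGen.rel _ _ (.gap_zero x hx)
  have ho : ∀ x, x ∈ S → L.regions S C (L.left (underpass x)) (L.right (L.next.symm (underpass x))) :=
    fun x hx => Relation.EqvGen.rel _ _ (.gap_one x hx)
  have hrefl := (L.regions S C).refl
  cases h with
  | point a => rw [L.left_point, L.right_point]; exact Or.inl ⟨hrefl _, hrefl _⟩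
  | oriented_under x hx =>
    cases hr : L.rightHanded x with
    | true =>
      obtain ⟨h₁, h₂, h₃, h₄⟩ := L.right_handed x hr
      have := hz x ((orientedAt_of_right hr).1 hx)
      rw [h₂] at this
      exact Or.inl ⟨(L.regions S C).symm this, h₄ ▸ hrefl _⟩
    | false =>
      obtain ⟨h₁, h₂, h₃, h₄⟩ := L.left_handed x hr
      have := ho x ((orientedAt_of_left hr).1 hx)
      rw [h₁] at this
      exact Or.inl ⟨h₃ ▸ hrefl _, (L.regions S C).symm this⟩
  | oriented_over x hx =>
    cases hr : L.rightHanded x with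
    | true =>
      obtain ⟨h₁, h₂, h₃, h₄⟩ := L.right_handed x hr
      have := hz x ((orientedAt_of_right hr).1 hx)
      rw [h₃] at this
      exact Or.inl ⟨h₁ ▸ hrefl _, (L.regions S C).symm this⟩
    | false =>
      obtain ⟨h₁, h₂, h₃, h₄⟩ := L.left_handed x hr
      have := ho x ((orientedAt_of_left hr).1 hx)
      rw [h₄] at this
      exact Or.inl ⟨(L.regions S C).symm this, h₂ ▸ hrefl _⟩
  | unoriented_in x hx =>
    cases hr : L.rightHanded x with
    | true =>
      obtain ⟨h₁, h₂, h₃, h₄⟩ := L.right_handed x hr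
      have := ho x (by by_contra h'; exact hx ((orientedAt_of_right hr).2 h'))
      rw [h₁] at this
      exact Or.inr ⟨h₃ ▸ hrefl _, (L.regions S C).symm this⟩
    | false =>
      obtain ⟨h₁, h₂, h₃, h₄⟩ := L.left_handed x hr
      have := hz x fun h' => hx ((orientedAt_of_left hr).2 h')
      rw [h₂] at this
      exact Or.inr ⟨(L.regions S C).symm this, h₄ ▸ hrefl _⟩
  | unoriented_out x hx =>
    cases hr : L.rightHanded x with
    | true =>
      obtain ⟨h₁, h₂, h₃, h₄⟩ := L.right_handed x hr
      have := ho x (by by_contra h'; exact hx ((orientedAt_of_right hr).2 h'))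
      rw [h₄] at this
      exact Or.inr ⟨this, h₂ ▸ hrefl _⟩
    | false =>
      obtain ⟨h₁, h₂, h₃, h₄⟩ := L.left_handed x hr
      have := hz x fun h' => hx ((orientedAt_of_left hr).2 h')
      rw [h₃] at this
      exact Or.inr ⟨h₁ ▸ hrefl _, this⟩

theorem regions_of_circles {S : Finset L.Crossing} (C : L.Circle S) {a b : L.Edge}
    (h : L.circles S a b) :
    (L.regions S C (L.left a) (L.left b) ∧ L.regions S C (L.right a) (L.right b)) ∨
      (L.regions S C (L.left a) (L.right b) ∧ L.regions S C (L.right a) (L.left b)) := by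
  have t : ∀ {a b c}, L.regions S C a b → L.regions S C b c → L.regions S C a c :=
    fun h₁ h₂ => (L.regions S C).trans h₁ h₂
  have s : ∀ {a b}, L.regions S C a b → L.regions S C b a := fun h => (L.regions S C).symm h
  induction h with
  | rel a b h => exact regions_of_joined C h
  | refl a => exact Or.inl ⟨(L.regions S C).refl _, (L.regions S C).refl _⟩
  | symm a b _ ih =>
    rcases ih with ⟨h₁, h₂⟩ | ⟨h₁, h₂⟩
    · exact Or.inl ⟨s h₁, s h₂⟩
    · exact Or.inr ⟨s h₂, s h₁⟩
  | trans a b c _ _ ih₁ ih₂ =>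
    rcases ih₁ with ⟨h₁, h₂⟩ | ⟨h₁, h₂⟩ <;> rcases ih₂ with ⟨h₃, h₄⟩ | ⟨h₃, h₄⟩
    · exact Or.inl ⟨t h₁ h₃, t h₂ h₄⟩
    · exact Or.inr ⟨t h₁ h₃, t h₂ h₄⟩
    · exact Or.inr ⟨t h₁ h₄, t h₂ h₃⟩
    · exact Or.inl ⟨t h₁ h₄, t h₂ h₃⟩

/-- The complement of a circle has no more than the two regions on the sides of one of its edges. -/
theorem regions_left_or_right {S : Finset L.Crossing} {C : L.Circle S} {e : L.Edge}
    (he : L.circleOf S e = C) (f : L.Face) :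
    L.regions S C f (L.left e) ∨ L.regions S C f (L.right e) := by
  have t : ∀ {a b c}, L.regions S C a b → L.regions S C b c → L.regions S C a c :=
    fun h₁ h₂ => (L.regions S C).trans h₁ h₂
  have s : ∀ {a b}, L.regions S C a b → L.regions S C b a := fun h => (L.regions S C).symm h
  have key : ∀ f g, Relation.EqvGen (fun f g => ∃ e, L.left e = f ∧ L.right e = g) f g →
      ((L.regions S C f (L.left e) ∨ L.regions S C f (L.right e)) ↔
        (L.regions S C g (L.left e) ∨ L.regions S C g (L.right e))) := by
    intro f g h
    induction h with
    | rel f g h =>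
      obtain ⟨e', rfl, rfl⟩ := h
      by_cases he' : L.circleOf S e' = C
      · have := regions_of_circles C ((L.circles_iff).2 (he'.trans he.symm))
        rcases this with ⟨h₁, h₂⟩ | ⟨h₁, h₂⟩
        · exact iff_of_true (Or.inl h₁) (Or.inr h₂)
        · exact iff_of_true (Or.inr h₁) (Or.inl h₂)
      · have : L.regions S C (L.left e') (L.right e') :=
          Relation.EqvGen.rel _ _ (.across e' he')
        exact ⟨fun h => h.imp (t (s this)) (t (s this)), fun h => h.imp (t this) (t this)⟩
    | refl => exact Iff.rfl
    | symm _ _ _ ih => exact ih.symm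
    | trans _ _ _ _ _ ih₁ ih₂ => exact ih₁.trans ih₂
  exact (key f (L.left e) (L.connected _ _)).2 (Or.inl ((L.regions S C).refl _))

theorem Separates.regions_iff {S : Finset L.Crossing} {C : L.Circle S} {χ : L.Face → ZMod 2}
    (h : Separates S C χ) (f g : L.Face) : L.regions S C f g ↔ χ f = χ g := by
  refine ⟨h.of_regions, fun hfg => ?_⟩
  obtain ⟨e, he⟩ : ∃ e, L.circleOf S e = C := Quot.exists_rep C
  have hne : χ (L.left e) ≠ χ (L.right e) := by
    have := h e
    rw [circleChain_eq_one he] at this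
    intro h'
    rw [h', zmod_two_add_self] at this
    exact one_ne_zero this
  have t : ∀ {a b c}, L.regions S C a b → L.regions S C b c → L.regions S C a c :=
    fun h₁ h₂ => (L.regions S C).trans h₁ h₂
  have s : ∀ {a b}, L.regions S C a b → L.regions S C b a := fun h => (L.regions S C).symm h
  rcases regions_left_or_right he f with hf | hf <;> rcases regions_left_or_right he g with hg | hg
  · exact t hf (s hg)
  · exact (hne ((h.of_regions hf).symm.trans (hfg.trans (h.of_regions hg)))).elim
  · exact (hne ((h.of_regions hg).symm.trans (hfg.symm.trans (h.of_regions hf)))).elim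
  · exact t hf (s hg)

variable (L) in
theorem exists_path (f g : L.Face) : ∃ n : L.Edge → ZMod 2, ∀ χ : L.Face → ZMod 2,
    ∑ e, n e * (χ (L.left e) + χ (L.right e)) = χ f + χ g := by
  classical
  induction L.connected f g with
  | rel f g h =>
    obtain ⟨e, rfl, rfl⟩ := h
    refine ⟨Pi.single e 1, fun χ => ?_⟩
    rw [Finset.sum_eq_single e]
    · rw [Pi.single_eq_same, one_mul]
    · intro b _ hb; rw [Pi.single_eq_of_ne hb, zero_mul]
    · simp
  | refl f => exact ⟨0, fun χ => by simp [zmod_two_add_self]⟩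
  | symm f g _ ih =>
    obtain ⟨n, hn⟩ := ih
    exact ⟨n, fun χ => by rw [hn, add_comm]⟩
  | trans f g h _ _ ih₁ ih₂ =>
    obtain ⟨n, hn⟩ := ih₁
    obtain ⟨n', hn'⟩ := ih₂
    refine ⟨n + n', fun χ => ?_⟩
    simp only [Pi.add_apply, add_mul, Finset.sum_add_distrib, hn, hn']
    have := zmod_two_add_self (χ g)
    grind

variable (L) in
/-- For each face, a path in the dual graph to the left face at the marked point, recorded by the number
modulo `2` of its crossings with each edge. -/
noncomputable def path (f : L.Face) : L.Edge → ZMod 2 :=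
  (L.exists_path f (L.left (point L.mark))).choose

theorem sum_path (f : L.Face) (χ : L.Face → ZMod 2) :
    ∑ e, L.path f e * (χ (L.left e) + χ (L.right e)) = χ f + χ (L.left (point L.mark)) :=
  (L.exists_path f (L.left (point L.mark))).choose_spec χ

open Classical in
/-- A face is in the interior of a circle if and only if its path crosses the circle an odd number of
times. -/
theorem sum_path_circle (S : Finset L.Crossing) (C : L.Circle S) (f : L.Face) :
    ∑ e, (if L.circleOf S e = C then L.path f e else 0) = if f ∈ L.interior S C then 1 else 0 := by
  obtain ⟨χ, hχ⟩ := L.exists_coboundary (boundary_circleChain S C)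
  have hs : Separates S C χ := hχ
  have h := sum_path f χ
  have e : ∀ e, (if L.circleOf S e = C then L.path f e else 0) =
      L.path f e * (χ (L.left e) + χ (L.right e)) := by
    intro e
    rw [← hχ, circleChain]
    split_ifs <;> simp
  simp_rw [e]
  rw [h]
  by_cases hf : f ∈ L.interior S C
  · rw [if_pos hf]
    have : χ f ≠ χ (L.left (point L.mark)) := fun h' => hf ((hs.regions_iff _ _).2 h')
    revert this
    generalize χ f = a
    generalize χ (L.left (point L.mark)) = b
    revert a b; decide
  · rw [if_neg hf]
    have : L.regions S C f (L.left (point L.mark)) := not_not.1 hf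
    rw [hs.of_regions this]
    exact zmod_two_add_self _

variable (L) in
/-- The weight of an edge, a formal sum of faces. -/
noncomputable def weight (e : L.Edge) : L.Face →₀ ZMod 2 :=
  ∑ f, Finsupp.single f (L.path f e)

theorem weight_apply (e : L.Edge) (f : L.Face) : L.weight e f = L.path f e := by
  classical
  rw [weight, Finsupp.finsetSum_apply, Finset.sum_eq_single f]
  · rw [Finsupp.single_eq_same]
  · intro b _ hb; rw [Finsupp.single_eq_of_ne (Ne.symm hb)]
  · simp

open Classical in
/-- The formal area of a circle is the sum of the weights of its edges. -/
theorem sum_weight_circle (S : Finset L.Crossing) (C : L.Circle S) :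
    ∑ e, (if L.circleOf S e = C then L.weight e else 0) =
      ∑ f, if f ∈ L.interior S C then Finsupp.single f 1 else 0 := by
  ext f
  have h : ∀ g, (if g ∈ L.interior S C then Finsupp.single g (1 : ZMod 2) else 0) f =
      if g = f then (if f ∈ L.interior S C then 1 else 0) else 0 := by
    intro g
    by_cases hg : g = f
    · subst hg; simp only [if_true]; split_ifs <;> simp
    · rw [if_neg hg]; split_ifs <;> simp [hg]
  rw [Finsupp.finsetSum_apply, Finsupp.finsetSum_apply]
  simp_rw [h]
  rw [Finset.sum_ite_eq' Finset.univ f]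
  simp only [Finset.mem_univ, if_true]
  rw [← sum_path_circle]
  refine Finset.sum_congr rfl fun e _ => ?_
  split_ifs
  · exact weight_apply e f
  · rfl

/-! ### The components of the link -/

variable (L)

/-- The equivalence relation on edges whose classes are the components of the link. -/
def components : Setoid L.Edge := Equiv.Perm.SameCycle.setoid L.next

/-- The components of the link. -/
abbrev Component : Type := Quotient L.components

noncomputable instance : Fintype L.Component := Fintype.ofFinite _

theorem components_next (e : L.Edge) : L.components e (L.next e) :=
  Equiv.Perm.sameCycle_apply_right.2 (Equiv.Perm.SameCycle.refl _ _)

open Classical in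
/-- The sum of the weights over a component. -/
noncomputable def componentSum {M : Type} [AddCommMonoid M] (w : L.Edge → M) (K : L.Component) : M :=
  ∑ e, if Quotient.mk L.components e = K then w e else 0

/-- The sums of the weights over the components of the link are linearly independent: a combination of
components crossing each path an even number of times is a cycle bounding no faces. -/
theorem linearIndependent_componentSum :
    LinearIndependent (ZMod 2) (L.componentSum L.weight) := by
  classical
  rw [Fintype.linearIndependent_iff]
  intro a ha
  let z : L.Edge → ZMod 2 := fun e => a (Quotient.mk L.components e)
  have hz : ∀ e, z (L.next.symm e) = z e := by
    intro e
    have : L.components (L.next.symm e) e := by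
      have := L.components_next (L.next.symm e)
      rwa [Equiv.apply_symm_apply] at this
    exact congrArg a (Quotient.sound this)
  obtain ⟨χ, hχ⟩ := L.exists_coboundary (z := z) (by
    funext v
    rcases v with x | b
    · rw [boundary_inl, hz, hz, zmod_two_add_self, zmod_two_add_self]; rfl
    · rw [boundary_inr, hz, zmod_two_add_self]; rfl)
  have h0 : ∀ f, χ f + χ (L.left (point L.mark)) = 0 := by
    intro f
    rw [← sum_path]
    have h0 := DFunLike.congr_fun ha f
    rw [Finsupp.finsetSum_apply] at h0
    refine Eq.trans ?_ h0
    have e : ∀ K, (a K • L.componentSum L.weight K) f =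
        ∑ e, if Quotient.mk L.components e = K then L.path f e * z e else 0 := by
      intro K
      rw [Finsupp.smul_apply, componentSum, Finsupp.finsetSum_apply, Finset.smul_sum]
      refine Finset.sum_congr rfl fun e _ => ?_
      split_ifs with h
      · rw [weight_apply, smul_eq_mul, mul_comm, ← h]
      · simp
    simp_rw [e]
    rw [Finset.sum_comm]
    refine Finset.sum_congr rfl fun e _ => ?_
    rw [Finset.sum_ite_eq, if_pos (Finset.mem_univ _), hχ]
  intro K
  obtain ⟨e, rfl⟩ := Quotient.exists_rep K
  change z e = 0
  rw [hχ, CharTwo.add_eq_zero.1 (h0 (L.left e)), CharTwo.add_eq_zero.1 (h0 (L.right e))]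
  exact zmod_two_add_self _

end MarkedDiagram

/-! ### Moving weights along the components of the link -/

namespace MarkedDiagram

open Passage DiffModule SurgeryCube

variable (L : MarkedDiagram) {R : Type} [CommRing R] [Algebra (ZMod 2) R]

/-- The complex of the cube of resolutions of a diagram, for given weights on the edges. -/
noncomputable abbrev weightComplex (w : L.Edge → R) : DiffModule R :=
  L.cube.complex (point L.mark) w L.nPlus

variable {L}

open Classical in
theorem weightComplex_next (w : L.Edge → R) (e : L.Edge) (t : R) :
    HEquiv (L.weightComplex w)
      (L.weightComplex (w + (Pi.single e t + Pi.single (L.next e) t))) := by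
  obtain ⟨n, rfl⟩ := L.next.symm.surjective e
  rw [Equiv.apply_symm_apply]
  rcases n with x | x | a
  · exact complex_slide (C := L.cube) w _ x t
  · refine (complex_slide (C := L.cube) w _ x t).trans (complex_congr _ fun S => ?_)
    -- In each resolution the strands at a crossing are joined in pairs.
    rw [weightPoly_add, weightPoly_add, weightPoly_add, weightPoly_add, weightPoly_single,
      weightPoly_single, weightPoly_single, weightPoly_single]
    simp only [map_add, map_smul, CircleAlgebra.mk_X]
    congr 1
    by_cases hx : L.OrientedAt S x
    · have h₁ := CircleAlgebra.x_eq (R := R) (r := L.cube.rel S) (point L.mark)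
        (L.circles_of_joined (.oriented_under x hx))
      have h₂ := CircleAlgebra.x_eq (R := R) (r := L.cube.rel S) (point L.mark)
        (L.circles_of_joined (.oriented_over x hx))
      rw [h₂, ← h₁]
      exact add_comm _ _
    · have h₁ := CircleAlgebra.x_eq (R := R) (r := L.cube.rel S) (point L.mark)
        (L.circles_of_joined (.unoriented_in x hx))
      have h₂ := CircleAlgebra.x_eq (R := R) (r := L.cube.rel S) (point L.mark)
        (L.circles_of_joined (.unoriented_out x hx))
      rw [← h₁, ← h₂]
      rfl
  · exact complex_joined w _ t fun S => L.circles_of_joined (.point a)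

open Classical in
theorem weightComplex_move (w : L.Edge → R) {a b : L.Edge} (h : L.components a b) (t : R) :
    HEquiv (L.weightComplex w) (L.weightComplex (w + (Pi.single a t + Pi.single b t))) := by
  have comb : ∀ {b c : L.Edge},
      HEquiv (L.weightComplex w) (L.weightComplex (w + (Pi.single a t + Pi.single b t))) →
      (∀ w : L.Edge → R, HEquiv (L.weightComplex w)
        (L.weightComplex (w + (Pi.single b t + Pi.single c t)))) →
      HEquiv (L.weightComplex w) (L.weightComplex (w + (Pi.single a t + Pi.single c t))) := by
    intro b c h₁ h₂
    have h₃ := h₁.trans (h₂ _)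
    have e : w + (Pi.single a t + Pi.single b t) + (Pi.single b t + Pi.single c t) =
        w + (Pi.single a t + Pi.single c t) := by
      have : (Pi.single b t + Pi.single b t : L.Edge → R) = 0 := add_self_of_charTwo R _
      calc _ = w + (Pi.single a t + Pi.single c t) + (Pi.single b t + Pi.single b t) := by abel
        _ = _ := by rw [this, add_zero]
    rwa [e] at h₃
  obtain ⟨n, rfl⟩ := h
  induction n with
  | zero =>
    have : (Pi.single a t + Pi.single a t : L.Edge → R) = 0 := add_self_of_charTwo R _
    rw [zpow_zero, Equiv.Perm.one_apply, this, add_zero]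
    exact HEquiv.refl _
  | succ n ih =>
    refine comb ih fun w => ?_
    rw [add_comm (n : ℤ), zpow_add, zpow_one, Equiv.Perm.mul_apply]
    exact weightComplex_next w _ t
  | pred n ih =>
    refine comb ih fun w => ?_
    have := weightComplex_next w ((L.next ^ (-(n : ℤ) - 1)) a) t
    rw [← Equiv.Perm.mul_apply, ← zpow_one_add, add_sub_cancel] at this
    rwa [add_comm (Pi.single ((L.next ^ (-(n : ℤ) - 1)) a) t : L.Edge → R)] at this

/-- The complex depends, up to homotopy equivalence, only on the sums of the weights over the components
of the link. -/
theorem weightComplex_hEquiv {w w' : L.Edge → R}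
    (h : ∀ K, L.componentSum w K = L.componentSum w' K) :
    HEquiv (L.weightComplex w) (L.weightComplex w') := by
  classical
  let rep : L.Edge → L.Edge := fun e => (Quotient.mk L.components e).out
  have hrep : ∀ e, L.components e (rep e) := fun e =>
    L.components.symm (Quotient.mk_out (s := L.components) e)
  have key : ∀ (w : L.Edge → R) (A : Finset L.Edge), HEquiv (L.weightComplex w)
      (L.weightComplex (w + ∑ e ∈ A, (Pi.single e (w e) + Pi.single (rep e) (w e)))) := by
    intro w A
    induction A using Finset.induction_on with
    | empty => rw [Finset.sum_empty, add_zero]; exact HEquiv.refl _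
    | insert e A he ih =>
      rw [Finset.sum_insert he, add_comm (_ + _) (Finset.sum _ _), ← add_assoc]
      exact ih.trans (weightComplex_move _ (hrep e) _)
  have key' : ∀ w : L.Edge → R,
      (w + ∑ e, (Pi.single e (w e) + Pi.single (rep e) (w e)) : L.Edge → R) =
        fun e => if rep e = e then L.componentSum w (Quotient.mk L.components e) else 0 := by
    intro w
    have h₁ : (∑ e, Pi.single e (w e) : L.Edge → R) = w := by
      funext e
      rw [Finset.sum_apply, Finset.sum_eq_single e]
      · rw [Pi.single_eq_same]
      · intro b _ hb; rw [Pi.single_eq_of_ne (Ne.symm hb)]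
      · simp
    rw [Finset.sum_add_distrib, h₁, ← add_assoc, add_self_of_charTwo R w, zero_add]
    funext e
    rw [Finset.sum_apply]
    split_ifs with he
    · rw [componentSum]
      refine Finset.sum_congr rfl fun b _ => ?_
      rw [Pi.single_apply]
      refine if_congr ?_ rfl rfl
      constructor
      · intro hb
        rw [hb]
        exact Quotient.sound (hrep b)
      · intro hb
        rw [← he]
        exact congrArg Quotient.out hb.symm
    · refine Finset.sum_eq_zero fun b _ => Pi.single_eq_of_ne (fun hb => he ?_) _
      rw [hb]
      exact congrArg Quotient.out (Quotient.sound (L.components.symm (hrep b)))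
  have h₁ := key w Finset.univ
  have h₂ := key w' Finset.univ
  rw [key'] at h₁ h₂
  have : (fun e => if rep e = e then L.componentSum w (Quotient.mk L.components e) else 0) =
      fun e => if rep e = e then L.componentSum w' (Quotient.mk L.components e) else 0 := by
    funext e; rw [h]
  rw [this] at h₁
  exact h₁.trans h₂.symm

theorem exists_componentSum_eq (t : L.Component → R) :
    ∃ w : L.Edge → R, ∀ K, L.componentSum w K = t K := by
  classical
  refine ⟨fun e => if (Quotient.mk L.components e).out = e then t (Quotient.mk _ e) else 0,
    fun K => ?_⟩
  rw [componentSum, Finset.sum_eq_single K.out]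
  · rw [if_pos (Quotient.out_eq K), Quotient.out_eq, if_pos rfl]
  · intro b _ hb
    split_ifs with h₁ h₂
    · rw [h₁] at h₂; exact absurd h₂.symm hb
    · rfl
    · rfl
  · simp

/-- Two diagrams have equivalent complexes if their components correspond in such a way that the
complexes are homotopy equivalent for all weights whose sums over corresponding components are
equal. -/
def HasEquivalentComplexes (L L' : MarkedDiagram) : Prop :=
  ∃ σ : L.Component ≃ L'.Component, ∀ (R : Type) [CommRing R] [Algebra (ZMod 2) R]
    (w : L.Edge → R) (w' : L'.Edge → R),
    (∀ K, L.componentSum w K = L'.componentSum w' (σ K)) →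
      HEquiv (L.weightComplex w) (L'.weightComplex w')

theorem HasEquivalentComplexes.refl (L : MarkedDiagram) : HasEquivalentComplexes L L :=
  ⟨Equiv.refl _, fun _ _ _ _ _ h => weightComplex_hEquiv h⟩

theorem HasEquivalentComplexes.symm {L L' : MarkedDiagram} (h : HasEquivalentComplexes L L') :
    HasEquivalentComplexes L' L := by
  obtain ⟨σ, h⟩ := h
  refine ⟨σ.symm, fun R _ _ w w' hw => (h R w' w fun K => ?_).symm⟩
  rw [hw, Equiv.symm_apply_apply]

theorem HasEquivalentComplexes.trans {L L' L'' : MarkedDiagram} (h : HasEquivalentComplexes L L')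
    (h' : HasEquivalentComplexes L' L'') : HasEquivalentComplexes L L'' := by
  obtain ⟨σ, h⟩ := h
  obtain ⟨σ', h'⟩ := h'
  refine ⟨σ.trans σ', fun R _ _ w w'' hw => ?_⟩
  obtain ⟨w', hw'⟩ := exists_componentSum_eq (L := L') fun K => L.componentSum w (σ.symm K)
  refine (h R w w' fun K => ?_).trans (h' R w' w'' fun K => ?_)
  · rw [hw', Equiv.symm_apply_apply]
  · rw [hw', hw, Equiv.trans_apply, Equiv.apply_symm_apply]

/-- It suffices to compare weights pushed forward from a common set of edges that meets all
components. -/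
theorem HasEquivalentComplexes.of_edges {L L' : MarkedDiagram} {E₀ : Type} [Fintype E₀]
    (j : E₀ → L.Edge) (j' : E₀ → L'.Edge)
    (hj : ∀ a b, L.components (j a) (j b) ↔ L'.components (j' a) (j' b))
    (hs : ∀ e, ∃ a, L.components (j a) e) (hs' : ∀ e, ∃ a, L'.components (j' a) e)
    (h : ∀ (R : Type) [CommRing R] [Algebra (ZMod 2) R] (w : E₀ → R),
      HEquiv (L.weightComplex (pushWeight j w)) (L'.weightComplex (pushWeight j' w))) :
    HasEquivalentComplexes L L' := by
  classical
  let r₀ : Setoid E₀ := L.components.comap j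
  have e₁ : Function.Bijective (fun K : Quotient r₀ =>
      (Quotient.map' (s₂ := L.components) j (fun a b hab => hab) K : L.Component)) := by
    constructor
    · rintro ⟨a⟩ ⟨b⟩ hab
      exact Quotient.sound (Quotient.exact hab : L.components (j a) (j b))
    · rintro ⟨e⟩
      obtain ⟨a, ha⟩ := hs e
      exact ⟨Quotient.mk _ a, Quotient.sound ha⟩
  have e₂ : Function.Bijective (fun K : Quotient r₀ =>
      (Quotient.map' (s₂ := L'.components) j' (fun a b hab => (hj a b).1 hab) K : L'.Component)) := by
    constructor
    · rintro ⟨a⟩ ⟨b⟩ hab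
      exact Quotient.sound ((hj a b).2 (Quotient.exact hab : L'.components (j' a) (j' b)))
    · rintro ⟨e⟩
      obtain ⟨a, ha⟩ := hs' e
      exact ⟨Quotient.mk _ a, Quotient.sound ha⟩
  let σ₁ := Equiv.ofBijective _ e₁
  let σ₂ := Equiv.ofBijective _ e₂
  refine ⟨σ₁.symm.trans σ₂, fun R _ _ w w' hw => ?_⟩
  -- Concentrate the weights on one edge of `E₀` for each component.
  let w₀ : E₀ → R := fun a => if (Quotient.mk r₀ a).out = a then
    L.componentSum w (σ₁ (Quotient.mk r₀ a)) else 0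
  have sum : ∀ (M : MarkedDiagram) (k : E₀ → M.Edge) (σ : Quotient r₀ ≃ M.Component)
      (_ : ∀ a, σ (Quotient.mk r₀ a) = Quotient.mk M.components (k a)) (K : Quotient r₀),
      M.componentSum (pushWeight k w₀) (σ K) = L.componentSum w (σ₁ K) := by
    intro M k σ hσ K
    have e : M.componentSum (pushWeight k w₀) (σ K) =
        ∑ a, if Quotient.mk r₀ a = K then w₀ a else 0 := by
      simp only [componentSum, pushWeight]
      have : ∀ e : M.Edge, (if Quotient.mk M.components e = σ K then
          ∑ a, if k a = e then w₀ a else 0 else 0) =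
          ∑ a, if k a = e then (if Quotient.mk r₀ a = K then w₀ a else 0) else 0 := by
        intro e
        split_ifs with he
        · refine Finset.sum_congr rfl fun a _ => ?_
          by_cases hka : k a = e
          · rw [if_pos hka, if_pos hka, if_pos]
            apply σ.injective
            rw [hσ, hka, he]
          · rw [if_neg hka, if_neg hka]
        · refine (Finset.sum_eq_zero fun a _ => ?_).symm
          by_cases hka : k a = e
          · rw [if_pos hka, if_neg]
            intro h'
            apply he
            rw [← hka, ← hσ, h']
          · rw [if_neg hka]
      simp_rw [this]
      rw [Finset.sum_comm]
      simp
    rw [e, Finset.sum_eq_single K.out]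
    · rw [if_pos (Quotient.out_eq K)]
      simp only [w₀, Quotient.out_eq, if_true]
    · intro a _ ha
      split_ifs with h₁
      · simp only [w₀]
        rw [if_neg]
        intro h₂
        exact ha (by rw [← h₁, h₂])
      · rfl
    · simp
  refine (weightComplex_hEquiv fun K => ?_).trans ((h R w₀).trans (weightComplex_hEquiv fun K => ?_))
  · obtain ⟨K, rfl⟩ := σ₁.surjective K
    exact (sum L j σ₁ (fun _ => rfl) K).symm
  · obtain ⟨K, rfl⟩ := σ₂.surjective K
    rw [sum L' j' σ₂ (fun _ => rfl) K, hw, Equiv.trans_apply, Equiv.symm_apply_apply]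

end MarkedDiagram

/-! ### Comparing resolutions before and after a move -/

theorem pushWeight_comp {A B E R : Type} [Fintype A] [Fintype B] [CommRing R] (i : A → B)
    (j : B → E) (w : A → R) : pushWeight j (pushWeight i w) = pushWeight (j ∘ i) w := by
  classical
  funext e
  simp only [pushWeight]
  have : ∀ b, (if j b = e then ∑ a, if i a = b then w a else 0 else 0) =
      ∑ a, if i a = b then (if j (i a) = e then w a else 0) else 0 := by
    intro b
    split_ifs with h
    · refine Finset.sum_congr rfl fun a _ => ?_
      by_cases ha : i a = b
      · rw [if_pos ha, if_pos ha, if_pos (by rw [ha, h])]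
      · rw [if_neg ha, if_neg ha]
    · refine (Finset.sum_eq_zero fun a _ => ?_).symm
      by_cases ha : i a = b
      · rw [if_pos ha, if_neg (by rw [ha]; exact h)]
      · rw [if_neg ha]
  simp_rw [this]
  rw [Finset.sum_comm]
  simp

theorem Merge.swap {E : Type} {r r' : Setoid E} {p q : E} (h : Merge r r' p q) :
    Merge r r' q p :=
  ⟨fun h' => h.1 (r.symm h'), fun a b => by rw [h.2, or_comm (a := r a p ∧ _)]⟩

theorem CircleAlgebra.IsolatesCircle.exists_merge {E E₀ : Type} {r₀ : Setoid E₀} {m₀ : E₀}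
    {r r' : Setoid E} {m : E} {j : E₀ → E} {u p q : E} (h : IsolatesCircle r₀ m₀ r m j u)
    (hs : Surgery r r' p q) (hpq : (r p u ∧ ∃ a, q = j a) ∨ (r q u ∧ ∃ a, p = j a)) :
    ∃ a, Merge r r' u (j a) := by
  rcases hpq with ⟨hp, a, rfl⟩ | ⟨hq, a, rfl⟩
  · have hm := hs.merge fun h' => h.not_rel a (r.trans (r.symm h') hp)
    exact ⟨a, hm.congr (r.symm hp) (r.refl _)⟩
  · have hm := hs.merge fun h' => h.not_rel a (r.trans h' hq)
    exact ⟨a, hm.swap.congr (r.symm hq) (r.refl _)⟩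

theorem Passage.map_injective {X P X' P' : Type} {f : X → X'} {g : P → P'}
    (hf : Function.Injective f) (hg : Function.Injective g) :
    Function.Injective (Passage.map f g) := by
  rintro (x | x | a) (y | y | b) h <;> simp_all [Passage.map] <;>
    first | exact hf h | exact hg h

namespace MarkedDiagram

open Passage DiffModule SurgeryCube CircleAlgebra

variable {L L' : MarkedDiagram}

/-- A union of classes of edges which are all joined to each other is an isolated circle. -/
theorem isolatesCircle_of_closed {S : Finset L.Crossing} (U : Set L.Edge) {u : L.Edge}
    (hU : ∀ a ∈ U, L.circles S a u) (hu : u ∈ U)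
    (hj : ∀ a b, L.Joined S a b → (a ∈ U ↔ b ∈ U)) (hm : point L.mark ∉ U) :
    IsolatesCircle ((L.circles S).comap (Subtype.val : {n // n ∉ U} → L.Edge))
      ⟨point L.mark, hm⟩ (L.circles S) (point L.mark) Subtype.val u := by
  have key : ∀ a b, L.circles S a b → (a ∈ U ↔ b ∈ U) := by
    intro a b h
    induction h with
    | rel a b h => exact hj a b h
    | refl => exact Iff.rfl
    | symm _ _ _ ih => exact ih.symm
    | trans _ _ _ _ _ ih₁ ih₂ => exact ih₁.trans ih₂
  refine ⟨fun a b => Iff.rfl, fun a h => a.2 ((key _ _ h).2 hu), fun e => ?_, (L.circles S).refl _⟩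
  by_cases he : e ∈ U
  · exact Or.inl (hU e he)
  · exact Or.inr ⟨⟨e, he⟩, (L.circles S).refl _⟩

theorem isCircleEquiv_of_retract {S : Finset L.Crossing} {S' : Finset L'.Crossing}
    {fX : L.Crossing → L'.Crossing} {fP : L.Point → L'.Point} (κ : L'.Edge → L.Edge)
    (hS : ∀ x, L'.OrientedAt S' (fX x) ↔ L.OrientedAt S x) (hm : L'.mark = fP L.mark)
    (hκ : ∀ n, κ (Passage.map fX fP n) = n)
    (hκ' : ∀ n, κ (L'.next.symm (Passage.map fX fP n)) = L.next.symm n)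
    (hρ : ∀ e, L'.circles S' (Passage.map fX fP (κ e)) e)
    (hX : ∀ x ∉ Set.range fX, (L'.OrientedAt S' x →
        L.circles S (κ (L'.underIn x)) (κ (L'.overOut x)) ∧
        L.circles S (κ (L'.overIn x)) (κ (L'.underOut x))) ∧
      (¬ L'.OrientedAt S' x →
        L.circles S (κ (L'.underIn x)) (κ (L'.overIn x)) ∧
        L.circles S (κ (L'.underOut x)) (κ (L'.overOut x))))
    (hP : ∀ a ∉ Set.range fP, L.circles S (κ (L'.next.symm (point a))) (κ (point a))) :
    IsCircleEquiv (L.circles S) (point L.mark) (L'.circles S') (point L'.mark)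
      (Passage.map fX fP) := by
  have hin : ∀ n, L'.circles S' (Passage.map fX fP (L.next.symm n))
      (L'.next.symm (Passage.map fX fP n)) := by
    intro n
    have := hρ (L'.next.symm (Passage.map fX fP n))
    rwa [hκ'] at this
  have fwd : ∀ a b, L.circles S a b → L'.circles S' (Passage.map fX fP a) (Passage.map fX fP b) := by
    intro a b h
    induction h with
    | rel a b h =>
      have t : ∀ {a b c}, L'.circles S' a b → L'.circles S' b c → L'.circles S' a c :=
        fun h₁ h₂ => (L'.circles S').trans h₁ h₂
      cases h with
      | point a => exact t (hin _) (L'.circles_of_joined (.point (fP a)))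
      | oriented_under x hx =>
        exact t (hin _) (L'.circles_of_joined (.oriented_under (fX x) ((hS x).2 hx)))
      | oriented_over x hx =>
        exact t (hin _) (L'.circles_of_joined (.oriented_over (fX x) ((hS x).2 hx)))
      | unoriented_in x hx =>
        exact t (hin _) (t (L'.circles_of_joined (.unoriented_in (fX x) fun h => hx ((hS x).1 h)))
          ((L'.circles S').symm (hin _)))
      | unoriented_out x hx =>
        exact L'.circles_of_joined (.unoriented_out (fX x) fun h => hx ((hS x).1 h))
    | refl a => exact (L'.circles S').refl _
    | symm _ _ _ ih => exact (L'.circles S').symm ih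
    | trans _ _ _ _ _ ih₁ ih₂ => exact (L'.circles S').trans ih₁ ih₂
  have bwd : ∀ a b, L'.circles S' a b → L.circles S (κ a) (κ b) := by
    intro a b h
    induction h with
    | rel a b h =>
      cases h with
      | point a =>
        by_cases ha : a ∈ Set.range fP
        · obtain ⟨a, rfl⟩ := ha
          have h₁ := hκ (point a)
          have h₂ := hκ' (point a)
          simp only [Passage.map] at h₁ h₂
          rw [h₁, h₂]
          exact L.circles_of_joined (.point a)
        · exact hP a ha
      | oriented_under x hx =>
        by_cases hr : x ∈ Set.range fX
        · obtain ⟨x, rfl⟩ := hr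
          have h₁ := hκ (overpass x)
          have h₂ := hκ' (underpass x)
          simp only [Passage.map] at h₁ h₂
          rw [h₁, h₂]
          exact L.circles_of_joined (.oriented_under x ((hS x).1 hx))
        · exact ((hX x hr).1 hx).1
      | oriented_over x hx =>
        by_cases hr : x ∈ Set.range fX
        · obtain ⟨x, rfl⟩ := hr
          have h₁ := hκ (underpass x)
          have h₂ := hκ' (overpass x)
          simp only [Passage.map] at h₁ h₂
          rw [h₁, h₂]
          exact L.circles_of_joined (.oriented_over x ((hS x).1 hx))
        · exact ((hX x hr).1 hx).2
      | unoriented_in x hx =>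
        by_cases hr : x ∈ Set.range fX
        · obtain ⟨x, rfl⟩ := hr
          have h₁ := hκ' (overpass x)
          have h₂ := hκ' (underpass x)
          simp only [Passage.map] at h₁ h₂
          rw [h₁, h₂]
          exact L.circles_of_joined (.unoriented_in x fun h => hx ((hS x).2 h))
        · exact ((hX x hr).2 hx).1
      | unoriented_out x hx =>
        by_cases hr : x ∈ Set.range fX
        · obtain ⟨x, rfl⟩ := hr
          have h₁ := hκ (overpass x)
          have h₂ := hκ (underpass x)
          simp only [Passage.map] at h₁ h₂
          rw [h₁, h₂]
          exact L.circles_of_joined (.unoriented_out x fun h => hx ((hS x).2 h))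
        · exact ((hX x hr).2 hx).2
    | refl a => exact (L.circles S).refl _
    | symm _ _ _ ih => exact (L.circles S).symm ih
    | trans _ _ _ _ _ ih₁ ih₂ => exact (L.circles S).trans ih₁ ih₂
  refine ⟨fun a b => ⟨fwd a b, fun h => ?_⟩, fun e => ⟨κ e, hρ e⟩, ?_⟩
  · have := bwd _ _ h
    rwa [hκ, hκ] at this
  · rw [hm]; exact (L'.circles S').refl _

theorem components_of_retract {ρ : L.Edge → L'.Edge} (κ : L'.Edge → L.Edge)
    (hκ : ∀ n, κ (ρ n) = n) (hκ' : ∀ n, κ (L'.next.symm (ρ n)) = L.next.symm n)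
    (hn : ∀ n, n ∈ Set.range ρ ∨ κ (L'.next.symm n) = κ n)
    (hρ : ∀ e, L'.components (ρ (κ e)) e) (a b : L.Edge) :
    L.components a b ↔ L'.components (ρ a) (ρ b) := by
  constructor
  · refine Equiv.Perm.SameCycle.map_of_step fun a => ?_
    have h₁ := hρ (L'.next.symm (ρ (L.next a)))
    rw [hκ', Equiv.symm_apply_apply] at h₁
    refine L'.components.trans h₁ ?_
    have := L'.components_next (L'.next.symm (ρ (L.next a)))
    rwa [Equiv.apply_symm_apply] at this
  · intro h
    have : L.components (κ (ρ a)) (κ (ρ b)) := by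
      refine Equiv.Perm.SameCycle.map_of_step (fun e => ?_) h
      rcases hn (L'.next e) with ⟨n, hn⟩ | hn
      · have h₁ := hκ' n
        rw [hn, Equiv.symm_apply_apply] at h₁
        rw [h₁, ← hn, hκ]
        have := L.components_next (L.next.symm n)
        rwa [Equiv.apply_symm_apply] at this
      · rw [Equiv.symm_apply_apply] at hn
        rw [hn]
    rwa [hκ, hκ] at this

/-- If the complex of `L'` can be reduced to one of a cube with the same circles as `L`, then `L` and
`L'` have equivalent complexes. -/
theorem HasEquivalentComplexes.of_cube {ρ : L.Edge → L'.Edge}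
    (hc : ∀ a b, L.components a b ↔ L'.components (ρ a) (ρ b))
    (hs : ∀ e, ∃ a, L'.components (ρ a) e) (C : SurgeryCube L.Crossing L'.Edge)
    (hC : ∀ S, IsCircleEquiv (L.circles S) (point L.mark) (C.rel S) (point L'.mark) ρ)
    (h : ∀ (R : Type) [CommRing R] [Algebra (ZMod 2) R] (w : L.Edge → R),
      HEquiv (L'.weightComplex (pushWeight ρ w))
        (C.complex (point L'.mark) (pushWeight ρ w) L.nPlus)) :
    HasEquivalentComplexes L L' := by
  refine HasEquivalentComplexes.of_edges id ρ hc (fun e => ⟨e, L.components.refl e⟩) hs ?_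
  intro R _ _ w
  refine HEquiv.trans ?_ (h R w).symm
  exact (transferMap_isIso (C := L.cube) (C' := C) (r₀ := L.circles) (fun S =>
    ⟨fun a b => Iff.rfl, fun e => ⟨e, (L.circles S).refl e⟩, (L.circles S).refl _⟩) hC w _).hEquiv

theorem nPlus_eq_sum (L : MarkedDiagram) :
    L.nPlus = ∑ x, if L.rightHanded x = true then 1 else 0 := by
  rw [nPlus, Finset.card_filter]

/-! ### Isotopies and auxiliary points -/

theorem IsIsotopic.hasEquivalentComplexes (h : L.IsIsotopic L') : HasEquivalentComplexes L L' := by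
  obtain ⟨eX, eP, eF, hr, hm, hn, -, -⟩ := h
  set ρ : L.Edge → L'.Edge := Passage.map eX eP with hρ
  let κ : L'.Edge → L.Edge := Passage.map eX.symm eP.symm
  have hκ : ∀ n, κ (ρ n) = n := by
    rintro (x | x | a) <;> simp [κ, ρ, Passage.map]
  have hκρ : ∀ n, ρ (κ n) = n := by
    rintro (x | x | a) <;> simp [κ, ρ, Passage.map]
  have hκ' : ∀ n, κ (L'.next.symm (ρ n)) = L.next.symm n := by
    intro n
    have := hn (L.next.symm n)
    rw [Equiv.apply_symm_apply] at this
    rw [← this, Equiv.symm_apply_apply, hκ]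
  refine HasEquivalentComplexes.of_cube (ρ := ρ) (components_of_retract κ hκ hκ'
    (fun n => Or.inl ⟨κ n, hκρ n⟩) fun e => by rw [hκρ])
    (fun e => ⟨κ e, by rw [hκρ]⟩) (L'.cube.relabel eX) (fun S => ?_) ?_
  · refine isCircleEquiv_of_retract (S' := S.map eX.toEmbedding) κ (fun x => ?_) hm hκ hκ'
      (fun e => by rw [← hρ, hκρ]) (fun x hx => (hx ⟨_, eX.apply_symm_apply x⟩).elim)
      (fun a ha => (ha ⟨_, eP.apply_symm_apply a⟩).elim)
    simp [OrientedAt, hr]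
  · intro R _ _ w
    refine (relabelMap_isIso L'.cube eX _ _).hEquiv.trans (complex_cast ?_)
    rw [nPlus_eq_sum, nPlus_eq_sum, ← Equiv.sum_comp eX]
    simp_rw [hr]

theorem IsSubdivision.hasEquivalentComplexes (h : L.IsSubdivision L') :
    HasEquivalentComplexes L L' := by
  classical
  obtain ⟨eX, eP, eF, e, hr, hm, h₁, h₂, hn, -, -⟩ := h
  set ρ : L.Edge → L'.Edge := Passage.map eX (fun a => eP (some a)) with hρ
  have hinj : Function.Injective ρ :=
    Passage.map_injective eX.injective fun a b h => Option.some_injective _ (eP.injective h)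
  let κ : L'.Edge → L.Edge := Function.extend ρ id fun _ => e
  have hκ : ∀ n, κ (ρ n) = n := fun n => hinj.extend_apply _ _ n
  have hcases : ∀ n, n ∈ Set.range ρ ∨ n = point (eP none) := by
    rintro (x | x | a)
    · exact Or.inl ⟨underpass (eX.symm x), by simp [ρ, Passage.map]⟩
    · exact Or.inl ⟨overpass (eX.symm x), by simp [ρ, Passage.map]⟩
    · cases ha : eP.symm a with
      | none => exact Or.inr (by rw [← ha, Equiv.apply_symm_apply])
      | some b => exact Or.inl ⟨point b, by simp [ρ, Passage.map, ← ha]⟩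
  have hnew : (point (eP none) : L'.Edge) ∉ Set.range ρ := by
    rintro ⟨(x | x | a), h⟩ <;> simp [ρ, Passage.map] at h
  have hκnew : κ (point (eP none)) = e := Function.extend_apply' _ _ _ hnew
  have hin : L'.next.symm (point (eP none)) = ρ e := by rw [← h₁, Equiv.symm_apply_apply]
  have hκ' : ∀ n, κ (L'.next.symm (ρ n)) = L.next.symm n := by
    intro n
    obtain ⟨n, rfl⟩ := L.next.surjective n
    rw [Equiv.symm_apply_apply]
    by_cases hne : n = e
    · rw [hne, ← h₂, Equiv.symm_apply_apply, hκnew]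
    · rw [← hn n hne, Equiv.symm_apply_apply, hκ]
  have hstep : κ (L'.next.symm (point (eP none))) = κ (point (eP none)) := by
    rw [hin, hκ, hκnew]
  refine HasEquivalentComplexes.of_cube (ρ := ρ) (components_of_retract κ hκ hκ'
    (fun n => (hcases n).imp_right fun hn => by rw [hn, hstep]) ?_) ?_ (L'.cube.relabel eX)
    (fun S => ?_) ?_
  · intro n
    rcases hcases n with ⟨n, rfl⟩ | rfl
    · rw [hκ]
    · rw [hκnew, ← h₁]; exact L'.components_next _
  · intro n
    rcases hcases n with ⟨n, rfl⟩ | rfl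
    · exact ⟨n, L'.components.refl _⟩
    · exact ⟨e, h₁ ▸ L'.components_next _⟩
  · refine isCircleEquiv_of_retract (S' := S.map eX.toEmbedding) κ (fun x => ?_) hm hκ hκ'
      (fun n => ?_) (fun x hx => (hx ⟨_, eX.apply_symm_apply x⟩).elim) (fun a ha => ?_)
    · simp [OrientedAt, hr]
    · rcases hcases n with ⟨n, rfl⟩ | rfl
      · rw [hκ]
      · have := L'.circles_of_joined (Joined.point (S := S.map eX.toEmbedding) (eP none))
        rwa [hin, ← hκnew] at this
    · rcases hcases (point a) with ⟨(x | x | b), hb⟩ | hb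
      · simp [ρ, Passage.map] at hb
      · simp [ρ, Passage.map] at hb
      · refine (ha ⟨b, ?_⟩).elim
        simpa [ρ, Passage.map] using hb
      · rw [hb, hstep]
  · intro R _ _ w
    refine (relabelMap_isIso L'.cube eX _ _).hEquiv.trans (complex_cast ?_)
    rw [nPlus_eq_sum, nPlus_eq_sum, ← Equiv.sum_comp eX]
    simp_rw [hr]

end MarkedDiagram

/-! ### The first Reidemeister move for link diagrams -/

theorem SurgeryCube.surgery_low_high {X E : Type} [DecidableEq X] [Fintype X]
    (C : SurgeryCube (Option X) E) (S : Finset X) :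
    Surgery (C.low.rel S) (C.high.rel S) (C.p none) (C.q none) := by
  have := C.surgery (S.map Function.Embedding.some) none (by simp)
  rwa [insert_none_map_some] at this

namespace MarkedDiagram

open Passage DiffModule SurgeryCube CircleAlgebra

variable {L L' : MarkedDiagram}

/-- A set of edges closed under the gluings at the points and at the crossings in the image of `fX`
is closed under gluing if it is so at the other crossings. -/
theorem joined_mem_iff {S : Finset L.Crossing} (U : Set L.Edge)
    (hP : ∀ a, L.next.symm (point a) ∈ U ↔ point a ∈ U)
    (hX : ∀ x, (L.underIn x ∉ U ∧ L.overIn x ∉ U ∧ L.underOut x ∉ U ∧ L.overOut x ∉ U) ∨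
      (L.OrientedAt S x → ((L.underIn x ∈ U ↔ L.overOut x ∈ U) ∧
        (L.overIn x ∈ U ↔ L.underOut x ∈ U))) ∧
      (¬ L.OrientedAt S x → ((L.underIn x ∈ U ↔ L.overIn x ∈ U) ∧
        (L.underOut x ∈ U ↔ L.overOut x ∈ U))))
    (a b : L.Edge) (h : L.Joined S a b) : a ∈ U ↔ b ∈ U := by
  cases h with
  | point a => exact hP a
  | oriented_under x hx =>
    rcases hX x with h | h
    · exact iff_of_false h.1 h.2.2.2
    · exact (h.1 hx).1
  | oriented_over x hx =>
    rcases hX x with h | h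
    · exact iff_of_false h.2.1 h.2.2.1
    · exact (h.1 hx).2
  | unoriented_in x hx =>
    rcases hX x with h | h
    · exact iff_of_false h.1 h.2.1
    · exact (h.2 hx).1
  | unoriented_out x hx =>
    rcases hX x with h | h
    · exact iff_of_false h.2.2.1 h.2.2.2
    · exact (h.2 hx).2

theorem IsReidemeisterI.hasEquivalentComplexes (h : L.IsReidemeisterI L') :
    HasEquivalentComplexes L L' := by
  classical
  obtain ⟨eX, eP, eF, e, o, hr, hm, h₁, h₂, h₃, hn, -, -, -, -⟩ := h
  set ρ : L.Edge → L'.Edge := Passage.map (fun x => eX (some x)) eP with hρ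
  set c : L'.Crossing := eX none with hc
  set u : L'.Edge := strand o c with hu
  set v : L'.Edge := strand (!o) c with hv
  have hinj : Function.Injective ρ :=
    Passage.map_injective (fun x y h => Option.some_injective _ (eX.injective h)) eP.injective
  let κ : L'.Edge → L.Edge := Function.extend ρ id fun _ => e
  have hκ : ∀ n, κ (ρ n) = n := fun n => hinj.extend_apply _ _ n
  have hX : ∀ x : L'.Crossing, x = c ∨ ∃ y, eX (some y) = x := by
    intro x
    obtain ⟨_ | y, rfl⟩ := eX.surjective x
    exacts [Or.inl rfl, Or.inr ⟨y, rfl⟩]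
  have hcases : ∀ n, n ∈ Set.range ρ ∨ n = u ∨ n = v := by
    rintro (x | x | a)
    · rcases hX x with rfl | ⟨y, rfl⟩
      · cases o <;> simp [hu, hv, strand]
      · exact Or.inl ⟨underpass y, rfl⟩
    · rcases hX x with rfl | ⟨y, rfl⟩
      · cases o <;> simp [hu, hv, strand]
      · exact Or.inl ⟨overpass y, rfl⟩
    · exact Or.inl ⟨point (eP.symm a), by simp [ρ, Passage.map]⟩
  have hnew : ∀ o n, ρ n ≠ strand o c := by
    rintro (_ | _) (x | x | a) <;> simp [ρ, Passage.map, strand, hc]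
  have hu' : u ∉ Set.range ρ := fun ⟨n, h⟩ => hnew _ n h
  have hv' : v ∉ Set.range ρ := fun ⟨n, h⟩ => hnew _ n h
  have huv : v ≠ u := by cases o <;> simp [hu, hv, strand]
  have hκu : κ u = e := Function.extend_apply' _ _ _ hu'
  have hκv : κ v = e := Function.extend_apply' _ _ _ hv'
  have h₁' : L'.next.symm u = ρ e := by rw [← h₁, Equiv.symm_apply_apply]
  have h₂' : L'.next.symm v = u := by rw [← h₂, Equiv.symm_apply_apply]
  have hin : ∀ n, L'.next.symm (ρ n) = v ∨ L'.next.symm (ρ n) ∈ Set.range ρ := by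
    intro n
    obtain ⟨n, rfl⟩ := L.next.surjective n
    by_cases hne : n = e
    · rw [hne, ← h₃, Equiv.symm_apply_apply]; exact Or.inl rfl
    · rw [← hn n hne, Equiv.symm_apply_apply]; exact Or.inr ⟨_, rfl⟩
  have hκ' : ∀ n, κ (L'.next.symm (ρ n)) = L.next.symm n := by
    intro n
    obtain ⟨n, rfl⟩ := L.next.surjective n
    rw [Equiv.symm_apply_apply]
    by_cases hne : n = e
    · rw [hne, ← h₃, Equiv.symm_apply_apply, hκv]
    · rw [← hn n hne, Equiv.symm_apply_apply, hκ]
  have hU : ∀ n, ρ n ∉ ({u} : Set L'.Edge) := fun n h => hnew _ n h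
  have hinU : ∀ n, L'.next.symm (ρ n) ∉ ({u} : Set L'.Edge) := by
    intro n h
    rcases hin n with h' | h'
    · exact huv (h'.symm.trans h)
    · exact hu' (h ▸ h')
  have hvU : v ∉ ({u} : Set L'.Edge) := huv
  have hmU : point L'.mark ∉ ({u} : Set L'.Edge) := by rw [hm]; exact hU (point L.mark)
  -- The resolution of the new crossing compatible with the orientation splits off the curl.
  have hiso : ∀ S' : Finset L'.Crossing, L'.OrientedAt S' c →
      IsolatesCircle ((L'.circles S').comap (Subtype.val : {n // n ∉ ({u} : Set L'.Edge)} → _))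
        ⟨point L'.mark, hmU⟩ (L'.circles S') (point L'.mark) Subtype.val u := by
    intro S' hS'
    refine isolatesCircle_of_closed {u} (fun a ha => ha ▸ (L'.circles S').refl _) rfl
      (joined_mem_iff _ (fun a => ?_) fun x => ?_) hmU
    · rw [show a = eP (eP.symm a) by simp]
      exact iff_of_false (hinU (point (eP.symm a))) (hU (point (eP.symm a)))
    · rcases hX x with rfl | ⟨x, rfl⟩
      · refine Or.inr ⟨fun _ => ?_, fun h => (h hS').elim⟩
        cases o <;> simp only [hu, hv, strand, Bool.not_false, Bool.not_true, if_true,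
          Bool.false_eq_true, if_false] at h₁' h₂' hvU hU ⊢
        · exact ⟨iff_of_false (fun h => hU e (h₁'.symm.trans h)) hvU,
            iff_of_eq (congrArg (· ∈ _) h₂')⟩
        · exact ⟨iff_of_eq (congrArg (· ∈ _) h₂'),
            iff_of_false (fun h => hU e (h₁'.symm.trans h)) hvU⟩
      · exact Or.inl ⟨hinU (underpass x), hinU (overpass x), hU (underpass x), hU (overpass x)⟩
  have hequiv : ∀ (S' : Finset L'.Crossing) (S : Finset L.Crossing), ¬ L'.OrientedAt S' c →
      (∀ x, L'.OrientedAt S' (eX (some x)) ↔ L.OrientedAt S x) →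
      IsCircleEquiv (L.circles S) (point L.mark) (L'.circles S') (point L'.mark) ρ := by
    intro S' S hS' hS
    have hjoin : L'.circles S' (ρ e) u ∧ L'.circles S' u v := by
      have i₁ := L'.circles_of_joined (.unoriented_in c hS')
      have i₂ := L'.circles_of_joined (.unoriented_out c hS')
      cases o <;> simp only [hu, hv, strand, Bool.not_false, Bool.not_true, if_true,
          Bool.false_eq_true, if_false] at h₁' h₂' ⊢ <;> rw [h₁', h₂'] at i₁
      · exact ⟨i₁, i₂⟩
      · exact ⟨(L'.circles S').symm i₁, (L'.circles S').symm i₂⟩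
    refine isCircleEquiv_of_retract (S' := S') κ hS hm hκ hκ' (fun n => ?_) (fun x hx => ?_)
      (fun a ha => (ha ⟨_, eP.apply_symm_apply a⟩).elim)
    · rcases hcases n with ⟨n, rfl⟩ | rfl | rfl
      · rw [hκ]
      · rw [hκu]; exact hjoin.1
      · rw [hκv]; exact (L'.circles S').trans hjoin.1 hjoin.2
    · rcases hX x with rfl | ⟨x, rfl⟩
      · refine ⟨fun h => (hS' h).elim, fun _ => ?_⟩
        have k : ∀ n, n = ρ e ∨ n = u ∨ n = v → κ n = e := by
          rintro _ (rfl | rfl | rfl); exacts [hκ e, hκu, hκv]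
        have k' : ∀ o, L.circles S (κ (L'.next.symm (strand o c))) e ∧
            L.circles S (κ (strand o c)) e := by
          intro o'
          have : strand o' c = u ∨ strand o' c = v := by
            rw [hu, hv]; cases o <;> cases o' <;> simp
          rcases this with h | h <;> rw [h]
          · rw [h₁', hκ, hκu]
            exact ⟨(L.circles S).refl _, (L.circles S).refl _⟩
          · rw [h₂', hκu, hκv]
            exact ⟨(L.circles S).refl _, (L.circles S).refl _⟩
        have t : ∀ {a b}, L.circles S a e → L.circles S b e → L.circles S a b :=
          fun h h' => (L.circles S).trans h ((L.circles S).symm h')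
        exact ⟨t (k' false).1 (k' true).1, t (k' false).2 (k' true).2⟩
      · exact (hx ⟨x, rfl⟩).elim
  have hcirc : ∀ a b, L.components a b ↔ L'.components (ρ a) (ρ b) := by
    refine components_of_retract κ hκ hκ' (fun n => ?_) fun n => ?_
    · rcases hcases n with h | rfl | rfl
      · exact Or.inl h
      · exact Or.inr (by rw [h₁', hκ, hκu])
      · exact Or.inr (by rw [h₂', hκu, hκv])
    · rcases hcases n with ⟨n, rfl⟩ | rfl | rfl
      · rw [hκ]
      · rw [hκu, ← h₁]; exact L'.components_next _
      · rw [hκv]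
        refine L'.components.trans (h₁ ▸ L'.components_next (ρ e)) (h₂ ▸ L'.components_next u)
  have hsurj : ∀ n, ∃ a, L'.components (ρ a) n := by
    intro n
    rcases hcases n with ⟨n, rfl⟩ | rfl | rfl
    · exact ⟨n, L'.components.refl _⟩
    · exact ⟨e, h₁ ▸ L'.components_next _⟩
    · exact ⟨e, L'.components.trans (h₁ ▸ L'.components_next (ρ e))
        (h₂ ▸ L'.components_next u)⟩
  let C := L'.cube.relabel eX
  have hmerge : ∀ (S' S'' : Finset L'.Crossing), L'.OrientedAt S' c →
      Surgery (L'.circles S') (L'.circles S'') (L'.underIn c) (L'.underOut c) →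
      ∃ a : {n // n ∉ ({u} : Set L'.Edge)}, Merge (L'.circles S') (L'.circles S'') u a.1 := by
    intro S' S'' hS' hs
    refine (hiso S' hS').exists_merge hs ?_
    cases o <;> simp only [hu, hv, strand, Bool.not_false, Bool.not_true, if_true,
          Bool.false_eq_true, if_false] at h₁' h₂' hU hvU ⊢
    · exact Or.inr ⟨(L'.circles S').refl _, ⟨_, hU e⟩, h₁'⟩
    · exact Or.inl ⟨h₂' ▸ (L'.circles S').refl _, ⟨_, hvU⟩, rfl⟩
  let ρ₀ : L.Edge → {n // n ∉ ({u} : Set L'.Edge)} := fun n => ⟨ρ n, hU n⟩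
  have harcs : ∀ x : L.Crossing, ∃ a b : {n // n ∉ ({u} : Set L'.Edge)},
      L'.underIn (eX (some x)) = a ∧ L'.underOut (eX (some x)) = b := fun x =>
    ⟨⟨_, hinU (underpass x)⟩, ⟨_, hU (underpass x)⟩, rfl, rfl⟩
  have hlow : ∀ S : Finset L.Crossing, c ∉ (S.map Function.Embedding.some).map eX.toEmbedding := by
    intro S; simp [hc]
  have hhigh : ∀ S : Finset L.Crossing, c ∈ (Finset.insertNone S).map eX.toEmbedding := by
    intro S; simp [hc]
  have hsum : L'.nPlus = (if L'.rightHanded c = true then 1 else 0) + L.nPlus := by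
    rw [nPlus_eq_sum, nPlus_eq_sum, ← Equiv.sum_comp eX, Fintype.sum_option]
    simp_rw [hr]
    rfl
  cases hcr : L'.rightHanded c with
  | true =>
    refine HasEquivalentComplexes.of_cube hcirc hsurj C.high (fun S => ?_) fun R _ _ w => ?_
    · refine hequiv _ S (fun h => h.1 hcr (hhigh S)) fun x => ?_
      simp [OrientedAt, hr]
    · have hor : ∀ S : Finset L.Crossing,
          L'.OrientedAt ((S.map Function.Embedding.some).map eX.toEmbedding) c :=
        fun S => iff_of_true hcr (hlow S)
      choose a ha using fun S : Finset L.Crossing => hmerge _ _ (hor S) (C.surgery_low_high S)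
      have := complex_hEquiv_high C (fun S => hiso _ (hor S)) ha harcs (pushWeight ρ₀ w) L'.nPlus
      rw [pushWeight_comp] at this
      refine (relabelMap_isIso L'.cube eX _ _).hEquiv.trans (this.trans (complex_cast ?_))
      rw [hsum, hcr]
      simp
  | false =>
    refine HasEquivalentComplexes.of_cube hcirc hsurj C.low (fun S => ?_) fun R _ _ w => ?_
    · refine hequiv _ S (fun h => by simpa [hcr] using h.2 (hlow S)) fun x => ?_
      simp [OrientedAt, hr]
    · have hor : ∀ S : Finset L.Crossing,
          L'.OrientedAt ((Finset.insertNone S).map eX.toEmbedding) c :=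
        fun S => iff_of_false (by simp [hcr]) (not_not.2 (hhigh S))
      choose a ha using fun S : Finset L.Crossing =>
        hmerge _ _ (hor S) (C.surgery_low_high S).symm
      have := complex_hEquiv_low C (fun S => hiso _ (hor S)) ha harcs (pushWeight ρ₀ w) L'.nPlus
      rw [pushWeight_comp] at this
      refine (relabelMap_isIso L'.cube eX _ _).hEquiv.trans (this.trans (complex_cast ?_))
      rw [hsum, hcr]
      simp

end MarkedDiagram

/-! ### The second Reidemeister move for link diagrams -/

namespace MarkedDiagram

open Passage DiffModule SurgeryCube CircleAlgebra

variable {L L' : MarkedDiagram}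

variable (L) in
/-- The relation `r` holds between the edges glued at the crossing `x` in the resolution along `S`. -/
def Resolved (S : Finset L.Crossing) (x : L.Crossing) (r : L.Edge → L.Edge → Prop) : Prop :=
  (L.OrientedAt S x → r (L.underIn x) (L.overOut x) ∧ r (L.overIn x) (L.underOut x)) ∧
  (¬ L.OrientedAt S x → r (L.underIn x) (L.overIn x) ∧ r (L.underOut x) (L.overOut x))

theorem resolved_circles (S : Finset L.Crossing) (x : L.Crossing) :
    L.Resolved S x (L.circles S) :=
  ⟨fun h => ⟨L.circles_of_joined (.oriented_under x h), L.circles_of_joined (.oriented_over x h)⟩,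
    fun h => ⟨L.circles_of_joined (.unoriented_in x h),
      L.circles_of_joined (.unoriented_out x h)⟩⟩

theorem resolved_iff_strand {S : Finset L.Crossing} {x : L.Crossing} {r : L.Edge → L.Edge → Prop}
    (hr : ∀ {a b}, r a b → r b a) (o : Bool) : L.Resolved S x r ↔
      (L.OrientedAt S x → r (L.next.symm (strand o x)) (strand (!o) x) ∧
        r (L.next.symm (strand (!o) x)) (strand o x)) ∧
      (¬ L.OrientedAt S x → r (L.next.symm (strand o x)) (L.next.symm (strand (!o) x)) ∧
        r (strand o x) (strand (!o) x)) := by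
  cases o
  · exact Iff.rfl
  · exact and_congr (imp_congr_right fun _ => and_comm)
      (imp_congr_right fun _ => and_congr ⟨hr, hr⟩ ⟨hr, hr⟩)

/-- The reordering of the crossings after a second Reidemeister move that puts the new crossing `d`
first and the other new one next. -/
def bigonEquiv {X : Type} (d : Bool) : Option (Option X) ≃ X ⊕ Bool where
  toFun
    | none => Sum.inr d
    | some none => Sum.inr !d
    | some (some z) => Sum.inl z
  invFun
    | Sum.inl z => some (some z)
    | Sum.inr b => if b = d then none else some none
  left_inv := by rintro (_ | _ | z) <;> cases d <;> simp
  right_inv := by rintro (z | b) <;> cases d <;> try cases b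
                  all_goals simp

theorem IsReidemeisterII.hasEquivalentComplexes (h : L.IsReidemeisterII L') :
    HasEquivalentComplexes L L' := by
  classical
  obtain ⟨eX, eP, -, e, f, bE, bF, o, hef, -, hr, hrx, hry, hm, he₁, he₂, he₃, hf₁, hf₂, hf₃, hn,
    -⟩ := h
  set ρ : L.Edge → L'.Edge := Passage.map (fun x => eX (Sum.inl x)) eP with hρ
  set x : L'.Crossing := eX (Sum.inr false) with hx
  set y : L'.Crossing := eX (Sum.inr true) with hy
  set e₁ : L'.Edge := strand o x with he₁d
  set e₂ : L'.Edge := strand o y with he₂d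
  set f₁ : L'.Edge := strand (!o) (if bE = bF then y else x) with hf₁d
  set f₂ : L'.Edge := strand (!o) (if bE = bF then x else y) with hf₂d
  have hxy : x ≠ y := fun h => by simpa using eX.injective h
  have hinj : Function.Injective ρ :=
    Passage.map_injective (fun x y h => Sum.inl_injective (eX.injective h)) eP.injective
  have hX : ∀ z : L'.Crossing, (∃ z', eX (Sum.inl z') = z) ∨ z = x ∨ z = y := by
    intro z
    obtain ⟨z | _ | _, rfl⟩ := eX.surjective z
    exacts [Or.inl ⟨z, rfl⟩, Or.inr (Or.inl rfl), Or.inr (Or.inr rfl)]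
  have hstrand : ∀ o' z, z = x ∨ z = y →
      (strand o' z = e₁ ∨ strand o' z = e₂ ∨ strand o' z = f₁ ∨ strand o' z = f₂) := by
    intro o' z hz
    rw [he₁d, he₂d, hf₁d, hf₂d]
    by_cases hb : bE = bF <;> simp only [hb, if_true, if_false] <;>
      rcases Bool.eq_or_eq_not o' o with rfl | rfl <;> rcases hz with rfl | rfl <;> simp
  have hcases : ∀ n, n ∈ Set.range ρ ∨ n = e₁ ∨ n = e₂ ∨ n = f₁ ∨ n = f₂ := by
    rintro (z | z | a)
    · rcases hX z with ⟨z, rfl⟩ | hz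
      · exact Or.inl ⟨underpass z, rfl⟩
      · exact Or.inr (hstrand false z hz)
    · rcases hX z with ⟨z, rfl⟩ | hz
      · exact Or.inl ⟨overpass z, rfl⟩
      · exact Or.inr (hstrand true z hz)
    · exact Or.inl ⟨point (eP.symm a), by simp [ρ, Passage.map]⟩
  have hnew : ∀ o' z, z = x ∨ z = y → ∀ n, ρ n ≠ strand o' z := by
    rintro (_ | _) z (rfl | rfl) (z | z | a) <;> simp [ρ, Passage.map, strand, hx, hy]
  have hne₁ : ∀ n, ρ n ≠ e₁ := hnew _ _ (Or.inl rfl)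
  have hne₂ : ∀ n, ρ n ≠ e₂ := hnew _ _ (Or.inr rfl)
  have hnf₁ : ∀ n, ρ n ≠ f₁ := hnew _ _ (by split_ifs <;> simp)
  have hnf₂ : ∀ n, ρ n ≠ f₂ := hnew _ _ (by split_ifs <;> simp)
  have hstr : ∀ o₁ o₂ z₁ z₂, (strand o₁ z₁ : L'.Edge) = strand o₂ z₂ → o₁ = o₂ ∧ z₁ = z₂ := by
    rintro (_ | _) (_ | _) z₁ z₂ h <;> simp_all [strand]
  have h12 : e₁ ≠ e₂ := fun h => hxy (hstr _ _ _ _ h).2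
  have hf12 : f₁ ≠ f₂ := fun h => by
    have := (hstr _ _ _ _ h).2
    split_ifs at this
    exacts [hxy this.symm, hxy this]
  have hef' : ∀ z z', (strand o z : L'.Edge) ≠ strand (!o) z' := fun z z' h => by
    have := (hstr _ _ _ _ h).1
    cases o <;> simp at this
  have h1f1 : e₁ ≠ f₁ := hef' _ _
  have h1f2 : e₁ ≠ f₂ := hef' _ _
  have h2f1 : e₂ ≠ f₁ := hef' _ _
  have h2f2 : e₂ ≠ f₂ := hef' _ _
  have ie₁ : L'.next.symm e₁ = ρ e := by rw [← he₁, Equiv.symm_apply_apply]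
  have ie₂ : L'.next.symm e₂ = e₁ := by rw [← he₂, Equiv.symm_apply_apply]
  have if₁ : L'.next.symm f₁ = ρ f := by rw [← hf₁, Equiv.symm_apply_apply]
  have if₂ : L'.next.symm f₂ = f₁ := by rw [← hf₂, Equiv.symm_apply_apply]
  have hin : ∀ n, (n = L.next e ∧ L'.next.symm (ρ n) = e₂) ∨
      (n = L.next f ∧ L'.next.symm (ρ n) = f₂) ∨ L'.next.symm (ρ n) = ρ (L.next.symm n) := by
    intro n
    obtain ⟨n, rfl⟩ := L.next.surjective n
    by_cases h₁ : n = e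
    · exact Or.inl ⟨by rw [h₁], by rw [h₁, ← he₃, Equiv.symm_apply_apply]⟩
    by_cases h₂ : n = f
    · exact Or.inr (Or.inl ⟨by rw [h₂], by rw [h₂, ← hf₃, Equiv.symm_apply_apply]⟩)
    · exact Or.inr (Or.inr (by rw [← hn n h₁ h₂, Equiv.symm_apply_apply, Equiv.symm_apply_apply]))
  -- Both strands avoid the bigon in the resolution in which it is opened at its two corners; there
  -- the two strands have exchanged their middle parts.
  let κ : L'.Edge → L.Edge := Function.extend ρ id fun n => if n = e₁ ∨ n = f₂ then f else e
  have hκ : ∀ n, κ (ρ n) = n := fun n => hinj.extend_apply _ _ n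
  have hκn : ∀ n, (∀ m, ρ m ≠ n) → κ n = if n = e₁ ∨ n = f₂ then f else e := fun n h =>
    Function.extend_apply' _ _ _ fun ⟨m, h'⟩ => h m h'
  have ke₁ : κ e₁ = f := by rw [hκn _ hne₁]; simp
  have ke₂ : κ e₂ = e := by rw [hκn _ hne₂]; simp [h12.symm, h2f2]
  have kf₁ : κ f₁ = e := by rw [hκn _ hnf₁]; simp [h1f1.symm, hf12]
  have kf₂ : κ f₂ = f := by rw [hκn _ hnf₂]; simp
  have hκ' : ∀ n, κ (L'.next.symm (ρ n)) = L.next.symm n := by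
    intro n
    rcases hin n with ⟨rfl, h⟩ | ⟨rfl, h⟩ | h <;> rw [h]
    · rw [ke₂, Equiv.symm_apply_apply]
    · rw [kf₂, Equiv.symm_apply_apply]
    · rw [hκ]
  -- Following the strands instead gives the bijection of components.
  let κc : L'.Edge → L.Edge := Function.extend ρ id fun n => if n = f₁ ∨ n = f₂ then f else e
  have hκc : ∀ n, κc (ρ n) = n := fun n => hinj.extend_apply _ _ n
  have hκcn : ∀ n, (∀ m, ρ m ≠ n) → κc n = if n = f₁ ∨ n = f₂ then f else e := fun n h =>
    Function.extend_apply' _ _ _ fun ⟨m, h'⟩ => h m h'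
  have ce₁ : κc e₁ = e := by rw [hκcn _ hne₁]; simp [h1f1, h1f2]
  have ce₂ : κc e₂ = e := by rw [hκcn _ hne₂]; simp [h2f1, h2f2]
  have cf₁ : κc f₁ = f := by rw [hκcn _ hnf₁]; simp
  have cf₂ : κc f₂ = f := by rw [hκcn _ hnf₂]; simp
  have pe₁ : L'.components (ρ e) e₁ := he₁ ▸ L'.components_next _
  have pe₂ : L'.components (ρ e) e₂ := L'.components.trans pe₁ (he₂ ▸ L'.components_next _)
  have pf₁ : L'.components (ρ f) f₁ := hf₁ ▸ L'.components_next _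
  have pf₂ : L'.components (ρ f) f₂ := L'.components.trans pf₁ (hf₂ ▸ L'.components_next _)
  have hcirc : ∀ a b, L.components a b ↔ L'.components (ρ a) (ρ b) := by
    refine components_of_retract κc hκc (fun n => ?_) (fun n => ?_) fun n => ?_
    · rcases hin n with ⟨rfl, h⟩ | ⟨rfl, h⟩ | h <;> rw [h]
      · rw [ce₂, Equiv.symm_apply_apply]
      · rw [cf₂, Equiv.symm_apply_apply]
      · rw [hκc]
    · rcases hcases n with h | rfl | rfl | rfl | rfl
      · exact Or.inl h
      · exact Or.inr (by rw [ie₁, hκc, ce₁])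
      · exact Or.inr (by rw [ie₂, ce₁, ce₂])
      · exact Or.inr (by rw [if₁, hκc, cf₁])
      · exact Or.inr (by rw [if₂, cf₁, cf₂])
    · rcases hcases n with ⟨n, rfl⟩ | rfl | rfl | rfl | rfl
      · rw [hκc]
      · rw [ce₁]; exact pe₁
      · rw [ce₂]; exact pe₂
      · rw [cf₁]; exact pf₁
      · rw [cf₂]; exact pf₂
  have hsurj : ∀ n, ∃ a, L'.components (ρ a) n := by
    intro n
    rcases hcases n with ⟨n, rfl⟩ | rfl | rfl | rfl | rfl
    exacts [⟨n, L'.components.refl _⟩, ⟨e, pe₁⟩, ⟨e, pe₂⟩, ⟨f, pf₁⟩, ⟨f, pf₂⟩]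
  let U : Set L'.Edge := {e₁, f₁}
  have hUρ : ∀ n, ρ n ∉ U := by
    rintro n (h | h)
    exacts [hne₁ n h, hnf₁ n h]
  have hUe₂ : e₂ ∉ U := by
    rintro (h | h)
    exacts [h12 h.symm, h2f1 h]
  have hUf₂ : f₂ ∉ U := by
    rintro (h | h)
    exacts [h1f2 h.symm, hf12 h.symm]
  have hUin : ∀ n, L'.next.symm (ρ n) ∉ U := by
    intro n
    rcases hin n with ⟨-, h⟩ | ⟨-, h⟩ | h <;> rw [h]
    exacts [hUe₂, hUf₂, hUρ _]
  have hUe₁ : e₁ ∈ U := Or.inl rfl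
  have hUf₁ : f₁ ∈ U := Or.inr rfl
  have hmU : point L'.mark ∉ U := by rw [hm]; exact hUρ (point L.mark)
  -- The gluings at the two corners of the bigon, in terms of the property of the corner of being
  -- closed, meaning that the two edges of the bigon are glued there.
  let Closed (S' : Finset L'.Crossing) (z : L'.Crossing) : Prop := L'.OrientedAt S' z ↔ bE = bF
  obtain ⟨A, B, hAB, hx', hy', hpx, hpy⟩ : ∃ A B, ((A = f₂ ∧ B = ρ f) ∨ (A = ρ f ∧ B = f₂)) ∧
      (∀ S' (r : L'.Edge → L'.Edge → Prop), (∀ {a b}, r a b → r b a) →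
        (L'.Resolved S' x r ↔ (Closed S' x → r (ρ e) A ∧ r e₁ f₁) ∧
          (¬ Closed S' x → r (ρ e) f₁ ∧ r e₁ A))) ∧
      (∀ S' (r : L'.Edge → L'.Edge → Prop), (∀ {a b}, r a b → r b a) →
        (L'.Resolved S' y r ↔ (Closed S' y → r e₁ f₁ ∧ r e₂ B) ∧
          (¬ Closed S' y → r e₁ B ∧ r e₂ f₁))) ∧
      (∀ o', (L'.next.symm (strand o' x) ∈ U ∧ strand o' x ∉ U) ∨
        (strand o' x ∈ U ∧ L'.next.symm (strand o' x) ∉ U)) ∧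
      (∀ o', (L'.next.symm (strand o' y) ∈ U ∧ strand o' y ∉ U) ∨
        (strand o' y ∈ U ∧ L'.next.symm (strand o' y) ∉ U)) := by
    have hUx : strand o x ∈ U ∧ L'.next.symm (strand o x) ∉ U := ⟨hUe₁, ie₁ ▸ hUρ e⟩
    have hUy : L'.next.symm (strand o y) ∈ U ∧ strand o y ∉ U := ⟨ie₂ ▸ hUe₁, hUe₂⟩
    by_cases hb : bE = bF
    · have s₁ : strand (!o) y = f₁ := by rw [hf₁d, if_pos hb]
      have s₂ : strand (!o) x = f₂ := by rw [hf₂d, if_pos hb]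
      refine ⟨f₂, ρ f, Or.inl ⟨rfl, rfl⟩, fun S' r hr => ?_, fun S' r hr => ?_, fun o' => ?_,
        fun o' => ?_⟩
      · rw [resolved_iff_strand hr o, s₂, ← he₁d, ie₁, if₂]
        simp only [Closed, hb, iff_true]
        exact and_congr (imp_congr_right fun _ => and_congr_right fun _ => ⟨hr, hr⟩) Iff.rfl
      · rw [resolved_iff_strand hr o, s₁, ← he₂d, ie₂, if₁]
        simp only [Closed, hb, iff_true]
        exact and_congr (imp_congr_right fun _ => and_congr_right fun _ => ⟨hr, hr⟩) Iff.rfl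
      · rcases Bool.eq_or_eq_not o' o with rfl | rfl
        · exact Or.inr hUx
        · rw [s₂, if₂]; exact Or.inl ⟨hUf₁, hUf₂⟩
      · rcases Bool.eq_or_eq_not o' o with rfl | rfl
        · exact Or.inl hUy
        · rw [s₁, if₁]; exact Or.inr ⟨hUf₁, hUρ f⟩
    · have s₁ : strand (!o) x = f₁ := by rw [hf₁d, if_neg hb]
      have s₂ : strand (!o) y = f₂ := by rw [hf₂d, if_neg hb]
      refine ⟨ρ f, f₂, Or.inr ⟨rfl, rfl⟩, fun S' r hr => ?_, fun S' r hr => ?_, fun o' => ?_,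
        fun o' => ?_⟩
      · rw [resolved_iff_strand hr o, s₁, ← he₁d, ie₁, if₁]
        simp only [Closed, hb, iff_false, not_not]
        rw [and_comm]
        exact and_congr Iff.rfl (imp_congr_right fun _ => and_congr_right fun _ => ⟨hr, hr⟩)
      · rw [resolved_iff_strand hr o, s₂, ← he₂d, ie₂, if₂]
        simp only [Closed, hb, iff_false, not_not]
        rw [and_comm]
        exact and_congr Iff.rfl (imp_congr_right fun _ => and_congr_right fun _ => ⟨hr, hr⟩)
      · rcases Bool.eq_or_eq_not o' o with rfl | rfl
        · exact Or.inr hUx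
        · rw [s₁, if₁]; exact Or.inr ⟨hUf₁, hUρ f⟩
      · rcases Bool.eq_or_eq_not o' o with rfl | rfl
        · exact Or.inl hUy
        · rw [s₂, if₂]; exact Or.inl ⟨hUf₁, hUf₂⟩
  have hUA : A ∉ U := by
    rcases hAB with ⟨rfl, -⟩ | ⟨rfl, -⟩
    exacts [hUf₂, hUρ f]
  have hUB : B ∉ U := by
    rcases hAB with ⟨-, rfl⟩ | ⟨-, rfl⟩
    exacts [hUρ f, hUf₂]
  have kAB : κ A = f ∧ κ B = f := by
    rcases hAB with ⟨rfl, rfl⟩ | ⟨rfl, rfl⟩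
    exacts [⟨kf₂, hκ f⟩, ⟨hκ f, kf₂⟩]
  have hiso : ∀ S' : Finset L'.Crossing, Closed S' x → Closed S' y →
      IsolatesCircle ((L'.circles S').comap (Subtype.val : {n // n ∉ U} → _))
        ⟨point L'.mark, hmU⟩ (L'.circles S') (point L'.mark) Subtype.val e₁ := by
    intro S' hcx hcy
    have hj := ((hx' S' _ (L'.circles S').symm).1 (resolved_circles S' x)).1 hcx
    refine isolatesCircle_of_closed U ?_ hUe₁ (joined_mem_iff _ (fun a => ?_) fun z => ?_) hmU
    · rintro a (rfl | rfl)
      exacts [(L'.circles S').refl _, (L'.circles S').symm hj.2]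
    · rw [show a = eP (eP.symm a) by simp]
      exact iff_of_false (hUin (point (eP.symm a))) (hUρ (point (eP.symm a)))
    · rcases hX z with ⟨z, rfl⟩ | rfl | rfl
      · exact Or.inl ⟨hUin (underpass z), hUin (overpass z), hUρ (underpass z), hUρ (overpass z)⟩
      · exact Or.inr ((hx' S' (fun a b => a ∈ U ↔ b ∈ U) Iff.symm).2
          ⟨fun _ => ⟨iff_of_false (hUρ e) hUA, iff_of_true hUe₁ hUf₁⟩, fun h => (h hcx).elim⟩)
      · exact Or.inr ((hy' S' (fun a b => a ∈ U ↔ b ∈ U) Iff.symm).2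
          ⟨fun _ => ⟨iff_of_true hUe₁ hUf₁, iff_of_false hUe₂ hUB⟩, fun h => (h hcy).elim⟩)
  have hequiv : ∀ (S' : Finset L'.Crossing) (S : Finset L.Crossing), ¬ Closed S' x →
      ¬ Closed S' y → (∀ z, L'.OrientedAt S' (eX (Sum.inl z)) ↔ L.OrientedAt S z) →
      IsCircleEquiv (L.circles S) (point L.mark) (L'.circles S') (point L'.mark) ρ := by
    intro S' S hcx hcy hS
    have t : ∀ {a b c}, L'.circles S' a b → L'.circles S' b c → L'.circles S' a c :=
      (L'.circles S').trans
    have s : ∀ {a b}, L'.circles S' a b → L'.circles S' b a := (L'.circles S').symm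
    have jx := ((hx' S' _ (L'.circles S').symm).1 (resolved_circles S' x)).2 hcx
    have jy := ((hy' S' _ (L'.circles S').symm).1 (resolved_circles S' y)).2 hcy
    have j₁ : L'.circles S' (ρ f) e₁ ∧ L'.circles S' (ρ f) f₂ := by
      rcases hAB with ⟨rfl, rfl⟩ | ⟨rfl, rfl⟩
      exacts [⟨s jy.1, t (s jy.1) jx.2⟩, ⟨s jx.2, t (s jx.2) jy.1⟩]
    refine isCircleEquiv_of_retract (S' := S') κ hS hm hκ hκ' (fun n => ?_) (fun z hz => ?_)
      (fun a ha => (ha ⟨_, eP.apply_symm_apply a⟩).elim)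
    · rcases hcases n with ⟨n, rfl⟩ | rfl | rfl | rfl | rfl
      · rw [hκ]
      · rw [ke₁]; exact j₁.1
      · rw [ke₂]; exact t jx.1 (s jy.2)
      · rw [kf₁]; exact jx.1
      · rw [kf₂]; exact j₁.2
    · have k : ∀ {a b}, κ a = κ b → L.circles S (κ a) (κ b) := fun h => h ▸ (L.circles S).refl _
      rcases hX z with ⟨z, rfl⟩ | rfl | rfl
      · exact (hz ⟨z, rfl⟩).elim
      · exact (hx' S' (fun a b => L.circles S (κ a) (κ b)) (L.circles S).symm).2
          ⟨fun h => (hcx h).elim, fun _ => ⟨k (by rw [hκ, kf₁]), k (by rw [ke₁, kAB.1])⟩⟩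
      · exact (hy' S' (fun a b => L.circles S (κ a) (κ b)) (L.circles S).symm).2
          ⟨fun h => (hcy h).elim, fun _ => ⟨k (by rw [ke₁, kAB.2]), k (by rw [ke₂, kf₁])⟩⟩
  -- The corner which is closed in the `0`-resolution comes first.
  let d : Bool := o != bE
  let eX' : Option (Option L.Crossing) ≃ L'.Crossing := (bigonEquiv d).trans eX
  have hd : (eX' none = x ∧ eX' (some none) = y) ∨ (eX' none = y ∧ eX' (some none) = x) := by
    simp only [eX', bigonEquiv, Equiv.trans_apply, Equiv.coe_fn_mk]
    cases d
    exacts [Or.inl ⟨rfl, rfl⟩, Or.inr ⟨rfl, rfl⟩]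
  have hcl₀ : ∀ S', Closed S' (eX' none) ↔ eX' none ∉ S' := by
    intro S'
    simp only [Closed, OrientedAt, eX', bigonEquiv, Equiv.trans_apply, Equiv.coe_fn_mk, d]
    cases o <;> cases bE <;> cases bF <;> simp [← hx, ← hy, hrx, hry]
  have hcl₁ : ∀ S', Closed S' (eX' (some none)) ↔ eX' (some none) ∈ S' := by
    intro S'
    simp only [Closed, OrientedAt, eX', bigonEquiv, Equiv.trans_apply, Equiv.coe_fn_mk, d]
    cases o <;> cases bE <;> cases bF <;> simp [← hx, ← hy, hrx, hry]
  have hp : ∀ z, z = x ∨ z = y → (L'.underIn z ∈ U ∧ L'.underOut z ∉ U) ∨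
      (L'.underOut z ∈ U ∧ L'.underIn z ∉ U) := by
    rintro z (rfl | rfl)
    exacts [hpx false, hpy false]
  have hmerge : ∀ (S' S'' : Finset L'.Crossing) (z : L'.Crossing), z = x ∨ z = y →
      Closed S' x → Closed S' y →
      Surgery (L'.circles S') (L'.circles S'') (L'.underIn z) (L'.underOut z) →
      ∃ a : {n // n ∉ U}, Merge (L'.circles S') (L'.circles S'') e₁ a.1 := by
    intro S' S'' z hz hcx hcy hs
    have hj := ((hx' S' _ (L'.circles S').symm).1 (resolved_circles S' x)).1 hcx
    have hUr : ∀ a ∈ U, L'.circles S' a e₁ := by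
      rintro a (rfl | rfl)
      exacts [(L'.circles S').refl _, (L'.circles S').symm hj.2]
    refine (hiso S' hcx hcy).exists_merge hs ?_
    rcases hp z hz with ⟨h₁, h₂⟩ | ⟨h₁, h₂⟩
    · exact Or.inl ⟨hUr _ h₁, ⟨_, h₂⟩, rfl⟩
    · exact Or.inr ⟨hUr _ h₁, ⟨_, h₂⟩, rfl⟩
  let T := L'.cube.relabel eX'
  have hd' : (eX' none = x ∨ eX' none = y) ∧ (eX' (some none) = x ∨ eX' (some none) = y) := by
    rcases hd with ⟨h₁, h₂⟩ | ⟨h₁, h₂⟩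
    exacts [⟨Or.inl h₁, Or.inr h₂⟩, ⟨Or.inr h₁, Or.inl h₂⟩]
  have hclosed : ∀ S', eX' none ∉ S' → eX' (some none) ∈ S' → Closed S' x ∧ Closed S' y := by
    intro S' h₀ h₁
    have h₀' := (hcl₀ S').2 h₀
    have h₁' := (hcl₁ S').2 h₁
    rcases hd with ⟨e₀, e₁⟩ | ⟨e₀, e₁⟩ <;> rw [e₀] at h₀' <;> rw [e₁] at h₁'
    exacts [⟨h₀', h₁'⟩, ⟨h₁', h₀'⟩]
  have hN : ∀ S : Finset L.Crossing,
      Closed (((Finset.insertNone S).map Function.Embedding.some).map eX'.toEmbedding) x ∧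
      Closed (((Finset.insertNone S).map Function.Embedding.some).map eX'.toEmbedding) y :=
    fun S => hclosed _ (by simp) (by simp)
  refine HasEquivalentComplexes.of_cube hcirc hsurj T.high.low (fun S => ?_) fun R _ _ w => ?_
  · have hK₀ := (hcl₀ ((Finset.insertNone (S.map Function.Embedding.some)).map
      eX'.toEmbedding)).not.2 (by simp)
    have hK₁ := (hcl₁ ((Finset.insertNone (S.map Function.Embedding.some)).map
      eX'.toEmbedding)).not.2 (by simp)
    have hS : ∀ z, L'.OrientedAt ((Finset.insertNone (S.map Function.Embedding.some)).map
        eX'.toEmbedding) (eX (Sum.inl z)) ↔ L.OrientedAt S z := by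
      intro z
      have hmem : eX' (some (some z)) ∈ (Finset.insertNone
          (S.map Function.Embedding.some)).map eX'.toEmbedding ↔ z ∈ S := by simp
      rw [OrientedAt, OrientedAt, hr]
      exact iff_congr Iff.rfl (not_congr hmem)
    rcases hd with ⟨e₀, e₁⟩ | ⟨e₀, e₁⟩ <;> rw [e₀] at hK₀ <;> rw [e₁] at hK₁
    exacts [hequiv _ S hK₀ hK₁ hS, hequiv _ S hK₁ hK₀ hS]
  · choose a ha using fun S : Finset L.Crossing => hmerge _ _ _ hd'.1 (hN S).1 (hN S).2
      (T.surgery_low_high (Finset.insertNone S))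
    choose a' ha' using fun S : Finset L.Crossing => hmerge _ _ _ hd'.2 (hN S).1 (hN S).2
      (T.low.surgery_low_high S).symm
    have harcs : T.low.high.ArcsFrom (Subtype.val : {n // n ∉ U} → L'.Edge) := fun z =>
      ⟨⟨_, hUin (underpass z)⟩, ⟨_, hUρ (underpass z)⟩, rfl, rfl⟩
    have := (quadRetraction (T := T) (fun S => hiso _ (hN S).1 (hN S).2) ha ha' harcs
      (pushWeight (fun n => ⟨ρ n, hUρ n⟩) w) L'.nPlus).hEquiv
    rw [pushWeight_comp] at this
    refine (relabelMap_isIso L'.cube eX' _ _).hEquiv.trans (this.trans (complex_cast ?_))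
    rw [nPlus_eq_sum, nPlus_eq_sum, ← Equiv.sum_comp eX, Fintype.sum_sum_type]
    simp_rw [hr]
    simp only [Fintype.sum_bool, ← hx, ← hy, hrx, hry]
    cases (o == bF) <;> simp

end MarkedDiagram

/-! ### The resolutions of a triangle -/

/-- The equivalence relation generated by a relation and three further pairs. -/
def pairing {E : Type} (g : E → E → Prop) (a a' b b' c c' : E) : Setoid E :=
  Relation.EqvGen.setoid fun e f => g e f ∨ (e = a ∧ f = a') ∨ (e = b ∧ f = b') ∨ (e = c ∧ f = c')

section Pairing

variable {E : Type} {g : E → E → Prop} {a a' b b' c c' : E}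

theorem pairing_le {r : Setoid E} (hg : ∀ e f, g e f → r e f) (ha : r a a') (hb : r b b')
    (hc : r c c') : pairing g a a' b b' c c' ≤ r := by
  refine Setoid.eqvGen_le ?_
  rintro e f (h | ⟨rfl, rfl⟩ | ⟨rfl, rfl⟩ | ⟨rfl, rfl⟩)
  exacts [hg _ _ h, ha, hb, hc]

theorem pairing_of {e f : E} (h : g e f) : pairing g a a' b b' c c' e f :=
  Relation.EqvGen.rel _ _ (Or.inl h)

theorem pairing_fst : pairing g a a' b b' c c' a a' :=
  Relation.EqvGen.rel _ _ (Or.inr (Or.inl ⟨rfl, rfl⟩))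

theorem pairing_snd : pairing g a a' b b' c c' b b' :=
  Relation.EqvGen.rel _ _ (Or.inr (Or.inr (Or.inl ⟨rfl, rfl⟩)))

theorem pairing_thd : pairing g a a' b b' c c' c c' :=
  Relation.EqvGen.rel _ _ (Or.inr (Or.inr (Or.inr ⟨rfl, rfl⟩)))

theorem pairing_reverse : pairing g a a' b b' c c' = pairing g c c' b b' a a' :=
  le_antisymm
    (pairing_le (fun _ _ => pairing_of) pairing_thd pairing_snd pairing_fst)
    (pairing_le (fun _ _ => pairing_of) pairing_thd pairing_snd pairing_fst)

theorem pairing_reverse_swap_snd : pairing g a a' b b' c c' = pairing g c c' b' b a a' :=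
  le_antisymm
    (pairing_le (fun _ _ => pairing_of) pairing_thd (Setoid.symm' _ pairing_snd) pairing_fst)
    (pairing_le (fun _ _ => pairing_of) pairing_thd (Setoid.symm' _ pairing_snd) pairing_fst)

theorem pairing_swap_fst_comm : pairing g a a' b b' c c' = pairing g a' a c c' b b' :=
  le_antisymm
    (pairing_le (fun _ _ => pairing_of) (Setoid.symm' _ pairing_fst) pairing_thd pairing_snd)
    (pairing_le (fun _ _ => pairing_of) (Setoid.symm' _ pairing_fst) pairing_thd pairing_snd)

end Pairing

namespace MarkedDiagram

open Passage DiffModule SurgeryCube CircleAlgebra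

variable {L L' : MarkedDiagram}

/-- Three strands of `L`, top, middle and bottom, form a triangle with corners `x` (top and middle),
`y` (top and bottom) and `z` (middle and bottom) and with sides `u`, `v`, `w` lying on the
three strands. The edges of `L` outside the triangle are labelled by `j`, and `t₁`, `t₂`, `m₁`,
`m₂`, `b₁`, `b₂` are the labels of the outer edges of the three strands at their first and second
corner (in the order `x`, `y`, `z`). The corners `x` and `z` are closed, in the sense that the two
sides meeting there are joined, in the `1`-resolution if `a = true` and in the `0`-resolution
otherwise; for `y` it is the other way round. The relation `G S` describes the gluing of edges
in the resolution along `S` at the points and at the crossings `i c` outside the triangle. -/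
structure LocalTriangle (L : MarkedDiagram) {X₀ E₀ : Type} (i : X₀ → L.Crossing) (j : E₀ → L.Edge)
    (G : Finset X₀ → E₀ → E₀ → Prop) (a : Bool) (x y z : L.Crossing) (u v w : L.Edge)
    (t₁ t₂ m₁ m₂ b₁ b₂ : E₀) : Prop where
  resolved_x : ∀ (S : Finset L.Crossing) (r : L.Edge → L.Edge → Prop), (∀ {e f}, r e f → r f e) →
    (L.Resolved S x r ↔ ((x ∈ S ↔ a = true) → r u v ∧ r (j t₁) (j m₁)) ∧
      (¬ (x ∈ S ↔ a = true) → r u (j m₁) ∧ r v (j t₁)))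
  resolved_y : ∀ (S : Finset L.Crossing) (r : L.Edge → L.Edge → Prop), (∀ {e f}, r e f → r f e) →
    (L.Resolved S y r ↔ ((y ∈ S ↔ a = false) → r u w ∧ r (j t₂) (j b₁)) ∧
      (¬ (y ∈ S ↔ a = false) → r u (j b₁) ∧ r w (j t₂)))
  resolved_z : ∀ (S : Finset L.Crossing) (r : L.Edge → L.Edge → Prop), (∀ {e f}, r e f → r f e) →
    (L.Resolved S z r ↔ ((z ∈ S ↔ a = true) → r v w ∧ r (j m₂) (j b₂)) ∧
      (¬ (z ∈ S ↔ a = true) → r v (j b₂) ∧ r w (j m₂)))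
  joined_of : ∀ (S : Finset L.Crossing) S₀, (∀ c, i c ∈ S ↔ c ∈ S₀) → ∀ e f, G S₀ e f →
    L.Joined S (j e) (j f)
  joined_cases : ∀ (S : Finset L.Crossing) S₀, (∀ c, i c ∈ S ↔ c ∈ S₀) → ∀ e f, L.Joined S e f →
    (∃ e' f', e = j e' ∧ f = j f' ∧ G S₀ e' f') ∨ ∃ c, (c = x ∨ c = y ∨ c = z) ∧
      ∀ r : L.Edge → L.Edge → Prop, L.Resolved S c r → r e f
  injective : Function.Injective j
  side_or : ∀ e, e = u ∨ e = v ∨ e = w ∨ ∃ e', j e' = e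
  notMem : ∀ e, j e ≠ u ∧ j e ≠ v ∧ j e ≠ w
  ne : u ≠ v ∧ u ≠ w ∧ v ≠ w
  arc : ∀ c, c = x ∨ c = y ∨ c = z →
    ((L.underIn c = u ∨ L.underIn c = v ∨ L.underIn c = w) ∧ ∃ e, L.underOut c = j e) ∨
    ((L.underOut c = u ∨ L.underOut c = v ∨ L.underOut c = w) ∧ ∃ e, L.underIn c = j e)
  arcs : ∀ c, ∃ e f, L.underIn (i c) = j e ∧ L.underOut (i c) = j f

namespace LocalTriangle

variable {X₀ E₀ : Type} {i : X₀ → L.Crossing} {j : E₀ → L.Edge} {m₀ : E₀}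
  {G : Finset X₀ → E₀ → E₀ → Prop} {a : Bool} {x y z : L.Crossing} {u v w : L.Edge}
  {t₁ t₂ m₁ m₂ b₁ b₂ : E₀} {S S' : Finset L.Crossing} {S₀ : Finset X₀}

/-- The circles of a resolution in terms of the outer edges, if each side of the triangle is on the
circle of some outer edge. -/
theorem isCircleEquiv_of (d : L.LocalTriangle i j G a x y z u v w t₁ t₂ m₁ m₂ b₁ b₂)
    (hm : j m₀ = point L.mark)
    (hS : ∀ c, i c ∈ S ↔ c ∈ S₀) {r : Setoid E₀} (α β γ : E₀) (hα : L.circles S (j α) u)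
    (hβ : L.circles S (j β) v) (hγ : L.circles S (j γ) w) (hr : r ≤ (L.circles S).comap j)
    (hG : ∀ e f, G S₀ e f → r e f)
    (hx : ((x ∈ S ↔ a = true) → r α β ∧ r t₁ m₁) ∧ (¬ (x ∈ S ↔ a = true) → r α m₁ ∧ r β t₁))
    (hy : ((y ∈ S ↔ a = false) → r α γ ∧ r t₂ b₁) ∧ (¬ (y ∈ S ↔ a = false) → r α b₁ ∧ r γ t₂))
    (hz : ((z ∈ S ↔ a = true) → r β γ ∧ r m₂ b₂) ∧ (¬ (z ∈ S ↔ a = true) → r β b₂ ∧ r γ m₂)) :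
    IsCircleEquiv r m₀ (L.circles S) (point L.mark) j := by
  classical
  let κ : L.Edge → E₀ := Function.extend j id fun e => if e = u then α else if e = v then β else γ
  have hκ : ∀ e, κ (j e) = e := fun e => d.injective.extend_apply _ _ e
  have hκn : ∀ e, (∀ e', j e' ≠ e) → κ e = if e = u then α else if e = v then β else γ :=
    fun e h => Function.extend_apply' _ _ _ fun ⟨m, h'⟩ => h m h'
  have ku : κ u = α := by rw [hκn _ fun e => (d.notMem e).1, if_pos rfl]
  have kv : κ v = β := by rw [hκn _ fun e => (d.notMem e).2.1, if_neg d.ne.1.symm, if_pos rfl]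
  have kw : κ w = γ := by
    rw [hκn _ fun e => (d.notMem e).2.2, if_neg d.ne.2.1.symm, if_neg d.ne.2.2.symm]
  have bwd : ∀ e f, L.circles S e f → r (κ e) (κ f) := by
    intro e f h
    induction h with
    | rel e f h =>
      rcases d.joined_cases S S₀ hS e f h with ⟨e', f', rfl, rfl, hg⟩ | ⟨c, hc, h⟩
      · rw [hκ, hκ]; exact hG _ _ hg
      · refine h (fun e f => r (κ e) (κ f)) ?_
        rcases hc with rfl | rfl | rfl
        · rw [d.resolved_x S (fun e f => r (κ e) (κ f)) r.symm, ku, kv, hκ, hκ]; exact hx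
        · rw [d.resolved_y S (fun e f => r (κ e) (κ f)) r.symm, ku, kw, hκ, hκ]; exact hy
        · rw [d.resolved_z S (fun e f => r (κ e) (κ f)) r.symm, kv, kw, hκ, hκ]; exact hz
    | refl => exact r.refl _
    | symm _ _ _ ih => exact r.symm ih
    | trans _ _ _ _ _ ih₁ ih₂ => exact r.trans ih₁ ih₂
  refine ⟨fun e f => ⟨fun h => hr h, fun h => ?_⟩, fun e => ?_, ?_⟩
  · have := bwd _ _ h
    rwa [hκ, hκ] at this
  · rcases d.side_or e with rfl | rfl | rfl | ⟨e', rfl⟩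
    exacts [⟨α, hα⟩, ⟨β, hβ⟩, ⟨γ, hγ⟩, ⟨e', (L.circles S).refl _⟩]
  · rw [hm]

section Patterns

theorem circles_x (d : L.LocalTriangle i j G a x y z u v w t₁ t₂ m₁ m₂ b₁ b₂)
    (S : Finset L.Crossing) :
    ((x ∈ S ↔ a = true) → L.circles S u v ∧ L.circles S (j t₁) (j m₁)) ∧
      (¬ (x ∈ S ↔ a = true) → L.circles S u (j m₁) ∧ L.circles S v (j t₁)) :=
  (d.resolved_x S _ (L.circles S).symm).1 (resolved_circles S x)

theorem circles_y (d : L.LocalTriangle i j G a x y z u v w t₁ t₂ m₁ m₂ b₁ b₂)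
    (S : Finset L.Crossing) :
    ((y ∈ S ↔ a = false) → L.circles S u w ∧ L.circles S (j t₂) (j b₁)) ∧
      (¬ (y ∈ S ↔ a = false) → L.circles S u (j b₁) ∧ L.circles S w (j t₂)) :=
  (d.resolved_y S _ (L.circles S).symm).1 (resolved_circles S y)

theorem circles_z (d : L.LocalTriangle i j G a x y z u v w t₁ t₂ m₁ m₂ b₁ b₂)
    (S : Finset L.Crossing) :
    ((z ∈ S ↔ a = true) → L.circles S v w ∧ L.circles S (j m₂) (j b₂)) ∧
      (¬ (z ∈ S ↔ a = true) → L.circles S v (j b₂) ∧ L.circles S w (j m₂)) :=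
  (d.resolved_z S _ (L.circles S).symm).1 (resolved_circles S z)

theorem circles_of (d : L.LocalTriangle i j G a x y z u v w t₁ t₂ m₁ m₂ b₁ b₂)
    (hS : ∀ c, i c ∈ S ↔ c ∈ S₀) (e f : E₀) (h : G S₀ e f) : L.circles S (j e) (j f) :=
  L.circles_of_joined (d.joined_of S S₀ hS e f h)

theorem isCircleEquiv_x (d : L.LocalTriangle i j G a x y z u v w t₁ t₂ m₁ m₂ b₁ b₂)
    (hm : j m₀ = point L.mark) (hS : ∀ c, i c ∈ S ↔ c ∈ S₀) (hx : ¬ (x ∈ S ↔ a = true))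
    (hy : y ∈ S ↔ a = false) (hz : z ∈ S ↔ a = true) :
    IsCircleEquiv (pairing (G S₀) t₁ m₁ t₂ b₁ m₂ b₂) m₀ (L.circles S) (point L.mark) j := by
  have t : ∀ {a b c}, L.circles S a b → L.circles S b c → L.circles S a c := (L.circles S).trans
  have s : ∀ {a b}, L.circles S a b → L.circles S b a := (L.circles S).symm
  have cx := (d.circles_x S).2 hx
  have cy := (d.circles_y S).1 hy
  have cz := (d.circles_z S).1 hz
  let r := pairing (G S₀) t₁ m₁ t₂ b₁ m₂ b₂
  exact d.isCircleEquiv_of hm hS m₁ t₁ m₁ (s cx.1) (s cx.2) (t (s cx.1) cy.1)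
    (pairing_le (d.circles_of hS) (t (s cx.2) (t cz.1 (t (s cy.1) cx.1))) cy.2 cz.2)
    (fun _ _ => pairing_of)
    ⟨fun h => (hx h).elim, fun _ => ⟨r.refl _, r.refl _⟩⟩
    ⟨fun _ => ⟨r.refl _, pairing_snd⟩, fun h => (h hy).elim⟩
    ⟨fun _ => ⟨pairing_fst, pairing_thd⟩, fun h => (h hz).elim⟩

theorem isCircleEquiv_xy (d : L.LocalTriangle i j G a x y z u v w t₁ t₂ m₁ m₂ b₁ b₂)
    (hm : j m₀ = point L.mark) (hS : ∀ c, i c ∈ S ↔ c ∈ S₀) (hx : ¬ (x ∈ S ↔ a = true))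
    (hy : ¬ (y ∈ S ↔ a = false)) (hz : z ∈ S ↔ a = true) :
    IsCircleEquiv (pairing (G S₀) m₁ b₁ t₁ t₂ m₂ b₂) m₀ (L.circles S) (point L.mark) j := by
  have t : ∀ {a b c}, L.circles S a b → L.circles S b c → L.circles S a c := (L.circles S).trans
  have s : ∀ {a b}, L.circles S a b → L.circles S b a := (L.circles S).symm
  have cx := (d.circles_x S).2 hx
  have cy := (d.circles_y S).2 hy
  have cz := (d.circles_z S).1 hz
  let r := pairing (G S₀) m₁ b₁ t₁ t₂ m₂ b₂
  exact d.isCircleEquiv_of hm hS m₁ t₁ t₂ (s cx.1) (s cx.2) (s cy.2)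
    (pairing_le (d.circles_of hS) (t (s cx.1) cy.1) (t (s cx.2) (t cz.1 cy.2)) cz.2)
    (fun _ _ => pairing_of)
    ⟨fun h => (hx h).elim, fun _ => ⟨r.refl _, r.refl _⟩⟩
    ⟨fun h => (hy h).elim, fun _ => ⟨pairing_fst, r.refl _⟩⟩
    ⟨fun _ => ⟨pairing_snd, pairing_thd⟩, fun h => (h hz).elim⟩

theorem isCircleEquiv_xz (d : L.LocalTriangle i j G a x y z u v w t₁ t₂ m₁ m₂ b₁ b₂)
    (hm : j m₀ = point L.mark) (hS : ∀ c, i c ∈ S ↔ c ∈ S₀) (hx : ¬ (x ∈ S ↔ a = true))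
    (hy : y ∈ S ↔ a = false) (hz : ¬ (z ∈ S ↔ a = true)) :
    IsCircleEquiv (pairing (G S₀) m₁ m₂ t₁ b₂ t₂ b₁) m₀ (L.circles S) (point L.mark) j := by
  have t : ∀ {a b c}, L.circles S a b → L.circles S b c → L.circles S a c := (L.circles S).trans
  have s : ∀ {a b}, L.circles S a b → L.circles S b a := (L.circles S).symm
  have cx := (d.circles_x S).2 hx
  have cy := (d.circles_y S).1 hy
  have cz := (d.circles_z S).2 hz
  let r := pairing (G S₀) m₁ m₂ t₁ b₂ t₂ b₁
  exact d.isCircleEquiv_of hm hS m₁ t₁ m₂ (s cx.1) (s cx.2) (s cz.2)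
    (pairing_le (d.circles_of hS) (t (s cx.1) (t cy.1 cz.2)) (t (s cx.2) cz.1) cy.2)
    (fun _ _ => pairing_of)
    ⟨fun h => (hx h).elim, fun _ => ⟨r.refl _, r.refl _⟩⟩
    ⟨fun _ => ⟨pairing_fst, pairing_thd⟩, fun h => (h hy).elim⟩
    ⟨fun h => (hz h).elim, fun _ => ⟨pairing_snd, r.refl _⟩⟩

theorem isCircleEquiv_yz (d : L.LocalTriangle i j G a x y z u v w t₁ t₂ m₁ m₂ b₁ b₂)
    (hm : j m₀ = point L.mark) (hS : ∀ c, i c ∈ S ↔ c ∈ S₀) (hx : x ∈ S ↔ a = true)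
    (hy : ¬ (y ∈ S ↔ a = false)) (hz : ¬ (z ∈ S ↔ a = true)) :
    IsCircleEquiv (pairing (G S₀) b₁ b₂ t₂ m₂ t₁ m₁) m₀ (L.circles S) (point L.mark) j := by
  have t : ∀ {a b c}, L.circles S a b → L.circles S b c → L.circles S a c := (L.circles S).trans
  have s : ∀ {a b}, L.circles S a b → L.circles S b a := (L.circles S).symm
  have cx := (d.circles_x S).1 hx
  have cy := (d.circles_y S).2 hy
  have cz := (d.circles_z S).2 hz
  let r := pairing (G S₀) b₁ b₂ t₂ m₂ t₁ m₁
  exact d.isCircleEquiv_of hm hS b₁ b₂ t₂ (s cy.1) (s cz.1) (s cy.2)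
    (pairing_le (d.circles_of hS) (t (s cy.1) (t cx.1 cz.1)) (t (s cy.2) cz.2) cx.2)
    (fun _ _ => pairing_of)
    ⟨fun _ => ⟨pairing_fst, pairing_thd⟩, fun h => (h hx).elim⟩
    ⟨fun h => (hy h).elim, fun _ => ⟨r.refl _, r.refl _⟩⟩
    ⟨fun h => (hz h).elim, fun _ => ⟨r.refl _, pairing_snd⟩⟩

theorem isCircleEquiv_xyz (d : L.LocalTriangle i j G a x y z u v w t₁ t₂ m₁ m₂ b₁ b₂)
    (hm : j m₀ = point L.mark) (hS : ∀ c, i c ∈ S ↔ c ∈ S₀) (hx : ¬ (x ∈ S ↔ a = true))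
    (hy : ¬ (y ∈ S ↔ a = false)) (hz : ¬ (z ∈ S ↔ a = true)) :
    IsCircleEquiv (pairing (G S₀) m₁ b₁ t₁ b₂ t₂ m₂) m₀ (L.circles S) (point L.mark) j := by
  have t : ∀ {a b c}, L.circles S a b → L.circles S b c → L.circles S a c := (L.circles S).trans
  have s : ∀ {a b}, L.circles S a b → L.circles S b a := (L.circles S).symm
  have cx := (d.circles_x S).2 hx
  have cy := (d.circles_y S).2 hy
  have cz := (d.circles_z S).2 hz
  let r := pairing (G S₀) m₁ b₁ t₁ b₂ t₂ m₂
  exact d.isCircleEquiv_of hm hS m₁ t₁ t₂ (s cx.1) (s cx.2) (s cy.2)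
    (pairing_le (d.circles_of hS) (t (s cx.1) cy.1) (t (s cx.2) cz.1) (t (s cy.2) cz.2))
    (fun _ _ => pairing_of)
    ⟨fun h => (hx h).elim, fun _ => ⟨r.refl _, r.refl _⟩⟩
    ⟨fun h => (hy h).elim, fun _ => ⟨pairing_fst, r.refl _⟩⟩
    ⟨fun h => (hz h).elim, fun _ => ⟨pairing_snd, pairing_thd⟩⟩

/-- The triangle is split off by the resolution in which its three corners are closed. -/
theorem isolatesCircle_comap (d : L.LocalTriangle i j G a x y z u v w t₁ t₂ m₁ m₂ b₁ b₂)
    (hm : j m₀ = point L.mark) (hS : ∀ c, i c ∈ S ↔ c ∈ S₀) (hx : x ∈ S ↔ a = true)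
    (hy : y ∈ S ↔ a = false) (hz : z ∈ S ↔ a = true) :
    IsolatesCircle ((L.circles S).comap j) m₀ (L.circles S) (point L.mark) j u := by
  have cx := (d.circles_x S).1 hx
  have cy := (d.circles_y S).1 hy
  have key : ∀ e f, L.circles S e f → ((e = u ∨ e = v ∨ e = w) ↔ (f = u ∨ f = v ∨ f = w)) := by
    have hj : ∀ e, ¬ (j e = u ∨ j e = v ∨ j e = w) := by
      rintro e (h | h | h)
      exacts [(d.notMem e).1 h, (d.notMem e).2.1 h, (d.notMem e).2.2 h]
    intro e f h
    induction h with
    | rel e f h =>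
      rcases d.joined_cases S S₀ hS e f h with ⟨e', f', rfl, rfl, h⟩ | ⟨c, hc, h⟩
      · exact iff_of_false (hj _) (hj _)
      · refine h (fun e f => (e = u ∨ e = v ∨ e = w) ↔ (f = u ∨ f = v ∨ f = w)) ?_
        rcases hc with rfl | rfl | rfl
        · rw [d.resolved_x S (fun e f => _ ↔ _) Iff.symm]
          exact ⟨fun _ => ⟨by simp, iff_of_false (hj _) (hj _)⟩, fun h => (h hx).elim⟩
        · rw [d.resolved_y S (fun e f => _ ↔ _) Iff.symm]
          exact ⟨fun _ => ⟨by simp, iff_of_false (hj _) (hj _)⟩, fun h => (h hy).elim⟩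
        · rw [d.resolved_z S (fun e f => _ ↔ _) Iff.symm]
          exact ⟨fun _ => ⟨by simp, iff_of_false (hj _) (hj _)⟩, fun h => (h hz).elim⟩
    | refl => exact Iff.rfl
    | symm _ _ _ ih => exact ih.symm
    | trans _ _ _ _ _ ih₁ ih₂ => exact ih₁.trans ih₂
  refine ⟨fun e f => Iff.rfl, fun e h => ?_, fun e => ?_, ?_⟩
  · rcases (key _ _ h).2 (Or.inl rfl) with h | h | h
    exacts [(d.notMem e).1 h, (d.notMem e).2.1 h, (d.notMem e).2.2 h]
  · rcases d.side_or e with rfl | rfl | rfl | ⟨e', rfl⟩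
    exacts [Or.inl ((L.circles S).refl _), Or.inl ((L.circles S).symm cx.1),
      Or.inl ((L.circles S).symm cy.1), Or.inr ⟨e', (L.circles S).refl _⟩]
  · rw [hm]

/-- Opening a corner of the triangle merges the triangle into another circle. -/
theorem exists_merge (d : L.LocalTriangle i j G a x y z u v w t₁ t₂ m₁ m₂ b₁ b₂)
    (hm : j m₀ = point L.mark) (hS : ∀ c, i c ∈ S ↔ c ∈ S₀) (hx : x ∈ S ↔ a = true)
    (hy : y ∈ S ↔ a = false) (hz : z ∈ S ↔ a = true) {c : L.Crossing} (hc : c = x ∨ c = y ∨ c = z)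
    (hs : Surgery (L.circles S) (L.circles S') (L.underIn c) (L.underOut c)) :
    ∃ e, Merge (L.circles S) (L.circles S') u (j e) := by
  have cx := (d.circles_x S).1 hx
  have cy := (d.circles_y S).1 hy
  have h : ∀ e, e = u ∨ e = v ∨ e = w → L.circles S e u := by
    rintro e (rfl | rfl | rfl)
    exacts [(L.circles S).refl _, (L.circles S).symm cx.1, (L.circles S).symm cy.1]
  refine (d.isolatesCircle_comap hm hS hx hy hz).exists_merge hs ?_
  exact (d.arc c hc).imp (And.imp_left (h _)) (And.imp_left (h _))

theorem isolatesCircle (d : L.LocalTriangle i j G a x y z u v w t₁ t₂ m₁ m₂ b₁ b₂)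
    (hm : j m₀ = point L.mark) (hS : ∀ c, i c ∈ S ↔ c ∈ S₀) (hx : x ∈ S ↔ a = true)
    (hy : y ∈ S ↔ a = false) (hz : z ∈ S ↔ a = true) (hS' : ∀ c, i c ∈ S' ↔ c ∈ S₀)
    (hx' : ¬ (x ∈ S' ↔ a = true)) (hy' : y ∈ S' ↔ a = false) (hz' : z ∈ S' ↔ a = true)
    (hs : Surgery (L.circles S) (L.circles S') (L.underIn x) (L.underOut x)) :
    IsolatesCircle (pairing (G S₀) t₁ m₁ t₂ b₁ m₂ b₂) m₀ (L.circles S) (point L.mark) j u := by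
  have h := d.isolatesCircle_comap hm hS hx hy hz
  obtain ⟨e, he⟩ := d.exists_merge hm hS hx hy hz (Or.inl rfl) hs
  have h₁ := h.isCircleEquiv_of_merge he
  have h₂ := d.isCircleEquiv_x hm hS' hx' hy' hz'
  exact ⟨fun e f => (h₂.rel e f).trans (h₁.rel e f).symm, h.not_rel, h.cover, h.mark⟩

end Patterns

end LocalTriangle

end MarkedDiagram

/-! ### The third Reidemeister move for link diagrams -/

namespace MarkedDiagram

open Passage DiffModule SurgeryCube CircleAlgebra

variable {L L' : MarkedDiagram}

namespace LocalTriangle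

variable {X₀ E₀ : Type} [DecidableEq X₀] [Fintype X₀] [Fintype E₀]
  {j : E₀ → L.Edge} {j' : E₀ → L'.Edge} {m₀ : E₀}
  {G : Finset X₀ → E₀ → E₀ → Prop} {a : Bool} {u v w : L.Edge} {u' v' w' : L'.Edge}
  {t₁ t₂ m₁ m₂ b₁ b₂ : E₀}

theorem exists_triangle_low {e : Option (Option (Option X₀)) ≃ L.Crossing}
    (d : L.LocalTriangle (fun c => e (some (some (some c)))) j G false (e (some none))
      (e (some (some none))) (e none) u v w t₁ t₂ m₁ m₂ b₁ b₂) (hm : j m₀ = point L.mark) :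
    Nonempty (Triangle (L.cube.relabel e).low (L.cube.relabel e).high j m₀ (point L.mark)
      (fun S => pairing (G S) m₁ b₁ t₁ t₂ m₂ b₂) (fun S => pairing (G S) b₁ b₂ t₂ m₂ t₁ m₁)
      (fun S => pairing (G S) m₁ m₂ t₁ b₂ t₂ b₁) (fun S => pairing (G S) t₁ m₁ t₂ b₁ m₂ b₂)
      (fun S => pairing (G S) m₁ b₁ t₁ b₂ t₂ m₂)) := by
  let C := L.cube.relabel e
  choose f hf using fun S : Finset X₀ => d.exists_merge (S₀ := S) hm (by simp) (by simp) (by simp)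
    (by simp) (Or.inl rfl) (C.low.surgery_low_high (Finset.insertNone S))
  choose f' hf' using fun S : Finset X₀ => d.exists_merge (S₀ := S) hm (by simp) (by simp)
    (by simp) (by simp) (Or.inr (Or.inl rfl)) (C.low.low.surgery_low_high S).symm
  choose g hg using fun S : Finset X₀ => d.exists_merge (S₀ := S) hm (by simp) (by simp)
    (by simp) (by simp) (Or.inr (Or.inr rfl))
    (C.surgery_low_high ((Finset.insertNone S).map Function.Embedding.some))
  exact ⟨{
    u := u, a := f, a' := f', b := g
    isolates := fun S => d.isolatesCircle hm (by simp) (by simp) (by simp) (by simp) (by simp)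
      (by simp) (by simp) (by simp) (C.low.surgery_low_high (Finset.insertNone S))
    merge := hf
    merge' := hf'
    merge_base := hg
    core := fun S => d.isCircleEquiv_xy hm (by simp) (by simp) (by simp) (by simp)
    lowLow := fun S => d.isCircleEquiv_yz hm (by simp) (by simp) (by simp) (by simp)
    highHigh := fun S => d.isCircleEquiv_xz hm (by simp) (by simp) (by simp) (by simp)
    highLow := fun S => d.isCircleEquiv_xyz hm (by simp) (by simp) (by simp) (by simp)
    arcs := d.arcs }⟩

theorem exists_triangle_high {e : Option (Option (Option X₀)) ≃ L.Crossing}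
    (d : L.LocalTriangle (fun c => e (some (some (some c)))) j G true (e (some (some none)))
      (e (some none)) (e none) u v w t₁ t₂ m₁ m₂ b₁ b₂) (hm : j m₀ = point L.mark) :
    Nonempty (Triangle (L.cube.relabel e).high (L.cube.relabel e).low j m₀ (point L.mark)
      (fun S => pairing (G S) m₁ b₁ t₁ t₂ m₂ b₂) (fun S => pairing (G S) m₁ m₂ t₁ b₂ t₂ b₁)
      (fun S => pairing (G S) b₁ b₂ t₂ m₂ t₁ m₁) (fun S => pairing (G S) t₁ m₁ t₂ b₁ m₂ b₂)
      (fun S => pairing (G S) m₁ b₁ t₁ b₂ t₂ m₂)) := by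
  let C := L.cube.relabel e
  choose f hf using fun S : Finset X₀ => d.exists_merge (S₀ := S) hm (by simp) (by simp) (by simp)
    (by simp) (Or.inr (Or.inl rfl)) (C.high.surgery_low_high (Finset.insertNone S))
  choose f' hf' using fun S : Finset X₀ => d.exists_merge (S₀ := S) hm (by simp) (by simp)
    (by simp) (by simp) (Or.inl rfl) (C.high.low.surgery_low_high S).symm
  choose g hg using fun S : Finset X₀ => d.exists_merge (S₀ := S) hm (by simp) (by simp)
    (by simp) (by simp) (Or.inr (Or.inr rfl))
    (C.surgery_low_high ((Finset.insertNone S).map Function.Embedding.some)).symm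
  exact ⟨{
    u := u, a := f, a' := f', b := g
    isolates := fun S => d.isolatesCircle hm (by simp) (by simp) (by simp) (by simp) (by simp)
      (by simp) (by simp) (by simp) (C.high.low.surgery_low_high S).symm
    merge := hf
    merge' := hf'
    merge_base := hg
    core := fun S => d.isCircleEquiv_xy hm (by simp) (by simp) (by simp) (by simp)
    lowLow := fun S => d.isCircleEquiv_xz hm (by simp) (by simp) (by simp) (by simp)
    highHigh := fun S => d.isCircleEquiv_yz hm (by simp) (by simp) (by simp) (by simp)
    highLow := fun S => d.isCircleEquiv_xyz hm (by simp) (by simp) (by simp) (by simp)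
    arcs := d.arcs }⟩

/-- Two diagrams which have a triangle with opposite orders of the corners on the three strands, and
agree otherwise, have homotopy equivalent complexes. -/
theorem hEquiv {x y z : L.Crossing} {x' y' z' : L'.Crossing} {e : Option (Option (Option X₀)) ≃ L.Crossing}
    {e' : Option (Option (Option X₀)) ≃ L'.Crossing}
    (hx : e (if a then some (some none) else some none) = x)
    (hy : e (if a then some none else some (some none)) = y) (hz : e none = z)
    (hx' : e' (if a then some (some none) else some none) = x')
    (hy' : e' (if a then some none else some (some none)) = y') (hz' : e' none = z')
    (d : L.LocalTriangle (fun c => e (some (some (some c)))) j G a x y z u v w t₁ t₂ m₁ m₂ b₁ b₂)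
    (d' : L'.LocalTriangle (fun c => e' (some (some (some c)))) j' G a x' y' z' u' v' w'
      t₂ t₁ m₂ m₁ b₂ b₁)
    (hm : j m₀ = point L.mark) (hm' : j' m₀ = point L'.mark) (hn : L.nPlus = L'.nPlus)
    {R : Type} [CommRing R] [Algebra (ZMod 2) R] (w₀ : E₀ → R) :
    HEquiv (L.weightComplex (pushWeight j w₀)) (L'.weightComplex (pushWeight j' w₀)) := by
  subst hx hy hz hx' hy' hz'
  refine (relabelMap_isIso L.cube e _ _).hEquiv.trans (HEquiv.trans ?_
    (relabelMap_isIso L'.cube e' _ _).hEquiv.symm)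
  rw [hn]
  cases a with
  | false =>
    obtain ⟨t⟩ := exists_triangle_low d hm
    obtain ⟨t'⟩ := exists_triangle_low d' hm'
    rw [funext fun S => pairing_reverse_swap_snd (g := G S) (a := m₂),
      funext fun S => pairing_swap_fst_comm (g := G S) (a := b₂),
      funext fun S => pairing_swap_fst_comm (g := G S) (a := m₂) (a' := m₁),
      funext fun S => pairing_reverse (g := G S) (a := t₂),
      funext fun S => pairing_reverse (g := G S) (a := m₂)] at t'
    exact Triangle.hEquiv_of_low t t' w₀ _
  | true =>
    obtain ⟨t⟩ := exists_triangle_high d hm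
    obtain ⟨t'⟩ := exists_triangle_high d' hm'
    rw [funext fun S => pairing_reverse_swap_snd (g := G S) (a := m₂),
      funext fun S => pairing_swap_fst_comm (g := G S) (a := b₂),
      funext fun S => pairing_swap_fst_comm (g := G S) (a := m₂) (a' := m₁),
      funext fun S => pairing_reverse (g := G S) (a := t₂),
      funext fun S => pairing_reverse (g := G S) (a := m₂)] at t'
    exact Triangle.hEquiv_of_high t t' w₀ _

end LocalTriangle

/-- The gluing of edges at the points and at the crossings `i c`. -/
inductive OuterJoined (L : MarkedDiagram) {X₀ : Type} (i : X₀ → L.Crossing) (S : Finset X₀) :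
    L.Edge → L.Edge → Prop
  | point (p : L.Point) : OuterJoined L i S (L.next.symm (point p)) (point p)
  | oriented_under (c : X₀) : (L.rightHanded (i c) = true ↔ c ∉ S) →
      OuterJoined L i S (L.underIn (i c)) (L.overOut (i c))
  | oriented_over (c : X₀) : (L.rightHanded (i c) = true ↔ c ∉ S) →
      OuterJoined L i S (L.overIn (i c)) (L.underOut (i c))
  | unoriented_in (c : X₀) : ¬ (L.rightHanded (i c) = true ↔ c ∉ S) →
      OuterJoined L i S (L.underIn (i c)) (L.overIn (i c))
  | unoriented_out (c : X₀) : ¬ (L.rightHanded (i c) = true ↔ c ∉ S) →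
      OuterJoined L i S (L.underOut (i c)) (L.overOut (i c))

/-- A strand through a corner of a triangle runs along the side `i` of the triangle and along the edge
`p` outside. It leaves the corner along `i` if `P = true`, and arrives along `i` otherwise. -/
def IsCornerStrand {E : Type} (inn out : E) (P : Bool) (i p : E) : Prop :=
  inn = (if P then p else i) ∧ out = if P then i else p

theorem resolved_iff_corner {S : Finset L.Crossing} {c : L.Crossing}
    {r : L.Edge → L.Edge → Prop} (hr : ∀ {a b}, r a b → r b a) {P Q col : Bool}
    {i p k q : L.Edge} (h : IsCornerStrand (L.overIn c) (L.overOut c) P i p)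
    (h' : IsCornerStrand (L.underIn c) (L.underOut c) Q k q)
    (hcol : L.rightHanded c = (col == (P == Q))) :
    L.Resolved S c r ↔ ((c ∈ S ↔ col = true) → r i k ∧ r p q) ∧
      (¬ (c ∈ S ↔ col = true) → r i q ∧ r k p) := by
  have hs : ∀ a b, r a b ↔ r b a := fun a b => ⟨hr, hr⟩
  obtain ⟨h₁, h₂⟩ := h
  obtain ⟨h₃, h₄⟩ := h'
  rw [Resolved, h₁, h₂, h₃, h₄, OrientedAt, hcol]
  by_cases hc : c ∈ S <;> cases col <;> cases P <;> cases Q <;> simp [hc] <;>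
    simp only [hs q, hs k p, hs k i, and_comm, implies_true]

theorem IsCornerStrand.or {E : Type} {inn out : E} {P : Bool} {i p : E}
    (h : IsCornerStrand inn out P i p) : (inn = i ∧ out = p) ∨ (out = i ∧ inn = p) := by
  obtain ⟨h₁, h₂⟩ := h
  cases P
  exacts [Or.inl ⟨h₁, h₂⟩, Or.inr ⟨h₂, h₁⟩]

/-- A strand of a triangle, having its corners at the passages `m` and `n`, which it meets in this order
if `s = true`. -/
theorem isCornerStrand_of_next {E : Type} (next : Equiv.Perm E) {m n i : E} {s : Bool}
    (hi : i = if s then m else n) (h : next i = if s then n else m) :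
    IsCornerStrand (next.symm m) m s i (if s then next.symm m else m) ∧
    IsCornerStrand (next.symm n) n (!s) i (if s then n else next.symm n) := by
  cases s <;> simp only [if_true, if_false, Bool.false_eq_true] at h hi <;>
    rw [← Equiv.eq_symm_apply] at h <;> simp [IsCornerStrand, hi, ← h]

/-- The handedness of a corner of a triangular face is determined by the directions of the two strands
and by the sides of them on which the face lies. -/
theorem left_eq_iff_of_corner {c : L.Crossing} {P Q : Bool} {i p k q : L.Edge}
    (h : IsCornerStrand (L.overIn c) (L.overOut c) P i p)
    (h' : IsCornerStrand (L.underIn c) (L.underOut c) Q k q) {t : L.Face}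
    (hi : L.left i = t ∨ L.right i = t) (hk : L.left k = t ∨ L.right k = t)
    (hp : ¬ (L.left p = t ∨ L.right p = t)) (hq : ¬ (L.left q = t ∨ L.right q = t)) :
    (L.left i = t ↔ L.rightHanded c = Q) ∧ (L.left k = t ↔ L.rightHanded c = !P) := by
  obtain ⟨h₁, h₂⟩ := h
  obtain ⟨h₃, h₄⟩ := h'
  cases hc : L.rightHanded c with
  | true =>
    have e := L.right_handed c hc
    change L.left (L.underOut c) = L.left (L.overIn c) ∧ L.right (L.underOut c) =
      L.left (L.overOut c) ∧ L.left (L.underIn c) = L.right (L.overIn c) ∧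
      L.right (L.underIn c) = L.right (L.overOut c) at e
    rw [h₁, h₂, h₃, h₄] at e
    cases P <;> cases Q <;> simp only [if_true, if_false, Bool.false_eq_true] at e <;> grind
  | false =>
    have e := L.left_handed c hc
    change L.left (L.underOut c) = L.right (L.overOut c) ∧ L.right (L.underOut c) =
      L.right (L.overIn c) ∧ L.left (L.underIn c) = L.left (L.overOut c) ∧
      L.right (L.underIn c) = L.left (L.overIn c) at e
    rw [h₁, h₂, h₃, h₄] at e
    cases P <;> cases Q <;> simp only [if_true, if_false, Bool.false_eq_true] at e <;> grind

/-- A triangle in `L'`, when the edges of `L'` are labelled through those of a diagram `L` that looks the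
same outside the triangle. -/
theorem localTriangle_of {X₀ E₀ : Type} {val : E₀ → L.Edge} (hval : Function.Injective val)
    {u v w : L.Edge} (hcov : ∀ n, n = u ∨ n = v ∨ n = w ∨ ∃ e, val e = n)
    (hnot : ∀ e, val e ≠ u ∧ val e ≠ v ∧ val e ≠ w) (hne : u ≠ v ∧ u ≠ w ∧ v ≠ w)
    {i : X₀ → L.Crossing} {i' : X₀ → L'.Crossing} (τ : L.Edge ≃ L'.Edge)
    (eP : L.Point ≃ L'.Point) (hnext : ∀ n, L'.next (τ n) = τ (L.next n))
    (hp : ∀ a, τ (point a) = point (eP a)) (hu : ∀ c, τ (underpass (i c)) = underpass (i' c))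
    (ho : ∀ c, τ (overpass (i c)) = overpass (i' c))
    (hR : ∀ c, L'.rightHanded (i' c) = L.rightHanded (i c))
    {x y z : L'.Crossing} (hX : ∀ c, c = x ∨ c = y ∨ c = z ∨ ∃ c', i' c' = c)
    (hP : ∀ a, (∃ e, val e = L.next.symm (point a)) ∧ ∃ e, val e = point a)
    (hO : ∀ c, ((∃ e, val e = L.underIn (i c)) ∧ ∃ e, val e = L.underOut (i c)) ∧
      (∃ e, val e = L.overIn (i c)) ∧ ∃ e, val e = L.overOut (i c))
    {t₁ t₂ m₁ m₂ b₁ b₂ : E₀} {a T M B : Bool}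
    (hxT : IsCornerStrand (L'.overIn x) (L'.overOut x) T (τ u) (τ (val t₁)))
    (hxM : IsCornerStrand (L'.underIn x) (L'.underOut x) M (τ v) (τ (val m₁)))
    (hyT : IsCornerStrand (L'.overIn y) (L'.overOut y) (!T) (τ u) (τ (val t₂)))
    (hyB : IsCornerStrand (L'.underIn y) (L'.underOut y) B (τ w) (τ (val b₁)))
    (hzM : IsCornerStrand (L'.overIn z) (L'.overOut z) (!M) (τ v) (τ (val m₂)))
    (hzB : IsCornerStrand (L'.underIn z) (L'.underOut z) (!B) (τ w) (τ (val b₂)))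
    (hx : L'.rightHanded x = (a == (T == M))) (hy : L'.rightHanded y = ((!a) == ((!T) == B)))
    (hz : L'.rightHanded z = (a == ((!M) == (!B)))) :
    L'.LocalTriangle i' (fun e => τ (val e)) (fun S e f => L.OuterJoined i S (val e) (val f)) a
      x y z (τ u) (τ v) (τ w) t₁ t₂ m₁ m₂ b₁ b₂ := by
  have hin : ∀ n, τ (L.next.symm n) = L'.next.symm (τ n) := by
    intro n
    rw [Equiv.eq_symm_apply, hnext, Equiv.apply_symm_apply]
  have hor : ∀ (S : Finset L'.Crossing) (S₀ : Finset X₀), (∀ c, i' c ∈ S ↔ c ∈ S₀) → ∀ c,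
      L'.OrientedAt S (i' c) ↔ (L.rightHanded (i c) = true ↔ c ∉ S₀) := by
    intro S S₀ hS c
    rw [OrientedAt, hR, hS]
  refine ⟨fun S r hr => resolved_iff_corner hr hxT hxM hx, fun S r hr => ?_,
    fun S r hr => resolved_iff_corner hr hzM hzB hz, ?_, ?_, fun e f h => hval (τ.injective h), ?_,
    fun e => ?_, ?_, ?_, fun c => ?_⟩
  · rw [resolved_iff_corner hr hyT hyB hy]
    simp
  · intro S S₀ hS e f h
    generalize val e = e at h
    generalize val f = f at h
    cases h with
    | point p => rw [hin, hp]; exact .point _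
    | oriented_under c h =>
      rw [hin, hu, ho]; exact .oriented_under _ ((hor S S₀ hS c).2 h)
    | oriented_over c h =>
      rw [hin, hu, ho]; exact .oriented_over _ ((hor S S₀ hS c).2 h)
    | unoriented_in c h =>
      rw [hin, hin, hu, ho]; exact .unoriented_in _ fun h' => h ((hor S S₀ hS c).1 h')
    | unoriented_out c h =>
      rw [hu, ho]; exact .unoriented_out _ fun h' => h ((hor S S₀ hS c).1 h')
  · intro S S₀ hS e f h
    have outer : ∀ {e f : L.Edge}, (∃ e', val e' = e) → (∃ f', val f' = f) →
        L.OuterJoined i S₀ e f → ∃ e' f', τ e = τ (val e') ∧ τ f = τ (val f') ∧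
          L.OuterJoined i S₀ (val e') (val f') := by
      rintro _ _ ⟨e, rfl⟩ ⟨f, rfl⟩ h
      exact ⟨e, f, rfl, rfl, h⟩
    have hX' : ∀ c, (c = x ∨ c = y ∨ c = z) ∨ ∃ c', i' c' = c := fun c => by
      rcases hX c with h | h | h | h
      exacts [Or.inl (Or.inl h), Or.inl (Or.inr (Or.inl h)), Or.inl (Or.inr (Or.inr h)), Or.inr h]
    cases h with
    | point p =>
      obtain ⟨p, rfl⟩ := eP.surjective p
      rw [← hp, ← hin]
      exact Or.inl (outer (hP p).1 (hP p).2 (.point p))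
    | oriented_under c h =>
      rcases hX' c with hc | ⟨c, rfl⟩
      · exact Or.inr ⟨c, hc, fun r hr => (hr.1 h).1⟩
      · rw [← hu, ← ho, ← hin]
        exact Or.inl (outer (hO c).1.1 (hO c).2.2 (.oriented_under c ((hor S S₀ hS c).1 h)))
    | oriented_over c h =>
      rcases hX' c with hc | ⟨c, rfl⟩
      · exact Or.inr ⟨c, hc, fun r hr => (hr.1 h).2⟩
      · rw [← hu, ← ho, ← hin]
        exact Or.inl (outer (hO c).2.1 (hO c).1.2 (.oriented_over c ((hor S S₀ hS c).1 h)))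
    | unoriented_in c h =>
      rcases hX' c with hc | ⟨c, rfl⟩
      · exact Or.inr ⟨c, hc, fun r hr => (hr.2 h).1⟩
      · rw [← hu, ← ho, ← hin, ← hin]
        exact Or.inl (outer (hO c).1.1 (hO c).2.1
          (.unoriented_in c fun h' => h ((hor S S₀ hS c).2 h')))
    | unoriented_out c h =>
      rcases hX' c with hc | ⟨c, rfl⟩
      · exact Or.inr ⟨c, hc, fun r hr => (hr.2 h).2⟩
      · rw [← hu, ← ho]
        exact Or.inl (outer (hO c).1.2 (hO c).2.2
          (.unoriented_out c fun h' => h ((hor S S₀ hS c).2 h')))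
  · intro e
    obtain ⟨n, rfl⟩ := τ.surjective e
    rcases hcov n with rfl | rfl | rfl | ⟨e, rfl⟩
    exacts [Or.inl rfl, Or.inr (Or.inl rfl), Or.inr (Or.inr (Or.inl rfl)),
      Or.inr (Or.inr (Or.inr ⟨e, rfl⟩))]
  · exact ⟨τ.injective.ne (hnot e).1, τ.injective.ne (hnot e).2.1, τ.injective.ne (hnot e).2.2⟩
  · exact ⟨τ.injective.ne hne.1, τ.injective.ne hne.2.1, τ.injective.ne hne.2.2⟩
  · rintro c (rfl | rfl | rfl)
    · rcases hxM.or with ⟨h, h'⟩ | ⟨h, h'⟩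
      exacts [Or.inl ⟨Or.inr (Or.inl h), _, h'⟩, Or.inr ⟨Or.inr (Or.inl h), _, h'⟩]
    · rcases hyB.or with ⟨h, h'⟩ | ⟨h, h'⟩
      exacts [Or.inl ⟨Or.inr (Or.inr h), _, h'⟩, Or.inr ⟨Or.inr (Or.inr h), _, h'⟩]
    · rcases hzB.or with ⟨h, h'⟩ | ⟨h, h'⟩
      exacts [Or.inl ⟨Or.inr (Or.inr h), _, h'⟩, Or.inr ⟨Or.inr (Or.inr h), _, h'⟩]
  · obtain ⟨⟨⟨e, he⟩, ⟨f, hf⟩⟩, -⟩ := hO c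
    refine ⟨e, f, ?_, ?_⟩
    · rw [he, hin, hu]
    · rw [hf, hu]

end MarkedDiagram

namespace MarkedDiagram

open Passage DiffModule SurgeryCube CircleAlgebra

variable {L L' : MarkedDiagram}

/-- An enumeration of a set, starting with three given elements. -/
theorem exists_equiv_of_triple {X₀ X : Type} {i : X₀ → X} (hi : Function.Injective i) {c c₀ c₁ : X}
    (h₀ : c ≠ c₀) (h₁ : c ≠ c₁) (h₂ : c₀ ≠ c₁) (hn : ∀ a, i a ≠ c ∧ i a ≠ c₀ ∧ i a ≠ c₁)
    (hc : ∀ b, b = c ∨ b = c₀ ∨ b = c₁ ∨ ∃ a, i a = b) :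
    ∃ e : Option (Option (Option X₀)) ≃ X, e none = c ∧ e (some none) = c₀ ∧
      e (some (some none)) = c₁ ∧ ∀ a, e (some (some (some a))) = i a := by
  let f : Option (Option (Option X₀)) → X
    | none => c
    | some none => c₀
    | some (some none) => c₁
    | some (some (some a)) => i a
  have hf : Function.Bijective f := by
    constructor
    · rintro (_ | _ | _ | a) (_ | _ | _ | b) h
      · rfl
      · exact (h₀ h).elim
      · exact (h₁ h).elim
      · exact ((hn b).1 h.symm).elim
      · exact (h₀ h.symm).elim
      · rfl
      · exact (h₂ h).elim
      · exact ((hn b).2.1 h.symm).elim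
      · exact (h₁ h.symm).elim
      · exact (h₂ h.symm).elim
      · rfl
      · exact ((hn b).2.2 h.symm).elim
      · exact ((hn a).1 h).elim
      · exact ((hn a).2.1 h).elim
      · exact ((hn a).2.2 h).elim
      · exact congrArg (some ∘ some ∘ some) (hi h)
    · intro b
      rcases hc b with rfl | rfl | rfl | ⟨a, rfl⟩
      exacts [⟨none, rfl⟩, ⟨some none, rfl⟩, ⟨some (some none), rfl⟩, ⟨some (some (some a)), rfl⟩]
  exact ⟨Equiv.ofBijective f hf, rfl, rfl, rfl, fun _ => rfl⟩

theorem IsReidemeisterIII.hasEquivalentComplexes (h : L.IsReidemeisterIII L') :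
    HasEquivalentComplexes L L' := by
  classical
  obtain ⟨eX, eP, -, x, y, z, u, v, w, t, hxy, hyz, hxz, hu, hu', hv, hv', hw, hw', ht, hr, hm, hn,
    -⟩ := h
  set σ : Equiv.Perm L.Edge :=
      Equiv.swap (.overpass x) (.overpass y) * Equiv.swap (.underpass x) (.overpass z) *
        Equiv.swap (.underpass y) (.underpass z) with hσ
  have σox : σ (overpass x) = overpass y := by
    simp [hσ, Equiv.swap_apply_of_ne_of_ne, hxz]
  have σoy : σ (overpass y) = overpass x := by
    simp [hσ, Equiv.swap_apply_of_ne_of_ne, hyz]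
  have σux : σ (underpass x) = overpass z := by
    simp [hσ, Equiv.swap_apply_of_ne_of_ne, hxy, hxz, hxz.symm, hyz.symm]
  have σoz : σ (overpass z) = underpass x := by
    simp [hσ, Equiv.swap_apply_of_ne_of_ne]
  have σuy : σ (underpass y) = underpass z := by
    simp [hσ, Equiv.swap_apply_of_ne_of_ne, hxz.symm]
  have σuz : σ (underpass z) = underpass y := by
    simp [hσ, Equiv.swap_apply_of_ne_of_ne, hxy.symm]
  have σp : ∀ a, σ (point a) = point a := fun a => by
    simp [hσ, Equiv.swap_apply_of_ne_of_ne]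
  have σu : ∀ c, c ≠ x → c ≠ y → c ≠ z → σ (underpass c) = underpass c := fun c h₁ h₂ h₃ => by
    simp [hσ, Equiv.swap_apply_of_ne_of_ne, h₁, h₂, h₃]
  have σo : ∀ c, c ≠ x → c ≠ y → c ≠ z → σ (overpass c) = overpass c := fun c h₁ h₂ h₃ => by
    simp [hσ, Equiv.swap_apply_of_ne_of_ne, h₁, h₂, h₃]
  clear_value σ
  -- The directions of the three strands.
  obtain ⟨T, huT, hnu⟩ : ∃ T : Bool, u = (if T then overpass x else overpass y) ∧
      L.next u = if T then overpass y else overpass x := by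
    rcases hu with rfl | rfl
    exacts [⟨true, rfl, by rw [hu', σox]; rfl⟩, ⟨false, rfl, by rw [hu', σoy]; rfl⟩]
  obtain ⟨M, hvM, hnv⟩ : ∃ M : Bool, v = (if M then underpass x else overpass z) ∧
      L.next v = if M then overpass z else underpass x := by
    rcases hv with rfl | rfl
    exacts [⟨true, rfl, by rw [hv', σux]; rfl⟩, ⟨false, rfl, by rw [hv', σoz]; rfl⟩]
  obtain ⟨B, hwB, hnw⟩ : ∃ B : Bool, w = (if B then underpass y else underpass z) ∧
      L.next w = if B then underpass z else underpass y := by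
    rcases hw with rfl | rfl
    exacts [⟨true, rfl, by rw [hw', σuy]; rfl⟩, ⟨false, rfl, by rw [hw', σuz]; rfl⟩]
  clear hu hu' hv hv' hw hw'
  have hne : u ≠ v ∧ u ≠ w ∧ v ≠ w := by
    rw [huT, hvM, hwB]
    cases T <;> cases M <;> cases B <;> simp [hxy, hyz, hxz]
  obtain ⟨hxT, hyT⟩ := isCornerStrand_of_next L.next huT hnu
  obtain ⟨hxM, hzM⟩ := isCornerStrand_of_next L.next hvM hnv
  obtain ⟨hyB, hzB⟩ := isCornerStrand_of_next L.next hwB hnw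
  -- The edges leaving a passage, or arriving at it.
  have hout : ∀ n, (n = u → n = overpass x ∨ n = overpass y) ∧
      (n = v → n = underpass x ∨ n = overpass z) ∧
      (n = w → n = underpass y ∨ n = underpass z) := by
    rw [huT, hvM, hwB]
    refine fun n => ⟨?_, ?_, ?_⟩ <;> rintro rfl
    · cases T <;> simp
    · cases M <;> simp
    · cases B <;> simp
  have hinn : ∀ n, (L.next.symm n = u → n = overpass x ∨ n = overpass y) ∧
      (L.next.symm n = v → n = underpass x ∨ n = overpass z) ∧
      (L.next.symm n = w → n = underpass y ∨ n = underpass z) := by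
    refine fun n => ⟨?_, ?_, ?_⟩ <;> rw [Equiv.symm_apply_eq] <;> rintro rfl
    · rw [hnu]; cases T <;> simp
    · rw [hnv]; cases M <;> simp
    · rw [hnw]; cases B <;> simp
  let E₀ := {n : L.Edge // n ≠ u ∧ n ≠ v ∧ n ≠ w}
  have ends : (∀ e ∈ ({if T then L.next.symm (overpass x) else overpass x,
      if T then overpass y else L.next.symm (overpass y),
      if M then L.next.symm (underpass x) else underpass x,
      if M then overpass z else L.next.symm (overpass z),
      if B then L.next.symm (underpass y) else underpass y,
      if B then underpass z else L.next.symm (underpass z)} : Set L.Edge),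
      e ≠ u ∧ e ≠ v ∧ e ≠ w) := by
    rintro e (rfl | rfl | rfl | rfl | rfl | rfl)
    all_goals
      cases T <;> cases M <;> cases B <;>
      simp only [if_true, if_false, Bool.false_eq_true] at huT hvM hwB hnu hnv hnw ⊢ <;>
      simp only [ne_eq, Equiv.symm_apply_eq, hnu, hnv, hnw] <;>
      simp [huT, hvM, hwB, hxy, hyz, hxz, hxy.symm, hyz.symm, hxz.symm]
  let t₁ : E₀ := ⟨_, ends (if T then L.next.symm (overpass x) else overpass x) (by simp)⟩
  let t₂ : E₀ := ⟨_, ends (if T then overpass y else L.next.symm (overpass y)) (by simp)⟩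
  let m₁ : E₀ := ⟨_, ends (if M then L.next.symm (underpass x) else underpass x) (by simp)⟩
  let m₂ : E₀ := ⟨_, ends (if M then overpass z else L.next.symm (overpass z)) (by simp)⟩
  let b₁ : E₀ := ⟨_, ends (if B then L.next.symm (underpass y) else underpass y) (by simp)⟩
  let b₂ : E₀ := ⟨_, ends (if B then underpass z else L.next.symm (underpass z)) (by simp)⟩
  -- As the three sides bound a common face, the directions of the strands determine which
  -- resolutions close the corners.
  have far : ∀ n : E₀, ¬ (L.left n = t ∨ L.right n = t) := fun n h => by
    rcases (ht n).1 h with h | h | h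
    exacts [n.2.1 h, n.2.2.1 h, n.2.2.2 h]
  have near : (L.left u = t ∨ L.right u = t) ∧ (L.left v = t ∨ L.right v = t) ∧
      (L.left w = t ∨ L.right w = t) := by
    rw [ht, ht, ht]; simp
  obtain ⟨lx₁, lx₂⟩ := left_eq_iff_of_corner hxT hxM near.1 near.2.1 (far t₁) (far m₁)
  obtain ⟨ly₁, -⟩ := left_eq_iff_of_corner hyT hyB near.1 near.2.2 (far t₂) (far b₁)
  obtain ⟨lz₁, -⟩ := left_eq_iff_of_corner hzM hzB near.2.1 near.2.2 (far m₂) (far b₂)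
  obtain ⟨a, cx, cy, cz⟩ : ∃ a, L.rightHanded x = (a == (T == M)) ∧
      L.rightHanded y = ((!a) == ((!T) == B)) ∧ L.rightHanded z = (a == ((!M) == (!B))) := by
    have h₁ := lx₁.symm.trans ly₁
    have h₂ := lx₂.symm.trans lz₁
    have key : ∀ T M B p q r : Bool, (p = M ↔ q = B) → (p = !T ↔ r = !B) →
        p = ((p == (T == M)) == (T == M)) ∧ q = ((!(p == (T == M))) == ((!T) == B)) ∧
          r = ((p == (T == M)) == ((!M) == (!B))) := by decide
    exact ⟨_, key _ _ _ _ _ _ h₁ h₂⟩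
  let X₀ := {c : L.Crossing // c ≠ x ∧ c ≠ y ∧ c ≠ z}
  obtain ⟨e, ez, ex, ey, ei⟩ : ∃ e : Option (Option (Option X₀)) ≃ L.Crossing, e none = z ∧
      e (if a then some (some none) else some none) = x ∧
      e (if a then some none else some (some none)) = y ∧
      ∀ c, e (some (some (some c))) = c.1 := by
    have hc : ∀ b, b = x ∨ b = y ∨ b = z ∨ ∃ c : X₀, c.1 = b := fun b => by
      by_cases h₁ : b = x
      · exact Or.inl h₁
      by_cases h₂ : b = y
      · exact Or.inr (Or.inl h₂)
      by_cases h₃ : b = z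
      · exact Or.inr (Or.inr (Or.inl h₃))
      · exact Or.inr (Or.inr (Or.inr ⟨⟨b, h₁, h₂, h₃⟩, rfl⟩))
    cases a with
    | true =>
      obtain ⟨e, h₁, h₂, h₃, h₄⟩ := exists_equiv_of_triple (i := (Subtype.val : X₀ → L.Crossing))
        Subtype.val_injective hyz.symm hxz.symm hxy.symm (fun c => ⟨c.2.2.2, c.2.2.1, c.2.1⟩)
        fun b => by
          rcases hc b with h | h | h | h
          exacts [Or.inr (Or.inr (Or.inl h)), Or.inr (Or.inl h), Or.inl h,
            Or.inr (Or.inr (Or.inr h))]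
      exact ⟨e, h₁, h₃, h₂, h₄⟩
    | false =>
      obtain ⟨e, h₁, h₂, h₃, h₄⟩ := exists_equiv_of_triple (i := (Subtype.val : X₀ → L.Crossing))
        Subtype.val_injective hxz.symm hyz.symm hxy (fun c => ⟨c.2.2.2, c.2.1, c.2.2.1⟩)
        fun b => by
          rcases hc b with h | h | h | h
          exacts [Or.inr (Or.inl h), Or.inr (Or.inr (Or.inl h)), Or.inl h,
            Or.inr (Or.inr (Or.inr h))]
      exact ⟨e, h₁, h₂, h₃, h₄⟩
  have outer : ∀ n : L.Edge, n ≠ overpass x → n ≠ overpass y → n ≠ underpass x → n ≠ overpass z →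
      n ≠ underpass y → n ≠ underpass z →
      (∃ e : E₀, e.1 = L.next.symm n) ∧ ∃ e : E₀, e.1 = n := by
    intro n h₁ h₂ h₃ h₄ h₅ h₆
    refine ⟨⟨⟨_, fun h => ?_, fun h => ?_, fun h => ?_⟩, rfl⟩,
      ⟨⟨_, fun h => ?_, fun h => ?_, fun h => ?_⟩, rfl⟩⟩
    · exact ((hinn n).1 h).elim h₁ h₂
    · exact ((hinn n).2.1 h).elim h₃ h₄
    · exact ((hinn n).2.2 h).elim h₅ h₆
    · exact ((hout n).1 h).elim h₁ h₂
    · exact ((hout n).2.1 h).elim h₃ h₄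
    · exact ((hout n).2.2 h).elim h₅ h₆
  have hP : ∀ p, (∃ e : E₀, e.1 = L.next.symm (point p)) ∧ ∃ e : E₀, e.1 = point p := fun p =>
    outer _ (by simp) (by simp) (by simp) (by simp) (by simp) (by simp)
  have hO : ∀ c : X₀, ((∃ n : E₀, n.1 = L.underIn (e (some (some (some c))))) ∧
      ∃ n : E₀, n.1 = L.underOut (e (some (some (some c))))) ∧
      (∃ n : E₀, n.1 = L.overIn (e (some (some (some c))))) ∧
      ∃ n : E₀, n.1 = L.overOut (e (some (some (some c)))) := by
    intro c
    rw [ei]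
    obtain ⟨h₁, h₂, h₃⟩ := c.2
    exact ⟨outer _ (by simp) (by simp) (by simpa) (by simp) (by simpa) (by simpa),
      outer _ (by simpa) (by simpa) (by simp) (by simpa) (by simp) (by simp)⟩
  have hcov : ∀ n, n = u ∨ n = v ∨ n = w ∨ ∃ e : E₀, e.1 = n := by
    intro n
    by_cases h₁ : n = u
    · exact Or.inl h₁
    by_cases h₂ : n = v
    · exact Or.inr (Or.inl h₂)
    by_cases h₃ : n = w
    · exact Or.inr (Or.inr (Or.inl h₃))
    · exact Or.inr (Or.inr (Or.inr ⟨⟨n, h₁, h₂, h₃⟩, rfl⟩))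
  have hX : ∀ c, c = x ∨ c = y ∨ c = z ∨ ∃ c', e (some (some (some c'))) = c := by
    intro c
    by_cases h₁ : c = x
    · exact Or.inl h₁
    by_cases h₂ : c = y
    · exact Or.inr (Or.inl h₂)
    by_cases h₃ : c = z
    · exact Or.inr (Or.inr (Or.inl h₃))
    · exact Or.inr (Or.inr (Or.inr ⟨⟨c, h₁, h₂, h₃⟩, ei _⟩))
  let ρ : L.Edge ≃ L'.Edge :=
    ⟨Passage.map eX eP, Passage.map eX.symm eP.symm, by rintro (n | n | n) <;> simp [Passage.map],
      by rintro (n | n | n) <;> simp [Passage.map]⟩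
  let τ : L.Edge ≃ L'.Edge := σ.trans ρ
  have hτ : ∀ n, L'.next (τ n) = τ (L.next n) := hn
  have hτ' : ∀ n, τ (L.next.symm n) = L'.next.symm (τ n) := by
    intro n
    rw [Equiv.eq_symm_apply, hτ, Equiv.apply_symm_apply]
  have τmk : ∀ {n n'}, σ n = n' → τ n = Passage.map eX eP n' := by
    rintro n _ rfl; rfl
  have d := localTriangle_of (L := L) (L' := L) (val := (Subtype.val : E₀ → L.Edge))
    Subtype.val_injective hcov (fun e => e.2) hne (i := fun c => e (some (some (some c))))
    (i' := fun c => e (some (some (some c)))) (Equiv.refl _) (Equiv.refl _) (fun _ => rfl)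
    (fun _ => rfl) (fun _ => rfl) (fun _ => rfl) (fun _ => rfl) hX hP hO (t₁ := t₁) (t₂ := t₂)
    (m₁ := m₁) (m₂ := m₂) (b₁ := b₁) (b₂ := b₂) hxT hxM hyT hyB hzM hzB cx cy cz
  -- After the move each strand meets its two corners in the opposite order.
  have trans : ∀ {n n' m P i p}, τ n = n' → IsCornerStrand (L.next.symm n) n P i p → P = m →
      IsCornerStrand (L'.next.symm n') n' m (τ i) (τ p) := by
    rintro n _ _ P i p rfl ⟨h₁, h₂⟩ rfl
    refine ⟨?_, ?_⟩
    · rw [← hτ', h₁, apply_ite τ]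
    · conv_lhs => rw [h₂]
      rw [apply_ite τ]
  have hσu : ∀ c : X₀, σ (underpass (e (some (some (some c))))) =
      underpass (e (some (some (some c)))) := fun c => by
    rw [ei]; exact σu _ c.2.1 c.2.2.1 c.2.2.2
  have hσo : ∀ c : X₀, σ (overpass (e (some (some (some c))))) =
      overpass (e (some (some (some c)))) := fun c => by
    rw [ei]; exact σo _ c.2.1 c.2.2.1 c.2.2.2
  have d' := localTriangle_of (L := L) (L' := L') (val := (Subtype.val : E₀ → L.Edge))
    Subtype.val_injective hcov (fun e => e.2) hne (i := fun c => e (some (some (some c))))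
    (i' := fun c => (e.trans eX) (some (some (some c)))) τ eP hτ (fun p => τmk (σp p))
    (fun c => τmk (hσu c)) (fun c => τmk (hσo c)) (fun c => hr _)
    (x := eX x) (y := eX y) (z := eX z)
    (fun c => by
      obtain ⟨c, rfl⟩ := eX.surjective c
      rcases hX c with rfl | rfl | rfl | ⟨c, rfl⟩
      exacts [Or.inl rfl, Or.inr (Or.inl rfl), Or.inr (Or.inr (Or.inl rfl)),
        Or.inr (Or.inr (Or.inr ⟨c, rfl⟩))]) hP hO
    (a := a) (T := !T) (M := !M) (B := !B) (t₁ := t₂) (t₂ := t₁) (m₁ := m₂) (m₂ := m₁)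
    (b₁ := b₂) (b₂ := b₁)
    (trans (τmk σoy) hyT rfl) (trans (τmk σoz) hzM rfl)
    (trans (τmk σox) hxT (by simp)) (trans (τmk σuz) hzB rfl)
    (trans (τmk σux) hxM (by simp)) (trans (τmk σuy) hyB (by simp))
    (by rw [hr, cx]; cases T <;> cases M <;> rfl) (by rw [hr, cy]; cases T <;> cases B <;> rfl)
    (by rw [hr, cz]; cases M <;> cases B <;> rfl)
  have hcomp : ∀ n, ∃ e : E₀, L.components e.1 n := by
    have step : ∀ n, L.components (L.next n) n := fun n => L.components.symm (L.components_next n)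
    intro n
    rcases hcov n with rfl | rfl | rfl | ⟨e, rfl⟩
    · exact ⟨⟨_, ends (L.next n) (by rw [hnu]; cases T <;> simp)⟩, step _⟩
    · exact ⟨⟨_, ends (L.next n) (by rw [hnv]; cases M <;> simp)⟩, step _⟩
    · exact ⟨⟨_, ends (L.next n) (by rw [hnw]; cases B <;> simp)⟩, step _⟩
    · exact ⟨e, L.components.refl _⟩
  have hτc : ∀ m n, L.components m n ↔ L'.components (τ m) (τ n) :=
    components_of_retract τ.symm τ.symm_apply_apply
      (fun n => by rw [← hτ', Equiv.symm_apply_apply]) (fun n => Or.inl (τ.surjective n))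
      (fun n => by rw [Equiv.apply_symm_apply])
  obtain ⟨m₀, hm₀⟩ := (hP L.mark).2
  refine HasEquivalentComplexes.of_edges (Subtype.val : E₀ → L.Edge) (fun e => τ e.1)
    (fun m n => hτc _ _) hcomp (fun n => ?_) fun R _ _ w₀ => ?_
  · obtain ⟨n, rfl⟩ := τ.surjective n
    obtain ⟨e, he⟩ := hcomp n
    exact ⟨e, (hτc _ _).1 he⟩
  · refine LocalTriangle.hEquiv (e' := e.trans eX) ex ey ez (congrArg eX ex) (congrArg eX ey)
      (congrArg eX ez) d d' hm₀ ?_ ?_ w₀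
    · rw [hm₀, τmk (σp _), hm]
      rfl
    · rw [nPlus_eq_sum, nPlus_eq_sum, ← Equiv.sum_comp eX]
      simp_rw [hr]

theorem hasEquivalentComplexes_of_moves (h : Relation.EqvGen Move L L') :
    HasEquivalentComplexes L L' := by
  induction h with
  | rel L L' h =>
    cases h with
    | isotopy h => exact h.hasEquivalentComplexes
    | subdivision h => exact h.hasEquivalentComplexes
    | reidemeisterI h => exact h.hasEquivalentComplexes
    | reidemeisterII h => exact h.hasEquivalentComplexes
    | reidemeisterIII h => exact h.hasEquivalentComplexes
  | refl L => exact HasEquivalentComplexes.refl L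
  | symm _ _ _ ih => exact ih.symm
  | trans _ _ _ _ _ ih₁ ih₂ => exact ih₁.trans ih₂

end MarkedDiagram

namespace MarkedDiagram

open Passage MvPolynomial CircleAlgebra

/-! ### Pure states as a basis of the algebras of circles -/

variable (L : MarkedDiagram) (R : Type) [CommRing R]

/-- An edge on a circle of a resolution. -/
noncomputable def someEdge {S : Finset L.Crossing} (C : L.Circle S) : L.Edge :=
  (Quot.exists_rep C).choose

/-- The action of a circle of a resolution. -/
noncomputable def circleX (S : Finset L.Crossing) (C : L.Circle S) :
    CircleAlgebra R (L.circles S) (point L.mark) := x (L.circles S) (point L.mark) (L.someEdge C)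

open Classical in
/-- The contribution of a circle decorated by `v₋`; as `v₀` is treated as a `v₋`, it is trivial for
the marked circle. -/
noncomputable def circleFactor (S : Finset L.Crossing) (C : L.Circle S) :
    CircleAlgebra R (L.circles S) (point L.mark) :=
  if C = L.markedCircle S then 1 else L.circleX R S C

/-- The element of the algebra of circles corresponding to a pure state. -/
noncomputable def stateVector {S : Finset L.Crossing} (ε : L.Decoration S) :
    CircleAlgebra R (L.circles S) (point L.mark) :=
  ∏ C with ε.1 C = false, L.circleFactor R S C

variable {L R} {S : Finset L.Crossing}

theorem circleOf_someEdge (C : L.Circle S) : L.circleOf S (L.someEdge C) = C :=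
  (Quot.exists_rep C).choose_spec

theorem circleFactor_of_ne {C : L.Circle S} (h : C ≠ L.markedCircle S) :
    L.circleFactor R S C = L.circleX R S C := if_neg h

theorem circleFactor_marked : L.circleFactor R S (L.markedCircle S) = 1 := if_pos rfl

theorem ne_marked (ε : L.Decoration S) {C : L.Circle S} (h : ε.1 C = true) :
    C ≠ L.markedCircle S := by
  rintro rfl
  rw [ε.2] at h
  exact Bool.false_ne_true h

theorem lower_self (ε : L.Decoration S) (C : L.Circle S) : (L.lower ε C).1 C = false := by
  simp [lower]

theorem lower_of_ne (ε : L.Decoration S) {C D : L.Circle S} (h : D ≠ C) :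
    (L.lower ε C).1 D = ε.1 D := by
  simp [lower, h]

open Classical in
theorem filter_lower (ε : L.Decoration S) (C : L.Circle S) :
    (Finset.univ.filter fun D => (L.lower ε C).1 D = false) =
      insert C (Finset.univ.filter fun D => ε.1 D = false) := by
  ext D
  by_cases h : D = C
  · subst h; simp [lower_self]
  · simp [lower_of_ne ε h, h]

open Classical in
/-- The exponents of the monomial in the circles corresponding to a pure state. -/
noncomputable def stateExponent (ε : L.Decoration S) : L.Circle S →₀ ℕ :=
  Finsupp.equivFunOnFinite.symm fun C => if ε.1 C = false ∧ C ≠ L.markedCircle S then 1 else 0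

theorem stateExponent_injective : Function.Injective (stateExponent (L := L) (S := S)) := by
  classical
  intro ε η h
  refine Subtype.ext (funext fun C => ?_)
  by_cases hC : C = L.markedCircle S
  · rw [hC, ε.2, η.2]
  · have := DFunLike.congr_fun h C
    simp only [stateExponent, Finsupp.equivFunOnFinite_symm_apply_apply, hC, ne_eq,
      not_false_eq_true, and_true] at this
    cases h₁ : ε.1 C <;> cases h₂ : η.1 C <;> simp_all

variable [Algebra (ZMod 2) R]

theorem circleX_circleOf (e : L.Edge) :
    L.circleX R S (L.circleOf S e) = x (L.circles S) (point L.mark) e :=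
  x_eq _ ((L.circles_iff).2 (circleOf_someEdge _))

theorem circleX_marked : L.circleX R S (L.markedCircle S) = 0 :=
  (circleX_circleOf _).trans (x_mark _ _)

theorem circleX_mul_self (C : L.Circle S) : L.circleX R S C * L.circleX R S C = 0 := x_mul_self _ _ _

open Classical in
theorem circleX_mul_stateVector (ε : L.Decoration S) (C : L.Circle S) :
    L.circleX R S C * L.stateVector R ε =
      if ε.1 C = true then L.stateVector R (L.lower ε C) else 0 := by
  split_ifs with h
  · rw [stateVector, stateVector, filter_lower, Finset.prod_insert (by simp [h]),
      circleFactor_of_ne (ne_marked ε h)]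
  · rw [Bool.not_eq_true] at h
    by_cases hC : C = L.markedCircle S
    · rw [hC, circleX_marked, zero_mul]
    · rw [stateVector, ← Finset.mul_prod_erase _ _ (Finset.mem_filter.2 ⟨Finset.mem_univ C, h⟩),
        circleFactor_of_ne hC, ← mul_assoc, circleX_mul_self, zero_mul]

/-- The pure states are linearly independent: their images in the quotient of the polynomial ring on the
circles by a monomial ideal are different monomials outside of this ideal. -/
theorem linearIndependent_stateVector :
    LinearIndependent R (L.stateVector R : L.Decoration S → _) := by
  classical
  let T : Set (L.Circle S →₀ ℕ) :=
    Set.range (fun C => Finsupp.single C 2) ∪ {Finsupp.single (L.markedCircle S) 1}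
  let J : Ideal (MvPolynomial (L.Circle S) R) := Ideal.span ((fun s => monomial s (1 : R)) '' T)
  have hJ : ∀ s ∈ T, (Ideal.Quotient.mkₐ R J) (monomial s 1) = 0 := fun s hs =>
    Ideal.Quotient.eq_zero_iff_mem.2 (Ideal.subset_span ⟨s, hs, rfl⟩)
  let F : CircleAlgebra R (L.circles S) (point L.mark) →ₐ[R] MvPolynomial (L.Circle S) R ⧸ J :=
    lift (fun e => Ideal.Quotient.mkₐ R J (X (L.circleOf S e)))
      (fun e => by
        rw [← map_pow, X_pow_eq_monomial]
        exact hJ _ (Or.inl ⟨_, rfl⟩))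
      (fun a b h => by rw [(L.circles_iff).1 h]; exact add_self_of_charTwo R _)
      (hJ _ (Or.inr rfl))
  have hF : ∀ ε : L.Decoration S, F (L.stateVector R ε) =
      Ideal.Quotient.mkₐ R J (monomial (stateExponent ε) 1) := by
    intro ε
    rw [stateVector, map_prod, monomial_eq, C_1, one_mul, Finsupp.prod_fintype _ _ (by simp),
      map_prod, Finset.prod_filter]
    refine Finset.prod_congr rfl fun C _ => ?_
    have hx : F (L.circleX R S C) = Ideal.Quotient.mkₐ R J (X C) := by
      refine (lift_x _ _ _ _ _).trans ?_
      rw [circleOf_someEdge]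
    simp only [stateExponent, Finsupp.equivFunOnFinite_symm_apply_apply, circleFactor]
    by_cases h : ε.1 C = false <;> by_cases hC : C = L.markedCircle S <;> simp [h, hC, hx]
  rw [Fintype.linearIndependent_iff]
  intro a ha ε
  by_contra hε
  have h := congrArg F ha
  have hs : ∑ η, a η • F (L.stateVector R η) = Ideal.Quotient.mkₐ R J
      (∑ η, monomial (stateExponent η) (a η)) := by
    rw [map_sum]
    refine Finset.sum_congr rfl fun η _ => ?_
    rw [hF, ← map_smul, smul_monomial, smul_eq_mul, mul_one]
  rw [map_zero, map_sum] at h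
  simp_rw [map_smul] at h
  rw [hs] at h
  have hmem : ∑ η, monomial (stateExponent η) (a η) ∈ J := Ideal.Quotient.eq_zero_iff_mem.1 h
  obtain ⟨s, hs, hle⟩ := mem_ideal_span_monomial_image.1 hmem (stateExponent ε) (by
    rw [mem_support_iff, coeff_sum, Finset.sum_eq_single ε]
    · rwa [coeff_monomial, if_pos rfl]
    · intro η _ hη
      rw [coeff_monomial, if_neg fun h => hη (stateExponent_injective h)]
    · simp)
  rcases hs with ⟨C, rfl⟩ | rfl
  · have := hle C
    simp only [Finsupp.single_eq_same, stateExponent,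
      Finsupp.equivFunOnFinite_symm_apply_apply] at this
    split_ifs at this <;> omega
  · have := hle (L.markedCircle S)
    simp [stateExponent] at this

open Classical in
/-- A monomial in the edges is zero or a pure state, with as many unmarked circles decorated by `v₋`
as its degree. -/
theorem mk_monomial_mem_span (s : L.Edge →₀ ℕ) :
    CircleAlgebra.mk (L.circles S) (point L.mark) (monomial s (1 : R)) ∈
      Submodule.span R (L.stateVector R ''
        {ε : L.Decoration S | (Finset.univ.filter fun C => ε.1 C = false).card = s.degree + 1}) := by
  let P : (L.Edge →₀ ℕ) → Prop := fun s =>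
    CircleAlgebra.mk (L.circles S) (point L.mark) (monomial s (1 : R)) ∈
      Submodule.span R (L.stateVector R ''
        {ε : L.Decoration S | (Finset.univ.filter fun C => ε.1 C = false).card = s.degree + 1})
  have h0 : P 0 := by
    let ε : L.Decoration S := ⟨fun C => decide (C ≠ L.markedCircle S), by simp⟩
    have hε : (Finset.univ.filter fun C => ε.1 C = false) = {L.markedCircle S} := by
      ext C; simp [ε]
    refine Submodule.subset_span ⟨ε, by simp [hε], ?_⟩
    rw [stateVector, hε, Finset.prod_singleton, circleFactor_marked]
    exact (map_one _).symm
  have h1 : ∀ t e, P t → P (t + Finsupp.single e 1) := by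
    intro t e ht
    change CircleAlgebra.mk (L.circles S) (point L.mark) _ ∈ _
    rw [← mul_one (1 : R), ← monomial_mul, mul_comm, map_mul, ← X, mk_X, ← circleX_circleOf]
    refine Submodule.span_induction (p := fun v _ => L.circleX R S (L.circleOf S e) * v ∈ _)
      ?_ ?_ ?_ ?_ ht
    · rintro _ ⟨ε, hε, rfl⟩
      rw [circleX_mul_stateVector]
      split_ifs with h
      · refine Submodule.subset_span ⟨_, ?_, rfl⟩
        change (Finset.univ.filter _).card = _ at hε
        change (Finset.univ.filter _).card = _
        rw [filter_lower, Finset.card_insert_of_notMem (by simp [h]), hε, map_add,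
          Finsupp.degree_single]
      · exact zero_mem _
    · rw [mul_zero]; exact zero_mem _
    · intro a b _ _ ha hb
      rw [mul_add]; exact add_mem ha hb
    · intro c a _ ha
      rw [mul_smul_comm]; exact Submodule.smul_mem _ _ ha
  suffices ∀ t, P t → P (t + s) by simpa using this 0 h0
  induction s using Finsupp.induction_linear with
  | zero => intro t ht; rwa [add_zero]
  | add s s' hs hs' => intro t ht; rw [← add_assoc]; exact hs' _ (hs _ ht)
  | single e n =>
    induction n with
    | zero => intro t ht; rwa [Finsupp.single_zero, add_zero]
    | succ n ih =>
      intro t ht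
      rw [Finsupp.single_add, ← add_assoc]
      exact h1 _ _ (ih _ ht)

theorem top_le_span_stateVector :
    ⊤ ≤ Submodule.span R (Set.range (L.stateVector R : L.Decoration S → _)) := by
  rintro v -
  obtain ⟨p, rfl⟩ := mk_surjective _ _ v
  induction p using MvPolynomial.induction_on' with
  | add p q hp hq => rw [map_add]; exact add_mem hp hq
  | monomial s a =>
    rw [← mul_one a, ← smul_eq_mul, ← smul_monomial, map_smul]
    exact Submodule.smul_mem _ _ (Submodule.span_mono (Set.image_subset_range _ _)
      (mk_monomial_mem_span s))

variable (L R) in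
/-- The basis of the algebra of circles of a resolution given by the pure states. -/
noncomputable def decorationBasis (S : Finset L.Crossing) :
    Module.Basis (L.Decoration S) R (CircleAlgebra R (L.cube.rel S) (point L.mark)) :=
  Module.Basis.mk (v := L.stateVector R) linearIndependent_stateVector top_le_span_stateVector

theorem decorationBasis_apply (ε : L.Decoration S) :
    L.decorationBasis R S ε = L.stateVector R ε := Module.Basis.mk_apply _ _ _

theorem coe_decorationBasis : ⇑(L.decorationBasis R S) = L.stateVector R :=
  funext decorationBasis_apply

variable (L R) in
/-- The basis of the chain groups given by the pure states. -/
noncomputable def stateBasis : Module.Basis L.State R (L.cube.Total R (point L.mark)) :=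
  Pi.basis (L.decorationBasis R)

theorem stateBasis_apply_self (s : L.State) : L.stateBasis R s s.1 = L.stateVector R s.2 := by
  classical
  rw [stateBasis, Pi.basis_apply]
  exact (Pi.single_eq_same _ _).trans (decorationBasis_apply _)

theorem stateBasis_apply_of_ne (s : L.State) (h : S ≠ s.1) : L.stateBasis R s S = 0 := by
  classical
  rw [stateBasis, Pi.basis_apply]
  exact Pi.single_eq_of_ne h _

open Classical in
theorem stateVector_mem_gr (ε : L.Decoration S) : L.stateVector R ε ∈
    CircleAlgebra.gr R (L.circles S) (point L.mark)
      (2 * (((Finset.univ.filter fun C => ε.1 C = false).card : ℤ) - 1) -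
        (Nat.card (Quotient (L.circles S)) - 1)) := by
  have hm : L.markedCircle S ∈ Finset.univ.filter fun C => ε.1 C = false := by simp [ε.2]
  refine Submodule.subset_span ⟨∑ C ∈ (Finset.univ.filter fun C => ε.1 C = false).erase
    (L.markedCircle S), Finsupp.single (L.someEdge C) 1, ?_, ?_⟩
  · rw [map_sum]
    simp_rw [Finsupp.degree_single]
    rw [Finset.sum_const, smul_eq_mul, mul_one, Finset.card_erase_of_mem hm,
      Nat.cast_sub (Finset.card_pos.2 ⟨_, hm⟩), Nat.cast_one]
  · rw [stateVector, ← Finset.mul_prod_erase _ _ hm, circleFactor_marked, one_mul,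
      monomial_sum_one, map_prod]
    exact Finset.prod_congr rfl fun C hC => circleFactor_of_ne (Finset.ne_of_mem_erase hC)

open Classical in
theorem qDegree_eq (s : L.State) : L.qDegree s =
    Fintype.card (L.Circle s.1) + 1 - 2 * (Finset.univ.filter fun C => s.2.1 C = false).card := by
  have h : ∀ C, (if C = L.markedCircle s.1 then 0 else if s.2.1 C = true then 1 else -1 : ℤ) =
      1 - 2 * (if s.2.1 C = false then 1 else 0) + (if C = L.markedCircle s.1 then 1 else 0) := by
    intro C
    by_cases hC : C = L.markedCircle s.1
    · subst hC; simp [s.2.2]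
    · cases h : s.2.1 C <;> simp [hC]
  rw [qDegree, Finset.sum_congr rfl fun C _ => h C, Finset.sum_add_distrib, Finset.sum_sub_distrib,
    ← Finset.mul_sum, Finset.sum_boole, Finset.sum_ite_eq' Finset.univ (L.markedCircle s.1)]
  simp
  ring

/-- The chains of degree `i` are the combinations of the pure states of degree `i`. -/
theorem mem_gr_iff {i : ℤ} {v : L.cube.Total R (point L.mark)} :
    v ∈ L.cube.gr L.nPlus i ↔ ∀ s, (L.stateBasis R).repr v s ≠ 0 → L.degree s = i := by
  classical
  have hcard : ∀ S, Nat.card (Quotient (L.circles S)) = Fintype.card (L.Circle S) := by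
    intro S
    rw [← Nat.card_eq_fintype_card]
    exact Nat.card_congr (Equiv.ofBijective (Quotient.lift (L.circleOf S) fun a b h =>
      (L.circles_iff).1 h) ⟨by
        rintro ⟨a⟩ ⟨b⟩ h
        exact Quotient.sound ((L.circles_iff).2 h), fun C => ⟨Quotient.mk _ (L.someEdge C),
          circleOf_someEdge C⟩⟩)
  have hd : ∀ s : L.State, L.degree s = i ↔
      2 * (((Finset.univ.filter fun C => s.2.1 C = false).card : ℤ) - 1) -
        (Nat.card (Quotient (L.circles s.1)) - 1) = i - s.1.card + L.nPlus := by
    intro s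
    rw [hcard, degree, qDegree_eq]
    constructor <;> intro h <;> linarith
  constructor
  · rintro hv ⟨S, ε⟩ hs
    rw [hd]
    have hmem := (SurgeryCube.mem_gr _).1 hv S
    have hle : CircleAlgebra.gr R (L.cube.rel S) (point L.mark) (i - S.card + L.nPlus) ≤
        Submodule.span R (L.decorationBasis R S '' {ε : L.Decoration S |
          2 * (((Finset.univ.filter fun C => ε.1 C = false).card : ℤ) - 1) -
            (Nat.card (Quotient (L.circles S)) - 1) = i - S.card + L.nPlus}) := by
      refine Submodule.span_le.2 ?_
      rintro _ ⟨t, ht, rfl⟩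
      rw [coe_decorationBasis]
      refine Submodule.span_mono (Set.image_mono fun η hη => ?_) (mk_monomial_mem_span t)
      change (Finset.univ.filter _).card = _ at hη
      change _ = _
      rw [hη, ← ht]
      push_cast
      rw [add_sub_cancel_right]
      rfl
    exact (Module.Basis.mem_span_image _).1 (hle hmem) (Finsupp.mem_support_iff.2 hs)
  · intro hv
    rw [← (L.stateBasis R).sum_repr v]
    refine sum_mem fun s _ => ?_
    by_cases hs : (L.stateBasis R).repr v s = 0
    · rw [hs, zero_smul]; exact zero_mem _
    · refine Submodule.smul_mem _ _ ?_
      rw [SurgeryCube.mem_gr]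
      intro S
      by_cases hS : S = s.1
      · subst hS
        rw [stateBasis_apply_self, ← (hd s).1 (hv s hs)]
        exact stateVector_mem_gr s.2
      · rw [stateBasis_apply_of_ne s hS]; exact zero_mem _

end MarkedDiagram

namespace MarkedDiagram

open Passage MvPolynomial CircleAlgebra

variable {L : MarkedDiagram} {R : Type} [CommRing R] {S T : Finset L.Crossing}

/-! ### The Khovanov maps on pure states -/

section

variable {p q : L.Edge}

/-- A circle of `L_T` meeting a circle of `L_S`. -/
noncomputable def transfer (T : Finset L.Crossing) (C : L.Circle S) : L.Circle T :=
  L.circleOf T (L.someEdge C)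

theorem transfer_circleOf (h : Merge (L.circles S) (L.circles T) p q) (e : L.Edge) :
    transfer T (L.circleOf S e) = L.circleOf T e :=
  (L.circles_iff).1 (h.le ((L.circles_iff).2 (circleOf_someEdge _)))

theorem transfer_marked (h : Merge (L.circles S) (L.circles T) p q) :
    transfer T (L.markedCircle S) = L.markedCircle T := transfer_circleOf h _

theorem transfer_eq_iff (h : Merge (L.circles S) (L.circles T) p q) {C D : L.Circle S} :
    transfer T C = transfer T D ↔ C = D ∨ (C = L.circleOf S p ∧ D = L.circleOf S q) ∨
      (C = L.circleOf S q ∧ D = L.circleOf S p) := by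
  have := h.2 (L.someEdge C) (L.someEdge D)
  simp only [circles_iff, circleOf_someEdge] at this
  exact this

theorem transfer_transfer (h : Merge (L.circles S) (L.circles T) p q) (D : L.Circle T) :
    transfer T (transfer S D) = D :=
  (transfer_circleOf h _).trans (circleOf_someEdge D)

theorem circleOf_ne (h : Merge (L.circles S) (L.circles T) p q) :
    L.circleOf S p ≠ L.circleOf S q := fun h' => h.1 ((L.circles_iff).2 h')

theorem transfer_left (h : Merge (L.circles S) (L.circles T) p q) :
    transfer T (L.circleOf S p) = transfer T (L.circleOf S q) :=
  (transfer_eq_iff h).2 (Or.inr (Or.inl ⟨rfl, rfl⟩))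

open Classical in
/-- The decoration of the circles after a merge, not used when both merged circles carry a `v₋`. -/
noncomputable def mergedDecoration (h : Merge (L.circles S) (L.circles T) p q)
    (ε : L.Decoration S) : L.Decoration T :=
  ⟨fun D => decide (∀ C, transfer T C = D → ε.1 C = true),
    decide_eq_false fun h' => Bool.false_ne_true (ε.2.symm.trans (h' _ (transfer_marked h)))⟩

/-- The decoration of the circles after a split giving both new circles the decoration of the old one. -/
noncomputable def splitDecoration (h : Merge (L.circles T) (L.circles S) p q)
    (ε : L.Decoration S) : L.Decoration T :=
  ⟨fun D => ε.1 (transfer S D), (congrArg ε.1 (transfer_marked h)).trans ε.2⟩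

theorem mergedDecoration_transfer (h : Merge (L.circles S) (L.circles T) p q) (ε : L.Decoration S)
    {C : L.Circle S} (hp : C ≠ L.circleOf S p) (hq : C ≠ L.circleOf S q) :
    (mergedDecoration h ε).1 (transfer T C) = ε.1 C := by
  have : (∀ D, transfer T D = transfer T C → ε.1 D = true) ↔ ε.1 C = true := by
    refine ⟨fun h' => h' C rfl, fun hC D hD => ?_⟩
    rcases (transfer_eq_iff h).1 hD with rfl | ⟨-, h'⟩ | ⟨-, h'⟩
    · exact hC
    · exact absurd h' hq
    · exact absurd h' hp
  simp only [mergedDecoration, this, Bool.decide_eq_true]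

theorem mergedDecoration_merged (h : Merge (L.circles S) (L.circles T) p q) (ε : L.Decoration S) :
    (mergedDecoration h ε).1 (transfer T (L.circleOf S p)) =
      (ε.1 (L.circleOf S p) && ε.1 (L.circleOf S q)) := by
  have : (∀ D, transfer T D = transfer T (L.circleOf S p) → ε.1 D = true) ↔
      (ε.1 (L.circleOf S p) && ε.1 (L.circleOf S q)) = true := by
    rw [Bool.and_eq_true]
    refine ⟨fun h' => ⟨h' _ rfl, h' _ (transfer_left h).symm⟩, fun hC D hD => ?_⟩
    rcases (transfer_eq_iff h).1 hD with rfl | ⟨rfl, -⟩ | ⟨rfl, -⟩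
    exacts [hC.1, hC.1, hC.2]
  simp only [mergedDecoration, this, Bool.decide_eq_true]

variable [Algebra (ZMod 2) R]

open Classical in
theorem exists_mk_eq_stateVector (ε : L.Decoration S) : ∃ f : MvPolynomial L.Edge R,
    CircleAlgebra.mk (L.circles S) (point L.mark) f = L.stateVector R ε ∧
    ∀ T, CircleAlgebra.mk (L.circles T) (point L.mark) f = ∏ C with ε.1 C = false,
      if C = L.markedCircle S then 1 else L.circleX R T (transfer T C) := by
  refine ⟨∏ C with ε.1 C = false, if C = L.markedCircle S then 1 else X (L.someEdge C), ?_, ?_⟩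
  · rw [map_prod]
    refine Finset.prod_congr rfl fun C _ => ?_
    rw [circleFactor, apply_ite (CircleAlgebra.mk _ _), map_one]; rfl
  · intro T
    rw [map_prod]
    refine Finset.prod_congr rfl fun C _ => ?_
    rw [apply_ite (CircleAlgebra.mk _ _), map_one, mk_X, ← circleX_circleOf]; rfl

open Classical in
theorem surgery_stateVector_of_merge (h : Merge (L.circles S) (L.circles T) p q)
    (ε : L.Decoration S) :
    surgery (L.circles S) (L.circles T) (point L.mark) (L.stateVector R ε) =
      if ε.1 (L.circleOf S p) = false ∧ ε.1 (L.circleOf S q) = false then 0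
      else L.stateVector R (mergedDecoration h ε) := by
  obtain ⟨f, hf, hf'⟩ := exists_mk_eq_stateVector (R := R) ε
  rw [← hf, surgery_of_merge _ h, hf']
  split_ifs with hpq
  · rw [← Finset.mul_prod_erase _ _ (Finset.mem_filter.2 ⟨Finset.mem_univ (L.circleOf S p), hpq.1⟩),
      ← Finset.mul_prod_erase _ _ (Finset.mem_erase.2 ⟨(circleOf_ne h).symm,
        Finset.mem_filter.2 ⟨Finset.mem_univ (L.circleOf S q), hpq.2⟩⟩), ← mul_assoc]
    convert zero_mul _
    by_cases hp : L.circleOf S p = L.markedCircle S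
    · rw [if_pos hp, if_neg fun hq => circleOf_ne h (hp.trans hq.symm), ← transfer_left h, hp,
        transfer_marked h, circleX_marked, mul_zero]
    · by_cases hq : L.circleOf S q = L.markedCircle S
      · rw [if_neg hp, transfer_left h, hq, transfer_marked h, circleX_marked, zero_mul]
      · rw [if_neg hp, if_neg hq, transfer_left h, circleX_mul_self]
  · have hinj : ∀ {C D : L.Circle S}, ε.1 C = false → ε.1 D = false →
        transfer T C = transfer T D → C = D := by
      intro C D hC hD hCD
      rcases (transfer_eq_iff h).1 hCD with h' | ⟨rfl, rfl⟩ | ⟨rfl, rfl⟩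
      exacts [h', absurd ⟨hC, hD⟩ hpq, absurd ⟨hD, hC⟩ hpq]
    refine Finset.prod_nbij (transfer T) ?_ ?_ ?_ ?_
    · intro C hC
      rw [Finset.mem_filter] at hC ⊢
      refine ⟨Finset.mem_univ _, decide_eq_false fun h' => ?_⟩
      rw [h' C rfl] at hC
      exact Bool.false_ne_true hC.2.symm
    · intro C hC D hD
      exact hinj (Finset.mem_filter.1 hC).2 (Finset.mem_filter.1 hD).2
    · intro D hD
      have := of_decide_eq_false (Finset.mem_filter.1 hD).2
      push Not at this
      obtain ⟨C, hC, hC'⟩ := this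
      exact ⟨C, Finset.mem_filter.2 ⟨Finset.mem_univ _, by simpa using hC'⟩, hC⟩
    · intro C hC
      rw [circleFactor]
      refine if_congr ⟨fun h' => ?_, fun h' => ?_⟩ rfl rfl
      · rw [h', transfer_marked h]
      · rw [← transfer_marked h] at h'
        exact hinj (Finset.mem_filter.1 hC).2 ε.2 h'

theorem splitDecoration_left (h : Merge (L.circles T) (L.circles S) p q) (ε : L.Decoration S) :
    (splitDecoration h ε).1 (L.circleOf T p) = ε.1 (L.circleOf S p) :=
  congrArg ε.1 (transfer_circleOf h p)

theorem splitDecoration_right (h : Merge (L.circles T) (L.circles S) p q) (ε : L.Decoration S) :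
    (splitDecoration h ε).1 (L.circleOf T q) = ε.1 (L.circleOf S p) := by
  rw [← (L.circles_iff).1 h.rel.symm]
  exact congrArg ε.1 (transfer_circleOf h q)

theorem transfer_eq_split (h : Merge (L.circles T) (L.circles S) p q) {D : L.Circle T} :
    transfer S D = L.circleOf S p ↔ D = L.circleOf T p ∨ D = L.circleOf T q := by
  rw [← transfer_circleOf h, transfer_eq_iff h]
  have := circleOf_ne h
  grind

open Classical in
theorem surgery_stateVector_of_split (h : Merge (L.circles T) (L.circles S) p q)
    (ε : L.Decoration S) :
    surgery (L.circles S) (L.circles T) (point L.mark) (L.stateVector R ε) =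
      if ε.1 (L.circleOf S p) = true then
        L.stateVector R (L.lower (splitDecoration h ε) (L.circleOf T p)) +
          L.stateVector R (L.lower (splitDecoration h ε) (L.circleOf T q))
      else L.stateVector R (splitDecoration h ε) := by
  obtain ⟨f, hf, hf'⟩ := exists_mk_eq_stateVector (R := R) ε
  rw [← hf, surgery_of_split _ h, hf', ← circleX_circleOf, ← circleX_circleOf]
  -- The circles other than the one that is split correspond to each other.
  have key : ∏ C ∈ (Finset.univ.filter fun C => ε.1 C = false).erase (L.circleOf S p),
        (if C = L.markedCircle S then 1 else L.circleX R T (transfer T C)) =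
      ∏ D ∈ ((Finset.univ.filter fun D => (splitDecoration h ε).1 D = false).erase
        (L.circleOf T p)).erase (L.circleOf T q), L.circleFactor R T D := by
    have ht : ∀ D : L.Circle T, transfer S D ≠ L.circleOf S p → transfer T (transfer S D) = D := by
      intro D hD
      rcases (transfer_eq_iff h).1 (transfer_transfer h (transfer S D)) with h' | ⟨-, h'⟩ | ⟨-, h'⟩
      · exact h'
      · exact absurd ((transfer_eq_split h).2 (Or.inr h')) hD
      · exact absurd ((transfer_eq_split h).2 (Or.inl h')) hD
    refine Finset.prod_nbij' (transfer T) (transfer S) ?_ ?_ ?_ ?_ ?_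
    · intro C hC
      simp only [Finset.mem_erase, Finset.mem_filter, Finset.mem_univ, true_and] at hC ⊢
      have h' : transfer S (transfer T C) = C := transfer_transfer h C
      refine ⟨fun h₁ => hC.1 ?_, fun h₁ => hC.1 ?_, ?_⟩
      · rw [← h']; exact (transfer_eq_split h).2 (Or.inr h₁)
      · rw [← h']; exact (transfer_eq_split h).2 (Or.inl h₁)
      · exact (congrArg ε.1 h').trans hC.2
    · intro D hD
      simp only [Finset.mem_erase, Finset.mem_filter, Finset.mem_univ, true_and] at hD ⊢
      exact ⟨fun h₁ => ((transfer_eq_split h).1 h₁).elim hD.2.1 hD.1, hD.2.2⟩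
    · intro C _
      exact transfer_transfer h C
    · intro D hD
      simp only [Finset.mem_erase] at hD
      exact ht D fun h₁ => ((transfer_eq_split h).1 h₁).elim hD.2.1 hD.1
    · intro C hC
      rw [circleFactor]
      refine if_congr ⟨?_, fun h' => ?_⟩ rfl rfl
      · rintro rfl
        rw [← transfer_marked h]
        refine ht _ fun h' => (Finset.mem_erase.1 hC).1 ?_
        rw [← transfer_marked h, h']
      · rw [← transfer_marked h, ← h', transfer_transfer h]
  split_ifs with hp
  · have hP := splitDecoration_left h ε
    have hQ := splitDecoration_right h ε
    rw [Finset.erase_eq_of_notMem (by simp [hp]), Finset.erase_eq_of_notMem (by simp [hQ, hp]),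
      Finset.erase_eq_of_notMem (by simp [hP, hp])] at key
    rw [key, ← stateVector, mul_comm, add_mul, circleX_mul_stateVector, circleX_mul_stateVector,
      if_pos (hP.trans hp), if_pos (hQ.trans hp)]
  · rw [Bool.not_eq_true] at hp
    have hP := (splitDecoration_left h ε).trans hp
    have hQ := (splitDecoration_right h ε).trans hp
    rw [stateVector, ← Finset.mul_prod_erase (Finset.univ.filter fun C => ε.1 C = false) _
        (Finset.mem_filter.2 ⟨Finset.mem_univ _, hp⟩), key,
      ← Finset.mul_prod_erase (Finset.univ.filter fun D => (splitDecoration h ε).1 D = false) _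
        (Finset.mem_filter.2 ⟨Finset.mem_univ _, hP⟩),
      ← Finset.mul_prod_erase _ _ (Finset.mem_erase.2 ⟨(circleOf_ne h).symm,
        Finset.mem_filter.2 ⟨Finset.mem_univ _, hQ⟩⟩), ← mul_assoc, mul_right_comm]
    congr 1
    have hm : L.markedCircle S = L.circleOf S p ↔
        L.markedCircle T = L.circleOf T p ∨ L.markedCircle T = L.circleOf T q := by
      rw [← transfer_eq_split h, transfer_marked h]
    have hne := circleOf_ne h
    by_cases hm' : L.circleOf S p = L.markedCircle S
    · rw [if_pos hm', one_mul]
      rcases hm.1 hm'.symm with h₁ | h₁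
      · rw [← h₁, circleX_marked, zero_add, circleFactor_marked, one_mul, circleFactor_of_ne]
        rw [h₁]; exact hne.symm
      · rw [← h₁, circleX_marked, add_zero, circleFactor_marked, mul_one, circleFactor_of_ne]
        rw [h₁]; exact hne
    · have hm₁ : ¬ (L.markedCircle T = L.circleOf T p ∨ L.markedCircle T = L.circleOf T q) :=
        fun h' => hm' (hm.2 h').symm
      rw [if_neg hm', circleFactor_of_ne fun h' => hm₁ (Or.inl h'.symm),
        circleFactor_of_ne fun h' => hm₁ (Or.inr h'.symm)]
      have h' : transfer S (transfer T (L.circleOf S p)) = L.circleOf S p := transfer_transfer h _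
      rcases (transfer_eq_split h).1 h' with h₁ | h₁
      · rw [h₁, mul_add, circleX_mul_self, zero_add]
      · rw [h₁, mul_add, circleX_mul_self, add_zero, mul_comm]

end

end MarkedDiagram

namespace MarkedDiagram

open Passage MvPolynomial CircleAlgebra

variable {L : MarkedDiagram} {R : Type} [CommRing R] {S T : Finset L.Crossing}

/-- A decoration is determined by its values on two circles and on the edges of the others. -/
theorem decoration_eq_iff {p q : L.Edge} (η ζ : L.Decoration T) :
    η = ζ ↔ (∀ e, L.circleOf T e ≠ L.circleOf T p → L.circleOf T e ≠ L.circleOf T q →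
      η.1 (L.circleOf T e) = ζ.1 (L.circleOf T e)) ∧
      η.1 (L.circleOf T p) = ζ.1 (L.circleOf T p) ∧ η.1 (L.circleOf T q) = ζ.1 (L.circleOf T q) := by
  refine ⟨by rintro rfl; simp, fun h => Subtype.ext (funext fun C => ?_)⟩
  obtain ⟨e, rfl⟩ := Quot.exists_rep C
  change η.1 (L.circleOf T e) = ζ.1 (L.circleOf T e)
  by_cases hp : L.circleOf T e = L.circleOf T p
  · rw [hp]; exact h.2.1
  · by_cases hq : L.circleOf T e = L.circleOf T q
    · rw [hq]; exact h.2.2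
    · exact h.1 e hp hq

open Classical in
theorem khovanovCoeff_of_merge {x : L.Crossing}
    (h : Merge (L.circles S) (L.circles (insert x S)) (L.underIn x) (L.underOut x))
    (ε : L.Decoration S) (η : L.Decoration (insert x S)) : L.khovanovCoeff x ε η =
      if ε.1 (L.circleOf S (L.underIn x)) = false ∧ ε.1 (L.circleOf S (L.underOut x)) = false then 0
      else if η = mergedDecoration h ε then 1 else 0 := by
  have hne := circleOf_ne h
  have heq : L.circleOf (insert x S) (L.underIn x) = L.circleOf (insert x S) (L.underOut x) :=
    (L.circles_iff).1 h.rel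
  have hm : (mergedDecoration h ε).1 (L.circleOf (insert x S) (L.underIn x)) = _ :=
    (congrArg _ (transfer_circleOf h _).symm).trans (mergedDecoration_merged h ε)
  have hiff : ∀ e, (L.circleOf (insert x S) e ≠ L.circleOf (insert x S) (L.underIn x) →
      η.1 (L.circleOf (insert x S) e) = (mergedDecoration h ε).1 (L.circleOf (insert x S) e)) ↔
      (L.circleOf S e ≠ L.circleOf S (L.underIn x) → L.circleOf S e ≠ L.circleOf S (L.underOut x) →
        η.1 (L.circleOf (insert x S) e) = ε.1 (L.circleOf S e)) := by
    intro e
    have h₁ : L.circleOf (insert x S) e = L.circleOf (insert x S) (L.underIn x) ↔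
        L.circleOf S e = L.circleOf S (L.underIn x) ∨
          L.circleOf S e = L.circleOf S (L.underOut x) := by
      rw [← transfer_circleOf h e, ← transfer_circleOf h, transfer_eq_iff h]
      grind
    constructor
    · intro h₂ hp hq
      rw [h₂ fun h' => (h₁.1 h').elim hp hq]
      exact (congrArg _ (transfer_circleOf h e).symm).trans (mergedDecoration_transfer h ε hp hq)
    · intro h₂ hpq
      have hp := fun h' => hpq (h₁.2 (Or.inl h'))
      have hq := fun h' => hpq (h₁.2 (Or.inr h'))
      rw [h₂ hp hq]
      exact ((congrArg _ (transfer_circleOf h e).symm).trans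
        (mergedDecoration_transfer h ε hp hq)).symm
  simp only [decoration_eq_iff (p := L.underIn x) (q := L.underIn x) η, hm]
  have hall := forall_congr' hiff
  by_cases hc : ∀ e, L.circleOf S e ≠ L.circleOf S (L.underIn x) →
      L.circleOf S e ≠ L.circleOf S (L.underOut x) →
        η.1 (L.circleOf (insert x S) e) = ε.1 (L.circleOf S e)
  · have hc' := hall.2 hc
    refine ((if_pos hc).trans (if_pos ⟨hne, heq⟩)).trans ?_
    change mulCoeff (ε.1 (L.circleOf S (L.underIn x))) (ε.1 (L.circleOf S (L.underOut x)))
      (η.1 (L.circleOf (insert x S) (L.underIn x))) = _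
    cases ε.1 (L.circleOf S (L.underIn x)) <;> cases ε.1 (L.circleOf S (L.underOut x)) <;>
      cases η.1 (L.circleOf (insert x S) (L.underIn x)) <;>
      simp +contextual [mulCoeff, hc']
  · refine (if_neg hc).trans ?_
    have n : ¬ ∀ e, L.circleOf (insert x S) e ≠ L.circleOf (insert x S) (L.underIn x) →
        L.circleOf (insert x S) e ≠ L.circleOf (insert x S) (L.underIn x) →
        η.1 (L.circleOf (insert x S) e) = (mergedDecoration h ε).1 (L.circleOf (insert x S) e) :=
      fun h' => hc (hall.1 fun e he => h' e he he)
    simp only [eq_false n, false_and, if_false, ite_self]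

open Classical in
theorem khovanovCoeff_of_split {x : L.Crossing}
    (h : Merge (L.circles (insert x S)) (L.circles S) (L.underIn x) (L.underOut x))
    (ε : L.Decoration S) (η : L.Decoration (insert x S)) : L.khovanovCoeff x ε η =
      if ε.1 (L.circleOf S (L.underIn x)) = true then
        (if η = L.lower (splitDecoration h ε) (L.circleOf (insert x S) (L.underIn x)) then 1 else 0) +
        (if η = L.lower (splitDecoration h ε) (L.circleOf (insert x S) (L.underOut x)) then 1 else 0)
      else if η = splitDecoration h ε then 1 else 0 := by
  have hne := circleOf_ne h
  have heq : L.circleOf S (L.underIn x) = L.circleOf S (L.underOut x) :=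
    (L.circles_iff).1 h.rel
  have hl := splitDecoration_left h ε
  have hr := splitDecoration_right h ε
  have hval : ∀ e, (splitDecoration h ε).1 (L.circleOf (insert x S) e) = ε.1 (L.circleOf S e) :=
    fun e => congrArg ε.1 (transfer_circleOf h e)
  have h₁ : ∀ e, L.circleOf S e = L.circleOf S (L.underIn x) ↔
      L.circleOf (insert x S) e = L.circleOf (insert x S) (L.underIn x) ∨
        L.circleOf (insert x S) e = L.circleOf (insert x S) (L.underOut x) := by
    intro e
    rw [← transfer_eq_split h, transfer_circleOf h]
  simp only [decoration_eq_iff (p := L.underIn x) (q := L.underOut x) η, lower_self,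
    lower_of_ne _ hne, lower_of_ne _ hne.symm, hl, hr]
  have hc : ∀ ζ : L.Decoration (insert x S), (∀ e,
      L.circleOf (insert x S) e ≠ L.circleOf (insert x S) (L.underIn x) →
      L.circleOf (insert x S) e ≠ L.circleOf (insert x S) (L.underOut x) →
      ζ.1 (L.circleOf (insert x S) e) = (splitDecoration h ε).1 (L.circleOf (insert x S) e)) →
      ((∀ e, L.circleOf S e ≠ L.circleOf S (L.underIn x) →
        L.circleOf S e ≠ L.circleOf S (L.underOut x) →
        η.1 (L.circleOf (insert x S) e) = ε.1 (L.circleOf S e)) ↔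
      ∀ e, L.circleOf (insert x S) e ≠ L.circleOf (insert x S) (L.underIn x) →
        L.circleOf (insert x S) e ≠ L.circleOf (insert x S) (L.underOut x) →
        η.1 (L.circleOf (insert x S) e) = ζ.1 (L.circleOf (insert x S) e)) := by
    intro ζ hζ
    refine forall_congr' fun e => ⟨fun h' hp hq => ?_, fun h' hp _ => ?_⟩
    · have := fun h'' => ((h₁ e).1 h'').elim hp hq
      rw [hζ e hp hq, hval, h' this (heq ▸ this)]
    · have hp' := fun h'' => hp ((h₁ e).2 (Or.inl h''))
      have hq' := fun h'' => hp ((h₁ e).2 (Or.inr h''))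
      rw [h' hp' hq', hζ e hp' hq', hval]
  have hc₁ := hc _ fun e hp _ => lower_of_ne _ hp
  have hc₂ := hc _ fun e _ hq => lower_of_ne _ hq
  have hc₃ := hc _ fun e _ _ => rfl
  by_cases hall : ∀ e, L.circleOf S e ≠ L.circleOf S (L.underIn x) →
        L.circleOf S e ≠ L.circleOf S (L.underOut x) →
        η.1 (L.circleOf (insert x S) e) = ε.1 (L.circleOf S e)
  · refine ((if_pos hall).trans ((if_neg fun h' => h'.1 heq).trans (if_pos ⟨heq, hne⟩))).trans ?_
    change comulCoeff (ε.1 (L.circleOf S (L.underIn x)))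
      (η.1 (L.circleOf (insert x S) (L.underIn x)))
      (η.1 (L.circleOf (insert x S) (L.underOut x))) = _
    simp only [eq_true (hc₁.1 hall), eq_true (hc₂.1 hall), eq_true (hc₃.1 hall), true_and]
    cases ε.1 (L.circleOf S (L.underIn x)) <;>
      cases η.1 (L.circleOf (insert x S) (L.underIn x)) <;>
      cases η.1 (L.circleOf (insert x S) (L.underOut x)) <;> simp [comulCoeff]
  · refine (if_neg hall).trans ?_
    simp only [eq_false (mt hc₁.2 hall), eq_false (mt hc₂.2 hall), eq_false (mt hc₃.2 hall),
      false_and, if_false, add_zero, ite_self]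

variable [Algebra (ZMod 2) R]

theorem surgery_stateVector {x : L.Crossing} (hx : x ∉ S) (ε : L.Decoration S) :
    surgery (L.circles S) (L.circles (insert x S)) (point L.mark) (L.stateVector R ε) =
      ∑ η, algebraMap (ZMod 2) R (L.khovanovCoeff x ε η) • L.stateVector R η := by
  classical
  rcases L.surgery_circles hx with h | h
  · simp_rw [surgery_stateVector_of_merge h, khovanovCoeff_of_merge h]
    split_ifs
    · simp
    · simp [apply_ite (algebraMap (ZMod 2) R), ite_smul]
  · simp_rw [surgery_stateVector_of_split h, khovanovCoeff_of_split h]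
    split_ifs
    · simp [apply_ite (algebraMap (ZMod 2) R), ite_smul, add_smul, Finset.sum_add_distrib]
    · simp [apply_ite (algebraMap (ZMod 2) R), ite_smul]

/-! ### The totally twisted complex as a complex of weights -/

/-- The linear extension of the assignment of its variable to a face. -/
noncomputable def faceSum (L : MarkedDiagram) : (L.Face →₀ ZMod 2) →ₗ[ZMod 2] L.CoeffRing :=
  Finsupp.linearCombination (ZMod 2) MvPolynomial.X

/-- The weights of the edges, in an algebra over the coefficient ring. -/
noncomputable def edgeWeight (φ : L.CoeffRing →ₐ[ZMod 2] R) (e : L.Edge) : R :=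
  φ (L.faceSum (L.weight e))

variable (φ : L.CoeffRing →ₐ[ZMod 2] R)

open Classical in
theorem sum_edgeWeight (C : L.Circle S) :
    ∑ e, (if L.circleOf S e = C then edgeWeight φ e else 0) = φ (L.area S C) := by
  have h := congrArg (fun v => φ (L.faceSum v)) (L.sum_weight_circle S C)
  simp only [map_sum, apply_ite L.faceSum, apply_ite φ, map_zero] at h
  refine h.trans ?_
  rw [area, map_sum]
  refine Finset.sum_congr rfl fun f _ => ?_
  rw [apply_ite φ, map_zero, faceSum, Finsupp.linearCombination_single, one_smul]

/-- The total weight of the edges acts on the algebra of circles through the areas of the circles. -/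
theorem mk_weightPoly_edgeWeight (S : Finset L.Crossing) :
    CircleAlgebra.mk (L.circles S) (point L.mark) (weightPoly (edgeWeight φ)) =
      ∑ C, φ (L.area S C) • L.circleX R S C := by
  classical
  simp_rw [← sum_edgeWeight, Finset.sum_smul, weightPoly, map_sum, map_smul, mk_X]
  rw [Finset.sum_comm]
  refine Finset.sum_congr rfl fun e _ => ?_
  simp_rw [ite_smul, zero_smul]
  rw [Finset.sum_ite_eq Finset.univ (L.circleOf S e), if_pos (Finset.mem_univ _), circleX_circleOf]

/-- The map from the totally twisted complex to the complex of weights, identifying pure states with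
basis elements. It is semilinear over `φ`. -/
noncomputable def realize : (L.State →₀ L.CoeffRing) →+ L.cube.Total R (point L.mark) :=
  Finsupp.liftAddHom fun s => (AddMonoidHom.flip (smulAddHom R _) (L.stateBasis R s)).comp
    (φ : L.CoeffRing →+ R)

theorem realize_single (s : L.State) (c : L.CoeffRing) :
    realize φ (Finsupp.single s c) = φ c • L.stateBasis R s := by
  rw [realize, Finsupp.liftAddHom_apply_single]; rfl

theorem realize_smul (c : L.CoeffRing) (v : L.State →₀ L.CoeffRing) :
    realize φ (c • v) = φ c • realize φ v := by
  induction v using Finsupp.induction_linear with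
  | zero => simp
  | add f g hf hg => rw [smul_add, map_add, hf, hg, map_add, smul_add]
  | single s a => rw [Finsupp.smul_single, realize_single, realize_single, smul_eq_mul, map_mul,
      mul_smul]

theorem repr_realize (v : L.State →₀ L.CoeffRing) (s : L.State) :
    (L.stateBasis R).repr (realize φ v) s = φ (v s) := by
  classical
  induction v using Finsupp.induction_linear with
  | zero => simp
  | add f g hf hg => rw [map_add, map_add, Finsupp.add_apply, hf, hg, Finsupp.add_apply, map_add]
  | single t a =>
    rw [realize_single, map_smul, Module.Basis.repr_self, Finsupp.smul_apply,
      Finsupp.single_apply, Finsupp.single_apply]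
    split_ifs <;> simp

theorem realize_koszul (s : L.State) :
    realize φ (L.koszul s) = L.cube.act (weightPoly (edgeWeight φ)) (L.stateBasis R s) := by
  classical
  obtain ⟨S, ε⟩ := s
  funext T
  rw [koszul, map_sum, Finset.sum_apply, SurgeryCube.act_apply]
  by_cases hT : T = S
  · subst hT
    rw [stateBasis_apply_self ⟨T, ε⟩]
    change _ = CircleAlgebra.mk (L.circles T) (point L.mark) (weightPoly (edgeWeight φ)) *
      L.stateVector R ε
    rw [mk_weightPoly_edgeWeight, Finset.sum_mul]
    refine Finset.sum_congr rfl fun C _ => ?_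
    rw [smul_mul_assoc, circleX_mul_stateVector]
    dsimp only
    split_ifs
    · rw [realize_single]
      exact congrArg _ (stateBasis_apply_self ⟨T, L.lower ε C⟩)
    · rw [map_zero, smul_zero]; rfl
  · rw [stateBasis_apply_of_ne _ hT, mul_zero]
    refine Finset.sum_eq_zero fun C _ => ?_
    dsimp only
    split_ifs
    · rw [realize_single, Pi.smul_apply, stateBasis_apply_of_ne _ hT, smul_zero]
    · rw [map_zero]; rfl

theorem realize_khovanov (s : L.State) :
    realize φ (L.khovanov s) = ∑ x, L.cube.up x (L.stateBasis R s) := by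
  classical
  obtain ⟨S, ε⟩ := s
  have hup : ∀ x, x ∉ S → L.cube.up x (L.stateBasis R ⟨S, ε⟩) = ∑ η : L.Decoration (insert x S),
      algebraMap (ZMod 2) R (L.khovanovCoeff x ε η) • L.stateBasis R ⟨insert x S, η⟩ := by
    intro x hx
    funext T
    rw [Finset.sum_apply]
    by_cases hT : T = insert x S
    · subst hT
      rw [SurgeryCube.up_apply_of_mem (Finset.mem_insert_self _ _)]
      have h := surgery_stateVector (R := R) hx ε
      rw [← stateBasis_apply_self ⟨S, ε⟩] at h
      have he := Finset.erase_insert hx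
      rw [he]
      refine h.trans (Finset.sum_congr rfl fun η _ => ?_)
      exact congrArg _ (stateBasis_apply_self ⟨insert x S, η⟩).symm
    · rw [Finset.sum_eq_zero fun η _ => by
        rw [Pi.smul_apply, stateBasis_apply_of_ne _ hT, smul_zero]]
      by_cases hx' : x ∈ T
      · rw [SurgeryCube.up_apply_of_mem hx', stateBasis_apply_of_ne, map_zero]
        rintro rfl
        exact hT (Finset.insert_erase hx').symm
      · exact SurgeryCube.up_apply_of_notMem hx' _
  have hzero : ∀ x, x ∈ S → L.cube.up x (L.stateBasis R ⟨S, ε⟩) = 0 := by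
    intro x hx
    funext T
    by_cases hx' : x ∈ T
    · rw [SurgeryCube.up_apply_of_mem hx', stateBasis_apply_of_ne, map_zero]; rfl
      rintro rfl
      exact Finset.notMem_erase _ _ hx
    · exact SurgeryCube.up_apply_of_notMem hx' _
  rw [khovanov, map_sum, ← Finset.sum_subset (Finset.subset_univ Sᶜ) fun x _ hx =>
    hzero x (by simpa using hx)]
  refine Finset.sum_congr rfl fun x hx => ?_
  rw [hup x (Finset.mem_compl.1 hx), map_sum]
  refine Finset.sum_congr rfl fun η _ => ?_
  rw [realize_single, ← MvPolynomial.algebraMap_eq, φ.commutes]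

/-- The totally twisted differential is the differential of the complex of weights. -/
theorem realize_differential (v : L.State →₀ L.CoeffRing) :
    realize φ (L.differential v) = L.cube.differential (edgeWeight φ) (realize φ v) := by
  induction v using Finsupp.induction_linear with
  | zero => simp
  | add f g hf hg => rw [map_add, map_add, hf, hg, map_add, map_add]
  | single s a =>
    rw [differential, Finsupp.linearCombination_single, realize_smul, realize_single, map_smul,
      map_add, realize_khovanov, realize_koszul, SurgeryCube.differential_apply]

theorem realize_mem_gr {i : ℤ} {v : L.State →₀ L.CoeffRing} (h : ∀ s, v s ≠ 0 → L.degree s = i) :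
    realize φ v ∈ (L.weightComplex (edgeWeight φ)).gr i :=
  mem_gr_iff.2 fun s hs => h s fun h' => hs (by rw [repr_realize, h', map_zero])

theorem realize_injective {φ : L.CoeffRing →ₐ[ZMod 2] R} (h : Function.Injective φ) :
    Function.Injective (realize φ) := by
  intro v w hvw
  ext1 s
  apply h
  rw [← repr_realize, ← repr_realize, hvw]

variable (L) in
theorem isDifferential : L.IsDifferential := by
  let φ : L.CoeffRing →ₐ[ZMod 2] L.CoeffRing := AlgHom.id _ _
  have hφ := realize_injective (φ := φ) Function.injective_id
  refine ⟨LinearMap.ext fun v => hφ ?_, fun s t ht => ?_⟩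
  · rw [LinearMap.comp_apply, realize_differential, realize_differential,
      SurgeryCube.differential_differential]
    exact (map_zero _).symm
  · have h := (L.weightComplex (edgeWeight φ)).d_mem (L.degree s) (realize φ (Finsupp.single s 1))
      (realize_mem_gr φ fun t ht => by
        classical
        rw [Finsupp.single_apply] at ht
        rw [of_not_not fun h => ht (if_neg h)])
    refine mem_gr_iff.1 h t ?_
    change (L.stateBasis _).repr (L.cube.differential _ _) t ≠ 0
    rw [← realize_differential, repr_realize]; exact ht

end MarkedDiagram

/-! ### Passing to homological complexes -/

namespace DiffModule

variable {R : Type} [CommRing R]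

/-- The map induced by a homogeneous map on the parts of degrees `i` and `j`. -/
noncomputable def grMap {A B : DiffModule R} {f : A →ₗ[R] B} {k : ℤ} (hf : IsHomogeneous f k)
    {i j : ℤ} (h : i + k = j) : ModuleCat.of R (A.gr i) ⟶ ModuleCat.of R (B.gr j) :=
  ModuleCat.ofHom (f.restrict fun m hm => h ▸ hf i m hm)

/-- The complex formed by the homogeneous parts. -/
noncomputable def toComplex (A : DiffModule R) :
    HomologicalComplex (ModuleCat.{0} R) (ComplexShape.up' (2 : ℤ)) where
  X i := ModuleCat.of R (A.gr i)
  d i j := if h : i + 2 = j then grMap A.isHomogeneous_d h else 0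
  shape i j h := dif_neg h
  d_comp_d' i j k hij hjk := by
    rw [dif_pos (show i + 2 = j from hij), dif_pos (show j + 2 = k from hjk)]
    ext m
    exact A.d_d m

theorem toComplex_d (A : DiffModule R) {i j : ℤ} (h : i + 2 = j) :
    A.toComplex.d i j = grMap A.isHomogeneous_d h := dif_pos h

/-- The map of complexes induced by a homogeneous chain map. -/
noncomputable def toHom {A B : DiffModule R} {f : A →ₗ[R] B} (hf : IsHomogeneous f 0)
    (hc : IsChainMap f) : A.toComplex ⟶ B.toComplex where
  f i := grMap hf (add_zero i)
  comm' i j hij := by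
    rw [toComplex_d A hij, toComplex_d B hij]
    ext m
    exact Subtype.ext (hc (m : A.gr i).1).symm

/-- The family of maps induced by a homogeneous map of degree `-2`. -/
noncomputable def homotopyMap {A : DiffModule R} {h : A →ₗ[R] A} (hh : IsHomogeneous h (-2))
    (i j : ℤ) : A.toComplex.X i ⟶ A.toComplex.X j :=
  if e : i + -2 = j then grMap hh e else 0

theorem homotopyMap_eq {A : DiffModule R} {h : A →ₗ[R] A} (hh : IsHomogeneous h (-2))
    {i j : ℤ} (e : i + -2 = j) : homotopyMap hh i j = grMap hh e := dif_pos e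

/-- The homotopy of maps of complexes induced by a homogeneous homotopy. -/
noncomputable def toHomotopy [Algebra (ZMod 2) R] {A B : DiffModule R} {f : A →ₗ[R] B}
    {g : B →ₗ[R] A} {h : A →ₗ[R] A} (hf : IsHomogeneous f 0) (hg : IsHomogeneous g 0)
    (hh : IsHomogeneous h (-2)) (hfc : IsChainMap f) (hgc : IsChainMap g)
    (H : ∀ a, g (f a) = a + (h (A.d a) + A.d (h a))) :
    Homotopy (toHom hf hfc ≫ toHom hg hgc) (𝟙 A.toComplex) where
  hom := homotopyMap hh
  zero i j hij := dif_neg fun e => hij (show j + 2 = i by omega)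
  comm i := by
    rw [dNext_eq _ (show (ComplexShape.up' (2 : ℤ)).Rel i (i + 2) from rfl),
      prevD_eq _ (show (ComplexShape.up' (2 : ℤ)).Rel (i - 2) i from sub_add_cancel i 2),
      homotopyMap_eq hh (by omega), homotopyMap_eq hh (by omega), toComplex_d A rfl,
      toComplex_d A (sub_add_cancel i 2)]
    ext m
    exact Subtype.ext ((H (m : A.gr i).1).trans (add_comm _ _))

/-- An equivalence of graded differential modules induces one of complexes. -/
theorem HEquiv.homotopyEquiv [Algebra (ZMod 2) R] {A B : DiffModule R} (H : HEquiv A B) :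
    Nonempty (HomotopyEquiv A.toComplex B.toComplex) := by
  obtain ⟨f, g, h, k, hf, hg, hh, hk, hfc, hgc, H₁, H₂⟩ := H
  exact ⟨⟨toHom hf hfc, toHom hg hgc, toHomotopy hf hg hh hfc hgc H₁,
    toHomotopy hg hf hk hgc hfc H₂⟩⟩

end DiffModule

section ExtendScalars

open ChangeOfRings

variable {R R' : Type} [CommRing R] [CommRing R'] (φ : R →+* R') {T N : Type} [AddCommGroup N]
  [Module R' N] (b : Module.Basis T R' N)

open TensorProduct in
/-- The extension of scalars of a free module, identified with a free module over the new ring. -/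
noncomputable def extendScalarsFree :
    (ModuleCat.extendScalars φ).obj (ModuleCat.of R (T →₀ R)) ≅ ModuleCat.of R' N :=
  letI := φ.toAlgebra
  (show ModuleCat.of R' (R' ⊗[R] (T →₀ R)) ≅ ModuleCat.of R' N from
    ((Finsupp.basisSingleOne.baseChange R').equiv b (Equiv.refl T)).toModuleIso)

theorem baseChange_equiv_one_tmul [Algebra R R'] (v : T →₀ R) :
    (Finsupp.basisSingleOne.baseChange R').equiv b (Equiv.refl T) (1 ⊗ₜ[R] v) =
      v.sum fun t c => algebraMap R R' c • b t := by
  classical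
  induction v using Finsupp.induction_linear with
  | zero => simp
  | add v w hv hw =>
    rw [TensorProduct.tmul_add, map_add, hv, hw, Finsupp.sum_add_index (by simp)
      (fun t _ c c' => by rw [map_add, add_smul])]
  | single t c =>
    have h : (1 : R') ⊗ₜ[R] Finsupp.single t c =
        algebraMap R R' c • Finsupp.basisSingleOne.baseChange R' t := by
      rw [Module.Basis.baseChange_apply, Finsupp.coe_basisSingleOne, algebraMap_smul,
        ← TensorProduct.tmul_smul, Finsupp.smul_single, smul_eq_mul, mul_one]
    rw [h, map_smul, Module.Basis.equiv_apply, Finsupp.sum_single_index (by simp)]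
    rfl

theorem extendScalarsFree_hom (v : T →₀ R) :
    (extendScalarsFree φ b).hom.hom ((1 : R') ⊗ₜ[R, φ] v) = v.sum fun t c => φ c • b t :=
  letI := φ.toAlgebra
  baseChange_equiv_one_tmul b v

end ExtendScalars

namespace MarkedDiagram

open ChangeOfRings

variable {L : MarkedDiagram} {R : Type} [CommRing R] [Algebra (ZMod 2) R]

theorem gr_eq_span (i : ℤ) : L.cube.gr L.nPlus i = Submodule.span R
    (Set.range fun s : {s : L.State | L.degree s = i} => L.stateBasis R s) := by
  ext v
  rw [mem_gr_iff, show (fun s : {s : L.State | L.degree s = i} => L.stateBasis R s) =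
    L.stateBasis R ∘ Subtype.val from rfl, Set.range_comp, Subtype.range_coe,
    Module.Basis.mem_span_image]
  exact ⟨fun h s hs => h s (Finsupp.mem_support_iff.1 hs),
    fun h s hs => h (Finsupp.mem_support_iff.2 hs)⟩

variable (L R) in
/-- The basis of the part of degree `i` given by the pure states. -/
noncomputable def grBasis (i : ℤ) : Module.Basis {s : L.State | L.degree s = i} R
    (L.cube.gr (R := R) (m := .point L.mark) L.nPlus i) :=
  (Module.Basis.span ((L.stateBasis R).linearIndependent.comp Subtype.val
    Subtype.val_injective)).map (LinearEquiv.ofEq _ _ (gr_eq_span i).symm)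

theorem coe_grBasis (i : ℤ) (s : {s : L.State | L.degree s = i}) :
    (L.grBasis R i s).1 = L.stateBasis R s := by
  rw [grBasis, Module.Basis.map_apply]
  exact congrArg Subtype.val (Module.Basis.span_apply ((L.stateBasis R).linearIndependent.comp Subtype.val
    Subtype.val_injective) s)

variable (φ : L.CoeffRing →ₐ[ZMod 2] R)

theorem coe_sum_grBasis (i : ℤ) (v : {s : L.State | L.degree s = i} →₀ L.CoeffRing) :
    (v.sum fun s c => φ c • L.grBasis R i s).1 = realize φ (v.mapDomain Subtype.val) := by
  classical
  induction v using Finsupp.induction_linear with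
  | zero => simp
  | add f g hf hg =>
    rw [Finsupp.sum_add_index (by simp) (fun t _ c c' => by rw [map_add, add_smul]),
      Finsupp.mapDomain_add, map_add, ← hf, ← hg]
    rfl
  | single s c =>
    rw [Finsupp.sum_single_index (by simp), Finsupp.mapDomain_single, realize_single,
      ← coe_grBasis i s]
    rfl

theorem mapDomain_component (i : ℤ) (v : {s : L.State | L.degree s = i} →₀ L.CoeffRing) :
    (L.component i (i + 2) v).mapDomain Subtype.val = L.differential (v.mapDomain Subtype.val) := by
  induction v using Finsupp.induction_linear with
  | zero => simp
  | add f g hf hg => rw [map_add, Finsupp.mapDomain_add, Finsupp.mapDomain_add, hf, hg, map_add]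
  | single s c =>
    have hc : Finsupp.single s c = c • Finsupp.single s 1 := by
      rw [Finsupp.smul_single, smul_eq_mul, mul_one]
    rw [hc, map_smul, Finsupp.mapDomain_smul, Finsupp.mapDomain_smul, map_smul,
      Finsupp.mapDomain_single]
    congr 1
    ext1 r
    by_cases hr : L.degree r = i + 2
    · refine (Finsupp.mapDomain_apply Subtype.val_injective _
        (⟨r, hr⟩ : {s | L.degree s = i + 2})).trans ?_
      simp only [component, LinearMap.comp_apply, Finsupp.lmapDomain_apply,
        Finsupp.mapDomain_single]
      rfl
    · rw [Finsupp.mapDomain_of_notMem_range _ _ (by rintro ⟨r', rfl⟩; exact hr r'.2)]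
      by_contra hne
      exact hr ((L.isDifferential.2 s.1 r (Ne.symm hne)).trans (by rw [s.2]))

/-- The part of degree `i` of the complex of weights is obtained by extension of scalars from the
module of chains of degree `i`. -/
noncomputable def extendIso (i : ℤ) :
    (ModuleCat.extendScalars (φ : L.CoeffRing →+* R)).obj
      (ModuleCat.of L.CoeffRing ({s : L.State | L.degree s = i} →₀ L.CoeffRing)) ≅
    ModuleCat.of R ((L.weightComplex (edgeWeight φ)).gr i) :=
  extendScalarsFree (φ : L.CoeffRing →+* R) (N := (L.weightComplex (edgeWeight φ)).gr i)
    (L.grBasis R i)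

theorem extendIso_hom (i : ℤ) (v : {s : L.State | L.degree s = i} →₀ L.CoeffRing) :
    ((extendIso φ i).hom.hom ((1 : R) ⊗ₜ[L.CoeffRing, (φ : L.CoeffRing →+* R)] v) :
      (L.weightComplex (edgeWeight φ)).gr i).1 = realize φ (v.mapDomain Subtype.val) :=
  (congrArg Subtype.val (extendScalarsFree_hom (φ : L.CoeffRing →+* R)
    (N := (L.weightComplex (edgeWeight φ)).gr i) (L.grBasis R i) v)).trans (coe_sum_grBasis φ i v)

theorem KT_d (h : L.IsDifferential) (i : ℤ) :
    (L.KT h).d i (i + 2) = ModuleCat.ofHom (L.component i (i + 2)) := if_pos rfl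

theorem extendIso_comm (i : ℤ) :
    (extendIso φ i).hom ≫ DiffModule.grMap (L.weightComplex (edgeWeight φ)).isHomogeneous_d rfl =
      (ModuleCat.extendScalars (φ : L.CoeffRing →+* R)).map
        (ModuleCat.ofHom (L.component i (i + 2))) ≫ (extendIso φ (i + 2)).hom := by
  apply ModuleCat.ExtendScalars.hom_ext
  intro v
  refine Subtype.ext ?_
  have h₁ := extendIso_hom φ i v
  have h₂ := extendIso_hom φ (i + 2) (L.component i (i + 2) v)
  rw [mapDomain_component, realize_differential] at h₂
  exact (congrArg (L.cube.differential (edgeWeight φ)) h₁).trans h₂.symm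

/-- Over any algebra over the coefficient ring, the totally twisted complex is the complex of weights. -/
noncomputable def extendComplexIso (h : L.IsDifferential) :
    extendComplex (φ : L.CoeffRing →+* R) (L.KT h) ≅ (L.weightComplex (edgeWeight φ)).toComplex :=
  HomologicalComplex.Hom.isoOfComponents (extendIso φ) (by
    rintro i j hij
    obtain rfl : i + 2 = j := hij
    rw [DiffModule.toComplex_d _ rfl]
    change _ = (ModuleCat.extendScalars (φ : L.CoeffRing →+* R)).map ((L.KT h).d i (i + 2)) ≫ _
    rw [KT_d]
    exact extendIso_comm φ i)

end MarkedDiagram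

namespace MarkedDiagram

/-! ### The stable equivalence -/

variable {L L' : MarkedDiagram}

theorem componentSum_map {M N F : Type} [AddCommMonoid M] [AddCommMonoid N] [FunLike F M N]
    [AddMonoidHomClass F M N] (f : F) (w : L.Edge → M) (K : L.Component) :
    L.componentSum (fun e => f (w e)) K = f (L.componentSum w K) := by
  classical
  rw [componentSum, componentSum, map_sum]
  exact Finset.sum_congr rfl fun e _ => by rw [apply_ite f, map_zero]

/-- The map from the coefficient ring to the symmetric algebra induced by a linear map. -/
noncomputable def symHom {W : Type} [AddCommGroup W] [Module (ZMod 2) W]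
    (i : (L.Face →₀ ZMod 2) →ₗ[ZMod 2] W) : L.CoeffRing →ₐ[ZMod 2] SymmetricAlgebra (ZMod 2) W :=
  MvPolynomial.aeval fun f => SymmetricAlgebra.ι (ZMod 2) W (i (Finsupp.single f 1))

theorem componentSum_edgeWeight {W : Type} [AddCommGroup W] [Module (ZMod 2) W]
    (i : (L.Face →₀ ZMod 2) →ₗ[ZMod 2] W) (K : L.Component) :
    L.componentSum (edgeWeight (symHom i)) K =
      SymmetricAlgebra.ι (ZMod 2) W (i (L.componentSum L.weight K)) := by
  have h : (symHom i).toLinearMap ∘ₗ L.faceSum = SymmetricAlgebra.ι (ZMod 2) W ∘ₗ i := by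
    ext f
    simp [symHom, faceSum]
  have he : edgeWeight (symHom i) = fun e => (SymmetricAlgebra.ι (ZMod 2) W ∘ₗ i) (L.weight e) :=
    funext fun e => LinearMap.congr_fun h (L.weight e)
  rw [he, componentSum_map]
  rfl

/-- The spaces spanned by the faces of two diagrams embed into a common space in which given
bijective components have the same sums of weights: the embedding of the second space sends a vector
to its projection to the span of the sums, transported to the first space, and its remainder. -/
theorem exists_embeddings (σ : L.Component ≃ L'.Component) :
    ∃ (i : (L.Face →₀ ZMod 2) →ₗ[ZMod 2] (L.Face →₀ ZMod 2) × (L'.Face →₀ ZMod 2))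
      (j : (L'.Face →₀ ZMod 2) →ₗ[ZMod 2] (L.Face →₀ ZMod 2) × (L'.Face →₀ ZMod 2)),
      Function.Injective i ∧ Function.Injective j ∧
      ∀ K, i (L.componentSum L.weight K) = j (L'.componentSum L'.weight (σ K)) := by
  let s := Finsupp.linearCombination (ZMod 2) (L.componentSum L.weight ∘ σ.symm)
  let s' := Finsupp.linearCombination (ZMod 2) (L'.componentSum L'.weight)
  have hs : Function.Injective s := L.linearIndependent_componentSum.comp _ σ.symm.injective
  obtain ⟨r, hr⟩ := s'.exists_leftInverse_of_injective
    (LinearMap.ker_eq_bot.2 L'.linearIndependent_componentSum)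
  have hr' : ∀ a, r (s' a) = a := LinearMap.congr_fun hr
  refine ⟨LinearMap.inl _ _ _, (s ∘ₗ r).prod (LinearMap.id - s' ∘ₗ r), LinearMap.inl_injective, ?_,
    fun K => ?_⟩
  · rw [← LinearMap.ker_eq_bot, LinearMap.ker_eq_bot']
    intro v hv
    have h₁ : s (r v) = 0 := congrArg Prod.fst hv
    have h₂ : v - s' (r v) = 0 := congrArg Prod.snd hv
    rw [hs (h₁.trans (map_zero s).symm), map_zero, sub_zero] at h₂
    exact h₂
  · have h : L'.componentSum L'.weight (σ K) = s' (Finsupp.single (σ K) 1) := by simp [s']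
    rw [h]
    refine Prod.ext ?_ ?_
    · change _ = s (r (s' _))
      rw [hr']
      simp [s]
    · change _ = s' _ - s' (r (s' _))
      rw [hr', sub_self]
      rfl

end MarkedDiagram

theorem mainTheorem2 (L L' : MarkedDiagram)
    (hmoves : Relation.EqvGen MarkedDiagram.Move L L') :
    ∃ (h : L.IsDifferential) (h' : L'.IsDifferential),
      StablyHomotopyEquivalent (L.KT h) (L'.KT h') := by
  obtain ⟨σ, hσ⟩ := MarkedDiagram.hasEquivalentComplexes_of_moves hmoves
  obtain ⟨i, j, hi, hj, hij⟩ := MarkedDiagram.exists_embeddings σ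
  refine ⟨L.isDifferential, L'.isDifferential, _, inferInstance, inferInstance, i, j, hi, hj, ?_⟩
  obtain ⟨H⟩ := (hσ _ (MarkedDiagram.edgeWeight (MarkedDiagram.symHom i))
    (MarkedDiagram.edgeWeight (MarkedDiagram.symHom j)) fun K => by
      rw [MarkedDiagram.componentSum_edgeWeight, MarkedDiagram.componentSum_edgeWeight,
        hij]).homotopyEquiv
  exact ⟨((HomotopyEquiv.ofIso (MarkedDiagram.extendComplexIso (MarkedDiagram.symHom i) _)).trans
    H).trans (HomotopyEquiv.ofIso (MarkedDiagram.extendComplexIso (MarkedDiagram.symHom j) _)).symm⟩
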